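/- **Tangles.** A virtual tangle diagram is an oriented diagram properly embedded in the strip $\mathbb{R}\times[0,1]$ as a graph with univalent vertices on the boundary and tetravalent vertices (crossings) in the interior, each crossing being decorated as a real crossing (with over/under information) or as a virtual crossing, such that the identification of $\mathbb{R}\times\{0\}$ with $\mathbb{R}\times\{1\}$ turns it into the diagram of a virtual *knot* (one component) in $\mathbb{R}\times S^1$. Diagrams are taken in general position with respect to the height coordinate, i.e. as finite piles of horizontal slabs each containing exactly one crossing, one local minimum or one local maximum besides vertical strands, and up to planar isotopy. **T-diagrams.** A T-diagram consists of an oriented circle; finitely many signed arrows, each joining two points of the circle (its tail and its head), all these endpoints being distinct; an integer valuation for every arrow and for the circle; and finitely many markings with signs $\pm1$ at points of the circle away from the arrows, such that the valuation of each arrow equals the sum of the markings met when travelling on the circle along its orientation from the head of the arrow to its tail (the distinguished loop of the arrow), and the valuation of the circle equals the sum of all markings. T-diagrams are considered up to orientation preserving homeomorphisms of the circle which carry arrows and markings, with all decorations, to each other. The T-diagram of a tangle has the parametrized knot as its circle; an arrow for each real crossing, from the underpassing to the overpassing point, with the writhe of the crossing as its sign and the class in $H_1(\mathbb{R}\times S^1)=\mathbb{Z}$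 of its distinguished loop as its valuation; the class of the knot as valuation of the circle; and a marking for each intersection point of the knot with the section $S=\mathbb{R}\times\{0\}=\mathbb{R}\times\{1\}$, whose sign is the intersection number there ($+1$ when the knot crosses $S$ upwards). **Theorem.** 1. Every T-diagram is the T-diagram of some virtual tangle. 2. Any two virtual tangles with the same T-diagram are equivalent under virtual Reidemeister moves; more precisely, they are related by a finite sequence of planar isotopies of the strip fixing its boundary, virtual Reidemeister moves inside the strip (the virtual moves I, II and III, and the mixed move III in which a real crossing slides past a strand through two virtual crossings) and virtual Reidemeister moves II in $\mathbb{R}\times S^1$ whose bigon is cut in two by the section $S$. -/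

import Mathlib

/-!
# Virtual tangle diagrams and their T-diagrams

A diagram in the strip `ℝ × [0,1]`, in general position with respect to the height coordinate, is
cut by horizontal levels into finitely many slabs, each of which contains exactly one crossing, one
local minimum (cup) or one local maximum (cap), and vertical strands besides. It is recorded as the
orientations of its points on `ℝ × {0}` together with the sequence of its slabs, from bottom to top.
-/

namespace VirtualTangle

/-! ## T-diagrams -/

/-- A decorated point of the oriented circle of a T-diagram: the tail or the head of an arrow, or a
signed marking. -/
inductive CirclePoint (A : Type) where
  | tail (a : A)
  | head (a : A)
  | marking (s : ℤˣ)
  deriving DecidableEq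

namespace CirclePoint

/-- Relabelling of the arrows. -/
def map {A B : Type} (f : A → B) : CirclePoint A → CirclePoint B
  | tail a => tail (f a)
  | head a => head (f a)
  | marking s => marking s

/-- The contribution of a point to a sum of markings. -/
def weight {A : Type} : CirclePoint A → ℤ
  | marking s => s
  | _ => 0

end CirclePoint

/-- The sum of the markings met along a sequence of points of the circle. -/
def markingSum {A : Type} (l : List (CirclePoint A)) : ℤ := (l.map CirclePoint.weight).sum

/-- The points met on the circle by the distinguished loop of the arrow `a`: the loop goes along the
orientation of the circle from the head of `a` to its tail (and then back along `a`). The list `l`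
is read cyclically. -/
def distinguishedLoop {A : Type} [DecidableEq A] (l : List (CirclePoint A)) (a : A) :
    List (CirclePoint A) :=
  (l.rotate (l.idxOf (CirclePoint.head a))).takeWhile (fun p => p ≠ CirclePoint.tail a)

/-- A T-diagram: an oriented circle with finitely many signed arrows linking pairs of points of the
circle (each arrow has one tail and one head), with an integer valuation for every arrow and for the
circle, and with finitely many signed markings away from the endpoints of the arrows, such that the
valuation of every arrow is the sum of the markings met by its distinguished loop and the valuation
of the circle is the sum of all the markings. -/
structure TDiagram where
  /-- The set of arrows (finite, since every arrow has an endpoint in `points`). -/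
  Arrow : Type
  [decEq : DecidableEq Arrow]
  /-- The endpoints of arrows and the markings in the order in which they are met when the circle
  is travelled once along its orientation, from an arbitrary starting point. -/
  points : List (CirclePoint Arrow)
  tail_once : ∀ a, points.count (CirclePoint.tail a) = 1
  head_once : ∀ a, points.count (CirclePoint.head a) = 1
  /-- The signs of the arrows. -/
  sign : Arrow → ℤˣ
  /-- The valuations of the arrows. -/
  val : Arrow → ℤ
  /-- The valuation of the circle. -/
  circleVal : ℤ
  val_eq : ∀ a, val a = markingSum (distinguishedLoop points a)
  circleVal_eq : circleVal = markingSum points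

/-- Two T-diagrams are the same if they agree up to an orientation preserving homeomorphism of the
circle (so that the cyclic sequences of points agree) carrying the arrows of the first
to those of the second with all decorations. -/
def TDiagram.Same (G H : TDiagram) : Prop :=
  ∃ e : G.Arrow ≃ H.Arrow,
    (G.points.map (CirclePoint.map e)) ~r H.points ∧
    (∀ a, H.sign (e a) = G.sign a) ∧
    (∀ a, H.val (e a) = G.val a) ∧
    H.circleVal = G.circleVal

/-! ## Words of elementary slabs -/

/-- The decoration of a crossing of two strands, one of slope `/` and one of slope `\`: a real
crossing where the strand `/` is the overpassing one, a real crossing where the strand `\` is the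
overpassing one, or a virtual crossing. -/
inductive CrossingKind where
  | slashOver
  | backslashOver
  | virtual
  deriving DecidableEq

namespace CrossingKind

/-- The effect of a rotation of a crossing by a right angle: the two slopes are exchanged. -/
def rotate : CrossingKind → CrossingKind
  | slashOver => backslashOver
  | backslashOver => slashOver
  | virtual => virtual

/-- Whether the crossing is real. -/
def isReal : CrossingKind → Bool
  | virtual => false
  | _ => true

/-- The writhe of a real crossing when both strands go upwards. -/
def writheUp : CrossingKind → ℤˣ
  | backslashOver => -1
  | _ => 1

/-- How the strand of slope `/` (argument `true`) or `\` (argument `false`) goes through the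
crossing: `some true` for an overpass, `some false` for an underpass, and `none` when the crossing
is virtual. -/
def overpass : CrossingKind → Bool → Option Bool
  | slashOver, slash => some slash
  | backslashOver, slash => some !slash
  | virtual, _ => none

end CrossingKind

/-- The non-trivial part of a slab. For a cup, the Boolean is the orientation of its left branch
(`true` for upwards); the right branch has the opposite orientation. -/
inductive Piece where
  | cross (k : CrossingKind)
  | cup (leftUp : Bool)
  | cap
  deriving DecidableEq

/-- The number of endpoints of a piece on the bottom of its slab. -/
def Piece.bottoms : Piece → ℕ
  | cross _ => 2
  | cup _ => 0
  | cap => 2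

/-- The number of endpoints of a piece on the top of its slab. -/
def Piece.tops : Piece → ℕ
  | cross _ => 2
  | cup _ => 2
  | cap => 0

/-- A slab: a piece with `pos` vertical strands on its left (and some on its right). -/
structure Slab where
  pos : ℕ
  piece : Piece
  deriving DecidableEq

/-- The points of a diagram on a horizontal level, from left to right, each one recorded by the
orientation of the diagram there (`true` for upwards). -/
abbrev Level := List Bool

/-- An endpoint of a strand of a slab: the `p`-th point from the left (counted from `0`) on its
bottom or on its top. -/
inductive SlabEnd where
  | bottom (p : ℕ)
  | top (p : ℕ)
  deriving DecidableEq

namespace Slab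

/-- The slab `s` can be put on the level `a`. For a cap, the two strands that it joins must have
opposite orientations. -/
def Fits (s : Slab) (a : Level) : Prop :=
  s.pos + s.piece.bottoms ≤ a.length ∧
    (s.piece = Piece.cap → a[s.pos]? ≠ a[s.pos + 1]?)

/-- The level on the top of the slab `s` put on the level `a`. -/
def apply (s : Slab) (a : Level) : Level :=
  a.take s.pos ++
    (match s.piece with
      | Piece.cross _ => ((a.drop s.pos).take 2).reverse
      | Piece.cup b => [b, !b]
      | Piece.cap => []) ++
    a.drop (s.pos + s.piece.bottoms)

/-- The other endpoint of the strand of the slab `s` that has a given endpoint. -/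
def otherEnd (s : Slab) : SlabEnd → SlabEnd
  | SlabEnd.bottom p =>
      if p < s.pos then SlabEnd.top p
      else if s.pos + s.piece.bottoms ≤ p then
        SlabEnd.top (p - s.piece.bottoms + s.piece.tops)
      else
        match s.piece with
        | Piece.cap => SlabEnd.bottom (2 * s.pos + 1 - p)
        | _ => SlabEnd.top (2 * s.pos + 1 - p)
  | SlabEnd.top p =>
      if p < s.pos then SlabEnd.bottom p
      else if s.pos + s.piece.tops ≤ p then
        SlabEnd.bottom (p - s.piece.tops + s.piece.bottoms)
      else
        match s.piece with
        | Piece.cup _ => SlabEnd.top (2 * s.pos + 1 - p)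
        | _ => SlabEnd.bottom (2 * s.pos + 1 - p)

/-- Whether the slab contains a real crossing. -/
def isReal (s : Slab) : Bool :=
  match s.piece with
  | Piece.cross k => k.isReal
  | _ => false

/-- How the strand with the given endpoint goes through a real crossing in the slab: `some true` for
an overpass, `some false` for an underpass, `none` if it meets no real crossing. -/
def overpass (s : Slab) (x : SlabEnd) : Option Bool :=
  match s.piece with
  | Piece.cross k =>
      if x = SlabEnd.bottom s.pos ∨ x = SlabEnd.top (s.pos + 1) then k.overpass true
      else if x = SlabEnd.bottom (s.pos + 1) ∨ x = SlabEnd.top s.pos then k.overpass false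
      else none
  | _ => none

end Slab

/-- A pile of slabs `word` (from bottom to top) over the level `bot`. -/
structure Pile where
  bot : Level
  word : List Slab
  deriving DecidableEq

namespace Pile

/-- The level on the top of the first `n` slabs. -/
def level (T : Pile) (n : ℕ) : Level :=
  (T.word.take n).foldl (fun a s => s.apply a) T.bot

/-- Every slab fits on the one below it, and the top and bottom of the diagram agree, so that they
can be identified to give a diagram in `ℝ × S¹`. -/
def IsClosable (T : Pile) : Prop :=
  (∀ n, ∀ h : n < T.word.length, (T.word[n]).Fits (T.level n)) ∧
    T.level T.word.length = T.bot

/-- The pair `x = (n, p)` is a point of the diagram: the `p`-th point from the left on level `n`. -/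
def IsPoint (T : Pile) (x : ℕ × ℕ) : Prop :=
  x.1 ≤ T.word.length ∧ x.2 < (T.level x.1).length

/-- Whether the diagram is oriented upwards at the point `x`. -/
def isUp (T : Pile) (x : ℕ × ℕ) : Bool := (T.level x.1).getD x.2 true

/-- The point on a horizontal level that follows the point `x` on the closure of the diagram in
`ℝ × S¹`, along the orientation. The top level `T.word.length` and the bottom level `0` are two
copies of the section; going from one copy to the other is crossing the section. -/
def next (T : Pile) (x : ℕ × ℕ) : ℕ × ℕ :=
  if T.isUp x then
    match T.word[x.1]? with
    | none => (0, x.2)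
    | some s =>
      match s.otherEnd (SlabEnd.bottom x.2) with
      | SlabEnd.top q => (x.1 + 1, q)
      | SlabEnd.bottom q => (x.1, q)
  else
    match x.1 with
    | 0 => (T.word.length, x.2)
    | n + 1 =>
      match T.word[n]? with
      | none => x
      | some s =>
        match s.otherEnd (SlabEnd.top x.2) with
        | SlabEnd.bottom q => (n, q)
        | SlabEnd.top q => (n + 1, q)

/-- The closure of the diagram in `ℝ × S¹` is a knot diagram: it has exactly one component. -/
def IsKnot (T : Pile) : Prop :=
  (∃ x, T.IsPoint x) ∧ ∀ x y, T.IsPoint x → T.IsPoint y → ∃ k : ℕ, T.next^[k] x = y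

/-- The slab number `n` contains a real crossing. -/
def IsRealCrossing (T : Pile) (n : ℕ) : Prop := (T.word[n]?).any Slab.isReal = true

instance (T : Pile) (n : ℕ) : Decidable (T.IsRealCrossing n) :=
  inferInstanceAs (Decidable (_ = true))

/-- The real crossings of the diagram, labelled by the numbers of their slabs. -/
abbrev RealCrossing (T : Pile) : Type := {n : ℕ // T.IsRealCrossing n}

/-- The orientation of the diagram at a point, as a sign. -/
def direction (T : Pile) (x : ℕ × ℕ) : ℤˣ := if T.isUp x then 1 else -1

/-- The writhe of a real crossing: the sign of the basis formed by the directions of the overpassing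
and of the underpassing strand. -/
def writhe (T : Pile) (c : T.RealCrossing) : ℤˣ :=
  match T.word[c.1]? with
  | some ⟨i, Piece.cross k⟩ => k.writheUp * T.direction (c.1, i) * T.direction (c.1, i + 1)
  | _ => 1

/-- The endpoint of an arrow that is met on the strand of slab `n` with the given endpoint, if any.
Arrows go from the underpassing to the overpassing point. -/
def arrowEnd (T : Pile) (n : ℕ) (x : SlabEnd) : Option (CirclePoint T.RealCrossing) :=
  if h : T.IsRealCrossing n then
    (T.word[n]?.bind (fun s => s.overpass x)).map
      (fun isOver => if isOver then CirclePoint.head ⟨n, h⟩ else CirclePoint.tail ⟨n, h⟩)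
  else none

/-- What is met on the diagram between the point `x` and the next one: a marking where the diagram
crosses the section (with the intersection number as its sign), or an endpoint of an arrow where it
goes through a real crossing. -/
def event (T : Pile) (x : ℕ × ℕ) : Option (CirclePoint T.RealCrossing) :=
  if T.isUp x then
    if x.1 = T.word.length then some (CirclePoint.marking 1)
    else T.arrowEnd x.1 (SlabEnd.bottom x.2)
  else
    if x.1 = 0 then some (CirclePoint.marking (-1))
    else T.arrowEnd (x.1 - 1) (SlabEnd.top x.2)

/-- The points met when the component of `x` is travelled once. -/
noncomputable def travel (T : Pile) (x : ℕ × ℕ) : List (ℕ × ℕ) :=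
  (List.range (Function.minimalPeriod T.next x)).map (fun k => T.next^[k] x)

/-- The decorated points met when the component of `x` is travelled once. -/
noncomputable def circlePoints (T : Pile) (x : ℕ × ℕ) : List (CirclePoint T.RealCrossing) :=
  (T.travel x).filterMap T.event

end Pile

/-! ## Facts needed to read off the T-diagram -/

theorem Slab.length_apply (s : Slab) (a : Level) (h : s.Fits a) :
    (s.apply a).length + s.piece.bottoms = a.length + s.piece.tops := by
  obtain ⟨i, P⟩ := s
  have h1 := h.1
  cases P <;> simp [Slab.apply, Piece.bottoms, Piece.tops] at * <;> omega

theorem Slab.otherEnd_lt (s : Slab) (b t : ℕ) (h1 : s.pos + s.piece.bottoms ≤ b)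
    (h2 : t + s.piece.bottoms = b + s.piece.tops) (x : SlabEnd)
    (hx : match x with | SlabEnd.bottom p => p < b | SlabEnd.top p => p < t) :
    match s.otherEnd x with | SlabEnd.bottom p => p < b | SlabEnd.top p => p < t := by
  obtain ⟨i, P⟩ := s
  rcases x with p | p <;> by_cases c1 : p < i <;> by_cases c2 : i + 2 ≤ p <;> cases P <;>
    simp [Piece.bottoms, Piece.tops] at h1 h2 hx <;>
    simp [Slab.otherEnd, Piece.bottoms, Piece.tops, c1, c2, not_lt.1] <;> grind

theorem Slab.apply_cross (i : ℕ) (k : CrossingKind) (a : Level)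
    (h : (Slab.mk i (Piece.cross k)).Fits a) :
    (Slab.apply ⟨i, Piece.cross k⟩ a).getD i true = a.getD (i + 1) true ∧
      (Slab.apply ⟨i, Piece.cross k⟩ a).getD (i + 1) true = a.getD i true := by
  have h1 : i + 2 ≤ a.length := h.1
  have h2 : a.drop i = a[i] :: a[i + 1] :: a.drop (i + 2) := by
    rw [List.drop_eq_getElem_cons (by omega), List.drop_eq_getElem_cons (by omega)]
  have h4 : (a.drop i).take 2 = [a[i], a[i + 1]] := by rw [h2]; rfl
  have h3 : (a.take i).length = i := by simp; omega
  clear h2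
  constructor
  · rw [Slab.apply, List.append_assoc, List.getD_append_right _ _ _ _ h3.le, h3]
    simp [h4, List.getElem?_eq_getElem (show i + 1 < a.length by omega)]
  · rw [Slab.apply, List.append_assoc, List.getD_append_right _ _ _ _ (h3.le.trans (by simp)), h3]
    simp [h4, List.getElem?_eq_getElem (show i < a.length by omega)]

namespace Pile

theorem level_succ (T : Pile) (n : ℕ) (s : Slab) (h : T.word[n]? = some s) :
    T.level (n + 1) = s.apply (T.level n) := by
  simp [level, List.take_add_one, h]

theorem IsClosable.fits {T : Pile} (hT : T.IsClosable) {n : ℕ} {s : Slab}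
    (h : T.word[n]? = some s) : s.Fits (T.level n) := by
  obtain ⟨hn, rfl⟩ := List.getElem?_eq_some_iff.1 h
  exact hT.1 n hn

theorem IsClosable.isPoint_next {T : Pile} (hT : T.IsClosable) {x : ℕ × ℕ}
    (hx : T.IsPoint x) : T.IsPoint (T.next x) := by
  obtain ⟨n, p⟩ := x
  obtain ⟨hn, hp⟩ := hx
  simp only at hn hp
  have h0 : T.level 0 = T.bot := by simp [level]
  have key : ∀ m s, T.word[m]? = some s → m < T.word.length ∧
      (T.level (m + 1)).length + s.piece.bottoms = (T.level m).length + s.piece.tops ∧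
      s.pos + s.piece.bottoms ≤ (T.level m).length := by
    intro m s hs
    have hf := hT.fits hs
    refine ⟨(List.getElem?_eq_some_iff.1 hs).1, ?_, hf.1⟩
    rw [T.level_succ m s hs]
    exact s.length_apply _ hf
  unfold next
  split_ifs with hu
  · dsimp only
    cases hs : T.word[n]? with
    | none =>
      have : n = T.word.length := by
        have := List.getElem?_eq_none_iff.1 hs
        omega
      subst this
      refine ⟨by simp, ?_⟩
      simpa [h0, ← hT.2] using hp
    | some s =>
      obtain ⟨hl, hlen, hfit⟩ := key n s hs
      have hq := s.otherEnd_lt _ _ hfit hlen (SlabEnd.bottom p) hp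
      cases he : s.otherEnd (SlabEnd.bottom p) <;> rw [he] at hq <;> simp only [he]
      · exact ⟨hl.le, hq⟩
      · exact ⟨hl, hq⟩
  · dsimp only
    cases n with
    | zero =>
      refine ⟨by simp, ?_⟩
      simpa [h0, hT.2] using hp
    | succ m =>
      dsimp only
      cases hs : T.word[m]? with
      | none =>
        exact ⟨hn, hp⟩
      | some s =>
        obtain ⟨hl, hlen, hfit⟩ := key m s hs
        have hq := s.otherEnd_lt _ _ hfit hlen (SlabEnd.top p) hp
        cases he : s.otherEnd (SlabEnd.top p) <;> rw [he] at hq <;> simp only [he]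
        · exact ⟨hl.le, hq⟩
        · exact ⟨hl, hq⟩

theorem IsKnot.mem_travel {T : Pile} (hT : T.IsClosable) (hK : T.IsKnot) {x y : ℕ × ℕ}
    (hx : T.IsPoint x) : T.IsPoint y ↔ y ∈ T.travel x := by
  have hper : ∃ k : ℕ, T.next^[k + 1] x = x := by
    obtain ⟨k, hk⟩ := hK.2 (T.next x) x (hT.isPoint_next hx) hx
    exact ⟨k, by simpa using hk⟩
  have hx' : x ∈ Function.periodicPts T.next := by
    obtain ⟨k, hk⟩ := hper
    exact ⟨k + 1, by omega, hk⟩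
  simp only [travel, List.mem_map, List.mem_range]
  constructor
  · intro hy
    obtain ⟨k, hk⟩ := hK.2 x y hx hy
    refine ⟨k % Function.minimalPeriod T.next x,
      Nat.mod_lt _ (Function.minimalPeriod_pos_of_mem_periodicPts hx'), ?_⟩
    rw [Function.iterate_mod_minimalPeriod_eq, hk]
  · rintro ⟨k, -, rfl⟩
    induction k with
    | zero => exact hx
    | succ k ih =>
      rw [Function.iterate_succ_apply']
      exact hT.isPoint_next ih

theorem nodup_travel (T : Pile) (x : ℕ × ℕ) : (T.travel x).Nodup := by
  refine List.Nodup.map_on ?_ List.nodup_range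
  intro i hi j hj hij
  rw [List.mem_range] at hi hj
  exact (Function.iterate_injOn_Iio_minimalPeriod) hi hj hij

/-- The point before the passage of the over- or underpassing strand through a real crossing. -/
theorem IsClosable.existsUnique_event {T : Pile} (hT : T.IsClosable) (c : T.RealCrossing)
    (v : Bool) :
    ∃ x, T.IsPoint x ∧ ∀ y, T.IsPoint y → (T.event y =
      some (if v then CirclePoint.head c else CirclePoint.tail c) ↔ y = x) := by
  obtain ⟨n, hn⟩ := c
  have hs : ∃ i k, k ≠ CrossingKind.virtual ∧ T.word[n]? = some ⟨i, Piece.cross k⟩ := by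
    have hn' := hn
    unfold IsRealCrossing at hn'
    cases h : T.word[n]? with
    | none => simp [h] at hn'
    | some s =>
      obtain ⟨i, P⟩ := s
      cases P with
      | cross k =>
        refine ⟨i, k, ?_, rfl⟩
        rintro rfl
        simp [h, Slab.isReal, CrossingKind.isReal] at hn'
      | cup b => simp [h, Slab.isReal] at hn'
      | cap => simp [h, Slab.isReal] at hn'
  obtain ⟨i, k, hk, hs⟩ := hs
  have hf := hT.fits hs
  have hnl : n < T.word.length := (List.getElem?_eq_some_iff.1 hs).1
  have hlen := Slab.length_apply _ _ hf
  have hi : i + 2 ≤ (T.level n).length := hf.1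
  obtain ⟨e1, e2⟩ := Slab.apply_cross i k _ hf
  rw [← T.level_succ n _ hs] at e1 e2 hlen
  simp only [Piece.bottoms, Piece.tops] at hlen
  -- the endpoints of an arrow come from its slab only
  have harrow : ∀ m z, T.arrowEnd m z =
      some (if v then CirclePoint.head ⟨n, hn⟩ else CirclePoint.tail ⟨n, hn⟩) ↔
      m = n ∧ (Slab.mk i (Piece.cross k)).overpass z = some v := by
    intro m z
    unfold arrowEnd
    by_cases hm : m = n
    · subst hm
      rw [dif_pos hn, hs]
      cases hz : (Slab.mk i (Piece.cross k)).overpass z with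
      | none => simp [hz]
      | some w => cases v <;> cases w <;> simp [hz]
    · simp only [hm, false_and, iff_false]
      by_cases h : T.IsRealCrossing m
      · rw [dif_pos h, Option.map_eq_some_iff]
        rintro ⟨w, -, hw⟩
        cases v <;> cases w <;> simp at hw <;> exact hm hw
      · simp [dif_neg h]
  -- the slope of the strand concerned
  obtain ⟨b, hb⟩ : ∃ b : Bool, ∀ z, (Slab.mk i (Piece.cross k)).overpass z = some v ↔
      (z = SlabEnd.bottom (if b then i else i + 1) ∨
        z = SlabEnd.top (if b then i + 1 else i)) := by
    cases k with
    | virtual => exact absurd rfl hk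
    | slashOver =>
      refine ⟨v, fun z => ?_⟩
      cases z <;> cases v <;> simp [Slab.overpass, CrossingKind.overpass] <;> grind
    | backslashOver =>
      refine ⟨!v, fun z => ?_⟩
      cases z <;> cases v <;> simp [Slab.overpass, CrossingKind.overpass] <;> grind
  have hdir : T.isUp (n, if b then i else i + 1) = T.isUp (n + 1, if b then i + 1 else i) := by
    cases b
    · simpa [isUp] using e1.symm
    · simpa [isUp] using e2.symm
  have hev : ∀ y, T.event y =
      some (if v then CirclePoint.head ⟨n, hn⟩ else CirclePoint.tail ⟨n, hn⟩) ↔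
      (T.isUp y = true ∧ y = (n, if b then i else i + 1)) ∨
      (T.isUp y = false ∧ y = (n + 1, if b then i + 1 else i)) := by
    rintro ⟨m, p⟩
    unfold event
    by_cases hu : T.isUp (m, p) = true
    · simp only [hu, if_true]
      by_cases hm : m = T.word.length
      · simp only [hm, if_true]
        cases v <;> simp <;> omega
      · simp only [hm, if_false, harrow, hb]
        simp
    · rw [Bool.not_eq_true] at hu
      simp only [hu, Bool.false_eq_true, if_false]
      by_cases hm : m = 0
      · simp only [hm, if_true]
        cases v <;> simp
      · simp only [hm, if_false, harrow, hb]
        simp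
        omega
  by_cases hu : T.isUp (n, if b then i else i + 1) = true
  · refine ⟨(n, if b then i else i + 1), ⟨hnl.le, ?_⟩, fun y _ => ?_⟩
    · dsimp only
      split_ifs <;> omega
    · rw [hev]
      constructor
      · rintro (⟨-, h⟩ | ⟨h, rfl⟩)
        · exact h
        · rw [← hdir, hu] at h
          cases h
      · rintro rfl
        exact Or.inl ⟨hu, rfl⟩
  · rw [Bool.not_eq_true] at hu
    refine ⟨(n + 1, if b then i + 1 else i), ⟨hnl, ?_⟩, fun y _ => ?_⟩
    · dsimp only
      split_ifs <;> omega
    · rw [hev]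
      constructor
      · rintro (⟨h, rfl⟩ | ⟨-, h⟩)
        · rw [hu] at h
          cases h
        · exact h
      · rintro rfl
        exact Or.inr ⟨hdir ▸ hu, rfl⟩

theorem IsKnot.count_circlePoints {T : Pile} (hT : T.IsClosable) (hK : T.IsKnot) {x : ℕ × ℕ}
    (hx : T.IsPoint x) (c : T.RealCrossing) (v : Bool) :
    (T.circlePoints x).count (if v then CirclePoint.head c else CirclePoint.tail c) = 1 := by
  obtain ⟨z, hz, hzu⟩ := hT.existsUnique_event c v
  rw [circlePoints, List.count_filterMap, List.countP_eq_length_filter]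
  have hperm : List.Perm ((T.travel x).filter (fun y => T.event y ==
      some (if v then CirclePoint.head c else CirclePoint.tail c))) [z] := by
    refine (List.perm_ext_iff_of_nodup ((T.nodup_travel x).filter _) (List.nodup_singleton z)).2 ?_
    intro y
    rw [List.mem_filter, List.mem_singleton, ← hK.mem_travel hT hx, beq_iff_eq]
    constructor
    · rintro ⟨h1, h2⟩
      exact (hzu y h1).1 h2
    · rintro rfl
      exact ⟨hz, (hzu y hz).2 rfl⟩
  simpa using hperm.length_eq

end Pile

/-! ## Virtual tangle diagrams -/

/-- A (virtual) tangle diagram in `ℝ × [0,1]` which closes into a knot diagram in `ℝ × S¹`. -/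
structure Tangle extends Pile where
  isClosable : toPile.IsClosable
  isKnot : toPile.IsKnot

namespace Tangle

/-- A starting point on the knot. -/
noncomputable def base (T : Tangle) : ℕ × ℕ := Classical.choose T.isKnot.1

theorem isPoint_base (T : Tangle) : T.IsPoint T.base := Classical.choose_spec T.isKnot.1

/-- The T-diagram of a tangle. The homology class in `H₁(ℝ × S¹) = ℤ` of a loop on the diagram is
its intersection number with the section `ℝ × {0} = ℝ × {1}`. -/
noncomputable def tDiagram (T : Tangle) : TDiagram where
  Arrow := T.RealCrossing
  points := T.circlePoints T.base
  tail_once c := T.isKnot.count_circlePoints T.isClosable T.isPoint_base c false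
  head_once c := T.isKnot.count_circlePoints T.isClosable T.isPoint_base c true
  sign := T.writhe
  val c := markingSum (distinguishedLoop (T.circlePoints T.base) c)
  circleVal := markingSum (T.circlePoints T.base)
  val_eq _ := rfl
  circleVal_eq := rfl

end Tangle

/-! ## Planar isotopies and virtual Reidemeister moves -/

/-- Planar isotopies of the strip, generated by their elementary instances: exchange of the heights
of two pieces situated side by side, straightening of a zigzag, and rotation of a crossing through a
local maximum or minimum. -/
inductive IsotopyMove : List Slab → List Slab → Prop
  | exchange (P Q : Piece) (i k : ℕ) :
      IsotopyMove [⟨i, P⟩, ⟨i + P.tops + k, Q⟩] [⟨i + P.bottoms + k, Q⟩, ⟨i, P⟩]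
  | zigzagRight (i : ℕ) (b : Bool) :
      IsotopyMove [⟨i + 1, Piece.cup b⟩, ⟨i, Piece.cap⟩] []
  | zigzagLeft (i : ℕ) (b : Bool) :
      IsotopyMove [⟨i, Piece.cup b⟩, ⟨i + 1, Piece.cap⟩] []
  | rotateCap (i : ℕ) (k : CrossingKind) :
      IsotopyMove [⟨i + 1, Piece.cross k⟩, ⟨i, Piece.cap⟩]
        [⟨i, Piece.cross k.rotate⟩, ⟨i + 1, Piece.cap⟩]
  | rotateCup (i : ℕ) (k : CrossingKind) (b : Bool) :
      IsotopyMove [⟨i, Piece.cup b⟩, ⟨i + 1, Piece.cross k⟩]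
        [⟨i + 1, Piece.cup b⟩, ⟨i, Piece.cross k.rotate⟩]

/-- The slab with a virtual crossing of the strands number `i` and `i + 1`. -/
def virtualAt (i : ℕ) : Slab := ⟨i, Piece.cross CrossingKind.virtual⟩

/-- The virtual Reidemeister moves: I (removal of a virtual curl), II (removal of a virtual bigon)
and III (a crossing of any kind, real or virtual, slides past a strand which has a virtual crossing
with each of its two branches). -/
inductive ReidemeisterMove : List Slab → List Slab → Prop
  | oneCap (i : ℕ) :
      ReidemeisterMove [virtualAt i, ⟨i, Piece.cap⟩] [⟨i, Piece.cap⟩]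
  | oneCup (i : ℕ) (b : Bool) :
      ReidemeisterMove [⟨i, Piece.cup b⟩, virtualAt i] [⟨i, Piece.cup !b⟩]
  | two (i : ℕ) :
      ReidemeisterMove [virtualAt i, virtualAt i] []
  | three (i : ℕ) (k : CrossingKind) :
      ReidemeisterMove [virtualAt i, virtualAt (i + 1), ⟨i, Piece.cross k⟩]
        [⟨i + 1, Piece.cross k⟩, virtualAt i, virtualAt (i + 1)]

/-- One elementary step between tangle diagrams, seen as knot diagrams in `ℝ × S¹` with a specified
section: a local modification inside the strip, by a planar isotopy or by a virtual Reidemeister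
move, or a virtual Reidemeister move II whose bigon is cut into two halves by the section, which
creates one virtual crossing directly above and another one directly below the section. -/
inductive Step : Tangle → Tangle → Prop
  | inside (T U : Tangle) (u v l r : List Slab) (h : IsotopyMove l r ∨ ReidemeisterMove l r)
      (hbot : T.bot = U.bot) (hT : T.word = u ++ l ++ v) (hU : U.word = u ++ r ++ v) : Step T U
  | acrossSection (T U : Tangle) (i : ℕ) (hbot : T.bot = (virtualAt i).apply U.bot)
      (hU : U.word = virtualAt i :: T.word ++ [virtualAt i]) : Step T U

/-- Equivalence of tangle diagrams under virtual Reidemeister moves. -/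
def VirtuallyEquivalent : Tangle → Tangle → Prop := Relation.EqvGen Step

end VirtualTangle

/-!
# Virtual tangles are the same as T-diagrams

A diagram is treated as a word of slabs, and `Rel a w w'` means that the words `w` and `w'` over the
level `a` are related by isotopies and virtual moves inside the strip. The link with T-diagrams is
made by colourings of words (`CWord`): the points on the levels get colours, which are carried along
the strands and change at real crossings as a `Palette` allows. The moves preserve the colours at the
ends, the colours at the overpasses and the set of all colours (`Rel.cword`). Two palettes matter.

* For `componentPalette`, colours are constant along the components of the closure, so that being a
  knot is a property of colourings (`Pile.IsClosable.isKnot_iff`), preserved by the moves.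
* For `TDiagram.palette G`, the colours are the edges of the circle of `G`. A word is a picture of
  `G` (`Pictures`) if it has a colouring that uses every arrow and every marking of `G` once. The
  parametrization of a knot by its circle is such a colouring for its T-diagram
  (`Tangle.reads_edge`), and conversely a tangle that is a picture of `G` has the T-diagram `G`
  (`Pile.exists_reads`, `Tangle.same_of_reads`); the valuations need no care since the markings
  determine them.

By the virtual moves, every word can be brought to a standard form (`exists_reduced`): at the
bottom, cups and blocks with one real crossing each are created at the right of the strands that are
there; then come only virtual crossings; then caps. Indeed, a real crossing can be rotated until
both of its strands go upwards (`rel_rotate`), and then its lower ends are bent down and joined to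
the strands below by two caps (`rel_block`). The block that is left has no endpoints below, so that,
like a cup, it can be moved virtually to the right of the other strands and slid down; the caps
slide up. The virtual crossings in the middle matter only through the permutation that they realize,
since the Coxeter relations of the symmetric group are virtual moves and isotopies
(`vrel_of_act_eq`). A cup with an end that leads to a cap is removed with that cap, so that in a
reduced form all the ends of cups lead to the top section.

A picture of `G` in reduced standard form is then determined by `G`, once its points on the section
are in a given order: the blocks are the arrows of `G`, the cups are the edges that leave the top
section downwards and come back to it, the caps are the edges that have no end there, there are no
small loops unless the circle is empty (`TDiagram.perm_items`, `TDiagram.capEquiv_capPairs`), and the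
permutation has to connect endpoints of the same edge. Putting the blocks, cups and caps of `G`
together in this way gives a tangle `G.tangle` with T-diagram `G`, which proves that every T-diagram
is realized. Any tangle with T-diagram `G` becomes equivalent to it once its points on the section are
permuted, which is achieved by virtual moves II across the section (`Tangle.exists_conjugate`); so any
two such tangles are equivalent.
-/

namespace VirtualTangle

/-! ### Coloured words -/

/-- Rules for colouring the strands of a diagram by elements of `K`. At a real crossing the colours
of the overpassing and of the underpassing strand may change: `cross s oi oo ui uo` allows a
crossing of writhe `s` to have the colours `oi`, `oo` before and after the overpass and `ui`, `uo`
before and after the underpass. Likewise `mark s i o` allows the colour `i` to change to `o` at an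
intersection point of sign `s` with the section. -/
structure Palette (K : Type) where
  cross : ℤˣ → K → K → K → K → Prop
  mark : ℤˣ → K → K → Prop

/-- An orientation as a sign. -/
def dir (o : Bool) : ℤˣ := if o then 1 else -1

/-- The points of a horizontal level with their orientations and colours. -/
abbrev CLevel (K : Type) := List (Bool × K)

/-- The colourings of the endpoints of a piece, at its bottom and at its top; the last argument
lists the colour of the overpassing strand before a real crossing. -/
inductive Colors {K : Type} (P : Palette K) : Piece → CLevel K → CLevel K → List K → Prop
  | virt (α β : Bool × K) : Colors P (Piece.cross CrossingKind.virtual) [α, β] [β, α] []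
  | slash (o p : Bool) (x x' y y' : K) :
      P.cross (dir o * dir p) (cond o x x') (cond o x' x) (cond p y y') (cond p y' y) →
      Colors P (Piece.cross CrossingKind.slashOver) [(o, x), (p, y)] [(p, y'), (o, x')]
        [cond o x x']
  | backslash (o p : Bool) (x x' y y' : K) :
      P.cross (-(dir o * dir p)) (cond p y y') (cond p y' y) (cond o x x') (cond o x' x) →
      Colors P (Piece.cross CrossingKind.backslashOver) [(o, x), (p, y)] [(p, y'), (o, x')]
        [cond p y y']
  | cup (b : Bool) (x : K) : Colors P (Piece.cup b) [] [(b, x), (!b, x)] []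
  | cap (b : Bool) (x : K) : Colors P Piece.cap [(b, x), (!b, x)] [] []

/-- The colours which occur on a level. -/
def hues {K : Type} (a : CLevel K) : Set K := {x | x ∈ a.map Prod.snd}

/-- The slab `s` coloured by `a` at its bottom and by `b` at its top. -/
def CStep {K : Type} (P : Palette K) (s : Slab) (a b : CLevel K) (cs : List K) : Prop :=
  ∃ x p q y, a = x ++ (p ++ y) ∧ b = x ++ (q ++ y) ∧ x.length = s.pos ∧ Colors P s.piece p q cs

/-- The word `w` has a colouring which is `a` at its bottom and `b` at its top, where `cs` lists the
colours that arrive on the overpasses, and `us` is the set of all colours which are used. -/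
def CWord {K : Type} (P : Palette K) : List Slab → CLevel K → CLevel K → List K → Set K → Prop
  | [], a, b, cs, us => a = b ∧ cs = [] ∧ us = hues a
  | s :: w, a, b, cs, us => ∃ m c c' us', CStep P s a m c ∧ CWord P w m b c' us' ∧ cs = c ++ c' ∧
      us = hues a ∪ us'

section
variable {K : Type} {P : Palette K}

@[simp] theorem hues_nil : hues ([] : CLevel K) = ∅ := by simp [hues]
@[simp] theorem hues_cons (p : Bool × K) (a : CLevel K) : hues (p :: a) = {p.2} ∪ hues a := by
  ext; simp [hues]
@[simp] theorem hues_append (a b : CLevel K) : hues (a ++ b) = hues a ∪ hues b := by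
  ext; simp [hues]

theorem Colors.length {p : Piece} {a b : CLevel K} {cs : List K} (h : Colors P p a b cs) :
    a.length = p.bottoms ∧ b.length = p.tops := by
  cases h <;> exact ⟨rfl, rfl⟩

@[simp] theorem colors_virt {a b : CLevel K} {cs : List K} :
    Colors P (Piece.cross CrossingKind.virtual) a b cs ↔
      ∃ α β, a = [α, β] ∧ b = [β, α] ∧ cs = [] := by
  constructor
  · rintro ⟨α, β⟩; exact ⟨_, _, rfl, rfl, rfl⟩
  · rintro ⟨α, β, rfl, rfl, rfl⟩; exact .virt _ _

@[simp] theorem colors_slash {a b : CLevel K} {cs : List K} :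
    Colors P (Piece.cross CrossingKind.slashOver) a b cs ↔ ∃ o p x x' y y',
      P.cross (dir o * dir p) (cond o x x') (cond o x' x) (cond p y y') (cond p y' y) ∧
      a = [(o, x), (p, y)] ∧ b = [(p, y'), (o, x')] ∧ cs = [cond o x x'] := by
  constructor
  · intro h; cases h; exact ⟨_, _, _, _, _, _, ‹_›, rfl, rfl, rfl⟩
  · rintro ⟨o, p, x, x', y, y', h, rfl, rfl, rfl⟩; exact .slash _ _ _ _ _ _ h

@[simp] theorem colors_backslash {a b : CLevel K} {cs : List K} :
    Colors P (Piece.cross CrossingKind.backslashOver) a b cs ↔ ∃ o p x x' y y',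
      P.cross (-(dir o * dir p)) (cond p y y') (cond p y' y) (cond o x x') (cond o x' x) ∧
      a = [(o, x), (p, y)] ∧ b = [(p, y'), (o, x')] ∧ cs = [cond p y y'] := by
  constructor
  · intro h; cases h; exact ⟨_, _, _, _, _, _, ‹_›, rfl, rfl, rfl⟩
  · rintro ⟨o, p, x, x', y, y', h, rfl, rfl, rfl⟩; exact .backslash _ _ _ _ _ _ h

@[simp] theorem colors_cup {a b : CLevel K} {cs : List K} {o : Bool} :
    Colors P (Piece.cup o) a b cs ↔ ∃ x, a = [] ∧ b = [(o, x), (!o, x)] ∧ cs = [] := by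
  constructor
  · intro h; cases h; exact ⟨_, rfl, rfl, rfl⟩
  · rintro ⟨x, rfl, rfl, rfl⟩; exact .cup _ _

@[simp] theorem colors_cap {a b : CLevel K} {cs : List K} :
    Colors P Piece.cap a b cs ↔ ∃ o x, a = [(o, x), (!o, x)] ∧ b = [] ∧ cs = [] := by
  constructor
  · intro h; cases h; exact ⟨_, _, rfl, rfl, rfl⟩
  · rintro ⟨o, x, rfl, rfl, rfl⟩; exact .cap _ _

theorem CStep.exists_prefix {i : ℕ} {p : Piece} {a b : CLevel K} {cs : List K}
    (h : CStep P ⟨i, p⟩ a b cs) {j : ℕ} (hj : j ≤ i) : ∃ x t, a = x ++ t ∧ x.length = j := by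
  obtain ⟨x, p, q, y, rfl, -, h1, -⟩ := h
  simp only at h1
  exact ⟨x.take j, x.drop j ++ (p ++ y), by simp [← List.append_assoc], by simp; omega⟩

theorem cstep_at {p : Piece} {x t b : CLevel K} {cs : List K} :
    CStep P ⟨x.length, p⟩ (x ++ t) b cs ↔
      ∃ u v y, t = u ++ y ∧ b = x ++ (v ++ y) ∧ Colors P p u v cs := by
  constructor
  · rintro ⟨x', u, v, y, h1, rfl, h2, h3⟩
    obtain ⟨rfl, rfl⟩ := List.append_inj h1 h2.symm
    exact ⟨u, v, y, rfl, rfl, h3⟩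
  · rintro ⟨u, v, y, rfl, rfl, h⟩
    exact ⟨x, u, v, y, rfl, rfl, rfl, h⟩

theorem cstep_at_succ {p : Piece} {x t b : CLevel K} {cs : List K} :
    CStep P ⟨x.length + 1, p⟩ (x ++ t) b cs ↔
      ∃ α u v y, t = α :: (u ++ y) ∧ b = x ++ α :: (v ++ y) ∧ Colors P p u v cs := by
  constructor
  · rintro ⟨x', u, v, y, h1, rfl, h2, h3⟩
    have hl : (x'.take x.length).length = x.length := by simp; simp at h2; omega
    rw [← List.take_append_drop x.length x', List.append_assoc] at h1
    obtain ⟨h4, rfl⟩ := List.append_inj h1 hl.symm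
    obtain ⟨α, hα⟩ : ∃ α, x'.drop x.length = [α] := by
      rw [← List.length_eq_one_iff]; simp at h2 ⊢; omega
    refine ⟨α, u, v, y, by simp [hα], ?_, h3⟩
    conv_lhs => rw [← List.take_append_drop x.length x', ← h4, hα]
    simp
  · rintro ⟨α, u, v, y, rfl, rfl, h⟩
    exact ⟨x ++ [α], u, v, y, by simp, by simp, by simp, h⟩

theorem cword_append {u v : List Slab} {a b : CLevel K} {cs : List K} {us : Set K} :
    CWord P (u ++ v) a b cs us ↔ ∃ m c c' us1 us2, CWord P u a m c us1 ∧ CWord P v m b c' us2 ∧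
      cs = c ++ c' ∧ us = us1 ∪ us2 := by
  have hsub : ∀ (v : List Slab) a b cs us, CWord P v a b cs us → hues a ⊆ us := by
    intro v a b cs us h
    cases v with
    | nil => exact h.2.2.ge
    | cons s v => obtain ⟨_, _, _, _, _, _, _, rfl⟩ := h; simp
  induction u generalizing a cs us with
  | nil =>
    constructor
    · intro h
      exact ⟨a, [], cs, _, _, ⟨rfl, rfl, rfl⟩, h, rfl, (Set.union_eq_right.2 (hsub _ _ _ _ _ h)).symm⟩
    · rintro ⟨m, c, c', us1, us2, ⟨rfl, rfl, rfl⟩, h, rfl, rfl⟩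
      rw [Set.union_eq_right.2 (hsub _ _ _ _ _ h)]
      exact h
  | cons s u ih =>
    constructor
    · rintro ⟨m, c, c', us', hs, hw, rfl, rfl⟩
      obtain ⟨m', d, d', us1, us2, h1, h2, rfl, rfl⟩ := ih.1 hw
      exact ⟨m', _, d', _, us2, ⟨m, c, d, us1, hs, h1, rfl, rfl⟩, h2, by simp,
        by rw [Set.union_assoc]⟩
    · rintro ⟨m, c, c', us1, us2, ⟨m', d, d', us', hs, hw, rfl, rfl⟩, h2, rfl, rfl⟩
      exact ⟨m', d, _, _, hs, ih.2 ⟨_, _, _, _, _, hw, h2, rfl, rfl⟩, by simp,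
        by rw [Set.union_assoc]⟩

/-! ### Invariance of coloured words under the moves -/

@[simp] theorem dir_true : dir true = 1 := rfl
@[simp] theorem dir_false : dir false = -1 := rfl

theorem cword_exchange_iff (p q : Piece) (i k : ℕ) (a b : CLevel K) (cs : List K) (us : Set K) :
    (∃ cs', cs'.Perm cs ∧ CWord P [⟨i, p⟩, ⟨i + p.tops + k, q⟩] a b cs' us) ↔
    (∃ cs', cs'.Perm cs ∧ CWord P [⟨i + p.bottoms + k, q⟩, ⟨i, p⟩] a b cs' us) := by
  constructor
  · rintro ⟨cs', hcs, m, c, _, _, ⟨x, u, v, y, rfl, rfl, hx, h1⟩, ⟨_, c', _, _,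
      ⟨x', u', v', y', h2, rfl, hx', h3⟩, ⟨rfl, rfl, rfl⟩, rfl, rfl⟩, rfl, rfl⟩
    have hl := h1.length
    simp only at hl hx hx'
    rw [← List.append_assoc, ← List.take_append_drop (x.length + v.length) x',
      List.append_assoc (x'.take _)] at h2
    obtain ⟨h4, rfl⟩ := List.append_inj h2 (by simp; omega)
    have h5 : x' = x ++ (v ++ x'.drop (x.length + v.length)) := by
      conv_lhs => rw [← List.take_append_drop (x.length + v.length) x', ← h4]
      simp
    generalize x'.drop (x.length + v.length) = z at *
    subst h5
    simp only [List.length_append] at hx'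
    refine ⟨c' ++ c, List.perm_append_comm.trans (by simpa using hcs), x ++ (u ++ (z ++ (v' ++ y'))), c', c, _,
      ⟨x ++ (u ++ z), u', v', y', by simp, by simp, by simp; omega, h3⟩,
      ⟨_, c, [], _, ⟨x, u, v, z ++ (v' ++ y'), rfl, rfl, hx, h1⟩, ⟨by simp, rfl, rfl⟩, by simp, rfl⟩,
      rfl, ?_⟩
    ext; simp only [hues_append, Set.mem_union]; grind
  · rintro ⟨cs', hcs, m, c, _, _, ⟨x', u', v', y', rfl, rfl, hx', h3⟩, ⟨_, c', _, _,
      ⟨x, u, v, y, h2, rfl, hx, h1⟩, ⟨rfl, rfl, rfl⟩, rfl, rfl⟩, rfl, rfl⟩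
    have hl := h1.length
    simp only at hl hx hx'
    symm at h2
    rw [← List.append_assoc, ← List.take_append_drop (x.length + u.length) x',
      List.append_assoc (x'.take _)] at h2
    obtain ⟨h4, rfl⟩ := List.append_inj h2 (by simp; omega)
    have h5 : x' = x ++ (u ++ x'.drop (x.length + u.length)) := by
      conv_lhs => rw [← List.take_append_drop (x.length + u.length) x', ← h4]
      simp
    generalize x'.drop (x.length + u.length) = z at *
    subst h5
    simp only [List.length_append] at hx'
    refine ⟨c' ++ c, List.perm_append_comm.trans (by simpa using hcs), x ++ (v ++ (z ++ (u' ++ y'))), c', c, _,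
      ⟨x, u, v, z ++ (u' ++ y'), by simp, by simp, hx, h1⟩,
      ⟨_, c, [], _, ⟨x ++ (v ++ z), u', v', y', by simp, rfl, by simp; omega, h3⟩, ⟨by simp, rfl, rfl⟩, by simp, rfl⟩,
      rfl, ?_⟩
    ext; simp only [hues_append, Set.mem_union]; grind

end
section
variable {K : Type} {P : Palette K}

theorem colors_cross_iff {k : CrossingKind} {a b : CLevel K} {cs : List K} :
    Colors P (Piece.cross k) a b cs ↔ ∃ α β γ δ, a = [α, β] ∧ b = [γ, δ] ∧ γ.1 = β.1 ∧ δ.1 = α.1 ∧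
      Colors P (Piece.cross k) [α, β] [γ, δ] cs := by
  constructor
  · intro h
    cases h with
    | virt α β => exact ⟨_, _, _, _, rfl, rfl, rfl, rfl, .virt _ _⟩
    | slash o p x x' y y' h => exact ⟨_, _, _, _, rfl, rfl, rfl, rfl, .slash _ _ _ _ _ _ h⟩
    | backslash o p x x' y y' h => exact ⟨_, _, _, _, rfl, rfl, rfl, rfl, .backslash _ _ _ _ _ _ h⟩
  · rintro ⟨α, β, γ, δ, rfl, rfl, -, -, h⟩
    exact h

theorem CStep.of_colors {i : ℕ} {p : Piece} {u v : CLevel K} {cs : List K} (h : Colors P p u v cs)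
    (x y : CLevel K) {a b : CLevel K} (hi : x.length = i) (ha : a = x ++ (u ++ y))
    (hb : b = x ++ (v ++ y)) : CStep P ⟨i, p⟩ a b cs :=
  ⟨x, u, v, y, ha, hb, hi, h⟩

theorem CStep.cword {s : Slab} {a b : CLevel K} {c cs : List K} {us : Set K}
    (h : CStep P s a b c) (hc : cs = c) (hu : us = hues a ∪ hues b) : CWord P [s] a b cs us :=
  ⟨b, c, [], _, h, ⟨rfl, rfl, rfl⟩, by simpa using hc, hu⟩

theorem CStep.cons {s : Slab} {w : List Slab} {a m b : CLevel K} {c c' cs : List K} {us us' : Set K}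
    (h : CStep P s a m c) (h' : CWord P w m b c' us') (hc : cs = c ++ c') (hu : us = hues a ∪ us') :
    CWord P (s :: w) a b cs us :=
  ⟨m, c, c', us', h, h', hc, hu⟩

theorem colors_rotateCap {k : CrossingKind} {β δ : Bool × K} {o : Bool} {z w : K} {cs : List K} :
    Colors P (Piece.cross k) [β, (!o, w)] [(!o, z), δ] cs ↔
      Colors P (Piece.cross k.rotate) [(o, z), β] [δ, (o, w)] cs := by
  obtain ⟨o1, c1⟩ := β
  obtain ⟨o2, c2⟩ := δ
  constructor
  · intro h
    cases h
    · exact .virt _ _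
    · refine .backslash _ _ _ _ _ _ ?_
      cases o <;> cases o1 <;> simpa using ‹_›
    · have h := Colors.slash o o1 z w c1 c2 (P := P) (by cases o <;> cases o1 <;> simpa using ‹_›)
      cases o <;> exact h
  · intro h
    cases k <;> cases h
    · refine .slash _ _ _ _ _ _ ?_
      cases o <;> cases o1 <;> simpa using ‹_›
    · have h := Colors.backslash o1 (!o) c1 c2 w z (P := P) (by cases o <;> cases o1 <;> simpa using ‹_›)
      cases o <;> exact h
    · exact .virt _ _

theorem colors_rotateCup {k : CrossingKind} {β δ : Bool × K} {o : Bool} {z w : K} {cs : List K} :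
    Colors P (Piece.cross k) [(!o, z), β] [δ, (!o, w)] cs ↔
      Colors P (Piece.cross k.rotate) [β, (o, w)] [(o, z), δ] cs := by
  obtain ⟨o1, c1⟩ := β
  obtain ⟨o2, c2⟩ := δ
  constructor
  · intro h
    cases h
    · exact .virt _ _
    · have h := Colors.backslash o1 o c1 c2 w z (P := P) (by cases o <;> cases o1 <;> simpa using ‹_›)
      cases o <;> exact h
    · refine .slash _ _ _ _ _ _ ?_
      cases o <;> cases o1 <;> simpa using ‹_›
  · intro h
    cases k <;> cases h
    · have h := Colors.slash (!o) o1 z w c1 c2 (P := P) (by cases o <;> cases o1 <;> simpa using ‹_›)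
      cases o <;> exact h
    · refine .backslash _ _ _ _ _ _ ?_
      cases o <;> cases o1 <;> simpa using ‹_›
    · exact .virt _ _

theorem cword_rotateCap_iff (i : ℕ) (k : CrossingKind) (a b : CLevel K) (cs : List K) (us : Set K) :
    CWord P [⟨i + 1, Piece.cross k⟩, ⟨i, Piece.cap⟩] a b cs us ↔
    CWord P [⟨i, Piece.cross k.rotate⟩, ⟨i + 1, Piece.cap⟩] a b cs us := by
  constructor
  · rintro ⟨m, c, _, _, h1, ⟨_, c', _, _, h2, ⟨rfl, rfl, rfl⟩, rfl, rfl⟩, rfl, rfl⟩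
    obtain ⟨x, t, rfl, rfl⟩ := h1.exists_prefix (show i ≤ i + 1 by omega)
    rw [cstep_at_succ] at h1
    obtain ⟨α, u, v, y, rfl, rfl, h1⟩ := h1
    rw [cstep_at] at h2
    obtain ⟨u', v', y', h3, rfl, h2⟩ := h2
    obtain ⟨o, z, rfl, rfl, rfl⟩ := colors_cap.1 h2
    obtain ⟨β, ⟨oγ, w⟩, γ', δ, rfl, rfl, e1, e2, h1⟩ := colors_cross_iff.1 h1
    simp at h3
    obtain ⟨rfl, rfl, rfl⟩ := h3
    simp only at e1
    subst e1
    refine (CStep.of_colors (colors_rotateCap.1 h1) x ((!o, w) :: y) rfl (by simp) rfl).cons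
      ((CStep.of_colors (Colors.cap o w) (x ++ [δ]) y (by simp) (by simp) (by simp)).cword rfl rfl)
      (by simp) ?_
    ext; simp; grind
  · rintro ⟨m, c, _, _, h1, ⟨_, c', _, _, h2, ⟨rfl, rfl, rfl⟩, rfl, rfl⟩, rfl, rfl⟩
    obtain ⟨x, t, rfl, rfl⟩ := h1.exists_prefix (show i ≤ i by omega)
    rw [cstep_at] at h1
    obtain ⟨u, v, y, rfl, rfl, h1⟩ := h1
    rw [cstep_at_succ] at h2
    obtain ⟨δ', u', v', y', h3, rfl, h2⟩ := h2
    obtain ⟨o, w, rfl, rfl, rfl⟩ := colors_cap.1 h2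
    obtain ⟨⟨o', z⟩, β, δ, γ', rfl, rfl, e1, e2, h1⟩ := colors_cross_iff.1 h1
    simp at h3
    obtain ⟨rfl, rfl, rfl⟩ := h3
    simp only at e2
    subst e2
    refine (CStep.of_colors (colors_rotateCap.2 h1) (x ++ [(o, z)]) y' (by simp) (by simp) rfl).cons
      ((CStep.of_colors (Colors.cap o z) x (δ :: y') rfl (by simp) (by simp)).cword rfl rfl)
      (by simp) ?_
    ext; simp; grind

theorem cword_rotateCup_iff (i : ℕ) (k : CrossingKind) (o : Bool) (a b : CLevel K) (cs : List K)
    (us : Set K) :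
    CWord P [⟨i, Piece.cup o⟩, ⟨i + 1, Piece.cross k⟩] a b cs us ↔
    CWord P [⟨i + 1, Piece.cup o⟩, ⟨i, Piece.cross k.rotate⟩] a b cs us := by
  constructor
  · rintro ⟨m, c, _, _, h1, ⟨_, c', _, _, h2, ⟨rfl, rfl, rfl⟩, rfl, rfl⟩, rfl, rfl⟩
    obtain ⟨x, t, rfl, rfl⟩ := h1.exists_prefix (show i ≤ i by omega)
    rw [cstep_at] at h1
    obtain ⟨u, v, y, rfl, rfl, h1⟩ := h1
    rw [cstep_at_succ] at h2
    obtain ⟨α, u', v', y', h3, rfl, h2⟩ := h2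
    obtain ⟨z, rfl, rfl, rfl⟩ := colors_cup.1 h1
    obtain ⟨β, γ, δ, ⟨oγ, w⟩, rfl, rfl, e1, e2, h2⟩ := colors_cross_iff.1 h2
    simp at h3
    obtain ⟨rfl, rfl, rfl⟩ := h3
    simp only at e2
    subst e2
    refine (CStep.of_colors (Colors.cup o w) (x ++ [γ]) y' (by simp) (by simp) rfl).cons
      ((CStep.of_colors (colors_rotateCup.1 h2) x ((!o, w) :: y') rfl (by simp) (by simp)).cword rfl
        rfl) (by simp) ?_
    ext; simp; grind
  · rintro ⟨m, c, _, _, h1, ⟨_, c', _, _, h2, ⟨rfl, rfl, rfl⟩, rfl, rfl⟩, rfl, rfl⟩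
    obtain ⟨x, t, rfl, rfl⟩ := h1.exists_prefix (show i ≤ i + 1 by omega)
    rw [cstep_at_succ] at h1
    obtain ⟨α, u, v, y, rfl, rfl, h1⟩ := h1
    rw [cstep_at] at h2
    obtain ⟨u', v', y', h3, rfl, h2⟩ := h2
    obtain ⟨w, rfl, rfl, rfl⟩ := colors_cup.1 h1
    obtain ⟨β, γ, ⟨o', z⟩, δ, rfl, rfl, e1, e2, h2⟩ := colors_cross_iff.1 h2
    simp at h3
    obtain ⟨rfl, rfl, rfl⟩ := h3
    simp only at e1
    subst e1
    refine (CStep.of_colors (Colors.cup o' z) x (α :: y) rfl (by simp) rfl).cons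
      ((CStep.of_colors (colors_rotateCup.2 h2) (x ++ [(o', z)]) y (by simp) (by simp)
        (by simp)).cword rfl rfl) (by simp) ?_
    ext; simp; grind

theorem cword_oneCap_iff (i : ℕ) (a b : CLevel K) (cs : List K) (us : Set K) :
    CWord P [virtualAt i, ⟨i, Piece.cap⟩] a b cs us ↔ CWord P [⟨i, Piece.cap⟩] a b cs us := by
  constructor
  · rintro ⟨m, c, _, _, h1, ⟨_, c', _, _, h2, ⟨rfl, rfl, rfl⟩, rfl, rfl⟩, rfl, rfl⟩
    obtain ⟨x, t, rfl, rfl⟩ := h1.exists_prefix (show i ≤ i by omega)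
    rw [virtualAt, cstep_at] at h1
    obtain ⟨u, v, y, rfl, rfl, h1⟩ := h1
    rw [cstep_at] at h2
    obtain ⟨u', v', y', h3, rfl, h2⟩ := h2
    obtain ⟨α, β, rfl, rfl, rfl⟩ := colors_virt.1 h1
    obtain ⟨o, z, rfl, rfl, rfl⟩ := colors_cap.1 h2
    simp at h3
    obtain ⟨rfl, rfl, rfl⟩ := h3
    refine ⟨_, [], _, _, cstep_at.2 ⟨_, _, y, rfl, rfl, ?_⟩, ⟨rfl, rfl, rfl⟩, by simp, ?_⟩
    · simp
    · ext; simp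
  · rintro ⟨_, c', _, _, h2, ⟨rfl, rfl, rfl⟩, rfl, rfl⟩
    obtain ⟨x, t, rfl, rfl⟩ := h2.exists_prefix (show i ≤ i by omega)
    rw [cstep_at] at h2
    obtain ⟨u', v', y', rfl, rfl, h2⟩ := h2
    obtain ⟨o, z, rfl, rfl, rfl⟩ := colors_cap.1 h2
    refine (CStep.of_colors (Colors.virt _ _) x y' rfl rfl rfl).cons
      ((CStep.of_colors (Colors.cap (!o) z) x y' rfl (by simp) rfl).cword rfl rfl) (by simp) ?_
    ext; simp

theorem cword_oneCup_iff (i : ℕ) (o : Bool) (a b : CLevel K) (cs : List K) (us : Set K) :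
    CWord P [⟨i, Piece.cup o⟩, virtualAt i] a b cs us ↔ CWord P [⟨i, Piece.cup !o⟩] a b cs us := by
  constructor
  · rintro ⟨m, c, _, _, h1, ⟨_, c', _, _, h2, ⟨rfl, rfl, rfl⟩, rfl, rfl⟩, rfl, rfl⟩
    obtain ⟨x, t, rfl, rfl⟩ := h1.exists_prefix (show i ≤ i by omega)
    rw [cstep_at] at h1
    obtain ⟨u, v, y, rfl, rfl, h1⟩ := h1
    rw [virtualAt, cstep_at] at h2
    obtain ⟨u', v', y', h3, rfl, h2⟩ := h2
    obtain ⟨α, β, rfl, rfl, rfl⟩ := colors_virt.1 h2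
    obtain ⟨z, rfl, rfl, rfl⟩ := colors_cup.1 h1
    simp at h3
    obtain ⟨rfl, rfl, rfl⟩ := h3
    refine ⟨_, [], _, _, cstep_at.2 ⟨_, _, y, rfl, rfl, ?_⟩, ⟨rfl, rfl, rfl⟩, by simp, ?_⟩
    · simp
    · ext; simp
  · rintro ⟨_, c', _, _, h2, ⟨rfl, rfl, rfl⟩, rfl, rfl⟩
    obtain ⟨x, t, rfl, rfl⟩ := h2.exists_prefix (show i ≤ i by omega)
    rw [cstep_at] at h2
    obtain ⟨u', v', y', rfl, rfl, h2⟩ := h2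
    obtain ⟨z, rfl, rfl, rfl⟩ := colors_cup.1 h2
    refine (CStep.of_colors (Colors.cup o z) x y' rfl rfl rfl).cons
      ((CStep.of_colors (Colors.virt _ _) x y' rfl rfl (by simp)).cword rfl rfl) (by simp) ?_
    ext; simp

theorem cword_three_iff (i : ℕ) (k : CrossingKind) (a b : CLevel K) (cs : List K) (us : Set K) :
    CWord P [virtualAt i, virtualAt (i + 1), ⟨i, Piece.cross k⟩] a b cs us ↔
      CWord P [⟨i + 1, Piece.cross k⟩, virtualAt i, virtualAt (i + 1)] a b cs us := by
  constructor
  · rintro ⟨m, c, _, _, h1, ⟨_, c', _, _, h2, ⟨_, c'', _, _, h3, ⟨rfl, rfl, rfl⟩, rfl, rfl⟩, rfl,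
      rfl⟩, rfl, rfl⟩
    obtain ⟨x, t, rfl, rfl⟩ := h1.exists_prefix (show i ≤ i by omega)
    rw [virtualAt, cstep_at] at h1
    obtain ⟨u, v, y, rfl, rfl, h1⟩ := h1
    obtain ⟨α, β, rfl, rfl, rfl⟩ := colors_virt.1 h1
    rw [virtualAt, cstep_at_succ] at h2
    obtain ⟨_, u', v', y', h4, rfl, h2⟩ := h2
    obtain ⟨_, γ, rfl, rfl, rfl⟩ := colors_virt.1 h2
    simp at h4
    obtain ⟨rfl, rfl, rfl⟩ := h4
    rw [cstep_at] at h3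
    obtain ⟨u', v', y1, h4, rfl, h3⟩ := h3
    obtain ⟨_, _, γ', β', rfl, rfl, -, -, h3⟩ := colors_cross_iff.1 h3
    simp at h4
    obtain ⟨rfl, rfl, rfl⟩ := h4
    refine (CStep.of_colors h3 (x ++ [α]) y' (by simp) (by simp) rfl).cons
      ((CStep.of_colors (Colors.virt α γ') x (β' :: y') rfl (by simp) rfl).cons
        ((CStep.of_colors (Colors.virt α β') (x ++ [γ']) y' (by simp) (by simp) (by simp)).cword rfl
          rfl) rfl rfl) (by simp) ?_
    ext; simp; grind
  · rintro ⟨m, c, _, _, h1, ⟨_, c', _, _, h2, ⟨_, c'', _, _, h3, ⟨rfl, rfl, rfl⟩, rfl, rfl⟩, rfl,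
      rfl⟩, rfl, rfl⟩
    obtain ⟨x, t, rfl, rfl⟩ := h1.exists_prefix (show i ≤ i + 1 by omega)
    rw [cstep_at_succ] at h1
    obtain ⟨α, u, v, y0, rfl, rfl, h1⟩ := h1
    obtain ⟨β, γ0, γ', β', rfl, rfl, -, -, h1⟩ := colors_cross_iff.1 h1
    rw [virtualAt, cstep_at] at h2
    obtain ⟨u', v', y', h4, rfl, h2⟩ := h2
    obtain ⟨_, γ, rfl, rfl, rfl⟩ := colors_virt.1 h2
    simp at h4
    obtain ⟨rfl, rfl, rfl⟩ := h4
    rw [virtualAt, cstep_at_succ] at h3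
    obtain ⟨_, u', v', y, h4, rfl, h3⟩ := h3
    obtain ⟨_, _, rfl, rfl, rfl⟩ := colors_virt.1 h3
    simp at h4
    obtain ⟨rfl, rfl, rfl, rfl⟩ := h4
    refine (CStep.of_colors (Colors.virt α β) x (γ0 :: y0) rfl (by simp) rfl).cons
      ((CStep.of_colors (Colors.virt α γ0) (x ++ [β]) y0 (by simp) (by simp) rfl).cons
        ((CStep.of_colors h1 x (α :: y0) rfl (by simp) (by simp)).cword rfl rfl) rfl rfl)
      (by simp) ?_
    ext; simp; grind

theorem CWord.of_two {i : ℕ} {a b : CLevel K} {cs : List K} {us : Set K}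
    (h : CWord P [virtualAt i, virtualAt i] a b cs us) : CWord P [] a b cs us := by
  obtain ⟨m, c, _, _, h1, ⟨_, c', _, _, h2, ⟨rfl, rfl, rfl⟩, rfl, rfl⟩, rfl, rfl⟩ := h
  obtain ⟨x, t, rfl, rfl⟩ := h1.exists_prefix (show i ≤ i by omega)
  rw [virtualAt, cstep_at] at h1
  obtain ⟨u, v, y, rfl, rfl, h1⟩ := h1
  obtain ⟨α, β, rfl, rfl, rfl⟩ := colors_virt.1 h1
  rw [virtualAt, cstep_at] at h2
  obtain ⟨u', v', y', h4, rfl, h2⟩ := h2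
  obtain ⟨_, _, rfl, rfl, rfl⟩ := colors_virt.1 h2
  simp at h4
  obtain ⟨rfl, rfl, rfl⟩ := h4
  refine ⟨rfl, rfl, ?_⟩
  ext; simp; grind

theorem CWord.to_two {i : ℕ} {a b : CLevel K} {cs : List K} {us : Set K} (hi : i + 1 < a.length)
    (h : CWord P [] a b cs us) : CWord P [virtualAt i, virtualAt i] a b cs us := by
  obtain ⟨rfl, rfl, rfl⟩ := h
  obtain ⟨x, t, rfl, rfl⟩ : ∃ x t, a = x ++ t ∧ x.length = i :=
    ⟨a.take i, a.drop i, by simp, by simp; omega⟩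
  obtain ⟨α, β, y, rfl⟩ : ∃ α β y, t = α :: β :: y := by
    match t, hi with
    | α :: β :: y, _ => exact ⟨α, β, y, rfl⟩
    | [α], hi => simp at hi
    | [], hi => simp at hi
  refine (CStep.of_colors (Colors.virt α β) x y rfl (by simp) rfl).cons
    ((CStep.of_colors (Colors.virt β α) x y rfl rfl (by simp)).cword rfl rfl) (by simp) ?_
  ext; simp; grind

theorem CWord.of_zigzagRight {i : ℕ} {o : Bool} {a b : CLevel K} {cs : List K} {us : Set K}
    (h : CWord P [⟨i + 1, Piece.cup o⟩, ⟨i, Piece.cap⟩] a b cs us) : CWord P [] a b cs us := by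
  obtain ⟨m, c, _, _, h1, ⟨_, c', _, _, h2, ⟨rfl, rfl, rfl⟩, rfl, rfl⟩, rfl, rfl⟩ := h
  obtain ⟨x, t, rfl, rfl⟩ := h1.exists_prefix (show i ≤ i + 1 by omega)
  rw [cstep_at_succ] at h1
  obtain ⟨α, u, v, y, rfl, rfl, h1⟩ := h1
  obtain ⟨z, rfl, rfl, rfl⟩ := colors_cup.1 h1
  rw [cstep_at] at h2
  obtain ⟨u', v', y', h4, rfl, h2⟩ := h2
  obtain ⟨_, _, rfl, rfl, rfl⟩ := colors_cap.1 h2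
  simp at h4
  obtain ⟨rfl, ⟨rfl, rfl⟩, rfl⟩ := h4
  refine ⟨by simp, rfl, ?_⟩
  ext; simp

theorem CWord.of_zigzagLeft {i : ℕ} {o : Bool} {a b : CLevel K} {cs : List K} {us : Set K}
    (h : CWord P [⟨i, Piece.cup o⟩, ⟨i + 1, Piece.cap⟩] a b cs us) : CWord P [] a b cs us := by
  obtain ⟨m, c, _, _, h1, ⟨_, c', _, _, h2, ⟨rfl, rfl, rfl⟩, rfl, rfl⟩, rfl, rfl⟩ := h
  obtain ⟨x, t, rfl, rfl⟩ := h1.exists_prefix (show i ≤ i by omega)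
  rw [cstep_at] at h1
  obtain ⟨u, v, y, rfl, rfl, h1⟩ := h1
  obtain ⟨z, rfl, rfl, rfl⟩ := colors_cup.1 h1
  rw [cstep_at_succ] at h2
  obtain ⟨_, u', v', y', h4, rfl, h2⟩ := h2
  obtain ⟨_, _, rfl, rfl, rfl⟩ := colors_cap.1 h2
  simp at h4
  obtain ⟨rfl, ⟨rfl, rfl⟩, rfl⟩ := h4
  refine ⟨by simp, rfl, ?_⟩
  ext; simp

theorem CWord.to_zigzagRight {i : ℕ} {o : Bool} {a b : CLevel K} {cs : List K} {us : Set K}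
    (hi : (a.map Prod.fst)[i]? = some (!o)) (h : CWord P [] a b cs us) :
    CWord P [⟨i + 1, Piece.cup o⟩, ⟨i, Piece.cap⟩] a b cs us := by
  obtain ⟨rfl, rfl, rfl⟩ := h
  obtain ⟨hl, -⟩ := List.getElem?_eq_some_iff.1 hi
  simp only [List.length_map] at hl
  obtain ⟨x, t, rfl, rfl⟩ : ∃ x t, a = x ++ t ∧ x.length = i :=
    ⟨a.take i, a.drop i, by simp, by simp; omega⟩
  obtain ⟨⟨o', z⟩, y, rfl⟩ : ∃ α y, t = α :: y := by
    cases t with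
    | nil => simp at hl
    | cons α y => exact ⟨α, y, rfl⟩
  simp at hi
  subst hi
  refine (CStep.of_colors (Colors.cup o z) (x ++ [(!o, z)]) y (by simp) (by simp) rfl).cons
    ((CStep.of_colors (Colors.cap (!o) z) x ((!o, z) :: y) rfl (by simp) (by simp)).cword rfl rfl)
    (by simp) ?_
  ext; simp

theorem CWord.to_zigzagLeft {i : ℕ} {o : Bool} {a b : CLevel K} {cs : List K} {us : Set K}
    (hi : (a.map Prod.fst)[i]? = some o) (h : CWord P [] a b cs us) :
    CWord P [⟨i, Piece.cup o⟩, ⟨i + 1, Piece.cap⟩] a b cs us := by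
  obtain ⟨rfl, rfl, rfl⟩ := h
  obtain ⟨hl, -⟩ := List.getElem?_eq_some_iff.1 hi
  simp only [List.length_map] at hl
  obtain ⟨x, t, rfl, rfl⟩ : ∃ x t, a = x ++ t ∧ x.length = i :=
    ⟨a.take i, a.drop i, by simp, by simp; omega⟩
  obtain ⟨⟨o', z⟩, y, rfl⟩ : ∃ α y, t = α :: y := by
    cases t with
    | nil => simp at hl
    | cons α y => exact ⟨α, y, rfl⟩
  simp at hi
  subst hi
  refine (CStep.of_colors (Colors.cup o' z) x ((o', z) :: y) rfl (by simp) rfl).cons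
    ((CStep.of_colors (Colors.cap (!o') z) (x ++ [(o', z)]) y (by simp) (by simp)
      (by simp)).cword rfl rfl) (by simp) ?_
  ext; simp
end

/-! ### Valid words and their equivalence -/

/-- The slabs of the word `w` can be piled up on the level `a`. -/
def Valid : Level → List Slab → Prop
  | _, [] => True
  | a, s :: w => s.Fits a ∧ Valid (s.apply a) w

/-- The level on the top of the word `w` put on the level `a`. -/
def run (a : Level) (w : List Slab) : Level := w.foldl (fun a s => s.apply a) a

@[simp] theorem run_nil (a : Level) : run a [] = a := rfl
@[simp] theorem run_cons (a : Level) (s : Slab) (w : List Slab) :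
    run a (s :: w) = run (s.apply a) w := rfl
theorem run_append (a : Level) (u v : List Slab) : run a (u ++ v) = run (run a u) v := by
  simp [run]
@[simp] theorem valid_nil (a : Level) : Valid a [] := trivial
@[simp] theorem valid_cons (a : Level) (s : Slab) (w : List Slab) :
    Valid a (s :: w) ↔ s.Fits a ∧ Valid (s.apply a) w := Iff.rfl
theorem valid_append (a : Level) (u v : List Slab) :
    Valid a (u ++ v) ↔ Valid a u ∧ Valid (run a u) v := by
  induction u generalizing a with
  | nil => simp
  | cons s u ih => simp [ih, and_assoc]

/-- The orientations at the top of a piece with the orientations `u` at its bottom. -/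
@[simp] def Piece.topLevel (u : Level) : Piece → Level
  | cross _ => u.reverse
  | cup b => [b, !b]
  | cap => []

theorem apply_append {i : ℕ} {p : Piece} {x u y : Level} (hx : x.length = i)
    (hu : u.length = p.bottoms) : Slab.apply ⟨i, p⟩ (x ++ (u ++ y)) = x ++ ((p.topLevel u) ++ y) := by
  subst hx
  have h2 : ((x ++ (u ++ y)).drop (x.length + p.bottoms)) = y := by
    rw [← hu, ← List.append_assoc, ← List.length_append, List.drop_left]
  unfold Slab.apply
  rw [h2]
  cases p <;> simp [Piece.bottoms, Piece.topLevel] at hu ⊢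
  rw [← hu, List.take_left]

theorem fits_append {i : ℕ} {p : Piece} {x u y : Level} (hx : x.length = i)
    (hu : u.length = p.bottoms) : Slab.Fits ⟨i, p⟩ (x ++ (u ++ y)) ↔
      (p = Piece.cap → ∃ b, u = [b, !b]) := by
  subst hx
  unfold Slab.Fits
  cases p <;> simp [Piece.bottoms] at hu ⊢
  · omega
  · obtain ⟨b, c, rfl⟩ := List.length_eq_two.1 hu
    simp
    cases b <;> cases c <;> simp

section
variable {K : Type} {P : Palette K}

theorem CStep.fits {s : Slab} {a b : CLevel K} {cs : List K} (h : CStep P s a b cs) :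
    s.Fits (a.map Prod.fst) ∧ s.apply (a.map Prod.fst) = b.map Prod.fst := by
  obtain ⟨x, u, v, y, rfl, rfl, hx, h⟩ := h
  obtain ⟨i, p⟩ := s
  have hl := h.length
  simp only [List.map_append]
  rw [fits_append (by simpa using hx) (by simpa using hl.1),
    apply_append (by simpa using hx) (by simpa using hl.1)]
  cases h <;> simp [Piece.topLevel]

theorem CWord.valid {w : List Slab} {a b : CLevel K} {cs : List K} {us : Set K}
    (h : CWord P w a b cs us) :
    Valid (a.map Prod.fst) w ∧ run (a.map Prod.fst) w = b.map Prod.fst := by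
  induction w generalizing a cs us with
  | nil => obtain ⟨rfl, -⟩ := h; simp
  | cons s w ih =>
    obtain ⟨m, c, c', us', h1, h2, -, -⟩ := h
    obtain ⟨h3, h4⟩ := h1.fits
    simp [h3, h4, ih h2]

/-- The palette whose colours are constant along each component of the closure of a diagram. -/
def componentPalette (K : Type) : Palette K where
  cross _ oi oo ui uo := oi = oo ∧ ui = uo
  mark _ i o := i = o

theorem exists_cstep_const {s : Slab} {a : Level} (h : s.Fits a) (x : K) :
    ∃ cs, CStep (componentPalette K) s (a.map (·, x)) ((s.apply a).map (·, x)) cs := by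
  obtain ⟨i, p⟩ := s
  obtain ⟨y, u, z, rfl, hy, hu⟩ : ∃ y u z, a = y ++ (u ++ z) ∧ y.length = i ∧
      u.length = p.bottoms := by
    have h1 := h.1
    simp only at h1
    refine ⟨a.take i, (a.drop i).take p.bottoms, (a.drop i).drop p.bottoms, by simp, ?_, ?_⟩ <;>
      simp <;> omega
  rw [fits_append hy hu] at h
  rw [apply_append hy hu]
  have key : ∃ v cs, Colors (componentPalette K) p (u.map (·, x)) (v.map (·, x)) cs ∧ v = p.topLevel u := by
    cases p with
    | cross k =>
      obtain ⟨o, o', rfl⟩ := List.length_eq_two.1 hu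
      refine ⟨[o', o], ?_⟩
      cases k
      · exact ⟨_, .slash o o' x x x x (by simp [componentPalette]), rfl⟩
      · exact ⟨_, .backslash o o' x x x x (by simp [componentPalette]), rfl⟩
      · exact ⟨_, .virt _ _, rfl⟩
    | cup b =>
      obtain rfl := List.eq_nil_of_length_eq_zero hu
      exact ⟨_, _, .cup b x, rfl⟩
    | cap =>
      obtain ⟨b, rfl⟩ := h rfl
      exact ⟨[], _, .cap b x, rfl⟩
  obtain ⟨v, cs, hc, rfl⟩ := key
  exact ⟨cs, .of_colors hc (y.map (·, x)) (z.map (·, x)) (by simpa using hy) (by simp) (by simp)⟩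

theorem hues_const_subset (a : Level) (x : K) : hues (a.map (·, x)) ⊆ {x} := by
  intro; simp [hues]; grind

theorem exists_cword_const {w : List Slab} {a : Level} (h : Valid a w) (x : K) :
    ∃ cs us, us ⊆ {x} ∧
      CWord (componentPalette K) w (a.map (·, x)) ((run a w).map (·, x)) cs us := by
  induction w generalizing a with
  | nil => exact ⟨[], _, hues_const_subset a x, rfl, rfl, rfl⟩
  | cons s w ih =>
    obtain ⟨cs, us, h1, h2⟩ := ih h.2
    obtain ⟨c, h3⟩ := exists_cstep_const h.1 x
    exact ⟨_, _, Set.union_subset (hues_const_subset a x) h1, _, _, _, _, h3, h2, rfl, rfl⟩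

/-- A planar isotopy or a virtual Reidemeister move. -/
def Move (l r : List Slab) : Prop := IsotopyMove l r ∨ ReidemeisterMove l r

theorem CWord.move {l r : List Slab} (h : Move l r) {a b : CLevel K} {cs : List K} {us : Set K}
    (hw : CWord P l a b cs us) : ∃ cs', cs'.Perm cs ∧ CWord P r a b cs' us := by
  rcases h with h | h
  · cases h with
    | exchange p q i k => exact (cword_exchange_iff p q i k a b cs us).1 ⟨cs, .refl _, hw⟩
    | zigzagRight i o => exact ⟨cs, .refl _, hw.of_zigzagRight⟩
    | zigzagLeft i o => exact ⟨cs, .refl _, hw.of_zigzagLeft⟩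
    | rotateCap i k => exact ⟨cs, .refl _, (cword_rotateCap_iff i k a b cs us).1 hw⟩
    | rotateCup i k o => exact ⟨cs, .refl _, (cword_rotateCup_iff i k o a b cs us).1 hw⟩
  · cases h with
    | oneCap i => exact ⟨cs, .refl _, (cword_oneCap_iff i a b cs us).1 hw⟩
    | oneCup i o => exact ⟨cs, .refl _, (cword_oneCup_iff i o a b cs us).1 hw⟩
    | two i => exact ⟨cs, .refl _, hw.of_two⟩
    | three i k => exact ⟨cs, .refl _, (cword_three_iff i k a b cs us).1 hw⟩

theorem CWord.move_symm {l r : List Slab} (h : Move l r) {a b : CLevel K} {cs : List K} {us : Set K}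
    (hv : Valid (a.map Prod.fst) l) (hw : CWord P r a b cs us) :
    ∃ cs', cs'.Perm cs ∧ CWord P l a b cs' us := by
  rcases h with h | h
  · cases h with
    | exchange p q i k => exact (cword_exchange_iff p q i k a b cs us).2 ⟨cs, .refl _, hw⟩
    | zigzagRight i o =>
      refine ⟨cs, .refl _, hw.to_zigzagRight ?_⟩
      obtain ⟨x, cx, hx⟩ : ∃ x : Level, ∃ c, a.map Prod.fst = x ++ c :: (a.map Prod.fst).drop (i + 1)
          ∧ x.length = i := by
        have h1 := hv.1.1
        simp only [Piece.bottoms] at h1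
        exact ⟨(a.map Prod.fst).take i, (a.map Prod.fst)[i], by rw [List.getElem_cons_drop, List.take_append_drop],
          by simp at h1 ⊢; omega⟩
      rw [hx.1] at hv ⊢
      obtain ⟨-, hv, -⟩ := hv
      have := apply_append (i := i + 1) (p := Piece.cup o) (x := x ++ [cx]) (u := [])
        (y := (a.map Prod.fst).drop (i + 1)) (by simp [hx.2]) rfl
      simp only [List.append_assoc, List.nil_append, List.cons_append] at this
      rw [this] at hv
      have h3 := (fits_append (p := Piece.cap) (u := [cx, o]) hx.2 rfl (y := (!o) ::
        (a.map Prod.fst).drop (i + 1))).1 (by simpa using hv) rfl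
      obtain ⟨b, h3⟩ := h3
      simp at h3
      simp [← hx.2, h3]
    | zigzagLeft i o =>
      refine ⟨cs, .refl _, hw.to_zigzagLeft ?_⟩
      have h2 := hv.2.1
      have h1 := hv.1.1
      simp only [Piece.bottoms] at h1
      obtain ⟨x, y, hxy, hx⟩ : ∃ x y : Level, a.map Prod.fst = x ++ y ∧ x.length = i :=
        ⟨(a.map Prod.fst).take i, (a.map Prod.fst).drop i, by simp [-List.map_drop, -List.map_take],
          by simp at h1 ⊢; omega⟩
      rw [hxy] at h2 ⊢
      have := apply_append (i := i) (p := Piece.cup o) (x := x) (u := [])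
        (y := y) hx rfl
      simp only [List.nil_append] at this
      rw [this] at h2
      cases y with
      | nil => have := h2.1; simp [Piece.bottoms, hx] at this
      | cons c y =>
        have h3 := (fits_append (i := i + 1) (p := Piece.cap) (x := x ++ [o]) (u := [!o, c])
          (y := y) (by simp [hx]) rfl).1 (by simpa using h2) rfl
        obtain ⟨b, h3⟩ := h3
        simp at h3
        obtain ⟨rfl, h3⟩ := h3
        simp [← hx, h3]
    | rotateCap i k => exact ⟨cs, .refl _, (cword_rotateCap_iff i k a b cs us).2 hw⟩
    | rotateCup i k o => exact ⟨cs, .refl _, (cword_rotateCup_iff i k o a b cs us).2 hw⟩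
  · cases h with
    | oneCap i => exact ⟨cs, .refl _, (cword_oneCap_iff i a b cs us).2 hw⟩
    | oneCup i o => exact ⟨cs, .refl _, (cword_oneCup_iff i o a b cs us).2 hw⟩
    | two i =>
      refine ⟨cs, .refl _, hw.to_two ?_⟩
      have h1 := hv.1.1
      simp only [virtualAt, Piece.bottoms, List.length_map] at h1
      omega
    | three i k => exact ⟨cs, .refl _, (cword_three_iff i k a b cs us).2 hw⟩

/-- A move inside a valid word which leads to a valid word. -/
def RelStep (a : Level) (w w' : List Slab) : Prop :=
  ∃ u l r v, Move l r ∧ w = u ++ l ++ v ∧ w' = u ++ r ++ v ∧ Valid a w ∧ Valid a w'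

/-- Equivalence of words over the level `a`, generated by the moves between valid words. -/
def Rel (a : Level) : List Slab → List Slab → Prop := Relation.EqvGen (RelStep a)

theorem RelStep.cword_iff {a : CLevel K} {w w' : List Slab} (h : RelStep (a.map Prod.fst) w w')
    (b : CLevel K) (cs : List K) (us : Set K) : (∃ cs', cs'.Perm cs ∧ CWord P w a b cs' us) ↔
      (∃ cs', cs'.Perm cs ∧ CWord P w' a b cs' us) := by
  obtain ⟨u, l, r, v, hm, rfl, rfl, hv, hv'⟩ := h
  rw [List.append_assoc, valid_append, valid_append] at hv hv'
  simp only [List.append_assoc, cword_append]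
  constructor
  · rintro ⟨_, hcs, m, c, _, us1, _, h1, ⟨m', c', c'', us2, us3, h2, h3, rfl, rfl⟩, rfl, rfl⟩
    obtain ⟨d, hd, h4⟩ := h2.move hm
    exact ⟨_, ((hd.append_right _).append_left _).trans hcs, _, _, _, _, _, h1,
      ⟨_, _, _, _, _, h4, h3, rfl, rfl⟩, rfl, rfl⟩
  · rintro ⟨_, hcs, m, c, _, us1, _, h1, ⟨m', c', c'', us2, us3, h2, h3, rfl, rfl⟩, rfl, rfl⟩
    have hl := hv.2.1
    rw [h1.valid.2] at hl
    obtain ⟨d, hd, h4⟩ := h2.move_symm hm hl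
    exact ⟨_, ((hd.append_right _).append_left _).trans hcs, _, _, _, _, _, h1,
      ⟨_, _, _, _, _, h4, h3, rfl, rfl⟩, rfl, rfl⟩

theorem Rel.cword_iff {a : CLevel K} {w w' : List Slab} (h : Rel (a.map Prod.fst) w w')
    (b : CLevel K) (cs : List K) (us : Set K) : (∃ cs', cs'.Perm cs ∧ CWord P w a b cs' us) ↔
      (∃ cs', cs'.Perm cs ∧ CWord P w' a b cs' us) := by
  induction h with
  | rel x y h => exact h.cword_iff b cs us
  | refl x => rfl
  | symm x y _ ih => exact ih.symm
  | trans x y z _ _ ih1 ih2 => exact ih1.trans ih2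

theorem Rel.cword {a : CLevel K} {w w' : List Slab} (h : Rel (a.map Prod.fst) w w')
    {b : CLevel K} {cs : List K} {us : Set K} (hw : CWord P w a b cs us) :
      ∃ cs', cs'.Perm cs ∧ CWord P w' a b cs' us :=
  (h.cword_iff b cs us).1 ⟨cs, .refl _, hw⟩

end

theorem valid_of_cword_of_cword {l r : List Slab} {a : Level} (hl : Valid a l)
    (h : ∀ (a b : CLevel Unit) cs us, CWord (componentPalette Unit) l a b cs us →
      ∃ cs', CWord (componentPalette Unit) r a b cs' us) : Valid a r ∧ run a r = run a l := by
  obtain ⟨cs, us, -, h1⟩ := exists_cword_const hl ()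
  obtain ⟨cs', h2⟩ := h _ _ _ _ h1
  simpa [Function.comp_def] using h2.valid

theorem Move.valid {l r : List Slab} (h : Move l r) {a : Level} (hl : Valid a l) :
    Valid a r ∧ run a r = run a l :=
  valid_of_cword_of_cword hl fun _ _ _ _ h1 => (h1.move h).imp fun _ h => h.2

namespace Rel
variable {a : Level} {w w' w'' : List Slab}

theorem refl (w : List Slab) : Rel a w w := Relation.EqvGen.refl _
theorem symm (h : Rel a w w') : Rel a w' w := Relation.EqvGen.symm _ _ h
theorem trans (h : Rel a w w') (h' : Rel a w' w'') : Rel a w w'' := Relation.EqvGen.trans _ _ _ h h'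

theorem valid_iff (h : Rel a w w') : Valid a w ↔ Valid a w' := by
  induction h with
  | rel x y h => obtain ⟨_, _, _, _, -, -, -, h, h'⟩ := h; exact iff_of_true h h'
  | refl x => rfl
  | symm x y _ ih => exact ih.symm
  | trans x y z _ _ ih1 ih2 => exact ih1.trans ih2

theorem run_eq (h : Rel a w w') : run a w = run a w' := by
  induction h with
  | rel x y h =>
    obtain ⟨u, l, r, v, hm, rfl, rfl, h, h'⟩ := h
    rw [List.append_assoc, valid_append, valid_append] at h
    simp only [run_append, (hm.valid h.2.1).2]
  | refl x => rfl
  | symm x y _ ih => exact ih.symm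
  | trans x y z _ _ ih1 ih2 => exact ih1.trans ih2

theorem append_left {u : List Slab} (hu : Valid a u) (h : Rel (run a u) w w') :
    Rel a (u ++ w) (u ++ w') := by
  induction h with
  | rel x y h =>
    obtain ⟨u', l, r, v, hm, rfl, rfl, h, h'⟩ := h
    exact .rel _ _ ⟨u ++ u', l, r, v, hm, by simp, by simp, (valid_append _ _ _).2 ⟨hu, h⟩,
      (valid_append _ _ _).2 ⟨hu, h'⟩⟩
  | refl x => exact .refl _
  | symm x y _ ih => exact ih.symm
  | trans x y z _ _ ih1 ih2 => exact ih1.trans ih2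

theorem append_right {v : List Slab} (h : Rel a w w') (hv : Valid (run a w) v) :
    Rel a (w ++ v) (w' ++ v) := by
  have key : ∀ {x y}, Rel a x y → Valid (run a x) v → Rel a (x ++ v) (y ++ v) := by
    intro x y h
    induction h with
    | rel x y h =>
      have hr : run a x = run a y := Rel.run_eq (.rel _ _ h)
      intro hv
      obtain ⟨u', l, r, v', hm, rfl, rfl, h, h'⟩ := h
      exact .rel _ _ ⟨u', l, r, v' ++ v, hm, by simp, by simp, (valid_append _ _ _).2 ⟨h, hv⟩,
        (valid_append _ _ _).2 ⟨h', hr ▸ hv⟩⟩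
    | refl x => exact fun _ => .refl _
    | symm x y h ih => exact fun hv => (ih (Rel.run_eq h ▸ hv)).symm
    | trans x y z h _ ih1 ih2 => exact fun hv => (ih1 hv).trans (ih2 (Rel.run_eq h ▸ hv))
  exact key h hv

end Rel

/-- Whenever the word `l` can be put on a level, it is equivalent to `r` over this level. -/
def Rule (l r : List Slab) : Prop := ∀ ⦃a⦄, Valid a l → Rel a l r

theorem Rule.refl (l : List Slab) : Rule l l := fun _ _ => .refl _

theorem Rule.trans {l m r : List Slab} (h : Rule l m) (h' : Rule m r) : Rule l r :=
  fun _ ha => (h ha).trans (h' ((h ha).valid_iff.1 ha))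

theorem Rule.ctx {l r : List Slab} (h : Rule l r) (u v : List Slab) :
    Rule (u ++ (l ++ v)) (u ++ (r ++ v)) := by
  intro a ha
  rw [valid_append, valid_append] at ha
  exact ((h ha.2.1).append_right ha.2.2).append_left ha.1

theorem Rule.pre {l r : List Slab} (h : Rule l r) (u : List Slab) : Rule (u ++ l) (u ++ r) := by
  simpa using h.ctx u []

theorem Rule.post {l r : List Slab} (h : Rule l r) (v : List Slab) : Rule (l ++ v) (r ++ v) := by
  simpa using h.ctx [] v

theorem Move.rule {l r : List Slab} (h : Move l r) : Rule l r := fun _ ha =>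
  .rel _ _ ⟨[], l, r, [], h, by simp, by simp, ha, (h.valid ha).1⟩

theorem Move.rule_symm {l r : List Slab} (h : Move l r)
    (hv : ∀ (a b : CLevel Unit) cs us, CWord (componentPalette Unit) r a b cs us →
      ∃ cs', CWord (componentPalette Unit) l a b cs' us) : Rule r l := fun _ ha =>
  Rel.symm (.rel _ _ ⟨[], l, r, [], h, by simp, by simp, (valid_of_cword_of_cword ha hv).1, ha⟩)

/-! ### Words of virtual crossings -/

/-- The word of virtual crossings at the given positions. -/
def vw (σ : List ℕ) : List Slab := σ.map virtualAt

section
variable {α β : Type}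

/-- The exchange of the entries number `i` and `i + 1` of a list. -/
def swapAt (i : ℕ) (l : List α) : List α :=
  l.take i ++ ((l.drop i).take 2).reverse ++ l.drop (i + 2)

/-- The action of a word of adjacent transpositions on lists. -/
def act (σ : List ℕ) (l : List α) : List α := σ.foldl (fun l i => swapAt i l) l

/-- The transpositions of the word `σ` exchange entries of lists of length `n`. -/
def InRange (n : ℕ) (σ : List ℕ) : Prop := ∀ i ∈ σ, i + 1 < n

@[simp] theorem act_nil (l : List α) : act [] l = l := rfl
@[simp] theorem act_cons (i : ℕ) (σ : List ℕ) (l : List α) :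
    act (i :: σ) l = act σ (swapAt i l) := rfl
theorem act_append (σ τ : List ℕ) (l : List α) : act (σ ++ τ) l = act τ (act σ l) := by
  simp [act]

@[simp] theorem inRange_nil (n : ℕ) : InRange n [] := by simp [InRange]
@[simp] theorem inRange_cons (n i : ℕ) (σ : List ℕ) :
    InRange n (i :: σ) ↔ i + 1 < n ∧ InRange n σ := by simp [InRange]
@[simp] theorem inRange_append (n : ℕ) (σ τ : List ℕ) :
    InRange n (σ ++ τ) ↔ InRange n σ ∧ InRange n τ := by simp [InRange, or_imp, forall_and]
theorem InRange.mono {n m : ℕ} {σ : List ℕ} (h : InRange n σ) (hm : n ≤ m) : InRange m σ :=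
  fun i hi => (h i hi).trans_le hm
theorem InRange.reverse {n : ℕ} {σ : List ℕ} (h : InRange n σ) : InRange n σ.reverse :=
  fun i hi => h i (by simpa using hi)

@[simp] theorem length_swapAt (i : ℕ) (l : List α) : (swapAt i l).length = l.length := by
  simp [swapAt]; omega
@[simp] theorem length_act (σ : List ℕ) (l : List α) : (act σ l).length = l.length := by
  induction σ generalizing l <;> simp [*]

theorem swapAt_perm (i : ℕ) (l : List α) : (swapAt i l).Perm l := by
  unfold swapAt
  conv_rhs => rw [← List.take_append_drop i l, ← List.take_append_drop 2 (l.drop i),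
    List.drop_drop, ← List.append_assoc]
  exact ((List.reverse_perm _).append_left _).append_right _
theorem act_perm (σ : List ℕ) (l : List α) : (act σ l).Perm l := by
  induction σ generalizing l with
  | nil => rfl
  | cons i σ ih => exact (ih _).trans (swapAt_perm i l)

theorem swapAt_map (f : α → β) (i : ℕ) (l : List α) : swapAt i (l.map f) = (swapAt i l).map f := by
  simp [swapAt]
theorem act_map (f : α → β) (σ : List ℕ) (l : List α) : act σ (l.map f) = (act σ l).map f := by
  induction σ generalizing l <;> simp [swapAt_map, *]

@[simp] theorem swapAt_length (x y : List α) (p q : α) :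
    swapAt x.length (x ++ p :: q :: y) = x ++ q :: p :: y := by
  simp [swapAt, List.drop_append]

theorem swapAt_of_length {i : ℕ} {x : List α} (hx : x.length = i) (y : List α) (p q : α) :
    swapAt i (x ++ p :: q :: y) = x ++ q :: p :: y := by
  subst hx; simp

theorem exists_split {i : ℕ} {l : List α} (h : i + 1 < l.length) :
    ∃ x p q y, l = x ++ p :: q :: y ∧ x.length = i := by
  refine ⟨l.take i, l[i], l[i + 1], l.drop (i + 2), ?_, by simp; omega⟩
  rw [List.getElem_cons_drop, List.getElem_cons_drop, List.take_append_drop]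

theorem swapAt_swapAt {i : ℕ} {l : List α} (h : i + 1 < l.length) : swapAt i (swapAt i l) = l := by
  obtain ⟨x, p, q, y, rfl, rfl⟩ := exists_split h
  simp

theorem act_reverse_act {σ : List ℕ} {l : List α} (h : InRange l.length σ) :
    act σ.reverse (act σ l) = l := by
  induction σ generalizing l with
  | nil => rfl
  | cons i σ ih =>
    rw [inRange_cons] at h
    rw [List.reverse_cons, act_append, act_cons i σ, ih (l := swapAt i l) (by simpa using h.2)]
    exact swapAt_swapAt h.1

theorem swapAt_append_left {i : ℕ} {l : List α} (h : i + 1 < l.length) (r : List α) :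
    swapAt i (l ++ r) = swapAt i l ++ r := by
  obtain ⟨x, p, q, y, rfl, rfl⟩ := exists_split h
  simp

theorem act_append_left {σ : List ℕ} {l : List α} (h : InRange l.length σ) (r : List α) :
    act σ (l ++ r) = act σ l ++ r := by
  induction σ generalizing l with
  | nil => rfl
  | cons i σ ih =>
    rw [inRange_cons] at h
    rw [act_cons, swapAt_append_left h.1, ih (by simpa using h.2), act_cons]

theorem swapAt_append_right (x : List α) (i : ℕ) (l : List α) :
    swapAt (x.length + i) (x ++ l) = x ++ swapAt i l := by
  simp [swapAt, add_assoc, List.take_append]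

theorem act_append_right (x : List α) (σ : List ℕ) (l : List α) :
    act (σ.map (x.length + ·)) (x ++ l) = x ++ act σ l := by
  induction σ generalizing l with
  | nil => rfl
  | cons i σ ih => rw [List.map_cons, act_cons, swapAt_append_right, ih, act_cons]

theorem InRange.shift {n : ℕ} {σ : List ℕ} (h : InRange n σ) (m : ℕ) :
    InRange (m + n) (σ.map (m + ·)) := by
  intro i hi
  obtain ⟨j, hj, rfl⟩ := List.mem_map.1 hi
  have := h j hj
  omega

theorem exists_act_of_perm {l l' : List α} (h : l.Perm l') :
    ∃ σ, InRange l.length σ ∧ act σ l = l' := by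
  induction h with
  | nil => exact ⟨[], by simp, rfl⟩
  | cons x _ ih =>
    obtain ⟨σ, h1, h2⟩ := ih
    refine ⟨σ.map (1 + ·), ?_, ?_⟩
    · have := h1.shift 1
      rwa [add_comm] at this
    · have := act_append_right [x] σ
      simp only [List.length_singleton, List.singleton_append] at this
      rw [this, h2]
  | swap x y l => exact ⟨[0], by simp, rfl⟩
  | trans h1 _ ih1 ih2 =>
    obtain ⟨σ, h2, h3⟩ := ih1
    obtain ⟨τ, h4, h5⟩ := ih2
    exact ⟨σ ++ τ, by simpa [← h1.length_eq, h2] using h1.length_eq ▸ h4, by rw [act_append, h3, h5]⟩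

end

@[simp] theorem vw_nil : vw [] = [] := rfl
theorem vw_cons (i : ℕ) (σ : List ℕ) : vw (i :: σ) = virtualAt i :: vw σ := rfl
theorem vw_append (σ τ : List ℕ) : vw (σ ++ τ) = vw σ ++ vw τ := by simp [vw]

theorem virtualAt_apply (i : ℕ) (a : Level) : (virtualAt i).apply a = swapAt i a := rfl
theorem virtualAt_fits (i : ℕ) (a : Level) : (virtualAt i).Fits a ↔ i + 1 < a.length := by
  simp [Slab.Fits, virtualAt, Piece.bottoms]; omega
theorem run_vw (a : Level) (σ : List ℕ) : run a (vw σ) = act σ a := by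
  induction σ generalizing a with
  | nil => rfl
  | cons i σ ih => rw [vw_cons, run_cons, virtualAt_apply, ih, act_cons]
theorem valid_vw (a : Level) (σ : List ℕ) : Valid a (vw σ) ↔ InRange a.length σ := by
  induction σ generalizing a with
  | nil => simp
  | cons i σ ih => rw [vw_cons, valid_cons, virtualAt_apply, ih, virtualAt_fits, inRange_cons,
      length_swapAt]

/-! ### The symmetric group acts through virtual crossings -/

theorem rule_exchange (p q : Piece) {i j j' : ℕ} (k : ℕ) (hj : j = i + p.tops + k)
    (hj' : j' = i + p.bottoms + k) : Rule [⟨i, p⟩, ⟨j, q⟩] [⟨j', q⟩, ⟨i, p⟩] := by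
  subst hj hj'
  exact Move.rule (.inl (.exchange p q i k))

theorem rule_exchange_symm (p q : Piece) {i j j' : ℕ} (k : ℕ) (hj : j = i + p.tops + k)
    (hj' : j' = i + p.bottoms + k) : Rule [⟨j', q⟩, ⟨i, p⟩] [⟨i, p⟩, ⟨j, q⟩] := by
  subst hj hj'
  refine Move.rule_symm (.inl (.exchange p q i k)) fun a b cs us h => ?_
  exact ((cword_exchange_iff p q i k a b cs us).2 ⟨cs, .refl _, h⟩).imp fun _ h => h.2

theorem rule_two (i : ℕ) : Rule [virtualAt i, virtualAt i] [] := Move.rule (.inr (.two i))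

theorem rel_two {i : ℕ} {a : Level} (h : i + 1 < a.length) :
    Rel a [] [virtualAt i, virtualAt i] := by
  refine Rel.symm (rule_two i ?_)
  simp [virtualAt_fits, virtualAt_apply, h]

theorem rule_three (i : ℕ) (k : CrossingKind) :
    Rule [virtualAt i, virtualAt (i + 1), ⟨i, Piece.cross k⟩]
      [⟨i + 1, Piece.cross k⟩, virtualAt i, virtualAt (i + 1)] := Move.rule (.inr (.three i k))

theorem rule_three_symm (i : ℕ) (k : CrossingKind) :
    Rule [⟨i + 1, Piece.cross k⟩, virtualAt i, virtualAt (i + 1)]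
      [virtualAt i, virtualAt (i + 1), ⟨i, Piece.cross k⟩] :=
  Move.rule_symm (.inr (.three i k)) fun a b cs us h =>
    ⟨cs, (cword_three_iff i k a b cs us).2 h⟩

/-- The words `σ` and `τ` of virtual crossings are equivalent over the levels with at least `n`
points. -/
def VRel (n : ℕ) (σ τ : List ℕ) : Prop := ∀ a : Level, n ≤ a.length → Rel a (vw σ) (vw τ)

namespace VRel
variable {n : ℕ} {σ τ ρ : List ℕ}

theorem refl (n : ℕ) (σ : List ℕ) : VRel n σ σ := fun _ _ => .refl _
theorem symm (h : VRel n σ τ) : VRel n τ σ := fun a ha => (h a ha).symm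
theorem trans (h : VRel n σ τ) (h' : VRel n τ ρ) : VRel n σ ρ :=
  fun a ha => (h a ha).trans (h' a ha)
theorem mono {m : ℕ} (h : VRel n σ τ) (hm : n ≤ m) : VRel m σ τ := fun a ha => h a (hm.trans ha)

theorem ctx (h : VRel n σ τ) {u v : List ℕ} (hu : InRange n u) (hv : InRange n v) :
    VRel n (u ++ (σ ++ v)) (u ++ (τ ++ v)) := by
  intro a ha
  simp only [vw_append]
  refine Rel.append_left ((valid_vw _ _).2 (hu.mono ha)) (Rel.append_right (h _ ?_) ?_)
  · simpa [run_vw] using ha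
  · rw [run_vw, run_vw, valid_vw]
    exact hv.mono (by simpa using ha)

theorem pre (h : VRel n σ τ) {u : List ℕ} (hu : InRange n u) : VRel n (u ++ σ) (u ++ τ) := by
  simpa using h.ctx hu (inRange_nil n)

theorem post (h : VRel n σ τ) {v : List ℕ} (hv : InRange n v) : VRel n (σ ++ v) (τ ++ v) := by
  simpa using h.ctx (inRange_nil n) hv

theorem two {i : ℕ} (h : i + 1 < n) : VRel n [i, i] [] := fun _ ha =>
  (rel_two (h.trans_le ha)).symm

theorem comm {i j : ℕ} (hi : i + 1 < n) (hj : j + 1 < n) (hij : i + 2 ≤ j ∨ j + 2 ≤ i) :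
    VRel n [i, j] [j, i] := by
  intro a ha
  have hv : Valid a (vw [i, j]) := (valid_vw _ _).2 (by simp; omega)
  rcases hij with hij | hij
  · exact rule_exchange _ _ (j - (i + 2)) (by simp [Piece.tops]; omega)
      (by simp [Piece.bottoms]; omega) hv
  · exact rule_exchange_symm _ _ (i - (j + 2)) (by simp [Piece.tops]; omega)
      (by simp [Piece.bottoms]; omega) hv

theorem braid {i : ℕ} (h : i + 2 < n) : VRel n [i, i + 1, i] [i + 1, i, i + 1] := by
  intro a ha
  exact rule_three i _ ((valid_vw a [i, i + 1, i]).2 (by simp; omega))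

theorem comm_list {i : ℕ} (hi : i + 1 < n) (hτ : InRange n τ)
    (h : ∀ j ∈ τ, i + 2 ≤ j ∨ j + 2 ≤ i) : VRel n (i :: τ) (τ ++ [i]) := by
  induction τ with
  | nil => exact refl _ _
  | cons j τ ih =>
    rw [inRange_cons] at hτ
    have h1 := (comm hi hτ.1 (h j (by simp))).post hτ.2
    exact h1.trans ((ih hτ.2 fun k hk => h k (by simp [hk])).pre (u := [j]) (by simpa using hτ.1))

end VRel

/-- The word of transpositions which moves the entry number `j + d` down to the position `j`. -/
def descend (j : ℕ) : ℕ → List ℕ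
  | 0 => []
  | d + 1 => (j + d) :: descend j d

theorem descend_add (j d e : ℕ) : descend j (d + e) = descend (j + d) e ++ descend j d := by
  induction e with
  | zero => rfl
  | succ e ih => rw [← add_assoc, descend, ih, descend]; simp [add_assoc]

theorem mem_descend {i j d : ℕ} (h : i ∈ descend j d) : j ≤ i ∧ i < j + d := by
  induction d with
  | zero => simp [descend] at h
  | succ d ih =>
    rw [descend, List.mem_cons] at h
    rcases h with rfl | h
    · omega
    · have := ih h; omega

theorem inRange_descend {n j d : ℕ} (h : j + d < n) : InRange n (descend j d) := fun i hi => by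
  have := mem_descend hi; omega

theorem act_descend {α : Type} (x y : List α) (p : α) :
    act (descend x.length y.length) (x ++ (y ++ [p])) = x ++ p :: y := by
  induction y using List.reverseRecOn with
  | nil => rfl
  | append_singleton y q ih =>
    have h1 : swapAt (x.length + y.length) (x ++ (y ++ [q] ++ [p])) = x ++ (y ++ [p]) ++ [q] := by
      rw [show x ++ (y ++ [q] ++ [p]) = (x ++ y) ++ q :: p :: [] by simp,
        swapAt_of_length (by simp)]
      simp
    rw [List.length_append, List.length_singleton, descend, act_cons, h1, act_append_left, ih]
    · simp
    · exact inRange_descend (by simp)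

/-- Every word of virtual crossings is equivalent to one which first permutes the points other than
the last one, and then moves the last point to its place. -/
theorem exists_vrel_descend {L : ℕ} {σ : List ℕ} (h : InRange (L + 1) σ) :
    ∃ σ' j d, j + d = L ∧ InRange L σ' ∧ VRel (L + 1) σ (σ' ++ descend j d) := by
  induction σ using List.reverseRecOn with
  | nil => exact ⟨[], L, 0, rfl, by simp, .refl _ _⟩
  | append_singleton σ i ih =>
    rw [inRange_append, inRange_cons] at h
    obtain ⟨σ', j, d, rfl, h1, h2⟩ := ih h.1
    have hi : i < j + d := by omega
    have h1' := h1.mono (Nat.le_succ _)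
    have h3 := h2.post (v := [i]) (by simpa using hi)
    rw [List.append_assoc] at h3
    rcases lt_trichotomy (i + 1) j with hj | hj | hj
    · refine ⟨σ' ++ [i], j, d, rfl, by simp [h1]; omega, h3.trans ?_⟩
      rw [List.append_assoc]
      refine VRel.pre (VRel.symm (VRel.comm_list (by omega) (inRange_descend (by omega)) ?_)) h1'
      intro k hk
      have := mem_descend hk
      omega
    · refine ⟨σ', i, d + 1, by omega, h1, h3.trans ?_⟩
      have h4 := descend_add i 1 d
      rw [add_comm] at h4
      rw [h4, hj]
      exact .refl _ _
    · rcases (Nat.lt_succ_iff.1 hj).eq_or_lt with rfl | hj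
      · obtain ⟨d, rfl⟩ : ∃ e, d = e + 1 := ⟨d - 1, by omega⟩
        refine ⟨σ', j + 1, d, by omega, h1, h3.trans ?_⟩
        have h4 := descend_add j 1 d
        rw [add_comm] at h4
        rw [h4, List.append_assoc]
        have h5 := (VRel.two (n := j + (d + 1) + 1) (i := j) (by omega)).pre
          (u := σ' ++ descend (j + 1) d) (by simp [h1', inRange_descend (show j + 1 + d < j + (d + 1) + 1 by omega)])
        simpa [descend] using h5
      · obtain ⟨e, rfl⟩ : ∃ e, i = j + e + 1 := ⟨i - j - 1, by omega⟩
        obtain ⟨f, rfl⟩ : ∃ f, d = e + 2 + f := ⟨d - e - 2, by omega⟩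
        refine ⟨σ' ++ [j + e], j, e + 2 + f, by omega, by simp [h1]; omega, h3.trans ?_⟩
        set n := j + (e + 2 + f) + 1 with hn
        have h4 : descend j (e + 2 + f) = descend (j + e + 2) f ++ ([j + e + 1, j + e] ++ descend j e) := by
          rw [descend_add, descend_add]; rfl
        have r1 : InRange n (descend (j + e + 2) f) := inRange_descend (by omega)
        have r2 : InRange n (descend j e) := inRange_descend (by omega)
        rw [List.append_assoc σ', h4]
        refine VRel.pre ?_ h1'
        have s1 : VRel n (descend j e ++ [j + e + 1]) ((j + e + 1) :: descend j e) := by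
          refine (VRel.comm_list (by omega) r2 ?_).symm
          intro k hk
          have := mem_descend hk
          omega
        have s2 : VRel n ((j + e) :: descend (j + e + 2) f) (descend (j + e + 2) f ++ [j + e]) := by
          refine VRel.comm_list (by omega) r1 ?_
          intro k hk
          have := mem_descend hk
          omega
        have t1 := s1.pre (u := descend (j + e + 2) f ++ [j + e + 1, j + e])
          (by simp [r1]; omega)
        have t2 := ((VRel.braid (n := n) (i := j + e) (by omega)).symm).ctx r1 r2
        have t3 := s2.symm.post (v := [j + e + 1, j + e] ++ descend j e) (by simp [r2]; omega)
        simp only [List.append_assoc, List.cons_append, List.nil_append] at t1 t2 t3 ⊢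
        exact t1.trans (t2.trans t3)

theorem cword_vw {K : Type} {P : Palette K} {σ : List ℕ} {a b : CLevel K} {cs : List K}
    {us : Set K} : CWord P (vw σ) a b cs us ↔
      InRange a.length σ ∧ b = act σ a ∧ cs = [] ∧ us = hues a := by
  induction σ generalizing a cs us with
  | nil => simp [CWord, eq_comm]
  | cons i σ ih =>
    have hh : ∀ l : CLevel K, hues (swapAt i l) = hues l := by
      intro l
      ext z
      exact ((swapAt_perm i l).map _).mem_iff
    rw [vw_cons, inRange_cons, act_cons]
    constructor
    · rintro ⟨m, c, c', us', h1, h2, rfl, rfl⟩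
      obtain ⟨h3, rfl, rfl, rfl⟩ := ih.1 h2
      obtain ⟨x, u, v, y, rfl, rfl, hx, h⟩ := h1
      obtain ⟨p, q, rfl, rfl, rfl⟩ := colors_virt.1 h
      have h5 : swapAt i (x ++ ([p, q] ++ y)) = x ++ ([q, p] ++ y) := swapAt_of_length hx y p q
      have h6 : x.length = i := hx
      refine ⟨⟨by simp; omega, by simpa using h3⟩, by rw [h5], rfl, ?_⟩
      rw [← h5, hh, Set.union_self]
    · rintro ⟨⟨hi, h1⟩, rfl, rfl, rfl⟩
      have h2 := ih.2 ⟨by simpa using h1, rfl, rfl, rfl⟩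
      refine ⟨swapAt i a, [], [], _, ?_, h2, rfl, by rw [hh, Set.union_self]⟩
      obtain ⟨x, p, q, y, rfl, hx⟩ := exists_split hi
      exact .of_colors (.virt p q) x y hx rfl (swapAt_of_length hx y p q)

theorem VRel.act_eq {α : Type} {l : List α} {σ τ : List ℕ} (h : VRel l.length σ τ)
    (hσ : InRange l.length σ) : act σ l = act τ l := by
  have h1 : CWord (componentPalette α) (vw σ) (l.map (true, ·)) (act σ (l.map (true, ·))) []
      (hues (l.map (true, ·))) := cword_vw.2 ⟨by simpa using hσ, rfl, rfl, rfl⟩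
  obtain ⟨_, -, h2⟩ := (h ((l.map (true, ·)).map Prod.fst) (by simp)).cword h1
  have h3 := (cword_vw.1 h2).2.1
  rw [act_map, act_map] at h3
  simpa [Function.comp_def] using congrArg (List.map Prod.snd) h3

/-- Two words of virtual crossings which permute distinct points in the same way are equivalent:
the moves on virtual crossings contain the Coxeter relations of the symmetric group. -/
theorem vrel_of_act_eq {α : Type} {l : List α} (hl : l.Nodup) {σ τ : List ℕ}
    (hσ : InRange l.length σ) (hτ : InRange l.length τ) (h : act σ l = act τ l) :
    VRel l.length σ τ := by
  induction l using List.reverseRecOn generalizing σ τ with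
  | nil =>
    have h0 : ∀ ρ : List ℕ, InRange ([] : List α).length ρ → ρ = [] := by
      intro ρ hρ
      cases ρ with
      | nil => rfl
      | cons i ρ => simp at hρ
    rw [h0 σ hσ, h0 τ hτ]
    exact .refl _ _
  | append_singleton l p ih =>
    have key : ∀ ρ, InRange (l ++ [p]).length ρ → ∃ ρ' j, InRange l.length ρ' ∧ j ≤ l.length ∧
        VRel (l ++ [p]).length ρ (ρ' ++ descend j (l.length - j)) ∧
        act (ρ' ++ descend j (l.length - j)) (l ++ [p]) =
          (act ρ' l).take j ++ p :: (act ρ' l).drop j := by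
      intro ρ hρ
      rw [List.length_append] at hρ
      obtain ⟨ρ', j, d, hjd, h1, h2⟩ := exists_vrel_descend hρ
      obtain rfl : d = l.length - j := by omega
      refine ⟨ρ', j, h1, by omega, by simpa using h2, ?_⟩
      rw [act_append, act_append_left h1]
      have := act_descend ((act ρ' l).take j) ((act ρ' l).drop j) p
      rw [← List.append_assoc, List.take_append_drop] at this
      simpa [show min j l.length = j by omega] using this
    obtain ⟨σ', j, s1, s2, s3, s4⟩ := key σ hσ
    obtain ⟨τ', k, t1, t2, t3, t4⟩ := key τ hτ
    rw [← s3.act_eq hσ] at s4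
    rw [← t3.act_eq hτ, ← h, s4] at t4
    rw [List.nodup_append] at hl
    have hp : ∀ (ρ : List ℕ) (i : ℕ), p ∉ (act ρ l).take i := fun ρ i hi =>
      hl.2.2 p ((act_perm ρ l).mem_iff.1 (List.mem_of_mem_take hi)) p (by simp) rfl
    obtain ⟨e1, e2⟩ : (act σ' l).take j = (act τ' l).take k ∧
        (act σ' l).drop j = (act τ' l).drop k := by
      rcases List.append_eq_append_iff.1 t4 with ⟨z, h1, h2⟩ | ⟨z, h1, h2⟩
      · cases z with
        | nil => simp at h1 h2; exact ⟨h1.symm, h2⟩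
        | cons q z =>
          simp at h2
          exact absurd (by rw [h1, h2.1]; simp) (hp τ' k)
      · cases z with
        | nil => simp at h1 h2; exact ⟨h1, h2.symm⟩
        | cons q z =>
          simp at h2
          exact absurd (by rw [h1, h2.1]; simp) (hp σ' j)
    obtain rfl : j = k := by simpa [s2, t2] using congrArg List.length e1
    have h5 : act σ' l = act τ' l := by
      rw [← List.take_append_drop j (act σ' l), e1, e2, List.take_append_drop]
    exact (s3.trans (((ih hl.1 s1 t1 h5).mono (by simp)).post
      (inRange_descend (by simp; omega)))).trans t3.symm

/-! ### Derived rules -/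

theorem rule_rotateCap (i : ℕ) (k : CrossingKind) : Rule [⟨i + 1, Piece.cross k⟩, ⟨i, Piece.cap⟩]
    [⟨i, Piece.cross k.rotate⟩, ⟨i + 1, Piece.cap⟩] := Move.rule (.inl (.rotateCap i k))

theorem rule_rotateCap_symm (i : ℕ) (k : CrossingKind) :
    Rule [⟨i, Piece.cross k⟩, ⟨i + 1, Piece.cap⟩]
      [⟨i + 1, Piece.cross k.rotate⟩, ⟨i, Piece.cap⟩] := by
  have hk : k.rotate.rotate = k := by cases k <;> rfl
  have h := Move.rule_symm (.inl (.rotateCap i k.rotate)) fun a b cs us h =>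
    ⟨cs, (cword_rotateCap_iff i k.rotate a b cs us).2 h⟩
  rwa [hk] at h

theorem rule_rotateCup_symm (i : ℕ) (k : CrossingKind) (o : Bool) :
    Rule [⟨i + 1, Piece.cup o⟩, ⟨i, Piece.cross k⟩]
      [⟨i, Piece.cup o⟩, ⟨i + 1, Piece.cross k.rotate⟩] := by
  have hk : k.rotate.rotate = k := by cases k <;> rfl
  have h := Move.rule_symm (.inl (.rotateCup i k.rotate o)) fun a b cs us h =>
    ⟨cs, (cword_rotateCup_iff i k.rotate o a b cs us).2 h⟩
  rwa [hk] at h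

theorem rule_oneCap_symm (i : ℕ) : Rule [⟨i, Piece.cap⟩] [virtualAt i, ⟨i, Piece.cap⟩] :=
  Move.rule_symm (.inr (.oneCap i)) fun a b cs us h => ⟨cs, (cword_oneCap_iff i a b cs us).2 h⟩

theorem rule_oneCup (i : ℕ) (o : Bool) :
    Rule [⟨i, Piece.cup o⟩, virtualAt i] [⟨i, Piece.cup !o⟩] := Move.rule (.inr (.oneCup i o))

theorem rule_oneCup_symm (i : ℕ) (o : Bool) :
    Rule [⟨i, Piece.cup o⟩] [⟨i, Piece.cup !o⟩, virtualAt i] := by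
  have h := Move.rule_symm (.inr (.oneCup i !o)) fun a b cs us h =>
    ⟨cs, (cword_oneCup_iff i (!o) a b cs us).2 h⟩
  simpa using h

theorem rule_zigzagRight (i : ℕ) (o : Bool) : Rule [⟨i + 1, Piece.cup o⟩, ⟨i, Piece.cap⟩] [] :=
  Move.rule (.inl (.zigzagRight i o))

theorem rel_zigzagRight {i : ℕ} {o : Bool} {a : Level} (h : a[i]? = some (!o)) :
    Rel a [] [⟨i + 1, Piece.cup o⟩, ⟨i, Piece.cap⟩] := by
  refine Rel.symm (rule_zigzagRight i o ?_)
  have h1 : CWord (componentPalette Unit) [] (a.map (·, ())) (a.map (·, ())) [] _ := ⟨rfl, rfl, rfl⟩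
  have h2 := (h1.to_zigzagRight (i := i) (o := o) (by simpa [Function.comp_def] using h)).valid.1
  simpa [Function.comp_def] using h2

/-- A cup which is crossed virtually by the strand on its left is pulled away from it. -/
theorem rule_cup_left (i : ℕ) (o : Bool) :
    Rule [⟨i + 1, Piece.cup o⟩, virtualAt i, virtualAt (i + 1)] [⟨i, Piece.cup o⟩] :=
  ((rule_rotateCup_symm i .virtual o).post [virtualAt (i + 1)]).trans
    ((rule_two (i + 1)).pre [⟨i, Piece.cup o⟩])

theorem rule_cap_left (i : ℕ) :
    Rule [⟨i + 1, Piece.cap⟩] [virtualAt i, virtualAt (i + 1), ⟨i, Piece.cap⟩] := by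
  intro a ha
  have h1 : i + 1 < a.length := by
    have := ha.1.1; simp [Piece.bottoms] at this; omega
  have h2 : Rel a [⟨i + 1, Piece.cap⟩] [virtualAt i, virtualAt i, ⟨i + 1, Piece.cap⟩] :=
    (rel_two h1).append_right ha
  exact h2.trans (((rule_rotateCap_symm i .virtual).pre [virtualAt i]) (h2.valid_iff.1 ha))

theorem rule_cap_left_symm (i : ℕ) :
    Rule [virtualAt i, virtualAt (i + 1), ⟨i, Piece.cap⟩] [⟨i + 1, Piece.cap⟩] :=
  ((rule_rotateCap i .virtual).pre [virtualAt i]).trans ((rule_two i).post [⟨i + 1, Piece.cap⟩])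

theorem rel_vw_reverse {a : Level} {σ : List ℕ} (h : InRange a.length σ) :
    Rel a [] (vw σ ++ vw σ.reverse) := by
  rw [← vw_append]
  have h1 := vrel_of_act_eq (l := List.range a.length) List.nodup_range (σ := [])
    (τ := σ ++ σ.reverse) (by simp) (by simp [h, h.reverse])
    (by rw [act_append, act_reverse_act (by simpa using h)]; rfl)
  exact h1 a (by simp)

/-! ### Sliding words past each other -/

/-- The word `z` with `p` further strands on its left. -/
def shift (p : ℕ) (z : List Slab) : List Slab := z.map fun s => ⟨p + s.pos, s.piece⟩

@[simp] theorem shift_nil (p : ℕ) : shift p [] = [] := rfl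
theorem shift_cons (p : ℕ) (s : Slab) (z : List Slab) :
    shift p (s :: z) = ⟨p + s.pos, s.piece⟩ :: shift p z := rfl
theorem shift_append (p : ℕ) (z z' : List Slab) : shift p (z ++ z') = shift p z ++ shift p z' := by
  simp [shift]
theorem shift_shift (p q : ℕ) (z : List Slab) : shift p (shift q z) = shift (p + q) z := by
  simp [shift, add_assoc]
theorem shift_zero (z : List Slab) : shift 0 z = z := by simp [shift]
theorem shift_vw (p : ℕ) (σ : List ℕ) : shift p (vw σ) = vw (σ.map (p + ·)) := by
  simp [shift, vw, virtualAt]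

theorem run_shift {c : Level} {z : List Slab} (h : Valid c z) (x y : Level) :
    Valid (x ++ (c ++ y)) (shift x.length z) ∧
      run (x ++ (c ++ y)) (shift x.length z) = x ++ (run c z ++ y) := by
  induction z generalizing c with
  | nil => simp
  | cons s z ih =>
    obtain ⟨i, p⟩ := s
    obtain ⟨h1, h2⟩ := h
    obtain ⟨x', u, z', rfl, hy, hu⟩ : ∃ y u z, c = y ++ (u ++ z) ∧ y.length = i ∧
        u.length = p.bottoms := by
      have h1 := h1.1
      simp only at h1
      refine ⟨c.take i, (c.drop i).take p.bottoms, (c.drop i).drop p.bottoms, by simp, ?_, ?_⟩ <;>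
        simp <;> omega
    have hl : (x ++ x').length = x.length + i := by simp [hy]
    have he : x ++ (x' ++ (u ++ z') ++ y) = (x ++ x') ++ (u ++ (z' ++ y)) := by simp
    rw [fits_append hy hu] at h1
    rw [apply_append hy hu] at h2
    have := ih h2
    simp only [shift_cons, valid_cons, run_cons]
    rw [he, fits_append hl hu, apply_append hl hu, apply_append hy hu]
    simp only [List.append_assoc] at this ⊢
    exact ⟨⟨h1, this.1⟩, this.2⟩

/-- A slab slides past a word on its right. -/
theorem rule_slab_past (i k : ℕ) (p : Piece) (z : List Slab) :
    Rule (⟨i, p⟩ :: shift (i + p.tops + k) z) (shift (i + p.bottoms + k) z ++ [⟨i, p⟩]) := by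
  induction z with
  | nil => exact .refl _
  | cons s z ih =>
    rw [shift_cons, shift_cons]
    exact ((rule_exchange p s.piece (k + s.pos) (by simp [add_assoc]) (by simp [add_assoc])).post
      _).trans (ih.pre [_])

/-- A word slides past a word on its right. -/
theorem rule_word_past {c : Level} {w : List Slab} (hw : Valid c w) (q k : ℕ) (z : List Slab) :
    Rule (shift q w ++ shift (q + (run c w).length + k) z)
      (shift (q + c.length + k) z ++ shift q w) := by
  induction w generalizing c with
  | nil => simpa using Rule.refl _
  | cons s w ih =>
    have hl := s.length_apply c hw.1
    have h1 := hw.1.1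
    have h2 := ih hw.2
    have h3 := rule_slab_past (q + s.pos) (c.length - s.pos - s.piece.bottoms + k) s.piece z
    rw [show q + s.pos + s.piece.tops + (c.length - s.pos - s.piece.bottoms + k) =
      q + (s.apply c).length + k by omega, show q + s.pos + s.piece.bottoms +
      (c.length - s.pos - s.piece.bottoms + k) = q + c.length + k by omega] at h3
    rw [shift_cons, run_cons]
    have h4 := (h2.pre [⟨q + s.pos, s.piece⟩]).trans (by simpa using h3.post (shift q w))
    simpa using h4

theorem rule_vw_past {σ : List ℕ} {q : ℕ} (h : InRange q σ) (z : List Slab) :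
    Rule (vw σ ++ shift q z) (shift q z ++ vw σ) := by
  have := rule_word_past (c := List.replicate q true) (w := vw σ)
    ((valid_vw _ _).2 (by simpa using h)) 0 0 z
  simpa [shift_zero, run_vw] using this

/-- A strand which crosses virtually everything above a slab on its right can be moved below it. -/
theorem rule_strand_under_slab (p j r : ℕ) (P : Piece) :
    Rule (⟨p + 1 + j, P⟩ :: vw (List.range' p (j + P.tops + r)))
      (vw (List.range' p (j + P.bottoms + r)) ++ [⟨p + j, P⟩]) := by
  have hsplit : ∀ t, vw (List.range' p (j + t + r)) = vw (List.range' p j) ++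
      (vw (List.range' (p + j) t) ++ vw (List.range' (p + j + t) r)) := by
    intro t
    rw [← vw_append, ← vw_append, add_assoc j, ← List.range'_append_1, ← List.range'_append_1]
  rw [hsplit, hsplit]
  have s1 : ∀ z : List ℕ, InRange (p + 1 + j) z →
      Rule (⟨p + 1 + j, P⟩ :: vw z) (vw z ++ [⟨p + 1 + j, P⟩]) := by
    intro z hz
    induction z with
    | nil => exact .refl _
    | cons i z ih =>
      rw [inRange_cons] at hz
      rw [vw_cons]
      exact ((rule_exchange_symm (Piece.cross .virtual) P (p + 1 + j - i - 2)
        (by simp [Piece.tops]; omega) (by simp [Piece.bottoms]; omega)).post _).trans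
        ((ih hz.2).pre [_])
  have s2 : Rule (⟨p + j + 1, P⟩ :: vw (List.range' (p + j) P.tops))
      (vw (List.range' (p + j) P.bottoms) ++ [⟨p + j, P⟩]) := by
    cases P with
    | cross k => exact rule_three_symm (p + j) k
    | cup o => exact rule_cup_left (p + j) o
    | cap => exact rule_cap_left (p + j)
  have s3 : Rule (⟨p + j, P⟩ :: vw (List.range' (p + j + P.tops) r))
      (vw (List.range' (p + j + P.bottoms) r) ++ [⟨p + j, P⟩]) := by
    have h := rule_slab_past (p + j) 0 P (vw (List.range r))
    simpa [shift_vw, List.range'_eq_map_range] using h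
  have t1 := (s1 (List.range' p j) fun i hi => by
    have := List.mem_range'_1.1 hi; omega).post
      (vw (List.range' (p + j) P.tops) ++ vw (List.range' (p + j + P.tops) r))
  have t2 := s2.ctx (vw (List.range' p j)) (vw (List.range' (p + j + P.tops) r))
  have t3 := s3.pre (vw (List.range' p j) ++ vw (List.range' (p + j) P.bottoms))
  rw [show p + j + 1 = p + 1 + j by omega] at t2
  simp only [List.append_assoc, List.cons_append, List.nil_append] at t1 t2 t3 ⊢
  exact t1.trans (t2.trans t3)

theorem rule_strand_under {c : Level} {z : List Slab} (hz : Valid c z) (p : ℕ) :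
    Rule (shift (p + 1) z ++ vw (List.range' p (run c z).length))
      (vw (List.range' p c.length) ++ shift p z) := by
  induction z generalizing c with
  | nil => simpa using Rule.refl _
  | cons s z ih =>
    have hl := s.length_apply c hz.1
    have h1 := hz.1.1
    have h3 := rule_strand_under_slab p s.pos (c.length - s.pos - s.piece.bottoms) s.piece
    rw [show s.pos + s.piece.tops + (c.length - s.pos - s.piece.bottoms) = (s.apply c).length
      by omega, show s.pos + s.piece.bottoms + (c.length - s.pos - s.piece.bottoms) = c.length
      by omega] at h3
    have h4 := ((ih hz.2).pre [⟨p + 1 + s.pos, s.piece⟩]).trans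
      (by simpa using h3.post (shift p z))
    simpa [shift_cons] using h4

theorem act_range' {α : Type} (x y : List α) (p : α) (z : List α) :
    act (List.range' x.length y.length) (x ++ p :: (y ++ z)) = x ++ (y ++ p :: z) := by
  induction y generalizing x with
  | nil => rfl
  | cons q y ih =>
    rw [List.length_cons, List.range'_succ, act_cons, List.cons_append, swapAt_length]
    have := ih (x ++ [q])
    simpa using this

/-- A word that creates points can be moved to the left, below virtual crossings which bring the
points that it creates back to their place. -/
theorem exists_rel_shift (z : List Slab) (hz : Valid [] z) (p : ℕ) :
    ∃ τ, InRange (p + (run [] z).length) τ ∧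
      (∀ (α : Type) (x y : List α), x.length = (run [] z).length → y.length = p →
        act τ (x ++ y) = y ++ x) ∧
      ∀ (q : ℕ) (a : Level), q + p ≤ a.length →
        Rel a (shift (q + p) z) (shift q z ++ vw (τ.map (q + ·))) := by
  induction p with
  | zero =>
    refine ⟨[], by simp, ?_, fun q a _ => by simpa using Rel.refl _⟩
    intro α x y _ hy
    simp [List.eq_nil_of_length_eq_zero hy]
  | succ p ih =>
    obtain ⟨τ, h1, h2, h3⟩ := ih
    set d := (run [] z).length with hd
    refine ⟨τ ++ (List.range' p d).reverse, ?_, ?_, ?_⟩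
    · rw [inRange_append]
      refine ⟨h1.mono (by omega), InRange.reverse fun i hi => ?_⟩
      have := List.mem_range'_1.1 hi; omega
    · intro α x y hx hy
      obtain ⟨y, s, rfl⟩ : ∃ y' s, y = y' ++ [s] := by
        rcases List.eq_nil_or_concat y with rfl | ⟨y', s, rfl⟩
        · simp at hy
        · exact ⟨y', s, by simp⟩
      simp at hy
      rw [act_append, ← List.append_assoc, act_append_left (by simp [hx, hy, add_comm d, h1]),
        h2 α x y hx hy]
      have h4 := act_range' y x s []
      rw [hx, hy, List.append_nil] at h4
      rw [List.append_assoc, ← h4, act_reverse_act]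
      · simp
      · intro i hi
        have := List.mem_range'_1.1 hi
        simp
        omega
    · intro q a ha
      obtain ⟨x, y, rfl, hx⟩ : ∃ x y, a = x ++ y ∧ x.length = q + p + 1 :=
        ⟨a.take (q + p + 1), a.drop (q + p + 1), by simp, by simp; omega⟩
      obtain ⟨v1, v2⟩ := run_shift hz x y
      rw [hx, List.nil_append] at v1 v2
      have hr : InRange (run (x ++ y) (shift (q + p + 1) z)).length (List.range' (q + p) d) := by
        intro i hi
        have := List.mem_range'_1.1 hi
        rw [v2]
        simp
        omega
      have r1 := (rel_vw_reverse hr).append_left v1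
      rw [List.append_nil, ← List.append_assoc] at r1
      have r2 := ((rule_strand_under hz (q + p)).post (vw (List.range' (q + p) d).reverse))
        (r1.valid_iff.1 v1)
      have r3 := r1.trans r2
      have r4 := h3 q (x ++ y) (by omega)
      have r5 := r3.trans (by
        simpa using r4.append_right (v := vw (List.range' (q + p) d).reverse)
          ((valid_append _ _ _).1 (by simpa using r3.valid_iff.1 v1)).2)
      rw [add_assoc] at r5
      convert r5 using 2
      rw [List.map_append, vw_append, List.map_reverse]
      simp [List.range'_eq_map_range, Function.comp_def, add_assoc]

/-! ### Items and caps -/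

/-- The diagrams without points at the bottom from which every diagram is put together: a circle, a
crossing of two upward strands whose lower ends are bent down to the left, so that all four ends are
at the top, and a cup. -/
inductive Item where
  | loop
  | block (slashOver : Bool)
  | cup

/-- The kind of a real crossing, given by whether the strand of slope `/` is the overpassing one. -/
def realKind (b : Bool) : CrossingKind :=
  cond b CrossingKind.slashOver CrossingKind.backslashOver

namespace Item

/-- The word of an item. -/
def word : Item → List Slab
  | loop => [⟨0, Piece.cup true⟩, ⟨0, Piece.cap⟩]
  | block b => [⟨0, Piece.cup false⟩, ⟨1, Piece.cup false⟩, ⟨2, Piece.cross (realKind b)⟩]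
  | cup => [⟨0, Piece.cup false⟩]

/-- The orientations at the top of an item. -/
def out : Item → Level
  | loop => []
  | block _ => [false, false, true, true]
  | cup => [false, true]

theorem valid_word (t : Item) : Valid [] t.word ∧ run [] t.word = t.out := by
  cases t <;> simp [word, out, Slab.Fits, Slab.apply, Piece.bottoms]

end Item

/-- The items are created one after the other, starting at position `q`. -/
def itemsWord : ℕ → List Item → List Slab
  | _, [] => []
  | q, t :: l => shift q t.word ++ itemsWord (q + t.out.length) l

/-- The orientations at the top of a list of items. -/
def itemsOut (l : List Item) : Level := l.flatMap Item.out

@[simp] theorem itemsWord_nil (q : ℕ) : itemsWord q [] = [] := rfl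
theorem itemsWord_cons (q : ℕ) (t : Item) (l : List Item) :
    itemsWord q (t :: l) = shift q t.word ++ itemsWord (q + t.out.length) l := rfl
@[simp] theorem itemsOut_nil : itemsOut [] = [] := rfl
@[simp] theorem itemsOut_cons (t : Item) (l : List Item) :
    itemsOut (t :: l) = t.out ++ itemsOut l := rfl
@[simp] theorem itemsOut_append (l l' : List Item) :
    itemsOut (l ++ l') = itemsOut l ++ itemsOut l' := by simp [itemsOut]

theorem itemsWord_append (q : ℕ) (l l' : List Item) :
    itemsWord q (l ++ l') = itemsWord q l ++ itemsWord (q + (itemsOut l).length) l' := by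
  induction l generalizing q with
  | nil => simp
  | cons t l ih => simp [itemsWord_cons, ih, add_assoc]

theorem shift_itemsWord (p q : ℕ) (l : List Item) :
    shift p (itemsWord q l) = itemsWord (p + q) l := by
  induction l generalizing q with
  | nil => rfl
  | cons t l ih => rw [itemsWord_cons, shift_append, shift_shift, ih, itemsWord_cons, add_assoc]

theorem run_itemsWord (x y : Level) (l : List Item) : Valid (x ++ y) (itemsWord x.length l) ∧
    run (x ++ y) (itemsWord x.length l) = x ++ (itemsOut l ++ y) := by
  induction l generalizing x with
  | nil => simp
  | cons t l ih =>
    obtain ⟨h1, h2⟩ := run_shift t.valid_word.1 x y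
    have h3 := ih (x ++ t.out)
    rw [itemsWord_cons, valid_append, run_append]
    rw [List.nil_append] at h1 h2
    rw [h2, t.valid_word.2]
    simp only [List.length_append, List.append_assoc] at h3
    simpa [h1] using h3

theorem run_itemsWord' (a : Level) (l : List Item) : Valid a (itemsWord a.length l) ∧
    run a (itemsWord a.length l) = a ++ itemsOut l := by
  simpa using run_itemsWord a [] l

section
variable {α : Type}

/-- Items whose endpoints are labelled. -/
def Labelled (zs : List (Item × List α)) : Prop := ∀ z ∈ zs, z.2.length = z.1.out.length

/-- The labels of a list of labelled items. -/
def labels (zs : List (Item × List α)) : List α := zs.flatMap Prod.snd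

@[simp] theorem labels_nil : labels ([] : List (Item × List α)) = [] := rfl
@[simp] theorem labels_cons (z : Item × List α) (zs : List (Item × List α)) :
    labels (z :: zs) = z.2 ++ labels zs := rfl
@[simp] theorem labels_append (zs zs' : List (Item × List α)) :
    labels (zs ++ zs') = labels zs ++ labels zs' := by simp [labels]

theorem Labelled.length {zs : List (Item × List α)} (h : Labelled zs) :
    (labels zs).length = (itemsOut (zs.map Prod.fst)).length := by
  induction zs with
  | nil => rfl
  | cons z zs ih =>
    simp [h z (by simp), ih fun z hz => h z (by simp [hz])]

/-- Items may be reordered, at the cost of virtual crossings. -/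
theorem exists_rel_items_perm {zs zs' : List (Item × List α)} (h : zs.Perm zs')
    (hz : Labelled zs) : ∃ τ, InRange (labels zs).length τ ∧ act τ (labels zs') = labels zs ∧
      ∀ (q : ℕ) (a : Level), q ≤ a.length → Rel a (itemsWord q (zs.map Prod.fst))
        (itemsWord q (zs'.map Prod.fst) ++ vw (τ.map (q + ·))) := by
  induction h with
  | nil => exact ⟨[], by simp, rfl, fun q a _ => .refl _⟩
  | @cons z zs zs' h ih =>
    obtain ⟨τ, h1, h2, h3⟩ := ih fun z hz' => hz z (by simp [hz'])
    have hl := hz z (by simp)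
    refine ⟨τ.map (z.2.length + ·), by simpa using h1.shift _, ?_, fun q a ha => ?_⟩
    · rw [labels_cons, act_append_right, h2, labels_cons]
    · obtain ⟨x, y, rfl, rfl⟩ : ∃ x y, a = x ++ y ∧ x.length = q :=
        ⟨a.take q, a.drop q, by simp, by simp; omega⟩
      obtain ⟨v1, v2⟩ := run_shift z.1.valid_word.1 x y
      rw [List.map_cons, itemsWord_cons, List.map_cons, itemsWord_cons, List.append_assoc]
      refine Rel.append_left v1 ?_
      have := h3 (x.length + z.1.out.length) (run (x ++ y) (shift x.length z.1.word))
        (by rw [List.nil_append] at v2; rw [v2, z.1.valid_word.2]; simp)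
      convert this using 3
      simp [hl, add_assoc]
  | swap z₁ z₂ l =>
    have hl1 := hz z₁ (by simp)
    have hl2 := hz z₂ (by simp)
    obtain ⟨τ, h1, h2, h3⟩ := exists_rel_shift z₁.1.word z₁.1.valid_word.1 z₂.1.out.length
    rw [z₁.1.valid_word.2] at h1 h2
    refine ⟨τ, h1.mono (by simp; omega), ?_, fun q a ha => ?_⟩
    · rw [labels_cons, labels_cons, labels_cons, labels_cons, ← List.append_assoc, act_append_left,
        h2 _ _ _ hl1 hl2, List.append_assoc]
      simpa [hl1, hl2, add_comm] using h1
    · simp only [List.map_cons, itemsWord_cons]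
      obtain ⟨x, y, rfl, rfl⟩ : ∃ x y, a = x ++ y ∧ x.length = q :=
        ⟨a.take q, a.drop q, by simp, by simp; omega⟩
      obtain ⟨v1, v2⟩ := run_shift z₂.1.valid_word.1 x y
      obtain ⟨v3, v4⟩ := run_shift z₁.1.valid_word.1 x y
      rw [List.nil_append] at v1 v2 v3 v4
      rw [z₂.1.valid_word.2] at v2
      rw [z₁.1.valid_word.2] at v4
      -- the first item slides below the second one, which is then moved to the left
      have r1 := (h3 x.length (run (x ++ y) (shift x.length z₂.1.word))
        (by rw [v2]; simp)).append_left v1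
      have r2 := rule_word_past z₁.1.valid_word.1 x.length 0 z₂.1.word
      rw [z₁.1.valid_word.2] at r2
      have v5 := (run_shift z₂.1.valid_word.1 (x ++ z₁.1.out) y).1
      simp only [List.nil_append, List.append_assoc, List.length_append] at v5
      have r3 := r2 (a := x ++ y) ((valid_append _ _ _).2 ⟨v3, by rw [v4]; exact v5⟩)
      simp only [List.length_nil, add_zero] at r3
      have v6 := r1.valid_iff.1 ((valid_append _ _ _).2 ⟨v1, by
        have := (run_shift z₁.1.valid_word.1 (x ++ z₂.1.out) y).1
        rw [v2]
        simpa using this⟩)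
      rw [← List.append_assoc] at v6
      have r4 := r1.trans (by
        rw [← List.append_assoc]
        exact r3.symm.append_right ((valid_append _ _ _).1 v6).2)
      have v7 := (run_itemsWord (x ++ (z₂.1.out ++ z₁.1.out)) y (l.map Prod.fst)).1
      have r5 := r4.append_right (v := itemsWord (x.length + z₂.1.out.length + z₁.1.out.length)
        (l.map Prod.fst)) (by
          have := (run_shift z₁.1.valid_word.1 (x ++ z₂.1.out) y).2
          simp only [List.nil_append, List.append_assoc, List.length_append] at this
          rw [run_append, v2, this, z₁.1.valid_word.2]
          simpa [add_assoc] using v7)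
      have r6 := (rule_vw_past (σ := τ.map (x.length + ·))
        (q := x.length + z₁.1.out.length + z₂.1.out.length) (by
          have := h1.shift x.length
          rwa [add_comm z₂.1.out.length, ← add_assoc] at this)
        (itemsWord 0 (l.map Prod.fst))).pre (shift x.length z₁.1.word ++
          shift (x.length + z₁.1.out.length) z₂.1.word)
      rw [shift_itemsWord, add_zero] at r6
      rw [show x.length + z₂.1.out.length + z₁.1.out.length =
        x.length + z₁.1.out.length + z₂.1.out.length by omega] at r5 
      have v8 := r5.valid_iff.1 ((valid_append _ _ _).2 ⟨(valid_append _ _ _).2 ⟨v1, by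
        have := (run_shift z₁.1.valid_word.1 (x ++ z₂.1.out) y).1
        rw [v2]
        simpa using this⟩, by
          have := (run_shift z₁.1.valid_word.1 (x ++ z₂.1.out) y).2
          simp only [List.nil_append, List.append_assoc, List.length_append] at this
          rw [run_append, v2, this, z₁.1.valid_word.2]
          simpa [add_assoc, add_comm, add_left_comm] using v7⟩)
      have r7 := r6 (by simpa using v8)
      simp only [List.append_assoc] at r5 r7
      rw [show x.length + z₂.1.out.length + z₁.1.out.length =
        x.length + z₁.1.out.length + z₂.1.out.length by omega]
      simpa using r5.trans r7
  | trans h h' ih ih' =>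
    obtain ⟨τ, h1, h2, h3⟩ := ih hz
    have hz' := fun z hz' => hz z (h.mem_iff.2 hz')
    obtain ⟨τ', h1', h2', h3'⟩ := ih' hz'
    have hle : ∀ {zs zs' : List (Item × List α)}, zs.Perm zs' →
        (labels zs).length = (labels zs').length := fun h => (h.flatMap_right _).length_eq
    refine ⟨τ' ++ τ, by rw [inRange_append, hle h]; exact ⟨h1', hle h ▸ h1⟩, by
      rw [act_append, h2', h2], fun q a ha => ?_⟩
    have r1 := h3 q a ha
    have r2 := h3' q a ha
    refine r1.trans ?_
    rw [List.map_append, vw_append, ← List.append_assoc]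
    refine r2.append_right ?_
    obtain ⟨x, y, rfl, rfl⟩ : ∃ x y, a = x ++ y ∧ x.length = q :=
        ⟨a.take q, a.drop q, by simp, by simp; omega⟩
    rw [(run_itemsWord x y _).2, valid_vw]
    refine (h1.shift x.length).mono ?_
    have := Labelled.length hz'
    simp [← this, hle h]

end

/-- The word of `k` caps at position `m`. -/
def capsWord (k m : ℕ) : List Slab := List.replicate k ⟨m, Piece.cap⟩

@[simp] theorem capsWord_zero (m : ℕ) : capsWord 0 m = [] := rfl
theorem capsWord_succ (k m : ℕ) : capsWord (k + 1) m = ⟨m, Piece.cap⟩ :: capsWord k m := rfl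

section
variable {α : Type}

/-- The list of the endpoints of a list of pairs. -/
def flatPairs (ps : List (α × α)) : List α := ps.flatMap fun p => [p.1, p.2]

@[simp] theorem flatPairs_nil : flatPairs ([] : List (α × α)) = [] := rfl
@[simp] theorem flatPairs_cons (p : α × α) (ps : List (α × α)) :
    flatPairs (p :: ps) = p.1 :: p.2 :: flatPairs ps := rfl
@[simp] theorem flatPairs_append (ps ps' : List (α × α)) :
    flatPairs (ps ++ ps') = flatPairs ps ++ flatPairs ps' := by simp [flatPairs]
@[simp] theorem length_flatPairs (ps : List (α × α)) :
    (flatPairs ps).length = 2 * ps.length := by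
  induction ps with
  | nil => rfl
  | cons p ps ih => simp [ih]; omega

/-- The caps which join the pairs `ps` absorb virtual crossings which rearrange the pairs to
`ps'`. -/
def CapEquiv (ps ps' : List (α × α)) : Prop :=
  ps.length = ps'.length ∧ ∃ τ, InRange (2 * ps.length) τ ∧ act τ (flatPairs ps) = flatPairs ps' ∧
    ∀ m, Rule (capsWord ps.length m) (vw (τ.map (m + ·)) ++ capsWord ps.length m)

theorem CapEquiv.refl (ps : List (α × α)) : CapEquiv ps ps :=
  ⟨rfl, [], by simp, rfl, fun _ => .refl _⟩

theorem CapEquiv.trans {ps ps' ps'' : List (α × α)} (h : CapEquiv ps ps')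
    (h' : CapEquiv ps' ps'') : CapEquiv ps ps'' := by
  obtain ⟨h0, τ, h1, h2, h3⟩ := h
  obtain ⟨h0', τ', h1', h2', h3'⟩ := h'
  refine ⟨h0.trans h0', τ ++ τ', (inRange_append _ _ _).2 ⟨h1, h0 ▸ h1'⟩, by rw [act_append, h2, h2'], fun m => ?_⟩
  have := (h3' m).pre (vw (τ.map (m + ·)))
  rw [List.map_append, vw_append, List.append_assoc]
  rw [← h0] at this
  exact (h3 m).trans this

theorem CapEquiv.cons {ps ps' : List (α × α)} (h : CapEquiv ps ps') (p : α × α) :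
    CapEquiv (p :: ps) (p :: ps') := by
  obtain ⟨h0, τ, h1, h2, h3⟩ := h
  refine ⟨by simp [h0], τ.map (2 + ·), ?_, ?_, fun m => ?_⟩
  · have := h1.shift 2
    rwa [List.length_cons, mul_add, add_comm]
  · have := act_append_right [p.1, p.2] τ (flatPairs ps)
    simpa [h2] using this
  · rw [List.length_cons, capsWord_succ]
    have h4 := rule_slab_past m 0 Piece.cap (vw τ)
    simp only [Piece.tops, Piece.bottoms, add_zero, shift_vw] at h4
    have := ((h3 m).pre [⟨m, Piece.cap⟩]).trans (by simpa using h4.post (capsWord ps.length m))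
    simpa [Function.comp_def, add_assoc] using this

theorem CapEquiv.flip (p : α × α) (ps : List (α × α)) :
    CapEquiv (p :: ps) ((p.2, p.1) :: ps) := by
  refine ⟨rfl, [0], by simp; omega, ?_, fun m => ?_⟩
  · simpa using swapAt_length [] (flatPairs ps) p.1 p.2
  · rw [List.length_cons, capsWord_succ]
    simpa [vw] using (rule_oneCap_symm m).post (capsWord ps.length m)

theorem CapEquiv.swap (p q : α × α) (ps : List (α × α)) :
    CapEquiv (p :: q :: ps) (q :: p :: ps) := by
  refine ⟨rfl, [1, 2, 0, 1], by simp; omega, ?_, fun m => ?_⟩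
  · simp [swapAt]
  · have r1 := (rule_exchange Piece.cap Piece.cap (i := m) 0 rfl rfl)
    simp only [Piece.tops, Piece.bottoms, add_zero] at r1
    have r2 := (rule_cap_left (m + 1)).post [⟨m, Piece.cap⟩]
    have r3 := (rule_cap_left m).ctx [virtualAt (m + 1), virtualAt (m + 2)] [⟨m, Piece.cap⟩]
    have := (r1.trans (r2.trans r3)).post (capsWord ps.length m)
    simpa [capsWord_succ, vw] using this

theorem CapEquiv.of_perm {ps ps' : List (α × α)} (h : ps.Perm ps') : CapEquiv ps ps' := by
  induction h with
  | nil => exact .refl _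
  | cons p _ ih => exact ih.cons p
  | swap p q l => exact .swap _ _ _
  | trans _ _ ih ih' => exact ih.trans ih'

/-- Each of the pairs may be turned round. -/
theorem CapEquiv.map_flip (f : α × α → Bool) (ps : List (α × α)) :
    CapEquiv ps (ps.map fun p => if f p then (p.2, p.1) else p) := by
  induction ps with
  | nil => exact .refl _
  | cons p ps ih =>
    refine (ih.cons p).trans ?_
    rw [List.map_cons]
    split_ifs
    · exact .flip _ _
    · exact .refl _

end

/-! ### Every word has a standard form -/

theorem Rel.middle {a : Level} {u l r v : List Slab} (h : Rel (run a u) l r)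
    (hv : Valid a (u ++ (l ++ v))) : Rel a (u ++ (l ++ v)) (u ++ (r ++ v)) := by
  rw [valid_append, valid_append] at hv
  exact (h.append_right hv.2.2).append_left hv.1

theorem rule_caps_past (i r k : ℕ) (p : Piece) :
    Rule (capsWord k (i + p.bottoms + r) ++ [⟨i, p⟩]) (⟨i, p⟩ :: capsWord k (i + p.tops + r)) := by
  induction k with
  | zero => exact .refl _
  | succ k ih =>
    exact (ih.pre [⟨i + p.bottoms + r, Piece.cap⟩]).trans
      ((rule_exchange_symm p Piece.cap r rfl rfl).post _)

theorem length_run_caps {c : Level} {k m : ℕ} (h : Valid c (capsWord k m)) :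
    (run c (capsWord k m)).length + 2 * k = c.length := by
  induction k generalizing c with
  | zero => simp
  | succ k ih =>
    rw [capsWord_succ] at h ⊢
    have h1 := ih h.2
    have h2 := Slab.length_apply _ _ h.1
    simp only [Piece.bottoms, Piece.tops] at h2
    rw [run_cons]
    omega

/-- The word `w` over the level `a` is equivalent to a word in standard form, which has a list of
items to the right of the points of `a`, then virtual crossings, and then caps which join the last
points pairwise. -/
def IsForm (a : Level) (w : List Slab) : Prop :=
  ∃ I σ k m, a.length + (itemsOut I).length = m + 2 * k ∧
    Rel a w (itemsWord a.length I ++ (vw σ ++ capsWord k m))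

theorem IsForm.of_rel {a : Level} {w w' : List Slab} (h : Rel a w w') (hw : IsForm a w') :
    IsForm a w := by
  obtain ⟨I, σ, k, m, h1, h2⟩ := hw
  exact ⟨I, σ, k, m, h1, h.trans h2⟩

theorem length_run_form {a : Level} {I : List Item} {σ : List ℕ} {k m : ℕ}
    (h : a.length + (itemsOut I).length = m + 2 * k)
    (hv : Valid a (itemsWord a.length I ++ (vw σ ++ capsWord k m))) :
    (run a (itemsWord a.length I ++ vw σ)).length = m + 2 * k ∧ InRange (m + 2 * k) σ ∧
    (run a (itemsWord a.length I ++ (vw σ ++ capsWord k m))).length = m := by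
  rw [valid_append, valid_append, (run_itemsWord' a I).2, valid_vw, List.length_append, h] at hv
  have h1 : (run a (itemsWord a.length I ++ vw σ)).length = m + 2 * k := by
    rw [run_append, (run_itemsWord' a I).2, run_vw, length_act, List.length_append, h]
  refine ⟨h1, hv.2.1, ?_⟩
  rw [run_append, run_append, (run_itemsWord' a I).2]
  have h2 := length_run_caps hv.2.2
  rw [run_vw, length_act, List.length_append] at h2
  rw [run_vw]
  omega

/-- A slab above a standard form slides below its caps. -/
theorem IsForm.exists_slide {a : Level} {w : List Slab} (hw : IsForm a w) {s : Slab}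
    (hv : Valid a (w ++ [s])) : ∃ I σ k m r, a.length + (itemsOut I).length = m + 2 * k ∧
      m = s.pos + s.piece.bottoms + r ∧
      Rel a (w ++ [s]) ((itemsWord a.length I ++ vw σ) ++
        ([s] ++ capsWord k (s.pos + s.piece.tops + r))) := by
  obtain ⟨I, σ, k, m, h1, h2⟩ := hw
  have h3 := (valid_append _ _ _).1 hv
  have h4 := h2.valid_iff.1 h3.1
  have h5 := (length_run_form h1 h4).2.2
  rw [← h2.run_eq] at h5
  have h6 := h3.2.1.1
  obtain ⟨r, hr⟩ : ∃ r, m = s.pos + s.piece.bottoms + r := ⟨m - (s.pos + s.piece.bottoms), by omega⟩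
  refine ⟨I, σ, k, m, r, h1, hr, ?_⟩
  have h7 := h2.append_right h3.2
  refine h7.trans ?_
  have h8 := (rule_caps_past s.pos r k s.piece).pre (itemsWord a.length I ++ vw σ)
  rw [← hr] at h8
  simp only [List.append_assoc] at h7 h8 ⊢
  exact h8 (h7.valid_iff.1 hv)

theorem IsForm.virtual {a : Level} {w : List Slab} (hw : IsForm a w) {i : ℕ}
    (hv : Valid a (w ++ [virtualAt i])) : IsForm a (w ++ [virtualAt i]) := by
  obtain ⟨I, σ, k, m, r, h1, hm, h2⟩ := hw.exists_slide hv
  refine ⟨I, σ ++ [i], k, m, h1, ?_⟩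
  simp only [virtualAt, Piece.tops, Piece.bottoms] at h2 hm
  rw [← hm] at h2
  simpa [vw, virtualAt] using h2

/-- A cap may be moved to the right, above virtual crossings. -/
theorem exists_rel_cap_right {c : Level} {i : ℕ} (hv : Valid c [⟨i, Piece.cap⟩]) (d : ℕ)
    (hd : i + 2 + d ≤ c.length) : ∃ ρ, Rel c [⟨i, Piece.cap⟩] (vw ρ ++ [⟨i + d, Piece.cap⟩]) := by
  induction d with
  | zero => exact ⟨[], .refl _⟩
  | succ d ih =>
    obtain ⟨ρ, h⟩ := ih (by omega)
    have hv' := h.valid_iff.1 hv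
    have h1 : Rel (run c (vw ρ)) [] (vw [i + d + 1, i + d] ++ vw [i + d + 1, i + d].reverse) :=
      rel_vw_reverse (by rw [run_vw]; simp; omega)
    have h2 := Rel.middle (l := []) (v := [⟨i + d, Piece.cap⟩]) h1 hv'
    have h3 := ((rule_cap_left_symm (i + d)).pre (vw ρ ++ vw [i + d + 1, i + d]))
    refine ⟨ρ ++ [i + d + 1, i + d], h.trans (h2.trans ?_)⟩
    have h4 := h3 (a := c) (by simpa [vw] using h2.valid_iff.1 hv')
    simpa [vw, add_assoc] using h4

theorem IsForm.cap {a : Level} {w : List Slab} (hw : IsForm a w) {i : ℕ}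
    (hv : Valid a (w ++ [⟨i, Piece.cap⟩])) : IsForm a (w ++ [⟨i, Piece.cap⟩]) := by
  obtain ⟨I, σ, k, m, r, h1, hm, h2⟩ := hw.exists_slide hv
  simp only [Piece.tops, Piece.bottoms, add_zero] at h2 hm
  have hv' := h2.valid_iff.1 hv
  have hl : (run a (itemsWord a.length I ++ vw σ)).length = m + 2 * k := by
    rw [run_append, (run_itemsWord' a I).2, run_vw, length_act, List.length_append, h1]
  obtain ⟨ρ, h3⟩ := exists_rel_cap_right (c := run a (itemsWord a.length I ++ vw σ)) (i := i)
    ((valid_append _ _ _).1 ((valid_append _ _ _).1 hv').2).1 r (by omega)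
  refine ⟨I, σ ++ ρ, k + 1, i + r, by omega, h2.trans ?_⟩
  have h4 := h3.middle hv'
  simpa [vw_append, capsWord_succ] using h4

/-- A slab with a virtual crossing or a cap. -/
def Slab.IsSimple (s : Slab) : Prop :=
  s.piece = Piece.cross CrossingKind.virtual ∨ s.piece = Piece.cap

theorem isSimple_of_mem_vw {σ : List ℕ} {s : Slab} (h : s ∈ vw σ) : s.IsSimple := by
  obtain ⟨i, -, rfl⟩ := List.mem_map.1 h
  exact .inl rfl

theorem IsForm.append_simple {a : Level} {w v : List Slab} (hw : IsForm a w)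
    (hs : ∀ s ∈ v, s.IsSimple) (hv : Valid a (w ++ v)) : IsForm a (w ++ v) := by
  induction v generalizing w with
  | nil => simpa using hw
  | cons s v ih =>
    have he : w ++ s :: v = (w ++ [s]) ++ v := by simp
    rw [he] at hv ⊢
    refine ih ?_ (fun t ht => hs t (by simp [ht])) hv
    have hv' := ((valid_append _ _ _).1 hv).1
    obtain ⟨i, p⟩ := s
    rcases hs _ List.mem_cons_self with h | h <;> simp only at h <;> subst h
    · exact hw.virtual hv'
    · exact hw.cap hv'

theorem rule_caps_past_word {e : Level} {z : List Slab} (hz : Valid e z) (q r k : ℕ) :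
    Rule (capsWord k (q + e.length + r) ++ shift q z)
      (shift q z ++ capsWord k (q + (run e z).length + r)) := by
  induction z generalizing e with
  | nil => simpa using Rule.refl _
  | cons s z ih =>
    have hl := s.length_apply e hz.1
    have h1 := hz.1.1
    have h2 := rule_caps_past (q + s.pos) (e.length - s.pos - s.piece.bottoms + r) k s.piece
    rw [show q + s.pos + s.piece.bottoms + (e.length - s.pos - s.piece.bottoms + r) =
      q + e.length + r by omega, show q + s.pos + s.piece.tops +
      (e.length - s.pos - s.piece.bottoms + r) = q + (s.apply e).length + r by omega] at h2
    have h3 := (h2.post (shift q z)).trans (by simpa using (ih hz.2).pre [⟨q + s.pos, s.piece⟩])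
    simpa [shift_cons] using h3

/-- A slab which can be replaced by an item together with virtual crossings and caps. -/
theorem IsForm.create {a : Level} {w : List Slab} (hw : IsForm a w) {s : Slab}
    (hv : Valid a (w ++ [s])) {t : Item} {v : List Slab} {q : ℕ} (hq : q ≤ (run a w).length)
    (hs : ∀ s ∈ v, s.IsSimple) (hr : Rel (run a w) [s] (shift q t.word ++ v)) :
    IsForm a (w ++ [s]) := by
  have hv' := (valid_append _ _ _).1 hv
  have r1 := hr.append_left hv'.1
  have v1 := r1.valid_iff.1 hv
  obtain ⟨I, σ, k, m, h1, h2⟩ := hw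
  have h4 := h2.valid_iff.1 hv'.1
  obtain ⟨h5, h6, h7⟩ := length_run_form h1 h4
  rw [← h2.run_eq] at h7
  have r2 := h2.append_right ((valid_append _ _ _).1 v1).2
  have v2 := r2.valid_iff.1 v1
  have r3 := (rule_caps_past_word t.valid_word.1 q (m - q) k).ctx (itemsWord a.length I ++ vw σ) v
  rw [List.length_nil, add_zero, show q + (m - q) = m by omega] at r3
  simp only [List.append_assoc] at r2 v2 r3
  have r4 := r3 v2
  have v4 := r4.valid_iff.1 v2
  obtain ⟨τ, -, -, hτ⟩ := exists_rel_shift t.word t.valid_word.1 (m + 2 * k - q)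
  set c := run a (itemsWord a.length I ++ vw σ) with hc
  have hτ' := hτ q c (by omega)
  rw [show q + (m + 2 * k - q) = m + 2 * k by omega] at hτ'
  -- the item and its inverse passage
  have vc : Valid c (shift (m + 2 * k) t.word) := by
    have := (run_shift t.valid_word.1 c []).1
    rwa [List.nil_append, List.append_nil, h5] at this
  have hrange : InRange (run c (shift q t.word)).length (τ.map (q + ·)) := by
    have := ((valid_append _ _ _).1 (hτ'.valid_iff.1 vc)).2
    exact (valid_vw _ _).1 this
  have vq : Valid c (shift q t.word) := ((valid_append _ _ _).1 (hτ'.valid_iff.1 vc)).1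
  have r5 : Rel c (shift q t.word)
      (shift (m + 2 * k) t.word ++ vw (τ.map (q + ·)).reverse) := by
    have e1 := (rel_vw_reverse hrange).append_left vq
    rw [List.append_nil, ← List.append_assoc] at e1
    refine e1.trans (hτ'.symm.append_right ?_)
    exact ((valid_append _ _ _).1 (e1.valid_iff.1 vq)).2
  have r6 := Rel.middle (a := a) (u := itemsWord a.length I ++ vw σ) r5 (by simpa using v4)
  have r7 := (rule_vw_past h6 t.word).ctx (itemsWord a.length I) (vw (τ.map (q + ·)).reverse ++
    (capsWord k (q + (run [] t.word).length + (m - q)) ++ v))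
  simp only [List.append_assoc] at r6 r7
  have r8 := r1.trans (r2.trans (r4.trans (r6.trans (r7 (r6.valid_iff.1 v4)))))
  refine IsForm.of_rel r8 ?_
  have hf : itemsWord a.length I ++ (shift (m + 2 * k) t.word ++ (vw σ ++ (vw (τ.map (q + ·)).reverse ++
      (capsWord k (q + (run [] t.word).length + (m - q)) ++ v)))) =
      (itemsWord a.length (I ++ [t]) ++ vw σ) ++ (vw (τ.map (q + ·)).reverse ++
      (capsWord k (q + (run [] t.word).length + (m - q)) ++ v)) := by
    rw [itemsWord_append, h1]
    simp [itemsWord_cons]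
  rw [hf] at r8 ⊢
  refine IsForm.append_simple ⟨I ++ [t], σ, 0, m + 2 * k + t.out.length, ?_, ?_⟩ ?_
    (r8.valid_iff.1 hv)
  · simp [← h1, add_assoc]
  · simpa using Rel.refl _
  · intro s hs'
    simp only [List.mem_append] at hs'
    rcases hs' with h | h | h
    · exact isSimple_of_mem_vw h
    · exact .inr (by rw [List.eq_of_mem_replicate h])
    · exact hs s h

theorem IsForm.cup {a : Level} {w : List Slab} (hw : IsForm a w) {i : ℕ} {o : Bool}
    (hv : Valid a (w ++ [⟨i, Piece.cup o⟩])) : IsForm a (w ++ [⟨i, Piece.cup o⟩]) := by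
  have h1 : i + 0 ≤ (run a w).length := ((valid_append _ _ _).1 hv).2.1.1
  cases o
  · exact hw.create hv (t := .cup) (v := []) h1 (by simp) (.refl _)
  · exact hw.create hv (t := .cup) (v := vw [i]) h1 (fun s => isSimple_of_mem_vw)
      (rule_oneCup_symm i true ((valid_append _ _ _).1 hv).2)

/-- A crossing of two upward strands, with its lower ends bent down. -/
theorem rel_block {a : Level} {i : ℕ} {b : Bool} (hv : Valid a [⟨i, Piece.cross (realKind b)⟩])
    (h1 : a[i]? = some true) (h2 : a[i + 1]? = some true) :
    Rel a [⟨i, Piece.cross (realKind b)⟩] (shift (i + 2) (Item.block b).word ++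
      [⟨i + 1, Piece.cap⟩, ⟨i, Piece.cap⟩]) := by
  let X : Piece := Piece.cross (realKind b)
  have r1 : Rel a [⟨i, X⟩] [⟨i + 1, Piece.cup false⟩, ⟨i, Piece.cap⟩, ⟨i, X⟩] :=
    (rel_zigzagRight (o := false) h1).append_right hv
  have r2 : Rel a [⟨i + 1, Piece.cup false⟩, ⟨i, Piece.cap⟩, ⟨i, X⟩]
      [⟨i + 2, Piece.cup false⟩, ⟨i + 1, Piece.cap⟩, ⟨i + 1, Piece.cup false⟩, ⟨i, Piece.cap⟩,
        ⟨i, X⟩] :=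
    (rel_zigzagRight (i := i + 1) (o := false) h2).append_right (r1.valid_iff.1 hv)
  have r3 : Rule [⟨i + 1, Piece.cap⟩, ⟨i + 1, Piece.cup false⟩]
      [⟨i + 3, Piece.cup false⟩, ⟨i + 1, Piece.cap⟩] := rule_exchange _ _ 0 rfl rfl
  have r4 : Rule [⟨i, Piece.cap⟩, ⟨i, X⟩] [⟨i + 2, X⟩, ⟨i, Piece.cap⟩] :=
    rule_exchange _ _ 0 rfl rfl
  have r5 : Rule [⟨i + 1, Piece.cap⟩, ⟨i + 2, X⟩] [⟨i + 4, X⟩, ⟨i + 1, Piece.cap⟩] :=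
    rule_exchange _ _ 1 rfl (by simp [Piece.bottoms])
  have r6 := ((r3.ctx [⟨i + 2, Piece.cup false⟩] [⟨i, Piece.cap⟩, ⟨i, X⟩]).trans
    (r4.pre [⟨i + 2, Piece.cup false⟩, ⟨i + 3, Piece.cup false⟩, ⟨i + 1, Piece.cap⟩])).trans
    (r5.ctx [⟨i + 2, Piece.cup false⟩, ⟨i + 3, Piece.cup false⟩] [⟨i, Piece.cap⟩])
  exact r1.trans (r2.trans (r6 (r2.valid_iff.1 (r1.valid_iff.1 hv))))

/-- Rotation of a crossing by a right angle. -/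
theorem rel_rotate {x y : Level} {o p : Bool} {k : CrossingKind}
    (hv : Valid (x ++ ([o, p] ++ y)) [⟨x.length, Piece.cross k⟩]) :
    Rel (x ++ ([o, p] ++ y)) [⟨x.length, Piece.cross k⟩] ([⟨x.length + 2, Piece.cup (!o)⟩] ++
      ([⟨x.length + 1, Piece.cross k.rotate⟩] ++ [⟨x.length, Piece.cap⟩])) := by
  have ha : run (x ++ ([o, p] ++ y)) [⟨x.length, Piece.cross k⟩] = x ++ ([p, o] ++ y) := by
    rw [run_cons, apply_append rfl rfl]; rfl
  have r1 := (rel_zigzagRight (a := x ++ ([p, o] ++ y)) (i := x.length + 1) (o := !o)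
    (by simp))
  rw [← ha] at r1
  have r2 := r1.append_left hv
  have r3 : Rule [⟨x.length, Piece.cross k⟩, ⟨x.length + 2, Piece.cup (!o)⟩]
      [⟨x.length + 2, Piece.cup (!o)⟩, ⟨x.length, Piece.cross k⟩] := rule_exchange _ _ 0 rfl rfl
  have r4 := (r3.post [⟨x.length + 1, Piece.cap⟩]).trans
    ((rule_rotateCap_symm x.length k).pre [⟨x.length + 2, Piece.cup (!o)⟩])
  exact r2.trans (r4 (r2.valid_iff.1 (by simpa using hv)))

theorem exists_pair_split {c : Level} {i : ℕ} {k : CrossingKind}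
    (hv : Valid c [⟨i, Piece.cross k⟩]) :
    ∃ x o p y, c = x ++ ([o, p] ++ y) ∧ x.length = i := by
  have h1 := hv.1.1
  simp only [Piece.bottoms] at h1
  obtain ⟨x, o, p, y, rfl, h⟩ := exists_split (show i + 1 < c.length by omega)
  exact ⟨x, o, p, y, rfl, h⟩

theorem IsForm.real_rotate {o p : Bool}
    (ih : ∀ {a : Level} {w : List Slab} {x y : Level} {b : Bool}, IsForm a w →
      run a w = x ++ ([p, !o] ++ y) → Valid a (w ++ [⟨x.length, Piece.cross (realKind b)⟩]) →
      IsForm a (w ++ [⟨x.length, Piece.cross (realKind b)⟩]))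
    {a : Level} {w : List Slab} {x y : Level} {b : Bool} (hw : IsForm a w)
    (hr : run a w = x ++ ([o, p] ++ y))
    (hv : Valid a (w ++ [⟨x.length, Piece.cross (realKind b)⟩])) :
    IsForm a (w ++ [⟨x.length, Piece.cross (realKind b)⟩]) := by
  have hv' := (valid_append _ _ _).1 hv
  have r1 := rel_rotate (hr ▸ hv'.2)
  rw [← hr] at r1
  have r2 := r1.append_left hv'.1
  have v2 := r2.valid_iff.1 hv
  refine IsForm.of_rel r2 ?_
  rw [← List.append_assoc, ← List.append_assoc] at v2 ⊢
  have v3 := ((valid_append _ _ _).1 v2).1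
  refine IsForm.cap ?_ v2
  have v4 := ((valid_append _ _ _).1 v3).1
  have h5 := hw.cup v4
  have hk : (realKind b).rotate = realKind (!b) := by cases b <;> rfl
  rw [hk] at v3 ⊢
  have hl : x.length + 1 = (x ++ [o]).length := by simp
  rw [hl] at v3 ⊢
  refine ih (y := (o) :: y) h5 ?_ v3
  rw [run_append, hr, show x ++ ([o, p] ++ y) = (x ++ [o, p]) ++ ([] ++ y) by simp, run_cons,
    apply_append (by simp) rfl]
  simp

theorem IsForm.real {a : Level} {w : List Slab} (hw : IsForm a w) {i : ℕ} {b : Bool}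
    (hv : Valid a (w ++ [⟨i, Piece.cross (realKind b)⟩])) :
    IsForm a (w ++ [⟨i, Piece.cross (realKind b)⟩]) := by
  have up : ∀ {a : Level} {w : List Slab} {x y : Level} {b : Bool}, IsForm a w →
      run a w = x ++ ([true, true] ++ y) → Valid a (w ++ [⟨x.length, Piece.cross (realKind b)⟩]) →
      IsForm a (w ++ [⟨x.length, Piece.cross (realKind b)⟩]) := by
    intro a w x y b hw hr hv
    refine hw.create hv (t := .block b) (q := x.length + 2) (by rw [hr]; simp) ?_
      (rel_block ((valid_append _ _ _).1 hv).2 (by simp [hr]) (by simp [hr]))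
    intro s hs
    simp at hs
    rcases hs with rfl | rfl <;> exact .inr rfl
  obtain ⟨x, o, p, y, hr, rfl⟩ := exists_pair_split ((valid_append _ _ _).1 hv).2
  have h1 := fun {a w x y b} => IsForm.real_rotate (o := false) (p := true) (fun {_ _ _ _ _} => up)
    (a := a) (w := w) (x := x) (y := y) (b := b)
  have h2 := fun {a w x y b} => IsForm.real_rotate (o := false) (p := false) (fun {_ _ _ _ _} => h1)
    (a := a) (w := w) (x := x) (y := y) (b := b)
  have h3 := fun {a w x y b} => IsForm.real_rotate (o := true) (p := false) (fun {_ _ _ _ _} => h2)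
    (a := a) (w := w) (x := x) (y := y) (b := b)
  cases o <;> cases p
  · exact h2 hw hr hv
  · exact h1 hw hr hv
  · exact h3 hw hr hv
  · exact up hw hr hv

theorem isForm_of_valid {a : Level} {w : List Slab} (hv : Valid a w) : IsForm a w := by
  induction w using List.reverseRecOn with
  | nil => exact ⟨[], [], 0, a.length, by simp, .refl _⟩
  | append_singleton w s ih =>
    have hw := ih ((valid_append _ _ _).1 hv).1
    obtain ⟨i, p⟩ := s
    match p with
    | .cross .virtual => exact hw.virtual hv
    | .cross .slashOver => exact hw.real (b := true) hv
    | .cross .backslashOver => exact hw.real (b := false) hv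
    | .cup o => exact hw.cup hv
    | .cap => exact hw.cap hv

/-! ### Cancellation of cups and caps -/

theorem rule_last_cap (k m : ℕ) :
    Rule (capsWord (k + 1) m) (⟨m + 2 * k, Piece.cap⟩ :: capsWord k m) := by
  induction k with
  | zero => exact .refl _
  | succ k ih =>
    have h := ih.pre [⟨m, Piece.cap⟩]
    have h2 := (rule_exchange Piece.cap Piece.cap (i := m) (j := m + 2 * k) (j' := m + 2 * (k + 1))
      (2 * k) (by simp [Piece.tops]) (by simp [Piece.bottoms]; omega)).post (capsWord k m)
    exact h.trans h2

theorem rule_loop (n : ℕ) (o : Bool) :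
    Rule [⟨n, Piece.cup o⟩, ⟨n, Piece.cap⟩] (shift n Item.loop.word) := by
  cases o
  · exact ((rule_oneCup_symm n false).post [⟨n, Piece.cap⟩]).trans
      ((Move.rule (.inr (.oneCap n))).pre [⟨n, Piece.cup true⟩])
  · exact .refl _

/-- A cup one end of which goes straight up to a cap either closes up to a circle, or can be
straightened. -/
theorem exists_rel_cancel {α : Type} {A B : List α} {g g' l : α} {ρ : List ℕ} {c : Level}
    {o : Bool} (hc : c.length = A.length) (hρ : InRange (A.length + 2) ρ)
    (hn : (A ++ [g, l]).Nodup) (hact : act ρ (A ++ [g, l]) = B ++ [g', l])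
    (hv : Valid c (⟨A.length, Piece.cup o⟩ :: (vw ρ ++ [⟨A.length, Piece.cap⟩]))) :
    ∃ σ', Rel c (⟨A.length, Piece.cup o⟩ :: (vw ρ ++ [⟨A.length, Piece.cap⟩]))
      (shift A.length Item.loop.word ++ vw σ') ∨
      Rel c (⟨A.length, Piece.cup o⟩ :: (vw ρ ++ [⟨A.length, Piece.cap⟩])) (vw σ') := by
  set N := A.length with hN
  have hperm : (A ++ [g, l]).Perm (B ++ [g', l]) := hact ▸ (act_perm _ _).symm
  have hperm2 : (A ++ [g]).Perm (B ++ [g']) := by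
    rw [← List.perm_append_right_iff [l]]
    simpa using hperm
  have hBN : B.length = N := by
    have := hperm.length_eq
    simp at this
    omega
  have hlen : (run c [⟨N, Piece.cup o⟩]).length = N + 2 := by
    have := Slab.length_apply _ _ hv.1
    simp only [Piece.bottoms, Piece.tops] at this
    rw [run_cons, run_nil]
    omega
  have hcup : Valid c [⟨N, Piece.cup o⟩] := ⟨hv.1, trivial⟩
  have hcap : ∀ {σ : List ℕ}, InRange N σ →
      Rule (vw σ ++ [⟨N, Piece.cap⟩]) (⟨N, Piece.cap⟩ :: vw σ) := fun h => by
    simpa [shift] using rule_vw_past h [⟨0, Piece.cap⟩]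
  by_cases hg : g' = g
  · subst hg
    obtain ⟨σ', h1, h2⟩ := exists_act_of_perm ((List.perm_append_right_iff _).1 hperm2)
    have r1 : VRel (N + 2) ρ σ' := by
      have := vrel_of_act_eq (l := A ++ [g', l]) hn (σ := ρ) (τ := σ') (by simpa using hρ)
        (by simpa using h1.mono (by omega)) (by rw [hact, act_append_left h1, h2])
      simpa using this
    have r2 := Rel.middle (u := [⟨N, Piece.cup o⟩]) (v := [⟨N, Piece.cap⟩]) (r1 _ hlen.ge)
      (by simpa using hv)
    have r3 := ((hcap h1).pre [⟨N, Piece.cup o⟩]).trans ((rule_loop N o).post (vw σ'))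
    exact ⟨σ', .inl (r2.trans (r3 (r2.valid_iff.1 (by simpa using hv))))⟩
  · have hgA : g' ∈ A := by
      have : g' ∈ A ++ [g] := hperm2.mem_iff.2 (by simp)
      simpa [hg] using this
    obtain ⟨A1, hA1⟩ : ∃ A1, A.Perm (A1 ++ [g']) := by
      obtain ⟨s, t, rfl⟩ := List.append_of_mem hgA
      exact ⟨s ++ t, List.perm_middle.trans (List.perm_append_singleton _ _).symm⟩
    obtain ⟨σ1, h1, h2⟩ := exists_act_of_perm hA1
    have hA1N : A1.length + 1 = N := by simpa using hA1.length_eq.symm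
    have hAB : (A1 ++ [g]).Perm B := by
      rw [← List.perm_append_right_iff [g']]
      refine List.Perm.trans ?_ hperm2
      refine List.Perm.trans ?_ (hA1.symm.append_right [g])
      simp only [List.append_assoc]
      exact (List.Perm.swap _ _ _).append_left _
    obtain ⟨σ2, h3, h4⟩ := exists_act_of_perm hAB
    have h3' : InRange N σ2 := by simpa [hA1N] using h3
    have r1 : VRel (N + 2) ρ (σ1 ++ (A1.length :: σ2)) := by
      have := vrel_of_act_eq (l := A ++ [g, l]) hn (σ := ρ) (τ := σ1 ++ (A1.length :: σ2))
        (by simpa using hρ) (by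
          simp only [List.length_append, inRange_append, inRange_cons, List.length_cons]
          exact ⟨h1.mono (by omega), by omega, h3'.mono (by omega)⟩) (by
          rw [hact, act_append, act_append_left h1, h2, act_cons, List.append_assoc,
            List.cons_append, List.nil_append, swapAt_length,
            show A1 ++ g :: g' :: [l] = (A1 ++ [g]) ++ [g', l] by simp, act_append_left h3, h4])
      simpa using this
    have r2 := Rel.middle (u := [⟨N, Piece.cup o⟩]) (v := [⟨N, Piece.cap⟩]) (r1 _ hlen.ge)
      (by simpa using hv)
    have r3 := (hcap h3').pre ([⟨N, Piece.cup o⟩] ++ vw (σ1 ++ [A1.length]))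
    have v2 := r2.valid_iff.1 (by simpa using hv)
    have e1 : vw (σ1 ++ A1.length :: σ2) = vw σ1 ++ ([virtualAt A1.length] ++ vw σ2) := by
      simp [vw]
    rw [e1] at r2 v2
    rw [vw_append] at r3
    simp only [List.append_assoc] at r2 r3 v2
    have r4 := r3 (a := c) (by simpa [vw] using v2)
    have v4 := r4.valid_iff.1 (by simpa [vw] using v2)
    -- the cup slides up to the crossing
    have r5 : Rel c (vw σ1 ++ [⟨N, Piece.cup o⟩]) ([⟨N, Piece.cup o⟩] ++ vw σ1) := by
      have := rule_vw_past h1 [⟨0, Piece.cup o⟩]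
      simp only [shift, List.map_cons, List.map_nil, add_zero] at this
      refine this ?_
      rw [valid_append, valid_vw, run_vw]
      exact ⟨h1.mono hc.ge, ⟨by simp [Piece.bottoms, hc, hN], by simp⟩, trivial⟩
    have v5 : Valid c (([⟨N, Piece.cup o⟩] ++ vw σ1) ++ (vw [A1.length] ++
        (⟨N, Piece.cap⟩ :: vw σ2))) := by simpa using v4
    have r6 := r5.symm.append_right ((valid_append _ _ _).1 v5).2
    have r7 : Rule [⟨N, Piece.cup o⟩, virtualAt A1.length, ⟨N, Piece.cap⟩] [] := by
      rw [← hA1N]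
      exact ((rule_rotateCap_symm A1.length .virtual).pre [⟨A1.length + 1, Piece.cup o⟩]).trans
        (((rule_oneCup (A1.length + 1) o).post [⟨A1.length, Piece.cap⟩]).trans
          (rule_zigzagRight A1.length !o))
    have r8 := r7.ctx (vw σ1) (vw σ2)
    have r9 := r8 (a := c) (by simpa [vw] using r6.valid_iff.1 v5)
    refine ⟨σ1 ++ σ2, .inr ?_⟩
    rw [vw_append]
    simp only [List.append_assoc, List.cons_append, List.nil_append, vw_cons, vw_nil] at r2 r4 r6 r9 ⊢
    exact r2.trans (r4.trans (r6.trans r9))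

namespace Item

/-- Whether an item is a cup. -/
@[simp] def isCup : Item → Bool
  | cup => true
  | _ => false

theorem isCup_iff {t : Item} : t.isCup = true ↔ t = cup := by cases t <;> simp

end Item

/-- The number of cups in a list of items. -/
def cupCount (I : List Item) : ℕ := I.countP Item.isCup

theorem exists_rel_fewer_cups {a : Level} {σ : List ℕ} {k m : ℕ} {x : List ℕ}
    {zs : List (Item × List ℕ)} {y : List ℕ} {ps : List (ℕ × ℕ)} (hx : x.length = a.length)
    (hzs : Labelled zs) (hn : (x ++ labels zs).Nodup) (hm : y.length = m) (hk : ps.length = k)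
    (hact : act σ (x ++ labels zs) = y ++ flatPairs ps)
    (hv : Valid a (itemsWord a.length (zs.map Prod.fst) ++ (vw σ ++ capsWord k m)))
    {z : Item × List ℕ} (hz : z ∈ zs) (hzc : z.1 = Item.cup) {l : ℕ} (hl : l ∈ z.2)
    (hlp : l ∈ flatPairs ps) :
    ∃ I' σ' k', a.length + (itemsOut I').length = m + 2 * k' ∧
      cupCount I' < cupCount (zs.map Prod.fst) ∧
      Rel a (itemsWord a.length (zs.map Prod.fst) ++ (vw σ ++ capsWord k m))
        (itemsWord a.length I' ++ (vw σ' ++ capsWord k' m)) := by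
  -- the cup becomes the last item
  obtain ⟨zs0, hzs0⟩ : ∃ zs0, zs.Perm (zs0 ++ [z]) := by
    obtain ⟨s, t, rfl⟩ := List.append_of_mem hz
    exact ⟨s ++ t, List.perm_middle.trans (List.perm_append_singleton _ _).symm⟩
  obtain ⟨τ, t1, t2, t3⟩ := exists_rel_items_perm hzs0 hzs
  -- its cap becomes the last one
  obtain ⟨g', ps0, hps⟩ : ∃ g' ps0, CapEquiv ps (ps0 ++ [(g', l)]) := by
    obtain ⟨p, hp, hlq⟩ := List.mem_flatMap.1 hlp
    obtain ⟨s, t, rfl⟩ := List.append_of_mem hp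
    have h1 : CapEquiv (s ++ p :: t) (p :: (s ++ t)) := .of_perm List.perm_middle
    simp at hlq
    rcases hlq with rfl | rfl
    · exact ⟨p.2, s ++ t, h1.trans ((CapEquiv.flip _ _).trans
        (.of_perm (List.perm_append_singleton _ _).symm))⟩
    · exact ⟨p.1, s ++ t, h1.trans (.of_perm (List.perm_append_singleton _ _).symm)⟩
  obtain ⟨s0, τ', s1, s2, s3⟩ := hps
  rw [hk] at s0 s1 s3
  obtain ⟨k', rfl⟩ : ∃ k', k = k' + 1 := ⟨ps0.length, by simpa using s0⟩
  have hps0 : ps0.length = k' := by simpa using s0.symm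
  have hz2 : z.2.length = 2 := by rw [hzs z hz, hzc]; rfl
  obtain ⟨p, q, hpq⟩ := List.length_eq_two.1 hz2
  have hzs' : Labelled (zs0 ++ [z]) := fun z hz => hzs z (hzs0.mem_iff.2 hz)
  have hzs0' : Labelled zs0 := fun z hz => hzs' z (by simp [hz])
  set A := x ++ labels zs0 with hA
  have hAl : A.length = a.length + (itemsOut (zs0.map Prod.fst)).length := by
    rw [hA, List.length_append, hx, hzs0'.length]
  have hperm : (labels zs).Perm (labels (zs0 ++ [z])) := hzs0.flatMap_right _
  have hn' : (A ++ [p, q]).Nodup := by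
    have := (hperm.append_left x).nodup_iff.1 hn
    simpa [hA, hpq] using this
  have hrun := run_itemsWord' a (zs.map Prod.fst)
  have hlen : (a ++ itemsOut (zs.map Prod.fst)).length = A.length + 2 := by
    rw [List.length_append, ← hzs.length, hperm.length_eq, hA]
    simp [hpq, hx, add_assoc]
  have hσ : InRange (A.length + 2) σ := by
    have := ((valid_append _ _ _).1 ((valid_append _ _ _).1 hv).2).1
    rwa [hrun.2, valid_vw, hlen] at this
  have hτ : InRange (A.length + 2) (τ.map (a.length + ·)) := by
    have := t1.shift a.length
    rwa [hzs.length, ← List.length_append, hlen] at this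
  have hN : A.length = m + 2 * k' := by
    have h1 := congrArg List.length hact
    rw [length_act, List.length_append, hperm.length_eq] at h1
    simp [hpq, hk, hm] at h1
    rw [hA, List.length_append]
    omega
  have hτ' : InRange (A.length + 2) (τ'.map (m + ·)) := by
    have := s1.shift m
    convert this using 1
    omega
  set ρ := τ.map (a.length + ·) ++ (σ ++ τ'.map (m + ·)) with hρ
  have hρr : InRange (A.length + 2) ρ := by
    rw [hρ, inRange_append, inRange_append]
    exact ⟨hτ, hσ, hτ'⟩
  have hρact : act ρ (A ++ [p, q]) = (y ++ flatPairs ps0) ++ [g', l] := by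
    rw [hρ, act_append, act_append]
    have e1 : act (τ.map (a.length + ·)) (A ++ [p, q]) = x ++ labels zs := by
      rw [← hx, ← t2, ← act_append_right]
      simp [hA, hpq]
    rw [e1, hact, ← hm, act_append_right, s2]
    simp
  -- the word in terms of `ρ`
  have r1 := (t3 a.length a le_rfl).append_right ((valid_append _ _ _).1 hv).2
  have v1 := r1.valid_iff.1 hv
  have r2 := (s3 m).pre (itemsWord a.length ((zs0 ++ [z]).map Prod.fst) ++
    vw (τ.map (a.length + ·)) ++ vw σ)
  have hI : itemsWord a.length ((zs0 ++ [z]).map Prod.fst) =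
      itemsWord a.length (zs0.map Prod.fst) ++ [⟨A.length, Piece.cup false⟩] := by
    rw [List.map_append, itemsWord_append, hAl]
    simp [itemsWord_cons, hzc, shift, Item.word]
  have r3 := (rule_last_cap k' m).pre (itemsWord a.length (zs0.map Prod.fst) ++
    [⟨A.length, Piece.cup false⟩] ++ vw ρ)
  rw [hI] at r1 r2 v1
  rw [hρ, vw_append, vw_append, ← hN] at r3
  simp only [List.append_assoc] at r1 r2 r3 v1
  have r4 := r1.trans ((r2.trans r3) v1)
  have v4 := r4.valid_iff.1 hv
  have hrun0 := run_itemsWord' a (zs0.map Prod.fst)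
  set c := a ++ itemsOut (zs0.map Prod.fst) with hc
  have hcl : c.length = A.length := by rw [hc, List.length_append, hAl]
  -- the end with label `l` becomes the right end of the cup
  obtain ⟨o, g, ρ', u1, u2, u3, u4⟩ : ∃ o g ρ', InRange (A.length + 2) ρ' ∧
      (A ++ [g, l]).Nodup ∧ act ρ' (A ++ [g, l]) = (y ++ flatPairs ps0) ++ [g', l] ∧
      Rule ([⟨A.length, Piece.cup false⟩] ++ vw ρ) ([⟨A.length, Piece.cup o⟩] ++ vw ρ') := by
    rw [hpq] at hl
    simp at hl
    rcases hl with rfl | rfl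
    · refine ⟨true, q, A.length :: ρ, by simp [hρr], ?_, ?_, ?_⟩
      · exact ((List.Perm.swap _ _ _).append_left A).nodup_iff.1 hn'
      · rw [act_cons, swapAt_length, hρact]
      · simpa [vw_cons] using (rule_oneCup_symm A.length false).post (vw ρ)
    · exact ⟨false, p, ρ, hρr, hn', hρact, .refl _⟩
  have r5 := (u4.ctx (itemsWord a.length (zs0.map Prod.fst))
    (⟨A.length, Piece.cap⟩ :: capsWord k' m))
  rw [hρ, vw_append, vw_append] at r5
  simp only [List.append_assoc, List.cons_append, List.nil_append] at r4 r5 v4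
  have r6 := r4.trans (r5 v4)
  have v6 := r6.valid_iff.1 hv
  have v7 := ((valid_append _ _ _).1 v6).2
  rw [hrun0.2] at v7
  have v8 : Valid c ((⟨A.length, Piece.cup o⟩ :: (vw ρ' ++ [⟨A.length, Piece.cap⟩])) ++
      capsWord k' m) := by simpa using v7
  obtain ⟨σ', hσ'⟩ := exists_rel_cancel hcl u1 u2 u3 ((valid_append _ _ _).1 v8).1
  have hcount : cupCount (zs.map Prod.fst) = cupCount (zs0.map Prod.fst) + 1 := by
    rw [cupCount, (hzs0.map Prod.fst).countP_eq]
    simp [hzc, cupCount]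
  rcases hσ' with h | h
  · refine ⟨zs0.map Prod.fst ++ [Item.loop], σ', k', ?_, ?_, r6.trans ?_⟩
    · simp [Item.out, ← hAl, hN]
    · rw [hcount]
      simp [cupCount]
    · have r7 := (h.append_right (v := capsWord k' m) ((valid_append _ _ _).1 v8).2)
      rw [← hrun0.2] at r7
      have r8 := r7.append_left hrun0.1
      rw [itemsWord_append, ← hAl]
      simpa [itemsWord_cons] using r8
  · refine ⟨zs0.map Prod.fst, σ', k', ?_, ?_, r6.trans ?_⟩
    · simp [← hAl, hN]
    · rw [hcount]
      simp
    · have r7 := (h.append_right (v := capsWord k' m) ((valid_append _ _ _).1 v8).2)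
      rw [← hrun0.2] at r7
      simpa using r7.append_left hrun0.1

/-- In the standard form with items `I` and virtual crossings `σ`, no end of a cup goes to a cap:
the labels of the cups are among the first `m` ones above `σ`. -/
def Reduced (n : ℕ) (I : List Item) (σ : List ℕ) (m : ℕ) : Prop :=
  ∀ (x : List ℕ) (zs : List (Item × List ℕ)), x.length = n → zs.map Prod.fst = I → Labelled zs →
    (x ++ labels zs).Nodup → ∀ z ∈ zs, z.1 = Item.cup → ∀ l ∈ z.2,
      l ∈ (act σ (x ++ labels zs)).take m

theorem exists_flatPairs {α : Type} {k : ℕ} {l : List α} (h : l.length = 2 * k) :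
    ∃ ps, l = flatPairs ps ∧ ps.length = k := by
  induction k generalizing l with
  | zero => exact ⟨[], by simpa using h, rfl⟩
  | succ k ih =>
    match l, h with
    | p :: q :: l, h =>
      obtain ⟨ps, rfl, rfl⟩ := ih (l := l) (by simpa [mul_add] using h)
      exact ⟨(p, q) :: ps, rfl, rfl⟩

theorem exists_reduced_of_form {a : Level} {m : ℕ} (n : ℕ) : ∀ {I : List Item} {σ : List ℕ} {k : ℕ},
    cupCount I ≤ n → a.length + (itemsOut I).length = m + 2 * k →
    Valid a (itemsWord a.length I ++ (vw σ ++ capsWord k m)) →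
    ∃ I' σ' k', a.length + (itemsOut I').length = m + 2 * k' ∧ Reduced a.length I' σ' m ∧
      Rel a (itemsWord a.length I ++ (vw σ ++ capsWord k m))
        (itemsWord a.length I' ++ (vw σ' ++ capsWord k' m)) := by
  induction n with
  | zero =>
    intro I σ k h0 h1 hv
    refine ⟨I, σ, k, h1, ?_, .refl _⟩
    rintro x zs - rfl - - z hz hzc
    have := List.countP_eq_zero.1 (Nat.le_zero.1 h0) z.1 (List.mem_map_of_mem hz)
    simp [hzc] at this
  | succ n ih =>
    intro I σ k h0 h1 hv
    by_cases hR : Reduced a.length I σ m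
    · exact ⟨I, σ, k, h1, hR, .refl _⟩
    · unfold Reduced at hR
      push Not at hR
      obtain ⟨x, zs, hx, rfl, hzs, hn, z, hz, hzc, l, hl, hlt⟩ := hR
      have hlen : (act σ (x ++ labels zs)).length = m + 2 * k := by
        rw [length_act, List.length_append, hx, hzs.length, h1]
      obtain ⟨ps, hps, hpk⟩ := exists_flatPairs (k := k)
        (l := (act σ (x ++ labels zs)).drop m) (by simp [-length_act, hlen])
      obtain ⟨I', σ', k', e1, e2, e3⟩ := exists_rel_fewer_cups (m := m) (k := k) hx hzs hn
        (y := (act σ (x ++ labels zs)).take m) (by simp [-length_act, hlen]) hpk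
        (by rw [← hps, List.take_append_drop]) hv hz hzc hl (by
          rw [← hps]
          have h2 : l ∈ act σ (x ++ labels zs) := by
            rw [(act_perm _ _).mem_iff, List.mem_append]
            exact .inr (List.mem_flatMap.2 ⟨z, hz, hl⟩)
          rw [← List.take_append_drop m (act σ _), List.mem_append] at h2
          exact h2.resolve_left hlt)
      obtain ⟨I'', σ'', k'', f1, f2, f3⟩ := ih (I := I') (by omega) e1 (e3.valid_iff.1 hv)
      exact ⟨I'', σ'', k'', f1, f2, e3.trans f3⟩

/-- Every word has a reduced standard form. -/
theorem exists_reduced {a : Level} {w : List Slab} (hv : Valid a w) :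
    ∃ I σ k, a.length + (itemsOut I).length = (run a w).length + 2 * k ∧
      Reduced a.length I σ (run a w).length ∧
      Rel a w (itemsWord a.length I ++ (vw σ ++ capsWord k (run a w).length)) := by
  obtain ⟨I, σ, k, m, h1, h2⟩ := isForm_of_valid hv
  have hv' := h2.valid_iff.1 hv
  obtain rfl : (run a w).length = m := by rw [h2.run_eq, (length_run_form h1 hv').2.2]
  obtain ⟨I', σ', k', e1, e2, e3⟩ := exists_reduced_of_form _ le_rfl h1 hv'
  exact ⟨I', σ', k', e1, e2, h2.trans e3⟩

/-! ### Travelling along a diagram -/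

theorem Slab.getElem?_apply {i : ℕ} {p : Piece} {a : Level} (h : i + p.bottoms ≤ a.length) (q : ℕ) :
    (Slab.apply ⟨i, p⟩ a)[q]? =
      if q < i then a[q]? else if q < i + p.tops then
        (match p with
          | .cross _ => a[2 * i + 1 - q]?
          | .cup b => some (if q = i then b else !b)
          | .cap => none)
      else a[q - p.tops + p.bottoms]? := by
  obtain ⟨x, u, z, rfl, rfl, hu⟩ : ∃ x u z, a = x ++ (u ++ z) ∧ x.length = i ∧
      u.length = p.bottoms := by
    refine ⟨a.take i, (a.drop i).take p.bottoms, (a.drop i).drop p.bottoms, by simp, ?_, ?_⟩ <;>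
      simp <;> omega
  rw [apply_append rfl hu]
  have ht : (p.topLevel u).length = p.tops := by
    cases p <;> simp [Piece.tops, Piece.bottoms] at *
    exact hu
  rcases lt_or_ge q x.length with h1 | h1
  · simp [h1, List.getElem?_append_left]
  · rw [List.getElem?_append_right h1, if_neg h1.not_gt]
    rcases lt_or_ge q (x.length + p.tops) with h2 | h2
    · rw [if_pos h2, List.getElem?_append_left (by omega)]
      cases p with
      | cross k =>
        obtain ⟨o, o', rfl⟩ := List.length_eq_two.1 hu
        simp only [Piece.tops] at h2
        obtain rfl | rfl : q = x.length ∨ q = x.length + 1 := by omega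
        · simp [two_mul, add_assoc]
        · simp [two_mul]
      | cup b =>
        simp only [Piece.tops] at h2
        obtain rfl | rfl : q = x.length ∨ q = x.length + 1 := by omega
        · simp
        · simp
      | cap => simp
    · rw [if_neg h2.not_gt, List.getElem?_append_right (by omega), ht, ← List.append_assoc,
        List.getElem?_append_right (by simp; omega)]
      congr 1
      simp
      omega

/-- Whether the diagram enters a slab put on the level `a` at a given endpoint of a strand. -/
def Slab.enters (s : Slab) (a : Level) : SlabEnd → Option Bool
  | .bottom p => a[p]?
  | .top p => ((s.apply a)[p]?).map (!·)

theorem Slab.enters_otherEnd {s : Slab} {a : Level} (h : s.Fits a) {e : SlabEnd} {b : Bool}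
    (he : s.enters a e = some b) :
    s.otherEnd (s.otherEnd e) = e ∧ s.enters a (s.otherEnd e) = some (!b) := by
  obtain ⟨i, p⟩ := s
  obtain ⟨h1, h2⟩ := h
  simp only at h1 h2
  replace h2 : p = Piece.cap → ∃ b c, a[i]? = some b ∧ a[i + 1]? = some c ∧ c = !b ∧ b = !c := by
    rintro rfl
    simp only [Piece.bottoms] at h1
    have h2 := h2 rfl
    rw [List.getElem?_eq_getElem (by omega), List.getElem?_eq_getElem (by omega)] at h2 ⊢
    refine ⟨_, _, rfl, rfl, ?_⟩
    revert h2
    cases a[i] <;> cases a[i + 1] <;> simp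
  have key : ∀ q, q < i ∨ q = i ∨ q = i + 1 ∨ ∃ j, q = i + 2 + j := fun q => by
    rcases lt_or_ge q i with h | h
    · exact .inl h
    · rcases Nat.lt_or_ge q (i + 2) with h' | h'
      · omega
      · exact .inr (.inr (.inr ⟨q - (i + 2), by omega⟩))
  have e1 : 2 * i + 1 - i = i + 1 := by omega
  have e2 : 2 * i + 1 - (i + 1) = i := by omega
  rcases e with q | q
  · simp only [enters, Slab.getElem?_apply h1, Slab.otherEnd] at he ⊢
    cases p <;> simp only [Piece.bottoms, Piece.tops] at h1 h2 he ⊢ <;>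
      obtain h | rfl | rfl | ⟨j, rfl⟩ := key q <;> (try simp [e1, e2, -Nat.add_sub_cancel_left] at he ⊢) <;> grind
  · simp only [enters, Slab.getElem?_apply h1, Slab.otherEnd] at he ⊢
    obtain ⟨b, he, rfl⟩ := Option.map_eq_some_iff.1 he
    cases p <;> simp only [Piece.bottoms, Piece.tops] at h1 h2 he ⊢ <;>
      obtain h | rfl | rfl | ⟨j, rfl⟩ := key q <;> simp [e1, e2] at he ⊢ <;> grind

/-- The writhe of a real crossing put on the level `a`. -/
def Slab.writhe (s : Slab) (a : Level) : ℤˣ :=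
  match s.piece with
  | .cross k => k.writheUp * dir (a.getD s.pos true) * dir (a.getD (s.pos + 1) true)
  | _ => 1

/-- The condition `CStep` in terms of the colours `C` of the endpoints of the strands. -/
def Slab.Coloured {K : Type} (P : Palette K) (s : Slab) (a : Level) (C : SlabEnd → K)
    (c : List K) : Prop :=
  (∀ e, s.enters a e = some true → s.overpass e = none → C (s.otherEnd e) = C e) ∧
  (∀ e e', s.enters a e = some true → s.overpass e = some true →
    s.enters a e' = some true → s.overpass e' = some false →
    P.cross (s.writhe a) (C e) (C (s.otherEnd e)) (C e') (C (s.otherEnd e')) ∧ c = [C e]) ∧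
  (s.isReal = false → c = [])

theorem cstep_mapIdx_iff {K : Type} {P : Palette K} {x u z : Level} {p : Piece}
    (hu : u.length = p.bottoms) (hf : Slab.Fits ⟨x.length, p⟩ (x ++ (u ++ z)))
    (C : SlabEnd → K) (c : List K) :
    CStep P ⟨x.length, p⟩ ((x ++ (u ++ z)).mapIdx fun q o => (o, C (.bottom q)))
      ((Slab.apply ⟨x.length, p⟩ (x ++ (u ++ z))).mapIdx fun q o => (o, C (.top q))) c ↔
    (∀ q < x.length, C (.bottom q) = C (.top q)) ∧
    (∀ j < z.length, C (.bottom (x.length + p.bottoms + j)) = C (.top (x.length + p.tops + j))) ∧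
    Colors P p (u.mapIdx fun q o => (o, C (.bottom (q + x.length))))
      ((p.topLevel u).mapIdx fun q o => (o, C (.top (q + x.length)))) c := by
  have ht : (p.topLevel u).length = p.tops := by
    cases p <;> simp [Piece.tops, Piece.bottoms] at *
    exact hu
  rw [apply_append rfl hu, List.mapIdx_append, List.mapIdx_append, List.mapIdx_append,
    List.mapIdx_append]
  have h1 : CStep P ⟨(x.mapIdx fun q o => (o, C (.bottom q))).length, p⟩ = CStep P ⟨x.length, p⟩ := by
    simp
  rw [← h1, cstep_at]
  constructor
  · rintro ⟨u', v, y, e1, e2, e3⟩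
    have hl := e3.length
    obtain ⟨rfl, rfl⟩ := List.append_inj e1 (by simp [hu, hl.1])
    obtain ⟨e4, e5⟩ := List.append_inj e2 (by simp)
    obtain ⟨rfl, e6⟩ := List.append_inj e5 (by simp [-Piece.topLevel, hl.2, ht])
    refine ⟨fun q hq => ?_, fun j hj => ?_, e3⟩
    · have := congrArg (·[q]?) e4
      simpa [hq, eq_comm] using this
    · have := congrArg (·[j]?) e6
      simp [hj, hu, ht, -Piece.topLevel] at this
      rw [show x.length + p.bottoms + j = j + p.bottoms + x.length by omega, ← this]
      congr 2
      omega
  · rintro ⟨e1, e2, e3⟩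
    refine ⟨_, _, _, rfl, ?_, e3⟩
    congr 1
    · refine List.ext_getElem? fun q => ?_
      by_cases hq : q < x.length
      · simp [hq, e1 q hq]
      · simp [hq]
    · congr 1
      refine List.ext_getElem? fun j => ?_
      by_cases hj : j < z.length
      · have := e2 j hj
        simp only [List.getElem?_mapIdx, hj, List.getElem?_eq_getElem, Option.map_some, hu, ht]
        rw [show j + p.bottoms + x.length = x.length + p.bottoms + j by omega, this]
        congr 4
        omega
      · simp [hj]

section
variable {x u z : Level} {p : Piece}

theorem Slab.strand_left (hu : u.length = p.bottoms) {q : ℕ} (hq : q < x.length) :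
    Slab.enters ⟨x.length, p⟩ (x ++ (u ++ z)) (.bottom q) = some x[q] ∧
    Slab.enters ⟨x.length, p⟩ (x ++ (u ++ z)) (.top q) = some (!x[q]) ∧
    Slab.otherEnd ⟨x.length, p⟩ (.bottom q) = .top q ∧
    Slab.otherEnd ⟨x.length, p⟩ (.top q) = .bottom q ∧
    Slab.overpass ⟨x.length, p⟩ (.bottom q) = none ∧
    Slab.overpass ⟨x.length, p⟩ (.top q) = none := by
  refine ⟨by simp [enters, List.getElem?_append_left hq], ?_, by simp [otherEnd, hq], by simp [otherEnd, hq], ?_, ?_⟩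
  · rw [enters, apply_append rfl hu]
    simp [List.getElem?_append_left hq]
  all_goals
    cases p <;> simp [overpass]
    rw [if_neg (by omega), if_neg (by omega)]

theorem Slab.strand_right (hu : u.length = p.bottoms) {j : ℕ} (hj : j < z.length) :
    Slab.enters ⟨x.length, p⟩ (x ++ (u ++ z)) (.bottom (x.length + p.bottoms + j)) = some z[j] ∧
    Slab.enters ⟨x.length, p⟩ (x ++ (u ++ z)) (.top (x.length + p.tops + j)) = some (!z[j]) ∧
    Slab.otherEnd ⟨x.length, p⟩ (.bottom (x.length + p.bottoms + j)) =
      .top (x.length + p.tops + j) ∧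
    Slab.otherEnd ⟨x.length, p⟩ (.top (x.length + p.tops + j)) =
      .bottom (x.length + p.bottoms + j) ∧
    Slab.overpass ⟨x.length, p⟩ (.bottom (x.length + p.bottoms + j)) = none ∧
    Slab.overpass ⟨x.length, p⟩ (.top (x.length + p.tops + j)) = none := by
  have ht : (p.topLevel u).length = p.tops := by
    cases p <;> simp [Piece.tops, Piece.bottoms] at *
    exact hu
  refine ⟨?_, ?_, ?_, ?_, ?_, ?_⟩
  · simp [enters, add_assoc, ← hu, hj]
  · rw [enters, apply_append rfl hu]
    simp [add_assoc, ← ht, hj, -Piece.topLevel]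
  · rw [otherEnd, if_neg (by simp; omega), if_pos (by simp)]
    simp only [SlabEnd.top.injEq]
    omega
  · rw [otherEnd, if_neg (by simp; omega), if_pos (by simp)]
    simp only [SlabEnd.bottom.injEq]
    omega
  all_goals
    cases p <;> simp [overpass, Piece.bottoms, Piece.tops]
    rw [if_neg (by omega), if_neg (by omega)]

theorem Slab.end_cases (hu : u.length = p.bottoms) {e : SlabEnd} {d : Bool}
    (he : Slab.enters ⟨x.length, p⟩ (x ++ (u ++ z)) e = some d) :
    (∃ q < x.length, e = .bottom q ∨ e = .top q) ∨
    (∃ j < z.length, e = .bottom (x.length + p.bottoms + j) ∨ e = .top (x.length + p.tops + j)) ∨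
    (∃ r < p.bottoms, e = .bottom (x.length + r)) ∨ ∃ r < p.tops, e = .top (x.length + r) := by
  have ht : (p.topLevel u).length = p.tops := by
    cases p <;> simp [Piece.tops, Piece.bottoms] at *
    exact hu
  rcases e with q | q
  · have hq : q < x.length + (u.length + z.length) := by
      have := (List.getElem?_eq_some_iff.1 he).1
      simpa using this
    rcases lt_or_ge q x.length with h | h
    · exact .inl ⟨q, h, .inl rfl⟩
    rcases lt_or_ge q (x.length + p.bottoms) with h' | h'
    · exact .inr (.inr (.inl ⟨q - x.length, by omega, by congr; omega⟩))
    · exact .inr (.inl ⟨q - (x.length + p.bottoms), by omega, .inl (by congr; omega)⟩)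
  · have hq : q < x.length + (p.tops + z.length) := by
      rw [enters, apply_append rfl hu] at he
      obtain ⟨b, he, -⟩ := Option.map_eq_some_iff.1 he
      have := (List.getElem?_eq_some_iff.1 he).1
      simpa [-Piece.topLevel, ht] using this
    rcases lt_or_ge q x.length with h | h
    · exact .inl ⟨q, h, .inr rfl⟩
    rcases lt_or_ge q (x.length + p.tops) with h' | h'
    · exact .inr (.inr (.inr ⟨q - x.length, by omega, by congr; omega⟩))
    · exact .inr (.inl ⟨q - (x.length + p.tops), by omega, .inr (by congr; omega)⟩)

/-- Vertical strands impose the evident condition on a colouring; what remains to be compared is the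
piece itself. -/
theorem Slab.coloured_iff_piece {K : Type} {P : Palette K} (hu : u.length = p.bottoms)
    (C : SlabEnd → K) (c : List K) :
    Slab.Coloured P ⟨x.length, p⟩ (x ++ (u ++ z)) C c ↔
    (∀ q < x.length, C (.bottom q) = C (.top q)) ∧
    (∀ j < z.length, C (.bottom (x.length + p.bottoms + j)) = C (.top (x.length + p.tops + j))) ∧
    (∀ e, ((∃ r < p.bottoms, e = .bottom (x.length + r)) ∨ ∃ r < p.tops, e = .top (x.length + r)) →
      Slab.enters ⟨x.length, p⟩ (x ++ (u ++ z)) e = some true →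
      Slab.overpass ⟨x.length, p⟩ e = none → C (Slab.otherEnd ⟨x.length, p⟩ e) = C e) ∧
    (∀ e e', Slab.enters ⟨x.length, p⟩ (x ++ (u ++ z)) e = some true →
      Slab.overpass ⟨x.length, p⟩ e = some true →
      Slab.enters ⟨x.length, p⟩ (x ++ (u ++ z)) e' = some true →
      Slab.overpass ⟨x.length, p⟩ e' = some false →
      P.cross (Slab.writhe ⟨x.length, p⟩ (x ++ (u ++ z))) (C e) (C (Slab.otherEnd ⟨x.length, p⟩ e))
        (C e') (C (Slab.otherEnd ⟨x.length, p⟩ e')) ∧ c = [C e]) ∧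
    (Slab.isReal ⟨x.length, p⟩ = false → c = []) := by
  constructor
  · rintro ⟨h1, h2, h3⟩
    refine ⟨fun q hq => ?_, fun j hj => ?_, fun e _ => h1 e, h2, h3⟩
    · obtain ⟨k1, k2, k3, k4, k5, k6⟩ := Slab.strand_left (z := z) hu hq
      cases hx : x[q] <;> rw [hx] at k1 k2
      · rw [← h1 _ k2 k6, k4]
      · rw [← h1 _ k1 k5, k3]
    · obtain ⟨k1, k2, k3, k4, k5, k6⟩ := Slab.strand_right (x := x) hu hj
      cases hx : z[j] <;> rw [hx] at k1 k2
      · rw [← h1 _ k2 k6, k4]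
      · rw [← h1 _ k1 k5, k3]
  · rintro ⟨h1, h2, h3, h4, h5⟩
    refine ⟨fun e he ho => ?_, h4, h5⟩
    rcases Slab.end_cases hu he with ⟨q, hq, h⟩ | ⟨j, hj, h⟩ | h
    · obtain ⟨k1, k2, k3, k4, k5, k6⟩ := Slab.strand_left (z := z) hu hq
      rcases h with rfl | rfl
      · rw [k3, h1 q hq]
      · rw [k4, h1 q hq]
    · obtain ⟨k1, k2, k3, k4, k5, k6⟩ := Slab.strand_right (x := x) hu hj
      rcases h with rfl | rfl
      · rw [k3, h2 j hj]
      · rw [k4, h2 j hj]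
    · exact h3 e h he ho

end

theorem Slab.coloured_iff {K : Type} {P : Palette K} {s : Slab} {a : Level} (hf : s.Fits a)
    (C : SlabEnd → K) (c : List K) :
    CStep P s (a.mapIdx fun q o => (o, C (.bottom q)))
      ((s.apply a).mapIdx fun q o => (o, C (.top q))) c ↔ s.Coloured P a C c := by
  obtain ⟨i, p⟩ := s
  obtain ⟨x, u, z, rfl, rfl, hu⟩ : ∃ x u z, a = x ++ (u ++ z) ∧ x.length = i ∧
      u.length = p.bottoms := by
    have h := hf.1
    simp only at h
    refine ⟨a.take i, (a.drop i).take p.bottoms, (a.drop i).drop p.bottoms, by simp, ?_, ?_⟩ <;>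
      simp <;> omega
  rw [cstep_mapIdx_iff hu hf, Slab.coloured_iff_piece hu]
  refine and_congr_right' (and_congr_right' ?_)
  rw [fits_append rfl hu] at hf
  have n1 : 2 * x.length + 1 - x.length = x.length + 1 := by omega
  have n2 : 2 * x.length + 1 - (x.length + 1) = x.length := by omega
  have two : ∀ F : ℕ → Prop, (∃ r < 2, F r) ↔ F 0 ∨ F 1 := fun F =>
    ⟨fun ⟨r, hr, h⟩ => by interval_cases r <;> simp [h],
      fun h => h.elim (fun h => ⟨0, by simp, h⟩) fun h => ⟨1, by simp, h⟩⟩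
  cases p with
  | cup b =>
    obtain rfl := List.eq_nil_of_length_eq_zero hu
    have e1 : Slab.enters ⟨x.length, .cup b⟩ (x ++ ([] ++ z)) (.top x.length) = some !b := by
      rw [Slab.enters, apply_append rfl hu]
      simp
    have e2 : Slab.enters ⟨x.length, .cup b⟩ (x ++ ([] ++ z)) (.top (x.length + 1)) = some b := by
      rw [Slab.enters, apply_append rfl hu]
      simp
    have o1 : Slab.otherEnd ⟨x.length, .cup b⟩ (.top x.length) = .top (x.length + 1) := by
      simp [Slab.otherEnd, Piece.tops, n1]
    have o2 : Slab.otherEnd ⟨x.length, .cup b⟩ (.top (x.length + 1)) = .top x.length := by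
      simp [Slab.otherEnd, Piece.tops, n2]
    simp only [Slab.isReal, Slab.overpass, Piece.bottoms, Piece.tops, two, colors_cup, or_imp,
      forall_and, forall_eq, add_zero, not_lt_zero, e1, e2, o1, o2]
    simp [add_comm 1]
    rintro rfl
    cases b <;> simp [eq_comm]
  | cap =>
    obtain ⟨b, rfl⟩ := hf rfl
    have e1 : Slab.enters ⟨x.length, .cap⟩ (x ++ ([b, !b] ++ z)) (.bottom x.length) = some b := by
      simp [Slab.enters]
    have e2 : Slab.enters ⟨x.length, .cap⟩ (x ++ ([b, !b] ++ z)) (.bottom (x.length + 1)) =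
        some !b := by
      simp [Slab.enters]
    have o1 : Slab.otherEnd ⟨x.length, .cap⟩ (.bottom x.length) = .bottom (x.length + 1) := by
      simp [Slab.otherEnd, Piece.bottoms, n1]
    have o2 : Slab.otherEnd ⟨x.length, .cap⟩ (.bottom (x.length + 1)) = .bottom x.length := by
      simp [Slab.otherEnd, Piece.bottoms, n2]
    simp only [Slab.isReal, Slab.overpass, Piece.bottoms, Piece.tops, two, colors_cap, or_imp,
      forall_and, forall_eq, add_zero, not_lt_zero, e1, e2, o1, o2]
    simp [add_comm 1]
    rintro rfl
    cases b <;> simp [eq_comm]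
  | cross k =>
    obtain ⟨o, o', rfl⟩ := List.length_eq_two.1 hu
    have e1 : Slab.enters ⟨x.length, .cross k⟩ (x ++ ([o, o'] ++ z)) (.bottom x.length) = some o := by
      simp [Slab.enters]
    have e2 : Slab.enters ⟨x.length, .cross k⟩ (x ++ ([o, o'] ++ z)) (.bottom (x.length + 1)) =
        some o' := by
      simp [Slab.enters]
    have e3 : Slab.enters ⟨x.length, .cross k⟩ (x ++ ([o, o'] ++ z)) (.top x.length) =
        some !o' := by
      rw [Slab.enters, apply_append rfl hu]
      simp
    have e4 : Slab.enters ⟨x.length, .cross k⟩ (x ++ ([o, o'] ++ z)) (.top (x.length + 1)) =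
        some !o := by
      rw [Slab.enters, apply_append rfl hu]
      simp
    have o1 : Slab.otherEnd ⟨x.length, .cross k⟩ (.bottom x.length) = .top (x.length + 1) := by
      simp [Slab.otherEnd, Piece.bottoms, n1]
    have o2 : Slab.otherEnd ⟨x.length, .cross k⟩ (.bottom (x.length + 1)) = .top x.length := by
      simp [Slab.otherEnd, Piece.bottoms, n2]
    have o3 : Slab.otherEnd ⟨x.length, .cross k⟩ (.top x.length) = .bottom (x.length + 1) := by
      simp [Slab.otherEnd, Piece.tops, n1]
    have o4 : Slab.otherEnd ⟨x.length, .cross k⟩ (.top (x.length + 1)) = .bottom x.length := by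
      simp [Slab.otherEnd, Piece.tops, n2]
    have w1 : Slab.writhe ⟨x.length, .cross k⟩ (x ++ ([o, o'] ++ z)) =
        k.writheUp * dir o * dir o' := by
      simp [Slab.writhe]
    have v1 : ∀ e v, Slab.overpass ⟨x.length, .cross k⟩ e = some v ↔
        (e = .bottom x.length ∨ e = .top (x.length + 1)) ∧ k.overpass true = some v ∨
        (e = .bottom (x.length + 1) ∨ e = .top x.length) ∧ k.overpass false = some v := by
      intro e v
      simp only [Slab.overpass]
      split_ifs with h1 h2
      · rcases h1 with rfl | rfl <;> simp
      · rcases h2 with rfl | rfl <;> simp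
      · simp [h1, h2]
    generalize hen : Slab.enters ⟨x.length, .cross k⟩ (x ++ ([o, o'] ++ z)) = en at *
    generalize hoe : Slab.otherEnd ⟨x.length, .cross k⟩ = oe at *
    rw [w1]
    have q1 : ∀ Q : SlabEnd → SlabEnd → Prop, (∀ e e', en e = some true →
      Slab.overpass ⟨x.length, .cross k⟩ e = some true → en e' = some true →
      Slab.overpass ⟨x.length, .cross k⟩ e' = some false → Q e e') ↔
      (k = .slashOver → Q (cond o (.bottom x.length) (.top (x.length + 1)))
        (cond o' (.bottom (x.length + 1)) (.top x.length))) ∧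
      (k = .backslashOver → Q (cond o' (.bottom (x.length + 1)) (.top x.length))
        (cond o (.bottom x.length) (.top (x.length + 1)))) := by
      intro Q
      simp only [v1]
      clear v1 w1 hu hf two
      cases k <;> simp [CrossingKind.overpass]
      · constructor
        · intro h
          apply h <;> cases o <;> cases o' <;> simp [*]
        · rintro h e e' h1 (rfl | rfl) h2 (rfl | rfl) <;> cases o <;> cases o' <;> simp [*] at * 
          all_goals exact h
      · constructor
        · intro h
          apply h <;> cases o <;> cases o' <;> simp [*]
        · rintro h e e' h1 (rfl | rfl) h2 (rfl | rfl) <;> cases o <;> cases o' <;> simp [*] at * 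
          all_goals exact h
    rw [q1]
    simp only [Piece.bottoms, Piece.tops, two, or_imp,
      forall_and, forall_eq, add_zero, e1, e2, o1, o2, e3, e4, o3, o4]
    clear hu hf two q1 v1 w1
    cases k
    · rw [colors_slash]
      simp [Slab.overpass, Slab.isReal, CrossingKind.overpass, CrossingKind.isReal,
        CrossingKind.writheUp, add_comm 1]
      cases o <;> cases o' <;> simp [o1, o2, o3, o4]
    · rw [colors_backslash]
      simp [Slab.overpass, Slab.isReal, CrossingKind.overpass, CrossingKind.isReal,
        CrossingKind.writheUp, add_comm 1]
      cases o <;> cases o' <;> simp [o1, o2, o3, o4]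
    · rw [colors_virt]
      simp [Slab.overpass, Slab.isReal, CrossingKind.overpass, CrossingKind.isReal, add_comm 1]
      cases o <;> cases o' <;> simp [eq_comm]
      all_goals grind

/-! ### Colourings of closed diagrams -/

namespace Pile

/-- The endpoint `e` of a strand of the slab number `n`, as a point of the diagram. -/
def endPoint (n : ℕ) : SlabEnd → ℕ × ℕ
  | .bottom p => (n, p)
  | .top p => (n + 1, p)

theorem isUp_of_getElem? {T : Pile} {n p : ℕ} {b : Bool} (h : (T.level n)[p]? = some b) :
    T.isUp (n, p) = b := by
  simp [isUp, h]

theorem getElem?_of_isPoint {T : Pile} {n p : ℕ} (h : T.IsPoint (n, p)) :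
    (T.level n)[p]? = some (T.isUp (n, p)) := by
  have h2 := h.2
  simp only at h2
  simp [isUp, h2]

theorem level_zero (T : Pile) : T.level 0 = T.bot := by simp [level]

theorem length_of_getElem? {T : Pile} {n : ℕ} {s : Slab} (h : T.word[n]? = some s) :
    n < T.word.length := (List.getElem?_eq_some_iff.1 h).1

/-- The diagram enters the slab number `n` at the endpoint `e`. -/
def EntersAt (T : Pile) (n : ℕ) (s : Slab) (e : SlabEnd) : Prop :=
  T.word[n]? = some s ∧ s.enters (T.level n) e = some true

theorem enters_iff {T : Pile} {n : ℕ} {s : Slab} (hs : T.word[n]? = some s) {e : SlabEnd} {b : Bool} :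
    s.enters (T.level n) e = some b ↔ T.IsPoint (endPoint n e) ∧
      T.isUp (endPoint n e) = match e with | .bottom _ => b | .top _ => !b := by
  have hn := length_of_getElem? hs
  rcases e with p | p
  · constructor
    · intro h
      exact ⟨⟨hn.le, (List.getElem?_eq_some_iff.1 h).1⟩, isUp_of_getElem? h⟩
    · rintro ⟨h1, h2⟩
      simp only at h2
      exact (getElem?_of_isPoint h1).trans (congrArg some h2)
  · rw [Slab.enters, ← T.level_succ n s hs, Option.map_eq_some_iff]
    constructor
    · rintro ⟨b, h, rfl⟩
      exact ⟨⟨hn, (List.getElem?_eq_some_iff.1 h).1⟩, (isUp_of_getElem? h).trans (by simp)⟩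
    · rintro ⟨h1, h2⟩
      exact ⟨_, getElem?_of_isPoint h1, by simp only [endPoint] at h2; simp [h2]⟩

theorem EntersAt.next {T : Pile} {n : ℕ} {s : Slab} {e : SlabEnd} (h : T.EntersAt n s e) :
    T.next (endPoint n e) = endPoint n (s.otherEnd e) ∧
      T.event (endPoint n e) = T.arrowEnd n e := by
  obtain ⟨hs, he⟩ := h
  have hn := length_of_getElem? hs
  obtain ⟨-, hu⟩ := (enters_iff hs).1 he
  rcases e with p | p <;> simp only [endPoint] at hu ⊢
  · refine ⟨?_, by simp [event, hu, hn.ne]⟩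
    simp only [Pile.next, hu, if_true, hs]
    cases s.otherEnd (.bottom p) <;> rfl
  · refine ⟨?_, by simp [event, hu]⟩
    cases h : s.otherEnd (.top p) <;> simp [Pile.next, hu, hs, h]

/-- What happens to the diagram after a point. -/
theorem IsClosable.point_cases {T : Pile} (hT : T.IsClosable) {x : ℕ × ℕ} (hx : T.IsPoint x) :
    (∃ p, x = (T.word.length, p) ∧ T.bot[p]? = some true ∧ T.next x = (0, p) ∧
      T.event x = some (.marking 1)) ∨
    (∃ p, x = (0, p) ∧ T.bot[p]? = some false ∧ T.next x = (T.word.length, p) ∧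
      T.event x = some (.marking (-1))) ∨
    ∃ n s e, T.EntersAt n s e ∧ x = endPoint n e := by
  obtain ⟨n, p⟩ := x
  have hg := getElem?_of_isPoint hx
  have h1 := hx.1
  simp only at h1
  cases hu : T.isUp (n, p) <;> rw [hu] at hg
  · rcases n with _ | n
    · refine .inr (.inl ⟨p, rfl, by rwa [level_zero] at hg, by simp [Pile.next, hu],
        by simp [event, hu]⟩)
    · obtain ⟨s, hs⟩ : ∃ s, T.word[n]? = some s := ⟨_, List.getElem?_eq_getElem (by omega)⟩
      refine .inr (.inr ⟨n, s, .top p, ⟨hs, ?_⟩, rfl⟩)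
      rw [enters_iff hs]
      exact ⟨hx, hu⟩
  · rcases h1.eq_or_lt with rfl | h1
    · refine .inl ⟨p, rfl, by rwa [hT.2] at hg, by simp [Pile.next, hu], by simp [event, hu]⟩
    · obtain ⟨s, hs⟩ : ∃ s, T.word[n]? = some s := ⟨_, List.getElem?_eq_getElem h1⟩
      refine .inr (.inr ⟨n, s, .bottom p, ⟨hs, ?_⟩, rfl⟩)
      rw [enters_iff hs]
      exact ⟨hx, hu⟩

theorem EntersAt.isPoint {T : Pile} {n : ℕ} {s : Slab} {e : SlabEnd} (h : T.EntersAt n s e) :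
    T.IsPoint (endPoint n e) := ((enters_iff h.1).1 h.2).1

theorem IsClosable.leaves {T : Pile} (hT : T.IsClosable) {n : ℕ} {s : Slab} {e : SlabEnd}
    (h : T.EntersAt n s e) : s.enters (T.level n) (s.otherEnd e) = some false :=
  (Slab.enters_otherEnd (hT.fits h.1) h.2).2

/-- Two different points are not followed by the same point. -/
theorem IsClosable.injOn_next {T : Pile} (hT : T.IsClosable) {x y : ℕ × ℕ} (hx : T.IsPoint x)
    (hy : T.IsPoint y) (h : T.next x = T.next y) : x = y := by
  -- the first point above the section is not the end of a strand oriented upwards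
  have h0 : ∀ {p n s e}, T.bot[p]? = some true → T.EntersAt n s e →
      (0, p) ≠ endPoint n (s.otherEnd e) := by
    intro p n s e hp he h
    have h1 := (enters_iff he.1).1 (hT.leaves he)
    rw [← h] at h1
    have h2 : T.isUp (0, p) = true := isUp_of_getElem? (by rwa [level_zero])
    cases ho : s.otherEnd e <;> rw [ho] at h h1 <;> simp_all [endPoint]
  have hN : ∀ {p n s e}, T.bot[p]? = some false → T.EntersAt n s e →
      (T.word.length, p) ≠ endPoint n (s.otherEnd e) := by
    intro p n s e hp he h
    have h1 := (enters_iff he.1).1 (hT.leaves he)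
    rw [← h] at h1
    have h2 : T.isUp (T.word.length, p) = false := isUp_of_getElem? (by rwa [hT.2])
    have := length_of_getElem? he.1
    cases ho : s.otherEnd e <;> rw [ho] at h h1 <;> simp_all [endPoint]
  rcases hT.point_cases hx with ⟨p, rfl, hp, e1, -⟩ | ⟨p, rfl, hp, e1, -⟩ | ⟨n, s, e, he, rfl⟩ <;>
    rcases hT.point_cases hy with ⟨q, rfl, hq, e2, -⟩ | ⟨q, rfl, hq, e2, -⟩ | ⟨m, t, f, hf, rfl⟩
  · simp [e1, e2] at h
    rw [h]
  · simp only [e1, e2, Prod.mk.injEq] at h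
    obtain ⟨-, rfl⟩ := h
    simp [hp] at hq
  · rw [e1, hf.next.1] at h
    exact absurd h (h0 hp hf)
  · simp only [e1, e2, Prod.mk.injEq] at h
    obtain ⟨-, rfl⟩ := h
    simp [hp] at hq
  · simp [e1, e2] at h
    rw [h]
  · rw [e1, hf.next.1] at h
    exact absurd h (hN hp hf)
  · rw [e2, he.next.1] at h
    exact absurd h.symm (h0 hq he)
  · rw [e2, he.next.1] at h
    exact absurd h.symm (hN hq he)
  · rw [he.next.1, hf.next.1] at h
    have h1 := (enters_iff he.1).1 (hT.leaves he)
    have h2 := (enters_iff hf.1).1 (hT.leaves hf)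
    have h3 := (Slab.enters_otherEnd (hT.fits he.1) he.2).1
    have h4 := (Slab.enters_otherEnd (hT.fits hf.1) hf.2).1
    obtain ⟨rfl, h5⟩ : n = m ∧ s.otherEnd e = t.otherEnd f := by
      rw [h] at h1
      cases ho : s.otherEnd e <;> cases ho' : t.otherEnd f <;> rw [ho, ho'] at h <;>
        rw [ho] at h1 <;> rw [ho'] at h2 h1 <;> simp_all [endPoint]
    obtain rfl : s = t := Option.some_injective _ (he.1.symm.trans hf.1)
    rw [← h3, ← h4, h5]

theorem arrowEnd_cases {T : Pile} {n : ℕ} {s : Slab} (hs : T.word[n]? = some s) (e : SlabEnd) :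
    (T.arrowEnd n e = none ∧ s.overpass e = none) ∨
    (∃ h, T.arrowEnd n e = some (.head ⟨n, h⟩) ∧ s.overpass e = some true) ∨
    ∃ h, T.arrowEnd n e = some (.tail ⟨n, h⟩) ∧ s.overpass e = some false := by
  unfold arrowEnd
  split_ifs with h
  · rw [hs]
    cases ho : s.overpass e with
    | none => simp [ho]
    | some v => cases v <;> simp [h, ho]
  · refine .inl ⟨rfl, ?_⟩
    unfold IsRealCrossing at h
    rw [hs] at h
    obtain ⟨i, p⟩ := s
    cases p with
    | cross k =>
      cases k <;> simp [Slab.isReal, CrossingKind.isReal] at h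
      simp [Slab.overpass, CrossingKind.overpass]
    | cup b => rfl
    | cap => rfl

theorem writhe_eq {T : Pile} {s : Slab} (c : T.RealCrossing) (hs : T.word[c.1]? = some s) :
    T.writhe c = s.writhe (T.level c.1) := by
  obtain ⟨i, p⟩ := s
  unfold writhe
  rw [hs]
  cases p with
  | cross k => simp [Slab.writhe, direction, isUp, dir]
  | cup b => rfl
  | cap => rfl

/-- The point before the overpass of a real crossing. -/
noncomputable def overPoint {T : Pile} (hT : T.IsClosable) (c : T.RealCrossing) : ℕ × ℕ :=
  Classical.choose (hT.existsUnique_event c true)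

/-- The point before the underpass of a real crossing. -/
noncomputable def underPoint {T : Pile} (hT : T.IsClosable) (c : T.RealCrossing) : ℕ × ℕ :=
  Classical.choose (hT.existsUnique_event c false)

section
variable {T : Pile} (hT : T.IsClosable) (c : T.RealCrossing)

theorem isPoint_overPoint : T.IsPoint (overPoint hT c) :=
  (Classical.choose_spec (hT.existsUnique_event c true)).1
theorem isPoint_underPoint : T.IsPoint (underPoint hT c) :=
  (Classical.choose_spec (hT.existsUnique_event c false)).1
theorem event_eq_head {y : ℕ × ℕ} (hy : T.IsPoint y) :
    T.event y = some (.head c) ↔ y = overPoint hT c :=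
  (Classical.choose_spec (hT.existsUnique_event c true)).2 y hy
theorem event_eq_tail {y : ℕ × ℕ} (hy : T.IsPoint y) :
    T.event y = some (.tail c) ↔ y = underPoint hT c :=
  (Classical.choose_spec (hT.existsUnique_event c false)).2 y hy

end

/-- A colouring of the points on the levels of a closed diagram which respects the rules of a
palette. -/
structure Colouring {K : Type} (T : Pile) (P : Palette K) (col : ℕ × ℕ → K) : Prop where
  plain : ∀ x, T.IsPoint x → T.event x = none → col (T.next x) = col x
  mark : ∀ x s, T.IsPoint x → T.event x = some (.marking s) → P.mark s (col x) (col (T.next x))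
  cross : ∀ c x y, T.IsPoint x → T.IsPoint y → T.event x = some (.head c) →
    T.event y = some (.tail c) →
    P.cross (T.writhe c) (col x) (col (T.next x)) (col y) (col (T.next y))

/-- The coloured level number `n`. -/
def coloured {K : Type} (T : Pile) (col : ℕ × ℕ → K) (n : ℕ) : CLevel K :=
  (T.level n).mapIdx fun p o => (o, col (n, p))

open Classical in
/-- The colours arriving on the overpass of the slab number `n`: none or one. -/
noncomputable def overColours {K : Type} {T : Pile} (hT : T.IsClosable) (col : ℕ × ℕ → K)
    (n : ℕ) : List K :=
  if h : T.IsRealCrossing n then [col (overPoint hT ⟨n, h⟩)] else []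

variable {K : Type} {P : Palette K}

theorem cstep_coloured_iff {T : Pile} (hT : T.IsClosable) {n : ℕ} {s : Slab}
    (hs : T.word[n]? = some s) (col : ℕ × ℕ → K) (c : List K) :
    CStep P s (T.coloured col n) (T.coloured col (n + 1)) c ↔
      s.Coloured P (T.level n) (col ∘ endPoint n) c := by
  rw [← Slab.coloured_iff (hT.fits hs), ← T.level_succ n s hs]
  rfl

theorem Colouring.cstep {T : Pile} (hT : T.IsClosable) {col : ℕ × ℕ → K} (h : T.Colouring P col)
    {n : ℕ} {s : Slab} (hs : T.word[n]? = some s) :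
    CStep P s (T.coloured col n) (T.coloured col (n + 1)) (overColours hT col n) := by
  rw [cstep_coloured_iff hT hs]
  refine ⟨fun e he ho => ?_, fun e e' he ho he' ho' => ?_, fun hr => ?_⟩
  · have hE : T.EntersAt n s e := ⟨hs, he⟩
    have := h.plain _ hE.isPoint (by
      rw [hE.next.2]
      rcases arrowEnd_cases hs e with h | ⟨_, h⟩ | ⟨_, h⟩
      · exact h.1
      · simp [ho] at h
      · simp [ho] at h)
    rwa [hE.next.1] at this
  · have hE : T.EntersAt n s e := ⟨hs, he⟩
    have hE' : T.EntersAt n s e' := ⟨hs, he'⟩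
    obtain ⟨hr, h1⟩ : ∃ h, T.arrowEnd n e = some (.head ⟨n, h⟩) := by
      rcases arrowEnd_cases hs e with h | ⟨h', h, -⟩ | ⟨_, h⟩
      · simp [ho] at h
      · exact ⟨h', h⟩
      · simp [ho] at h
    obtain ⟨_, h2⟩ : ∃ h, T.arrowEnd n e' = some (.tail ⟨n, h⟩) := by
      rcases arrowEnd_cases hs e' with h | ⟨_, h⟩ | ⟨h', h, -⟩
      · simp [ho'] at h
      · simp [ho'] at h
      · exact ⟨h', h⟩
    have := h.cross _ _ _ hE.isPoint hE'.isPoint (hE.next.2.trans h1) (hE'.next.2.trans h2)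
    rw [hE.next.1, hE'.next.1, writhe_eq _ hs] at this
    refine ⟨this, ?_⟩
    rw [overColours, dif_pos hr, ← (event_eq_head hT _ hE.isPoint).1 (hE.next.2.trans h1)]
    rfl
  · rw [overColours, dif_neg]
    simp [IsRealCrossing, hs, hr]

/-- The rule of a palette for a point of the section with the colours `α` above and `β` below it. -/
def _root_.VirtualTangle.Palette.Glues (P : Palette K) (α β : Bool × K) : Prop :=
  α.1 = β.1 ∧ if α.1 then P.mark 1 β.2 α.2 else P.mark (-1) α.2 β.2

theorem glues_coloured_iff {T : Pile} (hT : T.IsClosable) (col : ℕ × ℕ → K) :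
    List.Forall₂ P.Glues (T.coloured col 0) (T.coloured col T.word.length) ↔
      ∀ x s, T.IsPoint x → T.event x = some (.marking s) → P.mark s (col x) (col (T.next x)) := by
  simp only [coloured, level_zero, hT.2]
  rw [List.forall₂_iff_get]
  constructor
  · rintro ⟨-, h⟩ x s hx he
    have h' : ∀ p (hp : p < T.bot.length), if T.bot[p] then P.mark 1 (col (T.word.length, p))
        (col (0, p)) else P.mark (-1) (col (0, p)) (col (T.word.length, p)) := by
      intro p hp
      have := (h p (by simpa using hp) (by simpa using hp)).2
      simpa using this
    rcases hT.point_cases hx with ⟨p, rfl, hp, e1, e2⟩ | ⟨p, rfl, hp, e1, e2⟩ | ⟨n, t, e, hE, rfl⟩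
    · obtain ⟨hp, hp'⟩ := List.getElem?_eq_some_iff.1 hp
      have := h' p hp
      rw [hp', if_pos rfl] at this
      obtain rfl : 1 = s := by simpa [e2] using he
      rwa [e1]
    · obtain ⟨hp, hp'⟩ := List.getElem?_eq_some_iff.1 hp
      have := h' p hp
      rw [hp', if_neg (by simp)] at this
      obtain rfl : -1 = s := by simpa [e2] using he
      rwa [e1]
    · rw [hE.next.2] at he
      rcases arrowEnd_cases hE.1 e with h | ⟨_, h, -⟩ | ⟨_, h, -⟩ <;> simp [he] at h
  · intro h
    refine ⟨by simp, fun p hp _ => ?_⟩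
    simp only [List.length_mapIdx] at hp
    have hp0 : T.bot[p]? = some T.bot[p] := by simp [hp]
    simp only [Palette.Glues, List.get_eq_getElem, List.getElem_mapIdx, true_and]
    cases ho : T.bot[p] <;> rw [ho] at hp0
    · have hx : T.IsPoint (0, p) := ⟨Nat.zero_le _, by simpa [level_zero] using hp⟩
      have hu : T.isUp (0, p) = false := isUp_of_getElem? (by rwa [level_zero])
      have := h _ (-1) hx (by simp [event, hu])
      simpa [Pile.next, hu] using this
    · have hx : T.IsPoint (T.word.length, p) := ⟨le_rfl, by simpa [hT.2] using hp⟩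
      have hu : T.isUp (T.word.length, p) = true := isUp_of_getElem? (by rwa [hT.2])
      have := h _ 1 hx (by simp [event, hu])
      simpa [Pile.next, hu] using this

theorem _root_.VirtualTangle.cword_iff_levels {w : List Slab} {a b : CLevel K} {cs : List K}
    {us : Set K} : CWord P w a b cs us ↔ ∃ (lv : ℕ → CLevel K) (c : ℕ → List K),
      lv 0 = a ∧ lv w.length = b ∧
      (∀ n s, w[n]? = some s → CStep P s (lv n) (lv (n + 1)) (c n)) ∧
      cs = (List.range w.length).flatMap c ∧ us = {x | ∃ n ≤ w.length, x ∈ hues (lv n)} := by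
  induction w generalizing a cs us with
  | nil =>
    constructor
    · rintro ⟨rfl, rfl, rfl⟩
      exact ⟨fun _ => a, fun _ => [], rfl, rfl, by simp, by simp, by simp⟩
    · rintro ⟨lv, c, rfl, rfl, -, rfl, rfl⟩
      exact ⟨rfl, by simp, by simp⟩
  | cons s w ih =>
    constructor
    · rintro ⟨m, c, c', us', h1, h2, rfl, rfl⟩
      obtain ⟨lv, d, rfl, rfl, h3, rfl, rfl⟩ := ih.1 h2
      refine ⟨fun n => Nat.casesOn n a lv, fun n => Nat.casesOn n c d, rfl, by simp, ?_, ?_, ?_⟩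
      · rintro (_ | n) t ht
        · obtain rfl : s = t := by simpa using ht
          exact h1
        · exact h3 n t (by simpa using ht)
      · simp [List.range_succ_eq_map, List.flatMap_map]
      · ext x
        simp only [Set.mem_union, Set.mem_ofPred_eq, List.length_cons]
        constructor
        · rintro (h | ⟨n, hn, h⟩)
          · exact ⟨0, Nat.zero_le _, h⟩
          · exact ⟨n + 1, by omega, h⟩
        · rintro ⟨_ | n, hn, h⟩
          · exact .inl h
          · exact .inr ⟨n, by omega, h⟩
    · rintro ⟨lv, c, rfl, rfl, h1, rfl, rfl⟩
      refine ⟨lv 1, c 0, _, _, h1 0 s rfl, ih.2 ⟨fun n => lv (n + 1), fun n => c (n + 1), rfl, by simp,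
        fun n t ht => h1 (n + 1) t (by simpa using ht), rfl, rfl⟩, ?_, ?_⟩
      · simp [List.range_succ_eq_map, List.flatMap_map]
      · ext x
        simp only [Set.mem_union, Set.mem_ofPred_eq, List.length_cons]
        constructor
        · rintro ⟨_ | n, hn, h⟩
          · exact .inl h
          · exact .inr ⟨n, by omega, h⟩
        · rintro (h | ⟨n, hn, h⟩)
          · exact ⟨0, Nat.zero_le _, h⟩
          · exact ⟨n + 1, by omega, h⟩

theorem hues_coloured (T : Pile) (col : ℕ × ℕ → K) :
    {x | ∃ n ≤ T.word.length, x ∈ hues (T.coloured col n)} = col '' {x | T.IsPoint x} := by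
  ext y
  simp only [Set.mem_ofPred_eq, hues, coloured, List.mem_map, List.mem_mapIdx, Set.mem_image]
  constructor
  · rintro ⟨n, hn, _, ⟨p, hp, rfl⟩, rfl⟩
    exact ⟨(n, p), ⟨hn, hp⟩, rfl⟩
  · rintro ⟨⟨n, p⟩, ⟨hn, hp⟩, rfl⟩
    exact ⟨n, hn, _, ⟨p, hp, rfl⟩, rfl⟩

/-- A colouring of a closed diagram is a colouring of the word of the diagram. -/
theorem Colouring.cword {T : Pile} (hT : T.IsClosable) {col : ℕ × ℕ → K} (h : T.Colouring P col) :
    CWord P T.word (T.coloured col 0) (T.coloured col T.word.length)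
      ((List.range T.word.length).flatMap (overColours hT col)) (col '' {x | T.IsPoint x}) ∧
    List.Forall₂ P.Glues (T.coloured col 0) (T.coloured col T.word.length) :=
  ⟨cword_iff_levels.2 ⟨T.coloured col, overColours hT col, rfl, rfl, fun _ _ hs => h.cstep hT hs,
    rfl, (hues_coloured T col).symm⟩, (glues_coloured_iff hT col).2 h.mark⟩

/-- Every colouring of the word of a diagram whose ends fit together is obtained from a colouring of
the points of the closed diagram. -/
theorem IsClosable.exists_colouring [Inhabited K] {T : Pile} (hT : T.IsClosable) {a b : CLevel K}
    {cs : List K} {us : Set K} (h : CWord P T.word a b cs us) (ha : a.map Prod.fst = T.bot)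
    (hab : List.Forall₂ P.Glues a b) :
    ∃ col, T.Colouring P col ∧ a = T.coloured col 0 ∧ b = T.coloured col T.word.length ∧
      cs = (List.range T.word.length).flatMap (overColours hT col) ∧
      us = col '' {x | T.IsPoint x} := by
  obtain ⟨lv, c, h0, hN, hstep, rfl, rfl⟩ := cword_iff_levels.1 h
  have hlv : ∀ n ≤ T.word.length, (lv n).map Prod.fst = T.level n := by
    intro n
    induction n with
    | zero => intro _; rw [h0, ha, level_zero]
    | succ n ih =>
      intro hn
      have hs := List.getElem?_eq_getElem (l := T.word) (i := n) (by omega)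
      rw [T.level_succ n _ hs, ← ih (by omega)]
      exact (hstep n _ hs).fits.2.symm
  set col : ℕ × ℕ → K := fun x => ((lv x.1)[x.2]?.map Prod.snd).getD default with hcol
  have hc : ∀ n ≤ T.word.length, lv n = T.coloured col n := by
    intro n hn
    refine List.ext_getElem? fun p => ?_
    rw [coloured, List.getElem?_mapIdx, ← hlv n hn, List.getElem?_map]
    simp only [hcol]
    cases h : (lv n)[p]? <;> simp
  have hstep' : ∀ n (s : Slab), T.word[n]? = some s → s.Coloured P (T.level n) (col ∘ endPoint n) (c n) := by
    intro n s hs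
    have hn := length_of_getElem? hs
    rw [← cstep_coloured_iff hT hs, ← hc n hn.le, ← hc (n + 1) hn]
    exact hstep n s hs
  rw [← h0, ← hN, hc 0 (Nat.zero_le _), hc _ le_rfl] at hab
  have hC : T.Colouring P col := by
    refine ⟨fun x hx he => ?_, (glues_coloured_iff hT col).1 hab, fun d x y hx hy he he' => ?_⟩
    · rcases hT.point_cases hx with ⟨p, rfl, hp, e1, e2⟩ | ⟨p, rfl, hp, e1, e2⟩ | ⟨n, s, e, hE, rfl⟩
      · simp [e2] at he
      · simp [e2] at he
      · rw [hE.next.1]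
        refine (hstep' n s hE.1).1 e hE.2 ?_
        rcases arrowEnd_cases hE.1 e with h | ⟨_, h, -⟩ | ⟨_, h, -⟩
        · exact h.2
        all_goals simp [← hE.next.2, he] at h
    · rcases hT.point_cases hx with ⟨p, rfl, hp, e1, e2⟩ | ⟨p, rfl, hp, e1, e2⟩ | ⟨n, s, e, hE, rfl⟩
      · simp [e2] at he
      · simp [e2] at he
      rcases hT.point_cases hy with ⟨p, rfl, hp, e1, e2⟩ | ⟨p, rfl, hp, e1, e2⟩ |
        ⟨m, t, f, hF, rfl⟩
      · simp [e2] at he'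
      · simp [e2] at he'
      rw [hE.next.2] at he
      rw [hF.next.2] at he'
      rcases arrowEnd_cases hE.1 e with h | ⟨hr, h, h1⟩ | ⟨_, h, -⟩ <;> simp [he] at h
      rcases arrowEnd_cases hF.1 f with h' | ⟨_, h', -⟩ | ⟨_, h', h2⟩ <;> simp [he'] at h'
      subst h
      obtain rfl : n = m := by simpa using h'
      obtain rfl : s = t := Option.some_injective _ (hE.1.symm.trans hF.1)
      rw [hE.next.1, hF.next.1, writhe_eq _ hE.1]
      exact ((hstep' n s hE.1).2.1 e f hE.2 h1 hF.2 h2).1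
  refine ⟨col, hC, by rw [← h0, hc 0 (Nat.zero_le _)], by rw [← hN, hc _ le_rfl], ?_, ?_⟩
  · refine List.flatMap_congr fun n hn => ?_
    rw [List.mem_range] at hn
    have hs := List.getElem?_eq_getElem hn
    unfold overColours
    split_ifs with hr
    · have hx := isPoint_overPoint hT ⟨n, hr⟩
      have hy := isPoint_underPoint hT ⟨n, hr⟩
      have key : ∀ x v, T.IsPoint x → T.event x = some (if v then .head ⟨n, hr⟩ else .tail ⟨n, hr⟩) →
          ∃ e, x = endPoint n e ∧ T.word[n].enters (T.level n) e = some true ∧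
            T.word[n].overpass e = some v := by
        intro x v hx he
        rcases hT.point_cases hx with ⟨p, rfl, hp, e1, e2⟩ | ⟨p, rfl, hp, e1, e2⟩ |
          ⟨m, s, e, hE, rfl⟩
        · cases v <;> simp [e2] at he
        · cases v <;> simp [e2] at he
        rw [hE.next.2] at he
        have : m = n ∧ s.overpass e = some v := by
          rcases arrowEnd_cases hE.1 e with h | ⟨hr, h, h1⟩ | ⟨_, h, h1⟩ <;> rw [he] at h <;>
            cases v <;> simp at h <;> exact ⟨h.symm, h1⟩
        obtain ⟨rfl, h1⟩ := this
        obtain rfl : T.word[m] = s := Option.some_injective _ (hs.symm.trans hE.1)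
        exact ⟨e, rfl, hE.2, h1⟩
      obtain ⟨e, h1, h2, h3⟩ := key _ true hx ((event_eq_head hT _ hx).2 rfl)
      obtain ⟨f, -, h5, h6⟩ := key _ false hy ((event_eq_tail hT _ hy).2 rfl)
      rw [h1]
      exact ((hstep' n _ hs).2.1 e f h2 h3 h5 h6).2
    · refine (hstep' n _ hs).2.2 ?_
      simpa [IsRealCrossing, hs] using hr
  · rw [← hues_coloured]
    ext x
    simp only [Set.mem_ofPred_eq]
    refine exists_congr fun n => and_congr_right fun hn => ?_
    rw [hc n hn]

end Pile

/-! ### Connectedness, and equivalence of tangles -/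

/-- The closure of the word `w` over the level `a` has exactly one component: every colouring that
is constant on components has exactly one colour. -/
def Conn (a : Level) (w : List Slab) : Prop :=
  ∀ (α : CLevel Bool) (cs : List Bool) (us : Set Bool), α.map Prod.fst = a →
    CWord (componentPalette Bool) w α α cs us → ∃ x, us = {x}

theorem Conn.of_rel {a : Level} {w w' : List Slab} (hc : Conn a w) (h : Rel a w w') :
    Conn a w' := by
  rintro α cs us rfl hw
  obtain ⟨cs', -, h1⟩ := h.symm.cword hw
  exact hc α cs' us rfl h1

theorem valid_iff_fits (a : Level) (w : List Slab) :
    Valid a w ↔ ∀ n (h : n < w.length), (w[n]).Fits (run a (w.take n)) := by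
  induction w generalizing a with
  | nil => simp
  | cons s w ih =>
    rw [valid_cons, ih]
    constructor
    · rintro ⟨h1, h2⟩ (_ | n) h
      · exact h1
      · exact h2 n (by simpa using h)
    · exact fun h => ⟨h 0 (by simp), fun n hn => h (n + 1) (by simpa using hn)⟩

theorem isClosable_iff (a : Level) (w : List Slab) :
    Pile.IsClosable ⟨a, w⟩ ↔ Valid a w ∧ run a w = a := by
  rw [valid_iff_fits]
  unfold Pile.IsClosable Pile.level
  simp only [List.take_length]
  rfl

theorem CWord.hues_subset {K : Type} {P : Palette K} {w : List Slab} {a b : CLevel K} {cs : List K}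
    {us : Set K} (h : CWord P w a b cs us) : hues a ⊆ us := by
  cases w with
  | nil => exact h.2.2.ge
  | cons s w => obtain ⟨_, _, _, _, _, _, _, rfl⟩ := h; simp

theorem map_fst_pair {K : Type} (a : Level) (x : K) : (a.map (·, x)).map Prod.fst = a := by
  rw [List.map_map]
  exact List.map_id a

namespace Pile

theorem map_fst_coloured {K : Type} (T : Pile) (col : ℕ × ℕ → K) (n : ℕ) :
    (T.coloured col n).map Prod.fst = T.level n := by
  refine List.ext_getElem? fun p => ?_
  rw [List.getElem?_map, coloured, List.getElem?_mapIdx, Option.map_map]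
  exact congrFun Option.map_id _

theorem finite_isPoint (T : Pile) : {x | T.IsPoint x}.Finite := by
  refine Set.Finite.subset (Set.Finite.biUnion (Set.finite_Iic T.word.length)
    (fun n _ => (Set.finite_Iio (T.level n).length).image (Prod.mk n))) ?_
  rintro ⟨n, p⟩ ⟨hn, hp⟩
  exact Set.mem_biUnion (x := n) hn ⟨p, hp, rfl⟩

theorem IsClosable.isPoint_iterate {T : Pile} (hT : T.IsClosable) {x : ℕ × ℕ} (hx : T.IsPoint x)
    (k : ℕ) : T.IsPoint (T.next^[k] x) := by
  induction k with
  | zero => exact hx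
  | succ k ih =>
    rw [Function.iterate_succ_apply']
    exact hT.isPoint_next ih

theorem IsClosable.exists_iterate_eq {T : Pile} (hT : T.IsClosable) {x : ℕ × ℕ}
    (hx : T.IsPoint x) : ∃ k, T.next^[k + 1] x = x := by
  have : Finite {x // T.IsPoint x} := T.finite_isPoint
  let f : {x // T.IsPoint x} → {x // T.IsPoint x} := fun x => ⟨T.next x, hT.isPoint_next x.2⟩
  have hf : Function.Injective f := fun x y h =>
    Subtype.ext (hT.injOn_next x.2 y.2 (congrArg Subtype.val h))
  have hfk : ∀ k y, (f^[k] y).1 = T.next^[k] y.1 := fun k => by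
    induction k with
    | zero => exact fun _ => rfl
    | succ k ih => exact fun y => ih (f y)
  obtain ⟨k, hk, h⟩ := hf.mem_periodicPts ⟨x, hx⟩
  refine ⟨k - 1, ?_⟩
  rw [Nat.sub_add_cancel hk, ← hfk k ⟨x, hx⟩, h.eq]

/-- A colouring with the colours of components is constant along the diagram. -/
theorem Colouring.next_eq {K : Type} {T : Pile} (hT : T.IsClosable) {col : ℕ × ℕ → K}
    (h : T.Colouring (componentPalette K) col) {x : ℕ × ℕ} (hx : T.IsPoint x) :
    col (T.next x) = col x := by
  cases he : T.event x with
  | none => exact h.plain x hx he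
  | some e =>
    cases e with
    | head c => exact (h.cross c x _ hx (isPoint_underPoint hT c) he
        ((event_eq_tail hT c (isPoint_underPoint hT c)).2 rfl)).1.symm
    | tail c => exact (h.cross c _ x (isPoint_overPoint hT c) hx
        ((event_eq_head hT c (isPoint_overPoint hT c)).2 rfl) he).2.symm
    | marking s => exact (h.mark x s hx he).symm

theorem forall₂_glues_component {K : Type} (α : CLevel K) :
    List.Forall₂ (componentPalette K).Glues α α := by
  rw [List.forall₂_same]
  intro x _
  simp [Palette.Glues, componentPalette]

theorem eq_of_forall₂_glues {K : Type} {α β : CLevel K}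
    (h : List.Forall₂ (componentPalette K).Glues α β) : α = β := by
  rw [← List.forall₂_eq_eq_eq]
  refine h.imp ?_
  rintro ⟨o, x⟩ ⟨o', y⟩ ⟨rfl : o = o', h⟩
  cases o <;> simp [componentPalette] at h <;> rw [h]

theorem IsClosable.isKnot_iff {T : Pile} (hT : T.IsClosable) : T.IsKnot ↔ Conn T.bot T.word := by
  constructor
  · rintro hK α cs us hα hw
    obtain ⟨x, hx⟩ := hK.1
    obtain ⟨col, hcol, -, -, -, rfl⟩ :=
      hT.exists_colouring hw hα (forall₂_glues_component α)
    refine ⟨col x, Set.eq_singleton_iff_unique_mem.2 ⟨⟨x, hx, rfl⟩, ?_⟩⟩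
    rintro _ ⟨y, hy, rfl⟩
    obtain ⟨k, rfl⟩ := hK.2 x y hx hy
    clear hy
    induction k with
    | zero => rfl
    | succ k ih =>
      rw [Function.iterate_succ_apply', hcol.next_eq hT (hT.isPoint_iterate hx k), ih]
  · intro hC
    constructor
    · obtain ⟨hv, hr⟩ := (isClosable_iff T.bot T.word).1 hT
      obtain ⟨cs, us, -, hw⟩ := exists_cword_const hv true
      rw [hr] at hw
      obtain ⟨col, _, _, _, _, rfl⟩ :=
        hT.exists_colouring hw (map_fst_pair _ _) (forall₂_glues_component _)
      obtain ⟨x, hx⟩ := hC _ _ _ (map_fst_pair _ _) hw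
      have : x ∈ ({x} : Set Bool) := rfl
      rw [← hx] at this
      obtain ⟨y, hy, -⟩ := this
      exact ⟨y, hy⟩
    · intro x y hx hy
      classical
      -- one colour for the component of `x`, another one for the other points
      let col : ℕ × ℕ → Bool := fun y => decide (∃ k : ℕ, T.next^[k] x = y)
      have hnext : ∀ y, T.IsPoint y → col (T.next y) = col y := by
        intro y hy
        simp only [col, decide_eq_decide]
        constructor
        · rintro ⟨k, hk⟩
          obtain ⟨m, hm⟩ := hT.exists_iterate_eq hx
          refine ⟨k + m, hT.injOn_next (hT.isPoint_iterate hx _) hy ?_⟩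
          rw [← Function.iterate_succ_apply' T.next, Nat.succ_eq_add_one, add_assoc,
            Function.iterate_add_apply, hm, hk]
        · rintro ⟨k, hk⟩
          exact ⟨k + 1, by rw [Function.iterate_succ_apply', hk]⟩
      have hcol : T.Colouring (componentPalette Bool) col :=
        ⟨fun z hz _ => hnext z hz, fun z _ hz _ => (hnext z hz).symm,
          fun _ z t hz ht _ _ => ⟨(hnext z hz).symm, (hnext t ht).symm⟩⟩
      obtain ⟨hw, hg⟩ := hcol.cword hT
      rw [← eq_of_forall₂_glues hg] at hw
      obtain ⟨z, hz⟩ := hC _ _ _ ((map_fst_coloured T col 0).trans T.level_zero) hw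
      have h1 : col x ∈ ({z} : Set Bool) := hz ▸ ⟨x, hx, rfl⟩
      have h2 : col y ∈ ({z} : Set Bool) := hz ▸ ⟨y, hy, rfl⟩
      have h3 : col y = col x := h2.trans h1.symm
      have h4 : col x = true := decide_eq_true ⟨0, rfl⟩
      rw [h4] at h3
      exact of_decide_eq_true h3

end Pile

/-- The tangle with a connected closable word. -/
def tangleOf {a : Level} {w : List Slab} (hv : Valid a w) (hr : run a w = a) (hc : Conn a w) :
    Tangle where
  bot := a
  word := w
  isClosable := (isClosable_iff a w).2 ⟨hv, hr⟩
  isKnot := ((isClosable_iff a w).2 ⟨hv, hr⟩).isKnot_iff.2 hc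

theorem Tangle.conn (T : Tangle) : Conn T.bot T.word := T.isClosable.isKnot_iff.1 T.isKnot
theorem Tangle.valid (T : Tangle) : Valid T.bot T.word := ((isClosable_iff _ _).1 T.isClosable).1
theorem Tangle.run_eq (T : Tangle) : run T.bot T.word = T.bot :=
  ((isClosable_iff _ _).1 T.isClosable).2

theorem VirtuallyEquivalent.of_rel {a : Level} {w w' : List Slab} (h : Rel a w w') :
    ∀ T U : Tangle, T.toPile = ⟨a, w⟩ → U.toPile = ⟨a, w'⟩ → VirtuallyEquivalent T U := by
  induction h with
  | rel x y h =>
    intro T U hT hU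
    obtain ⟨u, l, r, v, hm, rfl, rfl, -, -⟩ := h
    exact .rel _ _ (.inside T U u v l r hm (by rw [hT, hU]) (by rw [hT]) (by rw [hU]))
  | refl x =>
    intro T U hT hU
    obtain rfl : T = U := by
      cases T; cases U
      simp only at hT hU
      subst hT; subst hU
      rfl
    exact .refl _
  | symm x y _ ih => exact fun T U hT hU => .symm _ _ (ih U T hU hT)
  | trans x y z h1 h2 ih1 ih2 =>
    intro T U hT hU
    have hv : Valid a x := by
      have := T.valid
      rwa [hT] at this
    have hr : run a x = a := by
      have := T.run_eq
      rwa [hT] at this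
    have hc : Conn a x := by
      have := T.conn
      rwa [hT] at this
    have h1' : Rel a x y := h1
    exact .trans _ (tangleOf (h1'.valid_iff.1 hv) (h1'.run_eq ▸ hr) (hc.of_rel h1')) _
      (ih1 _ _ hT rfl) (ih2 _ _ rfl hU)

/-- A tangle can be conjugated by virtual crossings. -/
theorem Tangle.exists_conjugate {σ : List ℕ} (T : Tangle) (h : InRange T.bot.length σ) :
    ∃ U : Tangle, U.toPile = ⟨act σ T.bot, vw σ.reverse ++ (T.word ++ vw σ)⟩ ∧
      VirtuallyEquivalent T U := by
  induction σ generalizing T with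
  | nil => exact ⟨T, by simp, .refl _⟩
  | cons i σ ih =>
    obtain ⟨hi, h⟩ := (inRange_cons _ _ _).1 h
    have hs : swapAt i (swapAt i T.bot) = T.bot := swapAt_swapAt hi
    have hv : Valid (swapAt i T.bot) (virtualAt i :: T.word ++ [virtualAt i]) := by
      rw [List.cons_append, valid_cons, valid_append, virtualAt_fits, length_swapAt,
        virtualAt_apply, hs, T.run_eq]
      exact ⟨hi, T.valid, (virtualAt_fits i T.bot).2 hi, trivial⟩
    have hr : run (swapAt i T.bot) (virtualAt i :: T.word ++ [virtualAt i]) = swapAt i T.bot := by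
      rw [List.cons_append, run_cons, run_append, virtualAt_apply, hs, T.run_eq, run_cons,
        virtualAt_apply, run_nil]
    have hc : Conn (swapAt i T.bot) (virtualAt i :: T.word ++ [virtualAt i]) := by
      intro α cs us hα hw
      have hl : i + 1 < α.length := by
        have := congrArg List.length hα
        simp at this
        omega
      have e1 : virtualAt i :: T.word ++ [virtualAt i] = vw [i] ++ (T.word ++ vw [i]) := rfl
      rw [e1, cword_append] at hw
      obtain ⟨β, c, _, us1, _, h1, h2, rfl, rfl⟩ := hw
      obtain ⟨γ, c1, c2, us2, us3, h2', h3, rfl, rfl⟩ := cword_append.1 h2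
      obtain ⟨-, rfl, rfl, rfl⟩ := cword_vw.1 h1
      obtain ⟨h4, h5, rfl, rfl⟩ := cword_vw.1 h3
      simp only [act_cons, act_nil, inRange_cons] at h2' h4 h5
      obtain rfl : γ = swapAt i α := by rw [h5, swapAt_swapAt h4.1]
      obtain ⟨x, rfl⟩ := T.conn _ _ _ (by rw [← swapAt_map, hα, hs]) h2'
      have h6 : hues (swapAt i α) = hues α := by
        ext y
        exact ((swapAt_perm i α).map Prod.snd).mem_iff
      have h7 : hues α ⊆ {x} := by
        rw [← h6]
        exact h2'.hues_subset
      exact ⟨x, by rw [h6, Set.union_eq_left.2 h7, Set.union_eq_right.2 h7]⟩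
    obtain ⟨U, hU, h1⟩ := ih (tangleOf hv hr hc) (by simpa [tangleOf] using h)
    refine ⟨U, ?_, .trans _ _ _ (.rel _ _ (.acrossSection T _ i ?_ rfl)) h1⟩
    · rw [hU]
      simp [tangleOf, vw_append, vw_cons]
    · exact hs.symm

/-! ### Colourings by the edges of a T-diagram -/

namespace CirclePoint
variable {A : Type}

/-- Whether a point is the head of an arrow. -/
def isHead : CirclePoint A → Bool
  | head _ => true
  | _ => false

/-- Whether a point is a marking. -/
def isMarking : CirclePoint A → Bool
  | marking _ => true
  | _ => false

end CirclePoint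

namespace TDiagram

/-- The number of the edge that follows the `k`-th point of the circle. The edges are numbered like
the points at their ends. -/
def succ (G : TDiagram) (k : ℕ) : ℕ := (k + 1) % G.points.length

/-- The palette whose colours are the edges of the circle of a T-diagram, each one numbered like the
point of the circle at its end: a strand of a diagram runs along the circle. -/
def palette (G : TDiagram) : Palette ℕ where
  cross s oi oo ui uo := ∃ c, G.points[oi]? = some (.head c) ∧ G.points[ui]? = some (.tail c) ∧
    oo = G.succ oi ∧ uo = G.succ ui ∧ G.sign c = s
  mark s i o := G.points[i]? = some (.marking s) ∧ o = G.succ i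

/-- The positions on the circle of the points with a given property. -/
def positions (G : TDiagram) (p : CirclePoint G.Arrow → Bool) : List ℕ :=
  (List.range G.points.length).filter fun i => G.points[i]?.any p

theorem mem_positions {G : TDiagram} {p : CirclePoint G.Arrow → Bool} {i : ℕ} :
    i ∈ G.positions p ↔ ∃ q, G.points[i]? = some q ∧ p q = true := by
  rw [positions, List.mem_filter, Option.any_eq_true, List.mem_range]
  constructor
  · exact fun h => h.2
  · rintro ⟨q, h, h'⟩
    exact ⟨(List.getElem?_eq_some_iff.1 h).1, q, h, h'⟩

theorem nodup_positions (G : TDiagram) (p : CirclePoint G.Arrow → Bool) : (G.positions p).Nodup :=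
  List.nodup_range.filter _

theorem eq_of_count_eq_one {B : Type} [DecidableEq B] {l : List B} {b : B} (h : l.count b = 1)
    {i j : ℕ} (hi : l[i]? = some b) (hj : l[j]? = some b) : i = j := by
  wlog hij : i ≤ j generalizing i j
  · exact (this hj hi (by omega)).symm
  by_contra hne
  rw [← List.take_append_drop (i + 1) l, List.count_append] at h
  have h1 : 0 < (l.take (i + 1)).count b := List.count_pos_iff.2
    (List.mem_of_getElem? (i := i) (by rw [List.getElem?_take_of_lt (by omega), hi]))
  have h2 : 0 < (l.drop (i + 1)).count b := List.count_pos_iff.2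
    (List.mem_of_getElem? (i := j - (i + 1)) (by
      rw [List.getElem?_drop, ← hj]
      congr 1
      omega))
  omega

theorem head_injective (G : TDiagram) {i j : ℕ} {c : G.Arrow} (hi : G.points[i]? = some (.head c))
    (hj : G.points[j]? = some (.head c)) : i = j :=
  have := G.decEq
  eq_of_count_eq_one (by convert G.head_once c) hi hj

theorem tail_injective (G : TDiagram) {i j : ℕ} {c : G.Arrow} (hi : G.points[i]? = some (.tail c))
    (hj : G.points[j]? = some (.tail c)) : i = j :=
  have := G.decEq
  eq_of_count_eq_one (by convert G.tail_once c) hi hj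

theorem exists_head (G : TDiagram) (c : G.Arrow) : ∃ i : ℕ, G.points[i]? = some (CirclePoint.head c) := by
  let := G.decEq
  rw [← List.mem_iff_getElem?, ← List.count_pos_iff, G.head_once]
  exact one_pos

theorem exists_tail (G : TDiagram) (c : G.Arrow) : ∃ i : ℕ, G.points[i]? = some (CirclePoint.tail c) := by
  let := G.decEq
  rw [← List.mem_iff_getElem?, ← List.count_pos_iff, G.tail_once]
  exact one_pos

end TDiagram

/-- The positions on the circle of the markings that belong to the points of the section, when these
points have the colours `α` above and `β` below the section. -/
def sectionColours (α β : CLevel ℕ) : List ℕ :=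
  List.zipWith (fun x y => if x.1 then y.2 else x.2) α β

/-- The points on the levels of a diagram correspond to the edges of the circle of `G`, and what is
met after them to the points of the circle. -/
structure Pile.Reads (T : Pile) (G : TDiagram) (e : T.RealCrossing ≃ G.Arrow) (col : ℕ × ℕ → ℕ) :
    Prop where
  colouring : T.Colouring G.palette col
  event : ∀ x p, T.IsPoint x → T.event x = some p → G.points[col x]? = some (p.map e)
  inj : ∀ x y, T.IsPoint x → T.IsPoint y → T.event x ≠ none → T.event y ≠ none →
    col x = col y → x = y
  surj : ∀ j < G.points.length, ∃ x, T.IsPoint x ∧ T.event x ≠ none ∧ col x = j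

/-- A word is a picture of the T-diagram `G` if it has a colouring by the edges of the circle which
uses every arrow and every marking once. -/
def Pictures (G : TDiagram) (w : List Slab) (α β : CLevel ℕ) : Prop :=
  List.Forall₂ G.palette.Glues α β ∧
  (sectionColours α β).Perm (G.positions CirclePoint.isMarking) ∧
  ∃ cs us, CWord G.palette w α β cs us ∧ cs.Perm (G.positions CirclePoint.isHead)

namespace Pile
variable {T : Pile} {G : TDiagram}

theorem mem_overColours (hT : T.IsClosable) {col : ℕ × ℕ → ℕ} {i : ℕ} :
    i ∈ (List.range T.word.length).flatMap (overColours hT col) ↔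
      ∃ c, i = col (overPoint hT c) := by
  simp only [List.mem_flatMap, List.mem_range]
  constructor
  · rintro ⟨n, hn, h⟩
    unfold overColours at h
    split_ifs at h with hr
    · exact ⟨⟨n, hr⟩, by simpa using h⟩
    · simp at h
  · rintro ⟨⟨n, hr⟩, rfl⟩
    refine ⟨n, ?_, by simp [overColours, hr]⟩
    by_contra h
    simp [IsRealCrossing, List.getElem?_eq_none (not_lt.1 h)] at hr

theorem nodup_overColours (hT : T.IsClosable) {col : ℕ × ℕ → ℕ} :
    ((List.range T.word.length).flatMap (overColours hT col)).Nodup ↔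
      ∀ c d, col (overPoint hT c) = col (overPoint hT d) → c = d := by
  rw [List.nodup_flatMap]
  constructor
  · rintro ⟨-, h⟩ c d hcd
    by_contra hne
    obtain ⟨n, hn⟩ := c
    obtain ⟨m, hm⟩ := d
    have lt : ∀ {n}, T.IsRealCrossing n → n ∈ List.range T.word.length := by
      intro n hn
      by_contra hl
      rw [List.mem_range, not_lt] at hl
      simp [IsRealCrossing, List.getElem?_eq_none hl] at hn
    have : Std.Symm (Function.onFun List.Disjoint (overColours hT col)) := ⟨fun _ _ h => h.symm⟩
    have h1 := h.forall (lt hn) (lt hm) (fun h => hne (Subtype.ext h))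
    exact h1 (a := col (overPoint hT ⟨n, hn⟩)) (by simp [overColours, hn])
      (by simp [overColours, hm, hcd])
  · intro h
    refine ⟨fun n _ => ?_, ?_⟩
    · unfold overColours
      split_ifs <;> simp
    · refine List.nodup_range.imp fun {n m} hne => ?_
      intro i hi hj
      unfold overColours at hi hj
      split_ifs at hi hj with h1 h2 <;> simp at hi hj
      exact hne (congrArg Subtype.val (h _ _ (hi.symm.trans hj)))

/-- The point before the `p`-th intersection point with the section, where the orientation is `o`. -/
def sectionPoint (T : Pile) (p : ℕ) (o : Bool) : ℕ × ℕ := (if o then T.word.length else 0, p)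

theorem sectionPoint_spec (hT : T.IsClosable) {p : ℕ} {o : Bool} (h : T.bot[p]? = some o) :
    T.IsPoint (T.sectionPoint p o) ∧ ∃ s, T.event (T.sectionPoint p o) = some (.marking s) := by
  have hp := (List.getElem?_eq_some_iff.1 h).1
  cases o
  · have hu : T.isUp (0, p) = false := isUp_of_getElem? (by rwa [level_zero])
    exact ⟨⟨Nat.zero_le _, by simpa [sectionPoint, level_zero] using hp⟩, -1,
      by simp [event, sectionPoint, hu]⟩
  · have hu : T.isUp (T.word.length, p) = true := isUp_of_getElem? (by rwa [hT.2])
    exact ⟨⟨le_rfl, by simpa [sectionPoint, hT.2] using hp⟩, 1, by simp [event, sectionPoint, hu]⟩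

theorem exists_sectionPoint (hT : T.IsClosable) {x : ℕ × ℕ} {s : ℤˣ} (hx : T.IsPoint x)
    (h : T.event x = some (.marking s)) : ∃ p o, T.bot[p]? = some o ∧ x = T.sectionPoint p o := by
  rcases hT.point_cases hx with ⟨p, rfl, hp, e1, e2⟩ | ⟨p, rfl, hp, e1, e2⟩ | ⟨n, t, e, hE, rfl⟩
  · exact ⟨p, true, hp, rfl⟩
  · exact ⟨p, false, hp, rfl⟩
  · rw [hE.next.2] at h
    rcases arrowEnd_cases hE.1 e with h1 | ⟨_, h1, -⟩ | ⟨_, h1, -⟩ <;> simp [h] at h1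

theorem getElem?_sectionColours (hT : T.IsClosable) (col : ℕ × ℕ → ℕ) (p : ℕ) :
    (sectionColours (T.coloured col 0) (T.coloured col T.word.length))[p]? =
      T.bot[p]?.map fun o => col (T.sectionPoint p o) := by
  simp only [sectionColours, List.getElem?_zipWith, coloured, List.getElem?_mapIdx, level_zero, hT.2]
  cases T.bot[p]? with
  | none => rfl
  | some o => cases o <;> rfl

theorem mem_sectionColours (hT : T.IsClosable) {col : ℕ × ℕ → ℕ} {i : ℕ} :
    i ∈ sectionColours (T.coloured col 0) (T.coloured col T.word.length) ↔
      ∃ x s, T.IsPoint x ∧ T.event x = some (.marking s) ∧ i = col x := by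
  simp only [List.mem_iff_getElem?, getElem?_sectionColours hT, Option.map_eq_some_iff]
  constructor
  · rintro ⟨p, o, h, rfl⟩
    obtain ⟨h1, s, h2⟩ := sectionPoint_spec hT h
    exact ⟨_, s, h1, h2, rfl⟩
  · rintro ⟨x, s, h1, h2, rfl⟩
    obtain ⟨p, o, h, rfl⟩ := exists_sectionPoint hT h1 h2
    exact ⟨p, o, h, rfl⟩

theorem nodup_sectionColours (hT : T.IsClosable) {col : ℕ × ℕ → ℕ} :
    (sectionColours (T.coloured col 0) (T.coloured col T.word.length)).Nodup ↔
      ∀ x y s t, T.IsPoint x → T.IsPoint y → T.event x = some (.marking s) →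
        T.event y = some (.marking t) → col x = col y → x = y := by
  rw [List.nodup_iff_getElem?_ne_getElem?]
  simp only [getElem?_sectionColours hT]
  have hl : (sectionColours (T.coloured col 0) (T.coloured col T.word.length)).length =
      T.bot.length := by
    simp [sectionColours, coloured, level_zero, hT.2]
  rw [hl]
  constructor
  · intro h x y s t hx hy hs ht hxy
    obtain ⟨p, o, hp, rfl⟩ := exists_sectionPoint hT hx hs
    obtain ⟨q, o', hq, rfl⟩ := exists_sectionPoint hT hy ht
    obtain rfl : p = q := by
      rcases lt_trichotomy p q with hpq | hpq | hpq
      · exact absurd (by simp [hp, hq, hxy]) (h p q hpq (List.getElem?_eq_some_iff.1 hq).1)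
      · exact hpq
      · exact absurd (by simp [hp, hq, hxy]) (h q p hpq (List.getElem?_eq_some_iff.1 hp).1)
    rw [hp, Option.some_inj] at hq
    rw [hq]
  · intro h p q hpq hq heq
    have hp0 := List.getElem?_eq_getElem (hpq.trans hq)
    have hq0 := List.getElem?_eq_getElem hq
    rw [hp0, hq0] at heq
    obtain ⟨h1, s, h2⟩ := sectionPoint_spec hT hp0
    obtain ⟨h3, t, h4⟩ := sectionPoint_spec hT hq0
    exact hpq.ne (congrArg Prod.snd (h _ _ s t h1 h3 h2 h4 (by simpa using heq)))

theorem Reads.pictures (hT : T.IsClosable) {e : T.RealCrossing ≃ G.Arrow} {col : ℕ × ℕ → ℕ}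
    (h : T.Reads G e col) :
    Pictures G T.word (T.coloured col 0) (T.coloured col T.word.length) := by
  obtain ⟨h1, h2⟩ := h.colouring.cword hT
  have hover := fun c => (event_eq_head hT c (isPoint_overPoint hT c)).2 rfl
  refine ⟨h2, ?_, _, _, h1, ?_⟩
  · refine (List.perm_ext_iff_of_nodup ?_ (G.nodup_positions _)).2 fun i => ?_
    · rw [nodup_sectionColours hT]
      exact fun x y s t hx hy hs ht => h.inj x y hx hy (by simp [hs]) (by simp [ht])
    · rw [mem_sectionColours hT, TDiagram.mem_positions]
      constructor
      · rintro ⟨x, s, hx, hs, rfl⟩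
        exact ⟨_, h.event x _ hx hs, rfl⟩
      · rintro ⟨q, hq, hq'⟩
        obtain ⟨x, hx, he, rfl⟩ := h.surj i (List.getElem?_eq_some_iff.1 hq).1
        obtain ⟨p, hp⟩ := Option.ne_none_iff_exists'.1 he
        have := h.event x p hx hp
        rw [hq, Option.some_inj] at this
        subst this
        cases p with
        | marking s => exact ⟨x, s, hx, hp, rfl⟩
        | head c => simp [CirclePoint.map, CirclePoint.isMarking] at hq'
        | tail c => simp [CirclePoint.map, CirclePoint.isMarking] at hq'
  · refine (List.perm_ext_iff_of_nodup ?_ (G.nodup_positions _)).2 fun i => ?_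
    · rw [nodup_overColours hT]
      intro c d hcd
      have := h.inj _ _ (isPoint_overPoint hT c) (isPoint_overPoint hT d) (by simp [hover])
        (by simp [hover]) hcd
      have h3 := hover c
      rw [this, hover d] at h3
      simpa using h3.symm
    · rw [mem_overColours hT, TDiagram.mem_positions]
      constructor
      · rintro ⟨c, rfl⟩
        exact ⟨_, h.event _ _ (isPoint_overPoint hT c) (hover c), rfl⟩
      · rintro ⟨q, hq, hq'⟩
        obtain ⟨x, hx, he, rfl⟩ := h.surj i (List.getElem?_eq_some_iff.1 hq).1
        obtain ⟨p, hp⟩ := Option.ne_none_iff_exists'.1 he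
        have := h.event x p hx hp
        rw [hq, Option.some_inj] at this
        subst this
        cases p with
        | marking s => simp [CirclePoint.map, CirclePoint.isHead] at hq'
        | head c => exact ⟨c, by rw [(event_eq_head hT c hx).1 hp]⟩
        | tail c => simp [CirclePoint.map, CirclePoint.isHead] at hq'

/-- A picture of a T-diagram determines the correspondence between the points of its closure and the
edges of the circle. -/
theorem exists_reads (hT : T.IsClosable) {α β : CLevel ℕ} (hα : α.map Prod.fst = T.bot)
    (h : Pictures G T.word α β) : ∃ e col, T.Reads G e col := by
  obtain ⟨h1, h2, cs, us, h3, h4⟩ := h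
  obtain ⟨col, hcol, rfl, rfl, rfl, -⟩ := hT.exists_colouring h3 hα h1
  have hover := fun c => (event_eq_head hT c (isPoint_overPoint hT c)).2 rfl
  have hunder := fun c => (event_eq_tail hT c (isPoint_underPoint hT c)).2 rfl
  have hc := fun c => hcol.cross c _ _ (isPoint_overPoint hT c) (isPoint_underPoint hT c) (hover c)
    (hunder c)
  choose f f1 f2 f3 f4 f5 using hc
  have hn1 := (nodup_overColours hT).1 (h4.nodup_iff.2 (G.nodup_positions _))
  have hn2 := (nodup_sectionColours hT).1 (h2.nodup_iff.2 (G.nodup_positions _))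
  have hinj : Function.Injective f := fun c d hcd =>
    hn1 c d (G.head_injective (f1 c) (hcd ▸ f1 d))
  have hsurj : Function.Surjective f := by
    intro c
    obtain ⟨i, hi⟩ := G.exists_head c
    have : i ∈ G.positions CirclePoint.isHead := TDiagram.mem_positions.2 ⟨_, hi, rfl⟩
    rw [← h4.mem_iff, mem_overColours] at this
    obtain ⟨d, rfl⟩ := this
    have := f1 d
    rw [hi] at this
    exact ⟨d, by simpa using this.symm⟩
  have hev : ∀ x p, T.IsPoint x → T.event x = some p → G.points[col x]? = some (p.map f) := by
    intro x p hx hp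
    cases p with
    | marking s => exact (hcol.mark x s hx hp).1
    | head c =>
      obtain rfl := (event_eq_head hT c hx).1 hp
      exact f1 c
    | tail c =>
      obtain rfl := (event_eq_tail hT c hx).1 hp
      exact f2 c
  refine ⟨Equiv.ofBijective f ⟨hinj, hsurj⟩, col, hcol, hev, ?_, ?_⟩
  · intro x y hx hy hx' hy' hxy
    obtain ⟨p, hp⟩ := Option.ne_none_iff_exists'.1 hx'
    obtain ⟨q, hq⟩ := Option.ne_none_iff_exists'.1 hy'
    have h5 := hev x p hx hp
    rw [hxy, hev y q hy hq, Option.some_inj] at h5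
    cases p <;> cases q <;> simp [CirclePoint.map] at h5
    · rw [(event_eq_tail hT _ hx).1 hp, (event_eq_tail hT _ hy).1 hq, hinj h5]
    · rw [(event_eq_head hT _ hx).1 hp, (event_eq_head hT _ hy).1 hq, hinj h5]
    · exact hn2 x y _ _ hx hy hp hq hxy
  · intro j hj
    have h5 := List.getElem?_eq_getElem hj
    cases hp : G.points[j] with
    | marking s =>
      have : j ∈ G.positions CirclePoint.isMarking :=
        TDiagram.mem_positions.2 ⟨_, h5, by rw [hp]; rfl⟩
      rw [← h2.mem_iff, mem_sectionColours hT] at this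
      obtain ⟨x, s, hx, hs, rfl⟩ := this
      exact ⟨x, hx, by simp [hs], rfl⟩
    | head c =>
      have : j ∈ G.positions CirclePoint.isHead :=
        TDiagram.mem_positions.2 ⟨_, h5, by rw [hp]; rfl⟩
      rw [← h4.mem_iff, mem_overColours] at this
      obtain ⟨d, rfl⟩ := this
      exact ⟨_, isPoint_overPoint hT d, by simp [hover], rfl⟩
    | tail c =>
      obtain ⟨d, rfl⟩ := hsurj c
      refine ⟨_, isPoint_underPoint hT d, by simp [hunder], ?_⟩
      exact G.tail_injective (f2 d) (h5.trans (by rw [hp]))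

end Pile

/-! ### The T-diagram of a tangle read off from a colouring -/

section
variable {α β : Type}

theorem filterMap_take_succ (f : α → Option β) {l : List α} {k : ℕ} {x : α} (h : l[k]? = some x) :
    (l.take (k + 1)).filterMap f = (l.take k).filterMap f ++ (f x).toList := by
  rw [List.take_add_one, h, List.filterMap_append]
  cases hx : f x <;> simp [hx]

theorem getElem?_filterMap (f : α → Option β) {l : List α} {k : ℕ} {x : α} {p : β}
    (h : l[k]? = some x) (hp : f x = some p) :
    (l.filterMap f)[((l.take k).filterMap f).length]? = some p := by
  conv_lhs => rw [← List.take_append_drop (k + 1) l, List.filterMap_append,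
    filterMap_take_succ f h, hp]
  simp

theorem exists_take_filterMap (f : α → Option β) {l : List α} {j : ℕ} {p : β}
    (h : (l.filterMap f)[j]? = some p) :
    ∃ (k : ℕ) (x : α), l[k]? = some x ∧ f x = some p ∧ ((l.take k).filterMap f).length = j := by
  induction l generalizing j with
  | nil => simp at h
  | cons y l ih =>
    cases hy : f y with
    | none =>
      rw [List.filterMap_cons_none hy] at h
      obtain ⟨k, x, h1, h2, h3⟩ := ih h
      exact ⟨k + 1, x, h1, h2, by rw [List.take_succ_cons, List.filterMap_cons_none hy, h3]⟩
    | some q =>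
      rw [List.filterMap_cons_some hy] at h
      cases j with
      | zero => exact ⟨0, y, rfl, by rw [hy]; simpa using h, rfl⟩
      | succ j =>
        obtain ⟨k, x, h1, h2, h3⟩ := ih (by simpa using h)
        exact ⟨k + 1, x, h1, h2, by
          rw [List.take_succ_cons, List.filterMap_cons_some hy, List.length_cons, h3]⟩

theorem length_filterMap_take_mono (f : α → Option β) (l : List α) {k m : ℕ} (h : k ≤ m) :
    ((l.take k).filterMap f).length ≤ ((l.take m).filterMap f).length := by
  obtain ⟨d, rfl⟩ := Nat.exists_eq_add_of_le h
  rw [List.take_add, List.filterMap_append, List.length_append]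
  exact Nat.le_add_right _ _

end

namespace Pile

theorem getElem?_travel (T : Pile) (x : ℕ × ℕ) {k : ℕ}
    (hk : k < Function.minimalPeriod T.next x) : (T.travel x)[k]? = some (T.next^[k] x) := by
  simp [travel, hk]

theorem length_travel (T : Pile) (x : ℕ × ℕ) :
    (T.travel x).length = Function.minimalPeriod T.next x := by
  simp [travel]

theorem exists_travel {T : Pile} (hT : T.IsClosable) (hK : T.IsKnot) {x y : ℕ × ℕ}
    (hx : T.IsPoint x) (hy : T.IsPoint y) :
    ∃ k < Function.minimalPeriod T.next x, y = T.next^[k] x := by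
  rw [hK.mem_travel hT hx] at hy
  obtain ⟨k, hk, rfl⟩ := List.mem_map.1 hy
  exact ⟨k, List.mem_range.1 hk, rfl⟩

end Pile

namespace Tangle
variable (T : Tangle)

/-- The number of decorated points met when travelling from the base point to the point `x`. -/
noncomputable def edge (x : ℕ × ℕ) : ℕ :=
  (((T.travel T.base).take ((T.travel T.base).idxOf x)).filterMap T.event).length %
    T.tDiagram.points.length

theorem minimalPeriod_pos : 0 < Function.minimalPeriod T.next T.base := by
  obtain ⟨k, hk, -⟩ := Pile.exists_travel T.isClosable T.isKnot T.isPoint_base T.isPoint_base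
  omega

theorem edge_iterate {k : ℕ} (hk : k ≤ Function.minimalPeriod T.next T.base) :
    T.edge (T.next^[k] T.base) =
      (((T.travel T.base).take k).filterMap T.event).length % T.tDiagram.points.length := by
  have key : ∀ k, k < Function.minimalPeriod T.next T.base →
      (T.travel T.base).idxOf (T.next^[k] T.base) = k := by
    intro k hk
    have h := T.getElem?_travel T.base hk
    obtain ⟨h1, h2⟩ := List.getElem?_eq_some_iff.1 h
    rw [← h2]
    exact (T.nodup_travel T.base).idxOf_getElem k h1
  rcases hk.lt_or_eq with hk | rfl
  · rw [edge, key k hk]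
  · have h0 := key 0 T.minimalPeriod_pos
    rw [Function.iterate_zero_apply] at h0
    rw [Function.iterate_minimalPeriod, edge, h0, ← T.length_travel, List.take_length]
    simp [tDiagram, Pile.circlePoints]

theorem reads_edge : T.Reads T.tDiagram (Equiv.refl _) T.edge := by
  set M := Function.minimalPeriod T.next T.base with hM
  set tr := T.travel T.base with htr
  have hpts : T.tDiagram.points = tr.filterMap T.event := rfl
  set N : ℕ → ℕ := fun k => ((tr.take k).filterMap T.event).length with hN
  have hmap : ∀ p : CirclePoint T.RealCrossing, p.map (Equiv.refl _) = p := by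
    rintro (c | c | s) <;> rfl
  have hget : ∀ k < M, tr[k]? = some (T.next^[k] T.base) := fun k hk => T.getElem?_travel _ hk
  have hev : ∀ k < M, ∀ p, T.event (T.next^[k] T.base) = some p →
      T.tDiagram.points[N k]? = some p ∧ T.edge (T.next^[k] T.base) = N k ∧
        T.edge (T.next (T.next^[k] T.base)) = T.tDiagram.succ (N k) := by
    intro k hk p hp
    have h1 := getElem?_filterMap T.event (hget k hk) hp
    have h2 : T.tDiagram.points[N k]? = some p := h1
    refine ⟨h2, ?_, ?_⟩
    · rw [T.edge_iterate hk.le]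
      exact Nat.mod_eq_of_lt (List.getElem?_eq_some_iff.1 h2).1
    · rw [← Function.iterate_succ_apply' T.next, T.edge_iterate hk, Nat.succ_eq_add_one, ← htr,
        filterMap_take_succ _ (hget k hk), hp]
      simp [TDiagram.succ, hN]
  refine ⟨⟨?_, ?_, ?_⟩, ?_, ?_, ?_⟩
  · intro x hx he
    obtain ⟨k, hk, rfl⟩ := Pile.exists_travel T.isClosable T.isKnot T.isPoint_base hx
    rw [← Function.iterate_succ_apply' T.next, T.edge_iterate hk, T.edge_iterate hk.le,
      Nat.succ_eq_add_one, ← htr, filterMap_take_succ _ (hget k hk), he]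
    simp
  · intro x s hx he
    obtain ⟨k, hk, rfl⟩ := Pile.exists_travel T.isClosable T.isKnot T.isPoint_base hx
    obtain ⟨h1, h2, h3⟩ := hev k hk _ he
    exact ⟨by rw [h2]; exact h1, by rw [h3, h2]⟩
  · intro c x y hx hy he he'
    obtain ⟨k, hk, rfl⟩ := Pile.exists_travel T.isClosable T.isKnot T.isPoint_base hx
    obtain ⟨m, hm, rfl⟩ := Pile.exists_travel T.isClosable T.isKnot T.isPoint_base hy
    obtain ⟨h1, h2, h3⟩ := hev k hk _ he
    obtain ⟨h4, h5, h6⟩ := hev m hm _ he'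
    exact ⟨c, by rw [h2]; exact h1, by rw [h5]; exact h4, by rw [h3, h2], by rw [h6, h5], rfl⟩
  · intro x p hx hp
    obtain ⟨k, hk, rfl⟩ := Pile.exists_travel T.isClosable T.isKnot T.isPoint_base hx
    obtain ⟨h1, h2, h3⟩ := hev k hk _ hp
    rw [h2]
    exact h1.trans (congrArg some (hmap p).symm)
  · intro x y hx hy hx' hy' hxy
    obtain ⟨k, hk, rfl⟩ := Pile.exists_travel T.isClosable T.isKnot T.isPoint_base hx
    obtain ⟨m, hm, rfl⟩ := Pile.exists_travel T.isClosable T.isKnot T.isPoint_base hy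
    wlog hkm : k ≤ m generalizing k m
    · exact (this m hm hy hy' k hk hx hx' hxy.symm (by omega)).symm
    obtain ⟨p, hp⟩ := Option.ne_none_iff_exists'.1 hx'
    obtain ⟨q, hq⟩ := Option.ne_none_iff_exists'.1 hy'
    rw [(hev k hk p hp).2.1, (hev m hm q hq).2.1] at hxy
    rcases hkm.lt_or_eq with hkm | rfl
    · have h1 := length_filterMap_take_mono T.event tr (show k + 1 ≤ m by omega)
      rw [filterMap_take_succ _ (hget k hk), hp] at h1
      simp [hN] at h1 hxy
      omega
    · rfl
  · intro j hj
    obtain ⟨k, x, h1, h2, h3⟩ := exists_take_filterMap T.event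
      (List.getElem?_eq_getElem (l := tr.filterMap T.event) hj)
    have hk : k < M := by
      rw [hM, ← T.length_travel]
      exact (List.getElem?_eq_some_iff.1 h1).1
    rw [hget k hk, Option.some_inj] at h1
    subst h1
    exact ⟨_, T.isClosable.isPoint_iterate T.isPoint_base k, by simp [h2],
      by rw [(hev k hk _ h2).2.1, ← h3]⟩

end Tangle

theorem CirclePoint.map_map {A B C : Type} (f : A → B) (g : B → C) (p : CirclePoint A) :
    (p.map f).map g = p.map (g ∘ f) := by
  cases p <;> rfl

/-- The correspondence with a T-diagram is carried along by a homeomorphism of the circles. -/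
theorem Pile.Reads.of_same {T : Pile} {G H : TDiagram} {e : T.RealCrossing ≃ G.Arrow}
    {col : ℕ × ℕ → ℕ} (h : T.Reads G e col) (hGH : G.Same H) : ∃ e' col', T.Reads H e' col' := by
  obtain ⟨f, hf, hs, -, -⟩ := hGH
  obtain ⟨n, hn⟩ := hf.symm
  have hlen : H.points.length = G.points.length := by
    simpa using congrArg List.length hn
  set L := G.points.length with hL
  have hget : ∀ {k p}, G.points[k]? = some p → H.points[(k + n) % L]? = some (p.map f) := by
    intro k p hp
    have hk := (List.getElem?_eq_some_iff.1 hp).1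
    rw [← hlen, ← List.getElem?_rotate (by omega), hn, List.getElem?_map, hp]
    rfl
  have hsucc : ∀ k, (G.succ k + n) % L = H.succ ((k + n) % L) := by
    intro k
    rw [TDiagram.succ, TDiagram.succ, hlen, ← hL, Nat.mod_add_mod, Nat.mod_add_mod,
      Nat.add_right_comm]
  have hlt : ∀ {x p}, T.IsPoint x → T.event x = some p → col x < L := fun hx hp =>
    (List.getElem?_eq_some_iff.1 (h.event _ _ hx hp)).1
  refine ⟨e.trans f, fun x => (col x + n) % L, ⟨?_, ?_, ?_⟩, ?_, ?_, ?_⟩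
  · intro x hx he
    simp only [h.colouring.plain x hx he]
  · intro x s hx he
    obtain ⟨h1, h2⟩ := h.colouring.mark x s hx he
    exact ⟨hget h1, by rw [h2, hsucc]⟩
  · intro c x y hx hy he he'
    obtain ⟨d, h1, h2, h3, h4, h5⟩ := h.colouring.cross c x y hx hy he he'
    exact ⟨f d, hget h1, hget h2, by rw [h3, hsucc], by rw [h4, hsucc], by rw [hs, h5]⟩
  · intro x p hx hp
    rw [hget (h.event x p hx hp), CirclePoint.map_map]
    rfl
  · intro x y hx hy hx' hy' hxy
    obtain ⟨p, hp⟩ := Option.ne_none_iff_exists'.1 hx'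
    obtain ⟨q, hq⟩ := Option.ne_none_iff_exists'.1 hy'
    refine h.inj x y hx hy hx' hy' ?_
    have h1 : col x ≡ col y [MOD L] := Nat.ModEq.add_right_cancel' n hxy
    rwa [Nat.ModEq, Nat.mod_eq_of_lt (hlt hx hp), Nat.mod_eq_of_lt (hlt hy hq)] at h1
  · intro j hj
    rw [hlen] at hj
    -- the rotation by `n` is inverted by the rotation by `L - n % L`
    have hq : n % L < L := Nat.mod_lt _ (by omega)
    obtain ⟨x, hx, hx', hxj⟩ := h.surj ((j + (L - n % L)) % L) (Nat.mod_lt _ (by omega))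
    refine ⟨x, hx, hx', ?_⟩
    simp only [hxj]
    rw [Nat.mod_add_mod, ← Nat.add_mod_mod, add_assoc, Nat.sub_add_cancel hq.le,
      Nat.add_mod_right, Nat.mod_eq_of_lt hj]

/-! ### Invariance of the valuations -/

section
variable {A B : Type}

theorem CirclePoint.map_injective {f : A → B} (hf : Function.Injective f) :
    Function.Injective (CirclePoint.map f) := by
  intro p q h
  cases p <;> cases q <;> simp_all [CirclePoint.map, hf.eq_iff]

theorem markingSum_map (f : A → B) (l : List (CirclePoint A)) :
    markingSum (l.map (CirclePoint.map f)) = markingSum l := by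
  rw [markingSum, markingSum, List.map_map]
  congr 2
  funext p
  cases p <;> rfl

variable [DecidableEq A] [DecidableEq B]

theorem distinguishedLoop_map {f : A → B} (hf : Function.Injective f) (l : List (CirclePoint A))
    (a : A) : distinguishedLoop (l.map (CirclePoint.map f)) (f a) =
      (distinguishedLoop l a).map (CirclePoint.map f) := by
  have hinj := CirclePoint.map_injective hf
  have h1 : (l.map (CirclePoint.map f)).idxOf (.head (f a)) = l.idxOf (.head a) := by
    rw [List.idxOf, List.idxOf, List.findIdx_map]
    congr 1
    funext p
    exact Bool.eq_iff_iff.2 (by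
      simp only [Function.comp, beq_iff_eq]
      exact hinj.eq_iff (b := .head a))
  rw [distinguishedLoop, distinguishedLoop, h1, ← List.map_rotate, List.takeWhile_map]
  congr 2
  funext p
  exact decide_eq_decide.2 (hinj.ne_iff (x := p) (y := .tail a))

theorem distinguishedLoop_rotate (l : List (CirclePoint A)) (a : A) (h : l.count (.head a) = 1)
    (n : ℕ) : distinguishedLoop (l.rotate n) a = distinguishedLoop l a := by
  have h0 : CirclePoint.head a ∈ l := List.count_pos_iff.1 (by omega)
  have h1 : CirclePoint.head a ∈ l.rotate n := List.mem_rotate.2 h0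
  have hi := List.idxOf_lt_length_of_mem h0
  have hj := List.idxOf_lt_length_of_mem h1
  have e1 : l[l.idxOf (.head a)]? = some (.head a) :=
    (List.getElem?_eq_getElem hi).trans (congrArg some (List.getElem_idxOf hi))
  have e2 : (l.rotate n)[(l.rotate n).idxOf (.head a)]? = some (.head a) :=
    (List.getElem?_eq_getElem hj).trans (congrArg some (List.getElem_idxOf hj))
  rw [List.length_rotate] at hj
  rw [List.getElem?_rotate hj] at e2
  have e3 := TDiagram.eq_of_count_eq_one h e1 e2
  rw [distinguishedLoop, distinguishedLoop, List.rotate_rotate, e3, List.rotate_mod, add_comm n]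

end

theorem Tangle.same_of_reads (T : Tangle) {G : TDiagram} {e : T.RealCrossing ≃ G.Arrow}
    {col : ℕ × ℕ → ℕ} (h : T.Reads G e col) : T.tDiagram.Same G := by
  set M := Function.minimalPeriod T.next T.base with hM
  set tr := T.travel T.base with htr
  set L := G.points.length with hL
  set N : ℕ → ℕ := fun k => ((tr.take k).filterMap T.event).length with hN
  have hget : ∀ k < M, tr[k]? = some (T.next^[k] T.base) := fun k hk => T.getElem?_travel _ hk
  have hpt : ∀ k, T.IsPoint (T.next^[k] T.base) := T.isClosable.isPoint_iterate T.isPoint_base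
  have hsucc : ∀ x p, T.IsPoint x → T.event x = some p → col (T.next x) = G.succ (col x) := by
    intro x p hx hp
    cases p with
    | marking s => exact (h.colouring.mark x s hx hp).2
    | head c =>
      obtain ⟨d, -, -, h3, -⟩ := h.colouring.cross c x _ hx
        (Pile.isPoint_underPoint T.isClosable c) hp
        ((Pile.event_eq_tail T.isClosable c (Pile.isPoint_underPoint T.isClosable c)).2 rfl)
      exact h3
    | tail c =>
      obtain ⟨d, -, -, -, h3, -⟩ := h.colouring.cross c _ x
        (Pile.isPoint_overPoint T.isClosable c) hx
        ((Pile.event_eq_head T.isClosable c (Pile.isPoint_overPoint T.isClosable c)).2 rfl) hp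
      exact h3
  have hcol : ∀ k ≤ M, col (T.next^[k] T.base) ≡ col T.base + N k [MOD L] ∧
      ((tr.take k).filterMap T.event).map (fun p => some (p.map e)) =
        (List.range (N k)).map fun j => G.points[(col T.base + j) % L]? := by
    intro k
    induction k with
    | zero => intro _; simp [hN, Nat.ModEq]
    | succ k ih =>
      intro hk
      obtain ⟨ih1, ih2⟩ := ih (by omega)
      have hN' : N (k + 1) = N k + (T.event (T.next^[k] T.base)).toList.length := by
        simp only [hN, filterMap_take_succ _ (hget k (by omega)), List.length_append]
      rw [Function.iterate_succ_apply', hN', filterMap_take_succ _ (hget k (by omega)),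
        List.map_append, ih2]
      cases hp : T.event (T.next^[k] T.base) with
      | none =>
        rw [h.colouring.plain _ (hpt k) hp]
        simpa using ih1
      | some p =>
        have h1 := h.event _ p (hpt k) hp
        have h2 : col (T.next^[k] T.base) < L := (List.getElem?_eq_some_iff.1 h1).1
        have h3 : (col T.base + N k) % L = col (T.next^[k] T.base) := by
          rw [← Nat.mod_eq_of_lt h2]
          exact ih1.symm
        constructor
        · rw [hsucc _ p (hpt k) hp, TDiagram.succ, ← hL]
          exact (Nat.mod_modEq _ _).trans (ih1.add_right 1)
        · simp [List.range_succ, h1, h3]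
  -- the points of the circle are met once each
  have hNM : N M = L := by
    have h1 : N M = (tr.filter fun x => (T.event x).isSome).length := by
      rw [← List.countP_eq_length_filter, ← List.length_filterMap_eq_countP]
      simp [hN, hM, ← T.length_travel, htr]
    have h2 : ((tr.filter fun x => (T.event x).isSome).map col).Perm (List.range L) := by
      have mem : ∀ {x}, x ∈ tr.filter (fun x => (T.event x).isSome) ↔
          T.IsPoint x ∧ T.event x ≠ none := by
        intro x
        rw [List.mem_filter, ← T.isKnot.mem_travel T.isClosable T.isPoint_base,
          Option.isSome_iff_ne_none]
      refine (List.perm_ext_iff_of_nodup ?_ List.nodup_range).2 fun j => ?_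
      · refine List.Nodup.map_on ?_ ((T.nodup_travel T.base).filter _)
        intro x hx y hy hxy
        rw [mem] at hx hy
        exact h.inj x y hx.1 hy.1 hx.2 hy.2 hxy
      · simp only [List.mem_map, mem, List.mem_range]
        constructor
        · rintro ⟨x, ⟨hx, he⟩, rfl⟩
          obtain ⟨p, hp⟩ := Option.ne_none_iff_exists'.1 he
          exact (List.getElem?_eq_some_iff.1 (h.event x p hx hp)).1
        · intro hj
          obtain ⟨x, hx, he, rfl⟩ := h.surj j hj
          exact ⟨x, ⟨hx, he⟩, rfl⟩
    rw [h1]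
    simpa using h2.length_eq
  have hrot : (T.circlePoints T.base).map (CirclePoint.map e) = G.points.rotate (col T.base) := by
    have h1 := (hcol M le_rfl).2
    have h2 : tr.take M = tr := by rw [hM, ← T.length_travel, List.take_length]
    rw [h2, hNM] at h1
    refine List.map_injective_iff.2 (Option.some_injective _) ?_
    rw [List.map_map]
    refine Eq.trans h1 ?_
    refine List.ext_getElem? fun j => ?_
    by_cases hj : j < L
    · rw [List.getElem?_map, List.getElem?_map, List.getElem?_rotate hj, add_comm j, ← hL]
      have : (col T.base + j) % L < L := Nat.mod_lt _ (by omega)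
      simp only [List.getElem?_eq_getElem this]
      simp [hj, List.getElem?_eq_getElem this]
    · rw [List.getElem?_eq_none (by simpa using hj),
        List.getElem?_eq_none (by simpa using hj)]
  refine ⟨e, List.IsRotated.symm ⟨_, hrot.symm⟩, fun c => ?_, fun c => ?_, ?_⟩
  · have hx := Pile.isPoint_overPoint T.isClosable c
    have he := (Pile.event_eq_head T.isClosable c hx).2 rfl
    obtain ⟨d, h1, -, -, -, h2⟩ := h.colouring.cross c _ _ hx
      (Pile.isPoint_underPoint T.isClosable c) he
      ((Pile.event_eq_tail T.isClosable c (Pile.isPoint_underPoint T.isClosable c)).2 rfl)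
    have h3 := h.event _ _ hx he
    rw [h1] at h3
    obtain rfl : d = e c := by simpa [CirclePoint.map] using h3
    exact h2
  · have h1 := @distinguishedLoop_rotate _ G.decEq G.points (e c) (G.head_once _) (col T.base)
    rw [← hrot] at h1
    have h2 := @distinguishedLoop_map _ _ _ G.decEq e e.injective (T.circlePoints T.base) c
    refine (G.val_eq _).trans ((congrArg markingSum (h1.symm.trans h2)).trans ?_)
    exact markingSum_map _ _
  · refine G.circleVal_eq.trans (Eq.trans ?_ (markingSum_map e (T.circlePoints T.base)))
    rw [hrot]
    exact (((List.rotate_perm _ _).map CirclePoint.weight).sum_eq).symm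

/-! ### Colourings of words in standard form -/

section
variable {K : Type} {P : Palette K}

/-- The colourings of the endpoints of an item. -/
def ItemColours (P : Palette K) : Item → CLevel K → Prop
  | .loop, l => l = []
  | .block b, l => ∃ x x' y y', l = [(false, x), (false, y), (true, x'), (true, y')] ∧
      if b then P.cross 1 y y' x x' else P.cross (-1) x x' y y'
  | .cup, l => ∃ x, l = [(false, x), (true, x)]

/-- The colour that arrives on the overpass of an item. -/
def Item.over : Item → CLevel K → List K
  | .block b, x :: y :: _ => [if b then y.2 else x.2]
  | _, _ => []

theorem ItemColours.length {t : Item} {l : CLevel K} (h : ItemColours P t l) :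
    l.length = t.out.length := by
  cases t with
  | loop =>
    obtain rfl : l = [] := h
    rfl
  | block b =>
    obtain ⟨x, x', y, y', rfl, -⟩ := h
    rfl
  | cup =>
    obtain ⟨x, rfl⟩ := h
    rfl

theorem cstep_end {p : Piece} {x b : CLevel K} {cs : List K} {i : ℕ} (hi : x.length = i)
    {t : CLevel K} (ht : t.length = p.bottoms) :
    CStep P ⟨i, p⟩ (x ++ t) b cs ↔ ∃ v, b = x ++ v ∧ Colors P p t v cs := by
  subst hi
  rw [cstep_at]
  constructor
  · rintro ⟨u, v, y, rfl, rfl, h⟩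
    have hl := h.length.1
    obtain rfl : y = [] := by
      rw [List.length_append] at ht
      exact List.eq_nil_of_length_eq_zero (by omega)
    exact ⟨v, by simp, by simpa using h⟩
  · rintro ⟨v, rfl, h⟩
    exact ⟨t, v, [], by simp, by simp, h⟩

theorem cword_block {a b : CLevel K} {cs : List K} {us : Set K} {s : Bool} :
    CWord P (shift a.length (Item.block s).word) a b cs us ↔
      ∃ l, ItemColours P (.block s) l ∧ b = a ++ l ∧ cs = (Item.block s).over l ∧ us = hues b := by
  have e1 : ∀ b cs, CStep P ⟨a.length, Piece.cup false⟩ a b cs ↔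
      ∃ x, b = a ++ [(false, x), (true, x)] ∧ cs = [] := by
    intro b cs
    have := cstep_end (P := P) (p := Piece.cup false) (x := a) (b := b) (cs := cs) rfl (t := []) rfl
    rw [List.append_nil] at this
    rw [this]
    simp only [colors_cup, true_and]
    constructor
    · rintro ⟨v, rfl, x, rfl, rfl⟩; exact ⟨x, rfl, rfl⟩
    · rintro ⟨x, rfl, rfl⟩; exact ⟨_, rfl, x, rfl, rfl⟩
  have e2 : ∀ x b cs, CStep P ⟨a.length + 1, Piece.cup false⟩ (a ++ [(false, x), (true, x)]) b cs ↔
      ∃ y, b = a ++ [(false, x), (false, y), (true, y), (true, x)] ∧ cs = [] := by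
    intro x b cs
    rw [cstep_at_succ]
    simp only [colors_cup]
    constructor
    · rintro ⟨α, u, v, z, h, rfl, y, rfl, rfl, rfl⟩
      simp only [List.nil_append, List.cons.injEq] at h
      obtain ⟨rfl, rfl⟩ := h
      exact ⟨y, rfl, rfl⟩
    · rintro ⟨y, rfl, rfl⟩
      exact ⟨_, [], _, _, rfl, rfl, y, rfl, rfl, rfl⟩
  have e3 : ∀ x y b cs, CStep P ⟨a.length + 2, Piece.cross (realKind s)⟩
      (a ++ [(false, x), (false, y), (true, y), (true, x)]) b cs ↔
      ∃ l, ItemColours P (.block s) l ∧ (∃ x' y', l = [(false, x), (false, y), (true, x'), (true, y')]) ∧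
        b = a ++ l ∧ cs = (Item.block s).over l := by
    intro x y b cs
    have := cstep_end (P := P) (p := Piece.cross (realKind s)) (x := a ++ [(false, x), (false, y)])
      (b := b) (cs := cs) (i := a.length + 2) (by simp) (t := [(true, y), (true, x)]) rfl
    rw [List.append_assoc] at this
    refine this.trans ?_
    cases s
    · simp only [realKind, cond_false, colors_backslash]
      constructor
      · rintro ⟨v, rfl, o, p, z, z', w, w', h, h1, rfl, rfl⟩
        simp at h1
        obtain ⟨⟨rfl, rfl⟩, rfl, rfl⟩ := h1
        exact ⟨_, ⟨_, _, _, _, rfl, by simpa using h⟩, ⟨_, _, rfl⟩, by simp, rfl⟩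
      · rintro ⟨l, ⟨_, _, _, _, h, h1⟩, ⟨x', y', rfl⟩, rfl, rfl⟩
        simp at h
        obtain ⟨rfl, rfl, rfl, rfl⟩ := h
        exact ⟨[(true, x'), (true, y')], by simp, true, true, y, y', x, x', by simpa using h1, rfl, rfl, rfl⟩
    · simp only [realKind, cond_true, colors_slash]
      constructor
      · rintro ⟨v, rfl, o, p, z, z', w, w', h, h1, rfl, rfl⟩
        simp at h1
        obtain ⟨⟨rfl, rfl⟩, rfl, rfl⟩ := h1
        exact ⟨_, ⟨_, _, _, _, rfl, by simpa using h⟩, ⟨_, _, rfl⟩, by simp, rfl⟩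
      · rintro ⟨l, ⟨_, _, _, _, h, h1⟩, ⟨x', y', rfl⟩, rfl, rfl⟩
        simp at h
        obtain ⟨rfl, rfl, rfl, rfl⟩ := h
        exact ⟨[(true, x'), (true, y')], by simp, true, true, y, y', x, x', by simpa using h1, rfl, rfl, rfl⟩
  constructor
  · rintro ⟨_, _, _, _, h1, ⟨_, _, _, _, h2, ⟨_, _, _, _, h3, ⟨rfl, rfl, rfl⟩, rfl, rfl⟩, rfl, rfl⟩,
      rfl, rfl⟩
    obtain ⟨x, rfl, rfl⟩ := (e1 _ _).1 h1
    obtain ⟨y, rfl, rfl⟩ := (e2 _ _ _).1 h2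
    obtain ⟨l, h4, ⟨x', y', rfl⟩, rfl, rfl⟩ := (e3 _ _ _ _).1 h3
    refine ⟨_, h4, rfl, by simp, ?_⟩
    ext z
    simp
  · rintro ⟨l, h, rfl, rfl, rfl⟩
    obtain ⟨x, x', y, y', rfl, h'⟩ := id h
    refine ⟨_, _, _, _, (e1 _ _).2 ⟨x, rfl, rfl⟩, ⟨_, _, _, _, (e2 _ _ _).2 ⟨y, rfl, rfl⟩,
      ⟨_, _, _, _, (e3 _ _ _ _).2 ⟨_, h, ⟨_, _, rfl⟩, rfl, rfl⟩, ⟨rfl, rfl, rfl⟩, rfl, rfl⟩, rfl,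
      rfl⟩, by simp, ?_⟩
    ext z
    simp

theorem cword_cup_item {a b : CLevel K} {cs : List K} {us : Set K} :
    CWord P (shift a.length Item.cup.word) a b cs us ↔
      ∃ l, ItemColours P .cup l ∧ b = a ++ l ∧ cs = [] ∧ us = hues b := by
  have := fun b cs => cstep_end (P := P) (p := Piece.cup false) (x := a) (b := b) (cs := cs) rfl
    (t := []) rfl
  simp only [List.append_nil, colors_cup, true_and] at this
  constructor
  · rintro ⟨_, _, _, _, h, ⟨rfl, rfl, rfl⟩, rfl, rfl⟩
    obtain ⟨v, rfl, x, rfl, rfl⟩ := (this _ _).1 h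
    exact ⟨_, ⟨x, rfl⟩, rfl, rfl, by simp⟩
  · rintro ⟨l, ⟨x, rfl⟩, rfl, rfl, rfl⟩
    exact ⟨_, [], [], _, (this _ _).2 ⟨_, rfl, x, rfl, rfl⟩, ⟨rfl, rfl, rfl⟩, rfl, by simp⟩

theorem cword_loop {a b : CLevel K} {cs : List K} {us : Set K} :
    CWord P (shift a.length Item.loop.word) a b cs us ↔
      b = a ∧ cs = [] ∧ ∃ x, us = hues b ∪ {x} := by
  have h1 := fun b cs => cstep_end (P := P) (p := Piece.cup true) (x := a) (b := b) (cs := cs) rfl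
    (t := []) rfl
  simp only [List.append_nil, colors_cup, true_and] at h1
  have h2 := fun x b cs => cstep_end (P := P) (p := Piece.cap) (x := a) (b := b) (cs := cs) rfl
    (t := [(true, x), (false, x)]) rfl
  simp only [colors_cap] at h2
  constructor
  · rintro ⟨_, _, _, _, h, ⟨_, _, _, _, h', ⟨rfl, rfl, rfl⟩, rfl, rfl⟩, rfl, rfl⟩
    obtain ⟨v, rfl, x, rfl, rfl⟩ := (h1 _ _).1 h
    obtain ⟨v, rfl, o, y, -, rfl, rfl⟩ := (h2 _ _ _).1 h'
    refine ⟨by simp, rfl, x, ?_⟩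
    ext z
    simp
    tauto
  · rintro ⟨rfl, rfl, x, rfl⟩
    refine ⟨_, [], [], _, (h1 _ _).2 ⟨_, rfl, x, rfl, rfl⟩,
      ⟨_, [], [], _, (h2 _ _ _).2 ⟨[], rfl, true, x, rfl, rfl, rfl⟩, ⟨by simp, rfl, rfl⟩, rfl, rfl⟩, rfl, ?_⟩
    ext z
    simp
    tauto

/-- The colours that arrive on the overpasses of a list of items. -/
def overs (zs : List (Item × CLevel K)) : List K := zs.flatMap fun z => z.1.over z.2

theorem CWord.exists_labels {I : List Item} {a b : CLevel K} {cs : List K} {us : Set K}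
    (h : CWord P (itemsWord a.length I) a b cs us) :
    ∃ zs : List (Item × CLevel K), zs.map Prod.fst = I ∧ (∀ z ∈ zs, ItemColours P z.1 z.2) ∧
      b = a ++ labels zs ∧ cs = overs zs ∧ (Item.loop ∉ I → us = hues b) := by
  induction I generalizing a cs us with
  | nil =>
    obtain ⟨rfl, rfl, rfl⟩ := h
    exact ⟨[], rfl, by simp, by simp, rfl, fun _ => rfl⟩
  | cons t I ih =>
    rw [itemsWord_cons, cword_append] at h
    obtain ⟨m, c, c', us1, us2, h1, h2, rfl, rfl⟩ := h
    obtain ⟨l, hl, rfl, rfl, hu⟩ : ∃ l, ItemColours P t l ∧ m = a ++ l ∧ c = t.over l ∧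
        (t ≠ .loop → us1 = hues m) := by
      cases t with
      | loop =>
        obtain ⟨rfl, rfl, -⟩ := cword_loop.1 h1
        exact ⟨[], rfl, by simp, rfl, fun h => absurd rfl h⟩
      | block s =>
        obtain ⟨l, hl, rfl, rfl, rfl⟩ := cword_block.1 h1
        exact ⟨l, hl, rfl, rfl, fun _ => rfl⟩
      | cup =>
        obtain ⟨l, hl, rfl, rfl, rfl⟩ := cword_cup_item.1 h1
        exact ⟨l, hl, rfl, rfl, fun _ => rfl⟩
    rw [← hl.length, ← List.length_append] at h2
    obtain ⟨zs, rfl, h3, rfl, rfl, h4⟩ := ih h2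
    refine ⟨(t, l) :: zs, rfl, ?_, by simp, rfl, fun hn => ?_⟩
    · rintro z (_ | ⟨_, hz⟩)
      · exact hl
      · exact h3 z hz
    · simp only [List.mem_cons, not_or] at hn
      rw [hu (Ne.symm hn.1), h4 hn.2]
      ext z
      simp
      tauto

open Classical in
theorem cword_itemsWord {zs : List (Item × CLevel K)} (hz : ∀ z ∈ zs, ItemColours P z.1 z.2)
    (a : CLevel K) (x : K) : CWord P (itemsWord a.length (zs.map Prod.fst)) a (a ++ labels zs)
      (overs zs) (hues (a ++ labels zs) ∪ if Item.loop ∈ zs.map Prod.fst then {x} else ∅) := by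
  induction zs generalizing a with
  | nil => exact ⟨by simp, rfl, by simp⟩
  | cons z zs ih =>
    obtain ⟨t, l⟩ := z
    have hl : ItemColours P t l := hz (t, l) (by simp)
    have h1 : CWord P (shift a.length t.word) a (a ++ l) (t.over l)
        (hues (a ++ l) ∪ if t = .loop then {x} else ∅) := by
      cases t with
      | loop =>
        obtain rfl : l = [] := hl
        exact cword_loop.2 ⟨by simp, rfl, x, by simp⟩
      | block s => exact cword_block.2 ⟨l, hl, rfl, rfl, by simp⟩
      | cup => exact cword_cup_item.2 ⟨l, hl, rfl, rfl, by simp⟩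
    have h2 := ih (fun z hz' => hz z (by simp [hz'])) (a ++ l)
    rw [List.length_append, hl.length] at h2
    rw [List.map_cons, itemsWord_cons, cword_append]
    rw [List.append_assoc] at h2
    refine ⟨_, _, _, _, _, h1, h2, rfl, ?_⟩
    ext z
    by_cases h3 : Item.loop = t <;> by_cases h4 : Item.loop ∈ zs.map Prod.fst <;>
      simp only [h3, h4, eq_comm, labels_cons, List.mem_cons, or_true, true_or,
        or_false, if_true, if_false, hues, Set.mem_union, Set.mem_singleton_iff,
        Set.mem_empty_iff_false] <;> simp <;> tauto

/-- The pairs of coloured endpoints that can be joined by a cap. -/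
def CapPair (p : (Bool × K) × (Bool × K)) : Prop := p.2 = (!p.1.1, p.1.2)

theorem cword_capsWord {k : ℕ} {a b : CLevel K} {cs : List K} {us : Set K} :
    CWord P (capsWord k b.length) a b cs us ↔
      (∃ ps, ps.length = k ∧ (∀ p ∈ ps, CapPair p) ∧ a = b ++ flatPairs ps) ∧ cs = [] ∧
        us = hues a := by
  induction k generalizing a cs us with
  | zero =>
    constructor
    · rintro ⟨rfl, rfl, rfl⟩
      exact ⟨⟨[], rfl, by simp, by simp⟩, rfl, rfl⟩
    · rintro ⟨⟨ps, h, -, rfl⟩, rfl, rfl⟩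
      obtain rfl := List.eq_nil_of_length_eq_zero h
      exact ⟨by simp, rfl, rfl⟩
  | succ k ih =>
    rw [capsWord_succ]
    constructor
    · rintro ⟨m, c, c', us', h1, h2, rfl, rfl⟩
      obtain ⟨⟨ps, h3, h4, rfl⟩, rfl, rfl⟩ := ih.1 h2
      obtain ⟨x, u, v, y, rfl, h5, h6, h7⟩ := h1
      simp only [colors_cap] at h7
      obtain ⟨o, z, rfl, rfl, rfl⟩ := h7
      obtain ⟨rfl, rfl⟩ := List.append_inj h5 h6.symm
      refine ⟨⟨((o, z), (!o, z)) :: ps, by simp [h3], ?_, by simp⟩, rfl, ?_⟩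
      · rintro p (_ | ⟨_, hp⟩)
        · rfl
        · exact h4 p hp
      · ext w
        simp
    · rintro ⟨⟨ps, h3, h4, rfl⟩, rfl, rfl⟩
      obtain _ | ⟨p, ps⟩ := ps
      · simp at h3
      obtain ⟨⟨o, z⟩, q⟩ := p
      obtain rfl : q = (!o, z) := h4 ((o, z), q) (by simp)
      refine ⟨b ++ flatPairs ps, [], [], _, ⟨b, _, _, flatPairs ps, ?_, rfl, rfl, .cap o z⟩,
        ih.2 ⟨⟨ps, by simpa using h3, fun p hp => h4 p (by simp [hp]), rfl⟩, rfl, rfl⟩, rfl, ?_⟩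
      · simp
      · ext w
        simp

/-- The colours of a word in standard form. -/
theorem CWord.exists_standard {I : List Item} {σ : List ℕ} {k : ℕ} {a b : CLevel K} {cs : List K}
    {us : Set K} (h : CWord P (itemsWord a.length I ++ (vw σ ++ capsWord k b.length)) a b cs us) :
    ∃ (zs : List (Item × CLevel K)) (ps : List ((Bool × K) × (Bool × K))),
      zs.map Prod.fst = I ∧ (∀ z ∈ zs, ItemColours P z.1 z.2) ∧ cs = overs zs ∧ ps.length = k ∧
      (∀ p ∈ ps, CapPair p) ∧ InRange (a ++ labels zs).length σ ∧
      act σ (a ++ labels zs) = b ++ flatPairs ps ∧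
      (Item.loop ∉ I → us = hues (a ++ labels zs)) := by
  obtain ⟨m, c, c', us1, us2, h1, h2, rfl, rfl⟩ := cword_append.1 h
  obtain ⟨m', d, d', us3, us4, h3, h4, rfl, rfl⟩ := cword_append.1 h2
  obtain ⟨zs, hI, hz, rfl, rfl, hu⟩ := h1.exists_labels
  obtain ⟨h5, rfl, rfl, rfl⟩ := cword_vw.1 h3
  obtain ⟨⟨ps, h6, h7, h8⟩, rfl, rfl⟩ := cword_capsWord.1 h4
  refine ⟨zs, ps, hI, hz, by simp, h6, h7, h5, h8, fun hl => ?_⟩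
  have : hues (act σ (a ++ labels zs)) = hues (a ++ labels zs) := by
    ext z
    exact ((act_perm _ _).map Prod.snd).mem_iff
  rw [hu hl, this, Set.union_self, Set.union_self]

open Classical in
theorem cword_standard {zs : List (Item × CLevel K)} (hz : ∀ z ∈ zs, ItemColours P z.1 z.2)
    {ps : List ((Bool × K) × (Bool × K))} (hp : ∀ p ∈ ps, CapPair p) {σ : List ℕ} {a b : CLevel K}
    (hσ : InRange (a ++ labels zs).length σ) (h : act σ (a ++ labels zs) = b ++ flatPairs ps)
    (x : K) : CWord P (itemsWord a.length (zs.map Prod.fst) ++ (vw σ ++ capsWord ps.length b.length))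
      a b (overs zs) (hues (a ++ labels zs) ∪ if Item.loop ∈ zs.map Prod.fst then {x} else ∅) := by
  have h1 : hues (act σ (a ++ labels zs)) = hues (a ++ labels zs) := by
    ext z
    exact ((act_perm _ _).map Prod.snd).mem_iff
  have h2 : CWord P (vw σ ++ capsWord ps.length b.length) (a ++ labels zs) b []
      (hues (a ++ labels zs)) :=
    cword_append.2 ⟨_, [], [], _, _, cword_vw.2 ⟨hσ, rfl, rfl, rfl⟩,
      cword_capsWord.2 ⟨⟨ps, rfl, hp, h⟩, rfl, rfl⟩, rfl, by rw [h1, Set.union_self]⟩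
  refine cword_append.2 ⟨_, _, _, _, _, cword_itemsWord hz a x, h2, by simp, ?_⟩
  rw [Set.union_right_comm, Set.union_self]

end

/-! ### The standard picture of a T-diagram -/

namespace TDiagram
variable {G : TDiagram}

open Classical in
/-- Whether the `k`-th point of the circle is a marking with the sign `s`. -/
noncomputable def marked (G : TDiagram) (s : ℤˣ) (k : ℕ) : Bool :=
  decide (G.points[k]? = some (.marking s))

theorem marked_iff {s : ℤˣ} {k : ℕ} : G.marked s k = true ↔ G.points[k]? = some (.marking s) := by
  simp [marked]

theorem marked_eq_false {s : ℤˣ} {k : ℕ} (h : G.points[k]? ≠ some (.marking s)) :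
    G.marked s k = false := by
  simp [marked, h]

/-- The number of the edge that follows the `k`-th edge in the direction opposite to the
orientation. -/
def pred (G : TDiagram) (k : ℕ) : ℕ := (k + G.points.length - 1) % G.points.length

theorem succ_lt {k : ℕ} (h : k < G.points.length) : G.succ k < G.points.length :=
  Nat.mod_lt _ (by omega)

theorem pred_lt {k : ℕ} (h : k < G.points.length) : G.pred k < G.points.length :=
  Nat.mod_lt _ (by omega)

theorem succ_pred {k : ℕ} (h : k < G.points.length) : G.succ (G.pred k) = k := by
  rw [succ, pred, Nat.mod_add_mod, show k + G.points.length - 1 + 1 = k + G.points.length by omega,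
    Nat.add_mod_right, Nat.mod_eq_of_lt h]

theorem pred_succ {k : ℕ} (h : k < G.points.length) : G.pred (G.succ k) = k := by
  rw [pred, succ]
  rcases Nat.lt_or_ge (k + 1) G.points.length with h' | h'
  · rw [Nat.mod_eq_of_lt h', show k + 1 + G.points.length - 1 = k + G.points.length by omega,
      Nat.add_mod_right, Nat.mod_eq_of_lt h]
  · rw [show k + 1 = G.points.length by omega, Nat.mod_self, Nat.mod_eq_of_lt (by omega)]
    omega

theorem succ_inj {j k : ℕ} (hj : j < G.points.length) (hk : k < G.points.length)
    (h : G.succ j = G.succ k) : j = k := by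
  rw [← pred_succ hj, h, pred_succ hk]

/-- The last endpoint of the `k`-th edge: the edge arrives at the top section if it leads to a
positive marking, and from above at the bottom section or at a crossing otherwise. -/
noncomputable def inLabel (G : TDiagram) (k : ℕ) : Bool × ℕ := (G.marked 1 k, k)

/-- The first endpoint of the edge after the `k`-th one: the edge leaves the top section downwards if
it comes from a negative marking, and it leaves the bottom section or a crossing upwards
otherwise. -/
noncomputable def outLabel (G : TDiagram) (k : ℕ) : Bool × ℕ := (!G.marked (-1) k, G.succ k)

/-- The endpoint on the bottom section of the edges at a marking. -/
noncomputable def lowerLabel (G : TDiagram) (k : ℕ) : Bool × ℕ :=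
  if G.marked 1 k then G.outLabel k else G.inLabel k

/-- The endpoint on the top section of the edges at a marking. -/
noncomputable def upperLabel (G : TDiagram) (k : ℕ) : Bool × ℕ :=
  if G.marked 1 k then G.inLabel k else G.outLabel k

open Classical in
/-- The block of the arrow whose head is the `i`-th point, with the endpoints of the edges there. -/
noncomputable def blockAt (G : TDiagram) (i : ℕ) : Item × CLevel ℕ :=
  match G.points[i]? with
  | some (.head c) =>
    let j := G.points.idxOf (.tail c)
    if G.sign c = 1 then (.block true, [(false, j), (false, i), (true, G.succ j), (true, G.succ i)])
    else (.block false, [(false, i), (false, j), (true, G.succ i), (true, G.succ j)])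
  | _ => (.loop, [])

theorem blockAt_eq {i j : ℕ} {c : G.Arrow} (hi : G.points[i]? = some (.head c))
    (hj : G.points[j]? = some (.tail c)) :
    G.blockAt i = if G.sign c = 1 then
      (.block true, [(false, j), (false, i), (true, G.succ j), (true, G.succ i)])
    else (.block false, [(false, i), (false, j), (true, G.succ i), (true, G.succ j)]) := by
  classical
  have h : G.points.idxOf (.tail c) = j := by
    have hm := List.mem_of_getElem? hj
    refine G.tail_injective ?_ hj
    rw [List.getElem?_eq_getElem (List.idxOf_lt_length_iff.2 hm), List.getElem_idxOf]
  simp only [blockAt, hi, h]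

/-- The edges that need a cup: they leave the top section and come back to it. -/
noncomputable def cupEdges (G : TDiagram) : List ℕ :=
  (List.range G.points.length).filter fun k => G.marked (-1) (G.pred k) && G.marked 1 k

/-- The edges that need a cap: neither of their ends is at the top section. -/
noncomputable def capEdges (G : TDiagram) : List ℕ :=
  (List.range G.points.length).filter fun k => !G.marked (-1) (G.pred k) && !G.marked 1 k

/-- The cup of an edge. -/
def cupOf (k : ℕ) : Item × CLevel ℕ := (.cup, [(false, k), (true, k)])

/-- The endpoints that are joined by the cap of an edge. -/
def capOf (k : ℕ) : (Bool × ℕ) × (Bool × ℕ) := ((true, k), (false, k))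

/-- The endpoints on the bottom section. -/
noncomputable def lower (G : TDiagram) : CLevel ℕ :=
  (G.positions CirclePoint.isMarking).map G.lowerLabel

/-- The endpoints on the top section. -/
noncomputable def upper (G : TDiagram) : CLevel ℕ :=
  (G.positions CirclePoint.isMarking).map G.upperLabel

/-- The items of the standard picture of `G`, with their endpoints. A circle without markings and
arrows is a small loop. -/
noncomputable def items (G : TDiagram) : List (Item × CLevel ℕ) :=
  (if G.points.length = 0 then [(.loop, [])] else []) ++
    ((G.positions CirclePoint.isHead).map G.blockAt ++ G.cupEdges.map cupOf)

/-- The pairs of endpoints that are joined by the caps of the standard picture of `G`. -/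
noncomputable def capPairs (G : TDiagram) : List ((Bool × ℕ) × (Bool × ℕ)) := G.capEdges.map capOf

theorem point_cases {k : ℕ} (h : k < G.points.length) :
    (G.points[k]? = some (.marking 1) ∧ G.marked 1 k = true ∧ G.marked (-1) k = false) ∨
    (G.points[k]? = some (.marking (-1)) ∧ G.marked 1 k = false ∧ G.marked (-1) k = true) ∨
    ((∃ c, G.points[k]? = some (.head c) ∨ G.points[k]? = some (.tail c)) ∧
      G.marked 1 k = false ∧ G.marked (-1) k = false) := by
  have h1 := List.getElem?_eq_getElem h
  cases hp : G.points[k] with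
  | head c =>
    rw [hp] at h1
    exact .inr (.inr ⟨⟨c, .inl h1⟩, marked_eq_false (by simp [h1]), marked_eq_false (by simp [h1])⟩)
  | tail c =>
    rw [hp] at h1
    exact .inr (.inr ⟨⟨c, .inr h1⟩, marked_eq_false (by simp [h1]), marked_eq_false (by simp [h1])⟩)
  | marking s =>
    rw [hp] at h1
    rcases Int.units_eq_one_or s with rfl | rfl
    · exact .inl ⟨h1, marked_iff.2 h1, marked_eq_false (by simp [h1])⟩
    · exact .inr (.inl ⟨h1, marked_eq_false (by simp [h1]), marked_iff.2 h1⟩)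

theorem mem_positions_isMarking {k : ℕ} : k ∈ G.positions CirclePoint.isMarking ↔
    k < G.points.length ∧ (G.marked 1 k = true ∨ G.marked (-1) k = true) := by
  rw [mem_positions]
  constructor
  · rintro ⟨q, hq, hq'⟩
    have hk := (List.getElem?_eq_some_iff.1 hq).1
    refine ⟨hk, ?_⟩
    rcases point_cases hk with ⟨h, h1, h2⟩ | ⟨h, h1, h2⟩ | ⟨⟨c, h | h⟩, h1, h2⟩
    · exact .inl h1
    · exact .inr h2
    all_goals
      rw [hq, Option.some_inj] at h
      simp [h, CirclePoint.isMarking] at hq'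
  · rintro ⟨-, h | h⟩ <;> exact ⟨_, marked_iff.1 h, rfl⟩

theorem mem_lower {z : Bool × ℕ} : z ∈ G.lower ↔ ∃ k, k < G.points.length ∧
    (G.marked 1 k = true ∧ z = G.outLabel k ∨ G.marked (-1) k = true ∧ z = G.inLabel k) := by
  rw [lower, List.mem_map]
  simp only [mem_positions_isMarking]
  constructor
  · rintro ⟨k, ⟨hk, h | h⟩, rfl⟩ <;> refine ⟨k, hk, ?_⟩
    · exact .inl ⟨h, by simp [lowerLabel, h]⟩
    · rcases point_cases hk with h' | h' | h'
      · simp [h'.2.2] at h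
      · exact .inr ⟨h, by simp [lowerLabel, h'.2.1]⟩
      · simp [h'.2.2] at h
  · rintro ⟨k, hk, ⟨h, rfl⟩ | ⟨h, rfl⟩⟩
    · exact ⟨k, ⟨hk, .inl h⟩, by simp [lowerLabel, h]⟩
    · refine ⟨k, ⟨hk, .inr h⟩, ?_⟩
      rcases point_cases hk with h' | h' | h'
      · simp [h'.2.2] at h
      · simp [lowerLabel, h'.2.1]
      · simp [h'.2.2] at h

theorem mem_upper {z : Bool × ℕ} : z ∈ G.upper ↔ ∃ k, k < G.points.length ∧
    (G.marked 1 k = true ∧ z = G.inLabel k ∨ G.marked (-1) k = true ∧ z = G.outLabel k) := by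
  rw [upper, List.mem_map]
  simp only [mem_positions_isMarking]
  constructor
  · rintro ⟨k, ⟨hk, h | h⟩, rfl⟩ <;> refine ⟨k, hk, ?_⟩
    · exact .inl ⟨h, by simp [upperLabel, h]⟩
    · rcases point_cases hk with h' | h' | h'
      · simp [h'.2.2] at h
      · exact .inr ⟨h, by simp [upperLabel, h'.2.1]⟩
      · simp [h'.2.2] at h
  · rintro ⟨k, hk, ⟨h, rfl⟩ | ⟨h, rfl⟩⟩
    · exact ⟨k, ⟨hk, .inl h⟩, by simp [upperLabel, h]⟩
    · refine ⟨k, ⟨hk, .inr h⟩, ?_⟩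
      rcases point_cases hk with h' | h' | h'
      · simp [h'.2.2] at h
      · simp [upperLabel, h'.2.1]
      · simp [h'.2.2] at h

theorem exists_arrow {i : ℕ} (hi : i ∈ G.positions CirclePoint.isHead) :
    ∃ (c : G.Arrow) (j : ℕ), G.points[i]? = some (.head c) ∧ G.points[j]? = some (CirclePoint.tail c) := by
  obtain ⟨q, hi, hq⟩ := mem_positions.1 hi
  cases q with
  | tail c => simp [CirclePoint.isHead] at hq
  | marking s => simp [CirclePoint.isHead] at hq
  | head c => exact ⟨c, (G.exists_tail c).choose, hi, (G.exists_tail c).choose_spec⟩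

theorem mem_blockAt {i j : ℕ} {c : G.Arrow} (hi : G.points[i]? = some (.head c))
    (hj : G.points[j]? = some (.tail c)) {z : Bool × ℕ} : z ∈ (G.blockAt i).2 ↔
      z = G.inLabel i ∨ z = G.inLabel j ∨ z = G.outLabel i ∨ z = G.outLabel j := by
  have h1 : G.marked 1 i = false := marked_eq_false (by simp [hi])
  have h2 : G.marked (-1) i = false := marked_eq_false (by simp [hi])
  have h3 : G.marked 1 j = false := marked_eq_false (by simp [hj])
  have h4 : G.marked (-1) j = false := marked_eq_false (by simp [hj])
  rw [blockAt_eq hi hj]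
  split_ifs
  · simp [inLabel, outLabel, h1, h2, h3, h4]; tauto
  · simp [inLabel, outLabel, h1, h2, h3, h4]

theorem exists_mem_blockAt {z : Bool × ℕ} :
    (∃ i ∈ G.positions CirclePoint.isHead, z ∈ (G.blockAt i).2) ↔
      ∃ k, k < G.points.length ∧ (G.marked 1 k = false ∧ G.marked (-1) k = false) ∧
        (z = G.inLabel k ∨ z = G.outLabel k) := by
  constructor
  · rintro ⟨i, hi, hz⟩
    obtain ⟨c, j, hi, hj⟩ := exists_arrow hi
    have hi' := (List.getElem?_eq_some_iff.1 hi).1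
    have hj' := (List.getElem?_eq_some_iff.1 hj).1
    have h1 : G.marked 1 i = false := marked_eq_false (by simp [hi])
    have h2 : G.marked (-1) i = false := marked_eq_false (by simp [hi])
    have h3 : G.marked 1 j = false := marked_eq_false (by simp [hj])
    have h4 : G.marked (-1) j = false := marked_eq_false (by simp [hj])
    rcases (mem_blockAt hi hj).1 hz with h | h | h | h
    exacts [⟨i, hi', ⟨h1, h2⟩, .inl h⟩, ⟨j, hj', ⟨h3, h4⟩, .inl h⟩, ⟨i, hi', ⟨h1, h2⟩, .inr h⟩,
      ⟨j, hj', ⟨h3, h4⟩, .inr h⟩]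
  · rintro ⟨k, hk, ⟨h1, h2⟩, h⟩
    rcases point_cases hk with h' | h' | ⟨⟨c, h' | h'⟩, -⟩
    · simp [h'.2.1] at h1
    · simp [h'.2.2] at h2
    · obtain ⟨j, hj⟩ := G.exists_tail c
      exact ⟨k, mem_positions.2 ⟨_, h', rfl⟩, (mem_blockAt h' hj).2 (by tauto)⟩
    · obtain ⟨i, hi⟩ := G.exists_head c
      exact ⟨i, mem_positions.2 ⟨_, hi, rfl⟩, (mem_blockAt hi h').2 (by tauto)⟩

theorem mem_cupEdges {k : ℕ} : k ∈ G.cupEdges ↔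
    k < G.points.length ∧ G.marked (-1) (G.pred k) = true ∧ G.marked 1 k = true := by
  simp [cupEdges]

theorem mem_capEdges {k : ℕ} : k ∈ G.capEdges ↔
    k < G.points.length ∧ G.marked (-1) (G.pred k) = false ∧ G.marked 1 k = false := by
  simp [capEdges]

theorem labels_items : labels G.items =
    (G.positions CirclePoint.isHead).flatMap (fun i => (G.blockAt i).2) ++
      G.cupEdges.flatMap fun k => (cupOf k).2 := by
  unfold items
  rw [labels_append, labels_append]
  simp only [labels, List.flatMap_map]
  split_ifs <;> simp

theorem flatPairs_capPairs : flatPairs G.capPairs =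
    G.capEdges.flatMap fun k => [(true, k), (false, k)] := by
  simp [flatPairs, capPairs, capOf, List.flatMap_map]

/-- The endpoints in the middle of the standard picture are the first and the last endpoints of the
edges. -/
def IsEnd (G : TDiagram) (z : Bool × ℕ) : Prop :=
  ∃ k, k < G.points.length ∧ (z = G.inLabel k ∨ z = G.outLabel k)

theorem isEnd_inLabel {k : ℕ} (h : k < G.points.length) : G.IsEnd (G.inLabel k) :=
  ⟨k, h, .inl rfl⟩

theorem isEnd_outLabel {k : ℕ} (h : k < G.points.length) : G.IsEnd (G.outLabel k) :=
  ⟨k, h, .inr rfl⟩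

theorem inLabel_eq_outLabel_pred {k : ℕ} (h : k < G.points.length)
    (h' : G.marked 1 k = !G.marked (-1) (G.pred k)) : G.inLabel k = G.outLabel (G.pred k) := by
  simp [inLabel, outLabel, h', succ_pred h]

theorem mem_lower_append {z : Bool × ℕ} : z ∈ G.lower ++ labels G.items ↔ G.IsEnd z := by
  have hcup : ∀ k ∈ G.cupEdges, (true, k) = G.inLabel k ∧ (false, k) = G.outLabel (G.pred k) := by
    intro k hk
    obtain ⟨h1, h2, h3⟩ := mem_cupEdges.1 hk
    simp [inLabel, outLabel, h2, h3, succ_pred h1]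
  rw [List.mem_append, labels_items, List.mem_append, List.mem_flatMap, List.mem_flatMap,
    exists_mem_blockAt, mem_lower]
  constructor
  · rintro (⟨k, hk, h⟩ | ⟨k, hk, -, h⟩ | ⟨k, hk, h⟩)
    · exact ⟨k, hk, by tauto⟩
    · exact ⟨k, hk, h⟩
    · have hk' := (mem_cupEdges.1 hk).1
      simp only [cupOf, List.mem_cons, List.not_mem_nil, or_false] at h
      rcases h with rfl | rfl
      · exact (hcup k hk).2 ▸ isEnd_outLabel (pred_lt hk')
      · exact (hcup k hk).1 ▸ isEnd_inLabel hk'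
  · have hin : ∀ k < G.points.length, G.marked (-1) k = true ∨ G.marked 1 k = false →
        (∃ j < G.points.length, G.marked 1 j = true ∧ G.inLabel k = G.outLabel j ∨
          G.marked (-1) j = true ∧ G.inLabel k = G.inLabel j) ∨
        (∃ j < G.points.length, (G.marked 1 j = false ∧ G.marked (-1) j = false) ∧
          (G.inLabel k = G.inLabel j ∨ G.inLabel k = G.outLabel j)) ∨
        ∃ a ∈ G.cupEdges, G.inLabel k ∈ (cupOf a).2 := by
      intro k hk h
      rcases point_cases hk with h' | h' | h'
      · simp [h'.2] at h
      · exact .inl ⟨k, hk, .inr ⟨h'.2.2, rfl⟩⟩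
      · exact .inr (.inl ⟨k, hk, h'.2, .inl rfl⟩)
    have hout : ∀ k < G.points.length, G.marked (-1) k = false →
        (∃ j < G.points.length, G.marked 1 j = true ∧ G.outLabel k = G.outLabel j ∨
          G.marked (-1) j = true ∧ G.outLabel k = G.inLabel j) ∨
        (∃ j < G.points.length, (G.marked 1 j = false ∧ G.marked (-1) j = false) ∧
          (G.outLabel k = G.inLabel j ∨ G.outLabel k = G.outLabel j)) ∨
        ∃ a ∈ G.cupEdges, G.outLabel k ∈ (cupOf a).2 := by
      intro k hk h
      rcases point_cases hk with h' | h' | h'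
      · exact .inl ⟨k, hk, .inl ⟨h'.2.1, rfl⟩⟩
      · simp [h'.2] at h
      · exact .inr (.inl ⟨k, hk, h'.2, .inr rfl⟩)
    rintro ⟨k, hk, rfl | rfl⟩
    · by_cases h1 : G.marked 1 k = true
      · have hp := pred_lt hk
        by_cases h2 : G.marked (-1) (G.pred k) = true
        · have hc := mem_cupEdges.2 ⟨hk, h2, h1⟩
          exact .inr (.inr ⟨k, hc, by simp [cupOf, ← (hcup k hc).1]⟩)
        · rw [inLabel_eq_outLabel_pred hk (by simp [h1, h2])]
          exact hout _ hp (by simpa using h2)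
      · exact hin k hk (.inr (by simpa using h1))
    · by_cases h1 : G.marked (-1) k = true
      · have hs := succ_lt hk
        by_cases h2 : G.marked 1 (G.succ k) = true
        · have hc := mem_cupEdges.2 ⟨hs, by rwa [pred_succ hk], h2⟩
          have := (hcup _ hc).2
          rw [pred_succ hk] at this
          exact .inr (.inr ⟨_, hc, by simp [cupOf, ← this]⟩)
        · have := inLabel_eq_outLabel_pred hs (by simp [pred_succ hk, h1, h2])
          rw [pred_succ hk] at this
          rw [← this]
          exact hin _ hs (.inr (by simpa using h2))
      · exact hout k hk (by simpa using h1)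

theorem mem_upper_append {z : Bool × ℕ} : z ∈ G.upper ++ flatPairs G.capPairs ↔ G.IsEnd z := by
  have hcap : ∀ k ∈ G.capEdges, (false, k) = G.inLabel k ∧ (true, k) = G.outLabel (G.pred k) := by
    intro k hk
    obtain ⟨h1, h2, h3⟩ := mem_capEdges.1 hk
    simp [inLabel, outLabel, h2, h3, succ_pred h1]
  rw [List.mem_append, flatPairs_capPairs, List.mem_flatMap, mem_upper]
  constructor
  · rintro (⟨k, hk, h⟩ | ⟨k, hk, h⟩)
    · exact ⟨k, hk, by tauto⟩
    · have hk' := (mem_capEdges.1 hk).1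
      simp only [List.mem_cons, List.not_mem_nil, or_false] at h
      rcases h with rfl | rfl
      · exact (hcap k hk).2 ▸ isEnd_outLabel (pred_lt hk')
      · exact (hcap k hk).1 ▸ isEnd_inLabel hk'
  · rintro ⟨k, hk, rfl | rfl⟩
    · by_cases h1 : G.marked 1 k = true
      · exact .inl ⟨k, hk, .inl ⟨h1, rfl⟩⟩
      · by_cases h2 : G.marked (-1) (G.pred k) = true
        · rw [inLabel_eq_outLabel_pred hk (by simp [h1, h2])]
          exact .inl ⟨_, pred_lt hk, .inr ⟨h2, rfl⟩⟩
        · have hc := mem_capEdges.2 ⟨hk, by simpa using h2, by simpa using h1⟩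
          exact .inr ⟨k, hc, by simp [← (hcap k hc).1]⟩
    · by_cases h1 : G.marked (-1) k = true
      · exact .inl ⟨k, hk, .inr ⟨h1, rfl⟩⟩
      · have hs := succ_lt hk
        by_cases h2 : G.marked 1 (G.succ k) = true
        · have := inLabel_eq_outLabel_pred hs (by simp [pred_succ hk, h1, h2])
          rw [pred_succ hk] at this
          rw [← this]
          exact .inl ⟨_, hs, .inl ⟨h2, rfl⟩⟩
        · have hc := mem_capEdges.2 ⟨hs, by simpa [pred_succ hk] using h1, by simpa using h2⟩
          have := (hcap _ hc).2
          rw [pred_succ hk] at this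
          exact .inr ⟨_, hc, by simp [← this]⟩

end TDiagram

namespace TDiagram
variable {G : TDiagram}

theorem lowerLabel_eq {k : ℕ} (h : k ∈ G.positions CirclePoint.isMarking) :
    (G.marked 1 k = true ∧ G.marked (-1) k = false ∧ G.lowerLabel k = (true, G.succ k) ∧
      G.upperLabel k = (true, k)) ∨
    (G.marked 1 k = false ∧ G.marked (-1) k = true ∧ G.lowerLabel k = (false, k) ∧
      G.upperLabel k = (false, G.succ k)) := by
  obtain ⟨hk, h⟩ := mem_positions_isMarking.1 h
  rcases point_cases hk with h' | h' | h'
  · simp [h'.2, lowerLabel, upperLabel, inLabel, outLabel]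
  · simp [h'.2, lowerLabel, upperLabel, inLabel, outLabel]
  · simp [h'.2] at h

theorem nodup_lower : G.lower.Nodup := by
  refine List.Nodup.map_on (fun j hj k hk h => ?_) (G.nodup_positions _)
  have hj' := (mem_positions_isMarking.1 hj).1
  have hk' := (mem_positions_isMarking.1 hk).1
  rcases lowerLabel_eq hj with ⟨-, -, h1, -⟩ | ⟨-, -, h1, -⟩ <;>
    rcases lowerLabel_eq hk with ⟨-, -, h2, -⟩ | ⟨-, -, h2, -⟩ <;> rw [h1, h2] at h <;>
    simp at h
  · exact succ_inj hj' hk' h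
  · exact h

theorem nodup_upper : G.upper.Nodup := by
  refine List.Nodup.map_on (fun j hj k hk h => ?_) (G.nodup_positions _)
  have hj' := (mem_positions_isMarking.1 hj).1
  have hk' := (mem_positions_isMarking.1 hk).1
  rcases lowerLabel_eq hj with ⟨-, -, -, h1⟩ | ⟨-, -, -, h1⟩ <;>
    rcases lowerLabel_eq hk with ⟨-, -, -, h2⟩ | ⟨-, -, -, h2⟩ <;> rw [h1, h2] at h <;>
    simp at h
  · exact h
  · exact succ_inj hj' hk' h

theorem nodup_blocks : ((G.positions CirclePoint.isHead).flatMap fun i => (G.blockAt i).2).Nodup := by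
  have hne : ∀ {i j : ℕ} {c d : G.Arrow}, G.points[i]? = some (.head c) →
      G.points[j]? = some (.tail d) → i ≠ j := by
    rintro i j c d hi hj rfl
    simp [hi] at hj
  rw [List.nodup_flatMap]
  refine ⟨fun i hi => ?_, ?_⟩
  · obtain ⟨c, j, h1, h2⟩ := exists_arrow hi
    have h3 : i ≠ j := hne h1 h2
    have h4 : G.succ i ≠ G.succ j := fun h => h3
      (succ_inj (List.getElem?_eq_some_iff.1 h1).1 (List.getElem?_eq_some_iff.1 h2).1 h)
    rw [blockAt_eq h1 h2]
    split_ifs <;> simp [h3, h4, h3.symm, h4.symm]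
  · refine (G.nodup_positions _).imp_of_mem fun {i i'} hi hi' hii' => ?_
    obtain ⟨c, j, h1, h2⟩ := exists_arrow hi
    obtain ⟨c', j', h1', h2'⟩ := exists_arrow hi'
    have hc : c ≠ c' := by
      rintro rfl
      exact hii' (G.head_injective h1 h1')
    have hj : j ≠ j' := by
      rintro rfl
      rw [h2] at h2'
      exact hc (by simpa using h2')
    have l1 := (List.getElem?_eq_some_iff.1 h1).1
    have l2 := (List.getElem?_eq_some_iff.1 h2).1
    have l1' := (List.getElem?_eq_some_iff.1 h1').1
    have l2' := (List.getElem?_eq_some_iff.1 h2').1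
    have e1 := hne h1 h2'
    have e2 := hne h1' h2
    have m : ∀ {i : ℕ} {c : G.Arrow}, (G.points[i]? = some (.head c) ∨ G.points[i]? = some (.tail c)) →
        G.marked 1 i = false ∧ G.marked (-1) i = false := by
      rintro i c (h | h) <;> exact ⟨marked_eq_false (by simp [h]), marked_eq_false (by simp [h])⟩
    obtain ⟨a1, b1⟩ := m (.inl h1)
    obtain ⟨a2, b2⟩ := m (.inr h2)
    obtain ⟨a3, b3⟩ := m (.inl h1')
    obtain ⟨a4, b4⟩ := m (.inr h2')
    intro z hz hz'
    rw [mem_blockAt h1 h2] at hz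
    rw [mem_blockAt h1' h2'] at hz'
    simp only [inLabel, outLabel, a1, a2, a3, a4, b1, b2, b3, b4] at hz hz'
    rcases hz with rfl | rfl | rfl | rfl <;> simp [e1, e2.symm, hii', hj] at hz'
    · rcases hz' with h | h
      · exact hii' (succ_inj l1 l1' h)
      · exact e1 (succ_inj l1 l2' h)
    · rcases hz' with h | h
      · exact e2 (succ_inj l2 l1' h).symm
      · exact hj (succ_inj l2 l2' h)

theorem nodup_cups : (G.cupEdges.flatMap fun k => (cupOf k).2).Nodup := by
  rw [List.nodup_flatMap]
  refine ⟨fun i _ => by simp [cupOf], ?_⟩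
  refine (List.nodup_range.filter _).imp fun {i j} hij z hz hz' => ?_
  simp only [cupOf, List.mem_cons, List.not_mem_nil, or_false] at hz hz'
  rcases hz with rfl | rfl <;> simp [hij] at hz'

theorem nodup_caps : (flatPairs G.capPairs).Nodup := by
  rw [flatPairs_capPairs, List.nodup_flatMap]
  refine ⟨fun i _ => by simp, ?_⟩
  refine (List.nodup_range.filter _).imp fun {i j} hij z hz hz' => ?_
  simp only [List.mem_cons, List.not_mem_nil, or_false] at hz hz'
  rcases hz with rfl | rfl <;> simp [hij] at hz'

theorem nodup_lower_append : (G.lower ++ labels G.items).Nodup := by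
  rw [labels_items, List.nodup_append, List.nodup_append]
  refine ⟨nodup_lower, ⟨nodup_blocks, nodup_cups, ?_⟩, ?_⟩
  · intro z hz y hy hzy
    subst hzy
    rw [List.mem_flatMap] at hz hy
    obtain ⟨k, hk, ⟨h1, h2⟩, h⟩ := exists_mem_blockAt.1 hz
    obtain ⟨j, hj, hz'⟩ := hy
    obtain ⟨hj, h3, h4⟩ := mem_cupEdges.1 hj
    simp only [cupOf, List.mem_cons, List.not_mem_nil, or_false] at hz'
    rcases h with rfl | rfl <;> simp [inLabel, outLabel, h1, h2] at hz'
    · subst hz'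
      simp [h1] at h4
    · subst hz'
      simp [pred_succ hk, h2] at h3
  · intro z hz y hy hzy
    subst hzy
    rw [List.mem_append, List.mem_flatMap, List.mem_flatMap, exists_mem_blockAt] at hy
    obtain ⟨k, hk, rfl⟩ := List.mem_map.1 hz
    have hk' := (mem_positions_isMarking.1 hk).1
    rcases lowerLabel_eq hk with ⟨h1, h2, h3, -⟩ | ⟨h1, h2, h3, -⟩ <;> rw [h3] at hy <;>
      rcases hy with ⟨j, hj, ⟨h4, h5⟩, h⟩ | ⟨j, hj, h⟩
    · rcases h with h | h <;> simp [inLabel, outLabel, h4, h5] at h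
      obtain rfl := succ_inj hk' hj h
      simp [h1] at h4
    · obtain ⟨hj, h4, h5⟩ := mem_cupEdges.1 hj
      simp [cupOf] at h
      subst h
      simp [pred_succ hk', h2] at h4
    · rcases h with h | h <;> simp [inLabel, outLabel, h4, h5] at h
      subst h
      simp [h2] at h5
    · obtain ⟨hj, h4, h5⟩ := mem_cupEdges.1 hj
      simp [cupOf] at h
      subst h
      simp [h1] at h5

theorem nodup_upper_append : (G.upper ++ flatPairs G.capPairs).Nodup := by
  rw [List.nodup_append]
  refine ⟨nodup_upper, nodup_caps, ?_⟩
  intro z hz y hy hzy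
  subst hzy
  rw [flatPairs_capPairs, List.mem_flatMap] at hy
  obtain ⟨k, hk, rfl⟩ := List.mem_map.1 hz
  have hk' := (mem_positions_isMarking.1 hk).1
  obtain ⟨j, hj, h⟩ := hy
  obtain ⟨hj, h4, h5⟩ := mem_capEdges.1 hj
  rcases lowerLabel_eq hk with ⟨h1, h2, -, h3⟩ | ⟨h1, h2, -, h3⟩ <;> rw [h3] at h <;> simp at h <;>
    subst h
  · simp [h1] at h5
  · simp [pred_succ hk', h2] at h4

/-- The endpoints of the edges below the virtual crossings of the standard picture are the same as the
ones above them. -/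
theorem lower_append_perm : (G.lower ++ labels G.items).Perm (G.upper ++ flatPairs G.capPairs) :=
  (List.perm_ext_iff_of_nodup nodup_lower_append nodup_upper_append).2 fun _ =>
    mem_lower_append.trans mem_upper_append.symm

theorem exists_perm (G : TDiagram) : ∃ σ, InRange (G.lower ++ labels G.items).length σ ∧
    act σ (G.lower ++ labels G.items) = G.upper ++ flatPairs G.capPairs :=
  exists_act_of_perm lower_append_perm

/-- The virtual crossings of the standard picture of `G`. -/
noncomputable def perm (G : TDiagram) : List ℕ := G.exists_perm.choose

theorem inRange_perm : InRange (G.lower ++ labels G.items).length G.perm := G.exists_perm.choose_spec.1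

theorem act_perm_eq : act G.perm (G.lower ++ labels G.items) = G.upper ++ flatPairs G.capPairs :=
  G.exists_perm.choose_spec.2

/-- The standard picture of `G`: the real crossings and the cups are created at the bottom, they are
connected by virtual crossings, and what is left is joined by caps. -/
noncomputable def word (G : TDiagram) : List Slab :=
  itemsWord G.lower.length (G.items.map Prod.fst) ++
    (vw G.perm ++ capsWord G.capPairs.length G.upper.length)

theorem blockAt_spec {i : ℕ} (hi : i ∈ G.positions CirclePoint.isHead) :
    ItemColours G.palette (G.blockAt i).1 (G.blockAt i).2 ∧
      (G.blockAt i).1.over (G.blockAt i).2 = [i] ∧ ∃ s, (G.blockAt i).1 = .block s := by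
  obtain ⟨c, j, hi, hj⟩ := exists_arrow hi
  rw [blockAt_eq hi hj]
  split_ifs with hs
  · exact ⟨⟨_, _, _, _, rfl, c, hi, hj, rfl, rfl, hs⟩, rfl, _, rfl⟩
  · exact ⟨⟨_, _, _, _, rfl, c, hi, hj, rfl, rfl, (Int.units_eq_one_or _).resolve_left hs⟩, rfl, _,
      rfl⟩

theorem eq_blockAt {s : Bool} {l : CLevel ℕ} (h : ItemColours G.palette (.block s) l) :
    ∃ i, (Item.block s).over l = [i] ∧ (Item.block s, l) = G.blockAt i := by
  obtain ⟨x, x', y, y', rfl, h⟩ := h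
  cases s
  · obtain ⟨c, h1, h2, rfl, rfl, h3⟩ := h
    refine ⟨x, rfl, ?_⟩
    rw [blockAt_eq h1 h2, if_neg (by rw [h3]; decide)]
  · obtain ⟨c, h1, h2, rfl, rfl, h3⟩ := h
    refine ⟨y, rfl, ?_⟩
    rw [blockAt_eq h1 h2, if_pos h3]

theorem itemColours_items : ∀ z ∈ G.items, ItemColours G.palette z.1 z.2 := by
  intro z hz
  simp only [items, List.mem_append, List.mem_map] at hz
  rcases hz with h | ⟨i, hi, rfl⟩ | ⟨k, hk, rfl⟩
  · split_ifs at h <;> simp at h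
    subst h
    rfl
  · exact (blockAt_spec hi).1
  · exact ⟨k, rfl⟩

theorem overs_items : overs G.items = G.positions CirclePoint.isHead := by
  have h1 : ∀ l : List ℕ, (∀ i ∈ l, i ∈ G.positions CirclePoint.isHead) →
      overs (l.map G.blockAt) = l := by
    intro l hl
    induction l with
    | nil => rfl
    | cons i l ih =>
      have := (blockAt_spec (hl i (by simp))).2.1
      have h2 := ih fun j hj => hl j (by simp [hj])
      simp only [overs] at h2
      simp [overs, this, h2]
  have h2 : ∀ l : List ℕ, overs (l.map cupOf) = [] := by
    intro l
    induction l with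
    | nil => rfl
    | cons i l ih => exact ih
  have h3 := h1 _ fun i hi => hi
  have h4 := h2 G.cupEdges
  unfold overs at h3 h4
  unfold items overs
  rw [List.flatMap_append, List.flatMap_append, h3, h4]
  split_ifs <;> simp [Item.over]

theorem capPair_capPairs : ∀ p ∈ G.capPairs, CapPair p := by
  intro p hp
  obtain ⟨k, -, rfl⟩ := List.mem_map.1 hp
  rfl

theorem glues_lower_upper : List.Forall₂ G.palette.Glues G.lower G.upper := by
  rw [lower, upper, List.forall₂_map_left_iff, List.forall₂_map_right_iff, List.forall₂_same]
  intro k hk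
  rcases lowerLabel_eq hk with ⟨h1, -, h2, h3⟩ | ⟨-, h1, h2, h3⟩ <;> rw [h2, h3] <;>
    exact ⟨rfl, marked_iff.1 h1, rfl⟩

theorem sectionColours_lower_upper :
    sectionColours G.lower G.upper = G.positions CirclePoint.isMarking := by
  have : ∀ l : List ℕ, (∀ k ∈ l, k ∈ G.positions CirclePoint.isMarking) →
      sectionColours (l.map G.lowerLabel) (l.map G.upperLabel) = l := by
    intro l hl
    induction l with
    | nil => rfl
    | cons k l ih =>
      have h2 := ih fun j hj => hl j (by simp [hj])
      rw [sectionColours] at h2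
      rcases lowerLabel_eq (hl k (by simp)) with ⟨-, -, h3, h4⟩ | ⟨-, -, h3, h4⟩ <;>
        simp [sectionColours, h3, h4, h2]
  exact this _ fun k hk => hk

theorem length_lower : G.lower.length = G.upper.length := by simp [lower, upper]

theorem pictures_word (G : TDiagram) : Pictures G G.word G.lower G.upper :=
  ⟨glues_lower_upper, by rw [sectionColours_lower_upper], _, _,
    cword_standard itemColours_items capPair_capPairs inRange_perm act_perm_eq 0,
    by rw [overs_items]⟩

end TDiagram

/-! ### The standard picture is a tangle -/

section
variable {α β : Type}

theorem exists_map_of_nodup [Nonempty β] {l : List α} (hl : l.Nodup) {l' : List β}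
    (h : l'.length = l.length) : ∃ g : α → β, l' = l.map g := by
  classical
  refine ⟨fun a => l'.getD (l.idxOf a) (Classical.arbitrary β), List.ext_getElem (by simp [h]) ?_⟩
  intro i h1 h2
  have h3 : i < l.length := h ▸ h1
  rw [List.getElem_map, hl.idxOf_getElem i h3, List.getD_eq_getElem _ _ h1]

theorem eq_map_of_labels {zs : List (Item × List α)} {zs' : List (Item × List β)} {g : α → β}
    (h : zs'.map Prod.fst = zs.map Prod.fst) (hz : Labelled zs) (hz' : Labelled zs')
    (hl : labels zs' = (labels zs).map g) : zs' = zs.map fun z => (z.1, z.2.map g) := by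
  induction zs generalizing zs' with
  | nil => simpa using h
  | cons z zs ih =>
    obtain _ | ⟨z', zs'⟩ := zs'
    · simp at h
    simp only [List.map_cons, List.cons.injEq] at h
    simp only [labels_cons, List.map_append] at hl
    obtain ⟨h1, h2⟩ := List.append_inj hl
      (by rw [List.length_map, hz' z' (by simp), hz z (by simp), h.1])
    rw [ih h.2 (fun z hm => hz z (by simp [hm])) (fun z hm => hz' z (by simp [hm])) h2,
      List.map_cons, ← h1, ← h.1]

theorem eq_map_of_flatPairs {ps : List (α × α)} {ps' : List (β × β)} {g : α → β}
    (h : flatPairs ps' = (flatPairs ps).map g) : ps' = ps.map (Prod.map g g) := by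
  induction ps generalizing ps' with
  | nil =>
    obtain _ | ⟨p', ps'⟩ := ps'
    · rfl
    · simp at h
  | cons p ps ih =>
    obtain _ | ⟨p', ps'⟩ := ps'
    · simp at h
    simp only [flatPairs_cons, List.map_cons, List.cons.injEq] at h
    rw [ih h.2.2, List.map_cons, Prod.map, ← h.1, ← h.2.1]

theorem ItemColours.labelled {K : Type} {P : Palette K} {zs : List (Item × CLevel K)}
    (h : ∀ z ∈ zs, ItemColours P z.1 z.2) : Labelled zs := fun z hz => (h z hz).length

end

namespace TDiagram
variable {G : TDiagram}

/-- The colours of the components of the standard picture do not change along the circle. -/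
theorem eq_of_component {g : Bool × ℕ → Bool × Bool}
    (h1 : G.lower.map g = G.upper.map g)
    (h2 : ∀ z ∈ G.items, ItemColours (componentPalette Bool) z.1 (z.2.map g))
    (h3 : ∀ p ∈ G.capPairs, CapPair (Prod.map g g p)) {z : Bool × ℕ} (hz : G.IsEnd z) :
    (g z).2 = (g (G.inLabel 0)).2 := by
  have e1 : ∀ k < G.points.length, (g (G.inLabel k)).2 = (g (G.outLabel k)).2 := by
    intro k hk
    by_cases hm : k ∈ G.positions CirclePoint.isMarking
    · rw [lower, upper, List.map_map, List.map_map, List.map_inj_left] at h1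
      have h4 := congrArg Prod.snd (h1 k hm)
      simp only [Function.comp, lowerLabel, upperLabel] at h4
      split_ifs at h4
      · exact h4.symm
      · exact h4
    · rw [mem_positions_isMarking] at hm
      have key : ∀ i ∈ G.positions CirclePoint.isHead, ∀ c j, G.points[i]? = some (.head c) →
          G.points[j]? = some (.tail c) → (g (G.inLabel i)).2 = (g (G.outLabel i)).2 ∧
            (g (G.inLabel j)).2 = (g (G.outLabel j)).2 := by
        intro i hi c j h4 h5
        have h6 := h2 _ (by
          rw [items, List.mem_append, List.mem_append]
          exact .inr (.inl (List.mem_map_of_mem hi)))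
        have m1 : G.marked 1 i = false := marked_eq_false (by simp [h4])
        have m2 : G.marked (-1) i = false := marked_eq_false (by simp [h4])
        have m3 : G.marked 1 j = false := marked_eq_false (by simp [h5])
        have m4 : G.marked (-1) j = false := marked_eq_false (by simp [h5])
        simp only [inLabel, outLabel, m1, m2, m3, m4, Bool.not_false]
        rw [blockAt_eq h4 h5] at h6
        split_ifs at h6
        · obtain ⟨x, x', y, y', h7, rfl, rfl⟩ := h6
          simp only [List.map_cons, List.map_nil, List.cons.injEq, and_true] at h7
          simp [h7]
        · obtain ⟨x, x', y, y', h7, rfl, rfl⟩ := h6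
          simp only [List.map_cons, List.map_nil, List.cons.injEq, and_true] at h7
          simp [h7]
      rcases point_cases hk with h' | h' | ⟨⟨c, h' | h'⟩, -⟩
      · exact absurd ⟨hk, .inl h'.2.1⟩ hm
      · exact absurd ⟨hk, .inr h'.2.2⟩ hm
      · obtain ⟨j, hj⟩ := G.exists_tail c
        exact (key k (mem_positions.2 ⟨_, h', rfl⟩) c j h' hj).1
      · obtain ⟨i, hi⟩ := G.exists_head c
        exact (key i (mem_positions.2 ⟨_, hi, rfl⟩) c k hi h').2
  have e2 : ∀ k < G.points.length, (g (G.inLabel k)).2 = (g (G.outLabel (G.pred k))).2 := by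
    intro k hk
    by_cases h : G.marked 1 k = !G.marked (-1) (G.pred k)
    · rw [inLabel_eq_outLabel_pred hk h]
    · by_cases h4 : G.marked 1 k = true
      · have h5 : G.marked (-1) (G.pred k) = true := by simpa [h4] using h
        obtain ⟨x, h6⟩ := h2 (cupOf k) (by
          rw [items, List.mem_append, List.mem_append]
          exact .inr (.inr (List.mem_map_of_mem (mem_cupEdges.2 ⟨hk, h5, h4⟩))))
        simp only [cupOf, List.map_cons, List.map_nil, List.cons.injEq, and_true] at h6
        simp [inLabel, outLabel, h4, h5, succ_pred hk, h6]
      · rw [Bool.not_eq_true] at h4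
        have h5 : G.marked (-1) (G.pred k) = false := by simpa [h4] using h
        have h6 : CapPair (g (true, k), g (false, k)) :=
          h3 _ (List.mem_map_of_mem (mem_capEdges.2 ⟨hk, h5, h4⟩))
        have h7 : g (false, k) = (!(g (true, k)).1, (g (true, k)).2) := h6
        simp [inLabel, outLabel, h4, h5, succ_pred hk, h7]
  have e3 : ∀ k < G.points.length, (g (G.inLabel k)).2 = (g (G.inLabel 0)).2 := by
    intro k
    induction k with
    | zero => exact fun _ => rfl
    | succ k ih =>
      intro hk
      have hk' : k < G.points.length := by omega
      have : G.succ k = k + 1 := Nat.mod_eq_of_lt hk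
      rw [e2 _ hk, ← this, pred_succ hk', ← e1 k hk', ih hk']
  obtain ⟨k, hk, rfl | rfl⟩ := hz
  · exact e3 k hk
  · rw [← e1 k hk, e3 k hk]

theorem conn_word (G : TDiagram) : Conn (G.lower.map Prod.fst) G.word := by
  intro α cs us hα h
  have hl : α.length = G.lower.length := by simpa using congrArg List.length hα
  by_cases h0 : G.points.length = 0
  · have hp : G.positions = fun _ => [] := by
      funext p
      simp [positions, h0]
    have hI : G.items = [(.loop, [])] := by simp [items, h0, hp, cupEdges]
    have hL : G.lower = [] := by simp [lower, hp]
    have hU : G.upper = [] := by simp [upper, hp]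
    have hC : G.capPairs = [] := by simp [capPairs, capEdges, h0]
    have hσ : G.perm = [] := by
      have := G.inRange_perm
      rw [hI, hL] at this
      exact List.eq_nil_iff_forall_not_mem.2 fun i hi => by simpa using this i hi
    rw [hL] at hl
    obtain rfl := List.eq_nil_of_length_eq_zero hl
    rw [word, hI, hL, hC, hσ] at h
    have h1 : CWord (componentPalette Bool) (shift ([] : CLevel Bool).length Item.loop.word) [] [] cs us := by
      simpa [vw, itemsWord_cons] using h
    obtain ⟨-, -, x, rfl⟩ := cword_loop.1 h1
    exact ⟨x, by simp⟩
  · rw [word, ← length_lower, ← hl] at h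
    obtain ⟨zs, ps, h1, h2, -, h3, h4, h5, h6, h7⟩ := h.exists_standard
    have hlab : (α ++ labels zs).length = (G.lower ++ labels G.items).length := by
      rw [List.length_append, List.length_append, hl, (ItemColours.labelled h2).length,
        (ItemColours.labelled itemColours_items).length, h1]
    obtain ⟨g, hg⟩ := exists_map_of_nodup nodup_lower_append hlab
    rw [hg, act_map, act_perm_eq, List.map_append] at h6
    obtain ⟨h8, h9⟩ := List.append_inj h6 (by rw [List.length_map, ← length_lower, hl])
    rw [List.map_append] at hg
    obtain ⟨h10, h11⟩ := List.append_inj hg (by rw [List.length_map, hl])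
    have h12 := eq_map_of_labels h1 (ItemColours.labelled itemColours_items)
      (ItemColours.labelled h2) h11
    have h13 := eq_map_of_flatPairs h9.symm
    have key : ∀ z, G.IsEnd z → (g z).2 = (g (G.inLabel 0)).2 := by
      intro z hz
      refine eq_of_component (h10.symm.trans h8.symm) (fun z hz => ?_) (fun p hp => ?_) hz
      · exact h2 (z.1, z.2.map g) (by rw [h12]; exact List.mem_map.2 ⟨z, hz, rfl⟩)
      · exact h4 _ (by rw [h13]; exact List.mem_map.2 ⟨p, hp, rfl⟩)
    refine ⟨(g (G.inLabel 0)).2, ?_⟩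
    rw [h7 (fun hc => ?_), hg, ← List.map_append]
    · refine Set.eq_singleton_iff_unique_mem.2 ⟨?_, ?_⟩
      · have h14 := mem_lower_append.2 (isEnd_inLabel (Nat.pos_of_ne_zero h0))
        exact List.mem_map_of_mem (List.mem_map_of_mem h14)
      · intro x hx
        obtain ⟨p, hp, rfl⟩ := List.mem_map.1 hx
        obtain ⟨z, hz, rfl⟩ := List.mem_map.1 hp
        exact key z (mem_lower_append.1 hz)
    · simp only [items, h0, if_false, List.nil_append, List.map_append, List.mem_append,
        List.mem_map] at hc
      rcases hc with ⟨_, ⟨i, hi, rfl⟩, hc⟩ | ⟨_, ⟨k, -, rfl⟩, hc⟩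
      · obtain ⟨s, hs⟩ := (blockAt_spec hi).2.2
        rw [hs] at hc
        cases hc
      · cases hc

theorem map_fst_lower : G.lower.map Prod.fst = G.upper.map Prod.fst := by
  rw [lower, upper, List.map_map, List.map_map, List.map_inj_left]
  intro k hk
  rcases lowerLabel_eq hk with ⟨-, -, h2, h3⟩ | ⟨-, -, h2, h3⟩ <;> simp [h2, h3]

theorem valid_word (G : TDiagram) : Valid (G.lower.map Prod.fst) G.word ∧
    run (G.lower.map Prod.fst) G.word = G.lower.map Prod.fst := by
  obtain ⟨-, -, cs, us, h, -⟩ := G.pictures_word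
  exact ⟨h.valid.1, h.valid.2.trans map_fst_lower.symm⟩

/-- The standard picture of `G` as a tangle. -/
noncomputable def tangle (G : TDiagram) : Tangle :=
  tangleOf G.valid_word.1 G.valid_word.2 G.conn_word

theorem tangle_same (G : TDiagram) : G.tangle.tDiagram.Same G := by
  obtain ⟨e, col, h⟩ := Pile.exists_reads G.tangle.isClosable rfl G.pictures_word
  exact G.tangle.same_of_reads h

end TDiagram

/-! ### Every picture is equivalent to the standard one -/

namespace TDiagram
variable {G : TDiagram}

/-- A coloured word in standard form consists of loops, the blocks of arrows, and cups. -/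
theorem exists_perm_items {zs : List (Item × CLevel ℕ)}
    (hz : ∀ z ∈ zs, ItemColours G.palette z.1 z.2) : ∃ (n : ℕ) (xs : List ℕ), zs.Perm
      (List.replicate n (.loop, []) ++ ((overs zs).map G.blockAt ++ xs.map cupOf)) := by
  induction zs with
  | nil => exact ⟨0, [], .refl _⟩
  | cons z zs ih =>
    obtain ⟨n, xs, h⟩ := ih fun z hz' => hz z (by simp [hz'])
    obtain ⟨t, l⟩ := z
    have hl : ItemColours G.palette t l := hz (t, l) (by simp)
    cases t with
    | loop =>
      obtain rfl : l = [] := hl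
      exact ⟨n + 1, xs, h.cons _⟩
    | block s =>
      obtain ⟨i, h1, h2⟩ := eq_blockAt hl
      refine ⟨n, xs, ?_⟩
      have : overs ((Item.block s, l) :: zs) = i :: overs zs := by
        simp only [overs, List.flatMap_cons, h1, List.singleton_append]
      rw [this, List.map_cons, ← h2]
      exact (h.cons _).trans List.perm_middle.symm
    | cup =>
      obtain ⟨k, rfl⟩ := hl
      refine ⟨n, k :: xs, ?_⟩
      have h1 : overs ((Item.cup, [(false, k), (true, k)]) :: zs) = overs zs := rfl
      rw [h1, List.map_cons, ← List.append_assoc]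
      refine .trans ?_ List.perm_middle.symm
      rw [List.append_assoc]
      exact h.cons _

theorem exists_labelled {α : Type} {I : List Item} {l : List α}
    (h : l.length = (itemsOut I).length) :
    ∃ zs : List (Item × List α), zs.map Prod.fst = I ∧ Labelled zs ∧ labels zs = l := by
  induction I generalizing l with
  | nil =>
    obtain rfl := List.eq_nil_of_length_eq_zero h
    exact ⟨[], rfl, by simp [Labelled], rfl⟩
  | cons t I ih =>
    rw [itemsOut_cons, List.length_append] at h
    obtain ⟨zs, rfl, h1, h2⟩ := ih (l := l.drop t.out.length) (by simp [h])
    refine ⟨(t, l.take t.out.length) :: zs, rfl, ?_, by simp [h2]⟩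
    rintro z (_ | ⟨_, hz⟩)
    · simp [h]
    · exact h1 z hz

/-- In a reduced standard form, the endpoints of the cups are on the top section. -/
theorem subperm_of_reduced {K : Type} [Nonempty K] {P : Palette K} {zs : List (Item × CLevel K)}
    (hz : ∀ z ∈ zs, ItemColours P z.1 z.2) {a b : CLevel K} {σ : List ℕ}
    {ps : List ((Bool × K) × (Bool × K))}
    (hR : Reduced a.length (zs.map Prod.fst) σ b.length)
    (h : act σ (a ++ labels zs) = b ++ flatPairs ps) :
    (labels (zs.filter fun z => z.1.isCup)).Subperm b := by
  have hz' := ItemColours.labelled hz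
  obtain ⟨ns, h1, h2, h3⟩ := exists_labelled (I := zs.map Prod.fst)
    (l := List.range' a.length (labels zs).length) (by simp [hz'.length])
  have hn : (List.range' 0 a.length ++ labels ns).Nodup := by
    have := List.range'_append (s := 0) (m := a.length) (n := (labels zs).length) (step := 1)
    rw [h3]
    simp only [one_mul, zero_add] at this
    rw [this]
    exact List.nodup_range'
  obtain ⟨g, hg⟩ := exists_map_of_nodup (l' := a ++ labels zs) hn (by simp [h3])
  have hR' := hR _ ns (by simp) h1 h2 hn
  rw [hg, act_map] at h
  rw [List.map_append] at hg
  obtain ⟨-, h4⟩ := List.append_inj hg (by simp)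
  have h5 := eq_map_of_labels h1.symm h2 hz' h4
  have h6 : b = ((act σ (List.range' 0 a.length ++ labels ns)).take b.length).map g := by
    rw [List.map_take, h, List.take_left]
  have h7 : labels (zs.filter fun z => z.1.isCup) =
      (labels (ns.filter fun z => z.1.isCup)).map g := by
    rw [h5, List.filter_map]
    simp [labels, List.map_flatMap, List.flatMap_map, Function.comp_def]
  rw [h7, h6]
  suffices h8 : (labels (ns.filter fun z => z.1.isCup)).Subperm
      ((act σ (List.range' 0 a.length ++ labels ns)).take b.length) by
    obtain ⟨l, h9, h10⟩ := h8
    exact ⟨l.map g, h9.map g, h10.map g⟩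
  refine List.Nodup.subperm ?_ ?_
  · have h8 : (labels (ns.filter fun z => z.1.isCup)).Sublist (labels ns) :=
      List.filter_sublist.flatMap _
    exact (List.nodup_append.1 hn).2.1.sublist h8
  · intro x hx
    obtain ⟨z, hz, hxz⟩ := List.mem_flatMap.1 hx
    rw [List.mem_filter] at hz
    exact hR' z hz.1 (Item.isCup_iff.1 hz.2) x hxz

theorem filter_labels_cups (xs : List ℕ) :
    (labels (xs.map cupOf)).filter (·.1) = xs.map (true, ·) := by
  induction xs with
  | nil => rfl
  | cons x xs ih => simp [cupOf, ih]

theorem filter_flatPairs_caps (xs : List ℕ) :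
    (flatPairs (xs.map capOf)).filter (·.1) = xs.map (true, ·) := by
  induction xs with
  | nil => rfl
  | cons x xs ih => simp [capOf, ih]

theorem true_mem_upper {k : ℕ} : (true, k) ∈ G.upper ↔ G.marked 1 k = true := by
  rw [mem_upper]
  constructor
  · rintro ⟨j, hj, ⟨h, h'⟩ | ⟨h, h'⟩⟩ <;> simp [inLabel, outLabel, h] at h'
    exact h' ▸ h
  · intro h
    exact ⟨k, (List.getElem?_eq_some_iff.1 (marked_iff.1 h)).1, .inl ⟨h, by simp [inLabel, h]⟩⟩

theorem false_mem_upper {k : ℕ} (hk : k < G.points.length) :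
    (false, k) ∈ G.upper ↔ G.marked (-1) (G.pred k) = true := by
  rw [mem_upper]
  constructor
  · rintro ⟨j, hj, ⟨h, h'⟩ | ⟨h, h'⟩⟩ <;> simp [inLabel, outLabel, h] at h'
    rw [h', pred_succ hj, h]
  · intro h
    exact ⟨_, pred_lt hk, .inr ⟨h, by simp [outLabel, h, succ_pred hk]⟩⟩

/-- In a reduced picture of `G`, an edge has a cup exactly if both of its ends are on the top
section. -/
theorem perm_cupEdges {zs : List (Item × CLevel ℕ)}
    (ho : (overs zs).Perm (G.positions CirclePoint.isHead)) {n : ℕ} {xs : List ℕ}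
    (h : zs.Perm (List.replicate n (.loop, []) ++ ((overs zs).map G.blockAt ++ xs.map cupOf)))
    (hsub : (labels (zs.filter fun z => z.1.isCup)).Subperm G.upper)
    (hL : ∀ z ∈ G.upper, z ∈ G.lower ++ labels zs) : xs.Perm G.cupEdges := by
  have hf : (zs.filter fun z => z.1.isCup).Perm (xs.map cupOf) := by
    refine (h.filter _).trans (.of_eq ?_)
    rw [List.filter_append, List.filter_append, List.filter_eq_nil_iff.2,
      List.filter_eq_nil_iff.2, List.filter_eq_self.2]
    · rfl
    · intro z hz
      obtain ⟨k, -, rfl⟩ := List.mem_map.1 hz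
      simp [cupOf]
    · intro z hz
      obtain ⟨i, hi, rfl⟩ := List.mem_map.1 hz
      obtain ⟨s, hs⟩ := (blockAt_spec (ho.mem_iff.1 hi)).2.2
      simp [hs]
    · intro z hz
      simp [List.eq_of_mem_replicate hz]
  have hs : (labels (xs.map cupOf)).Subperm G.upper :=
    ((hf.flatMap_right Prod.snd).symm.subperm).trans hsub
  have hn : xs.Nodup := by
    have : (labels (xs.map cupOf)).Nodup := by
      obtain ⟨l, hl, hl'⟩ := hs
      exact hl.nodup_iff.1 (nodup_upper.sublist hl')
    have := this.filter (·.1)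
    rw [filter_labels_cups] at this
    exact this.of_map
  have hmem : ∀ k z, k ∈ xs → z ∈ (cupOf k).2 → z ∈ G.upper := by
    intro k z hk hz
    exact hs.subset (List.mem_flatMap.2 ⟨_, List.mem_map_of_mem hk, hz⟩)
  refine (List.perm_ext_iff_of_nodup hn (List.nodup_range.filter _)).2 fun k => ?_
  change _ ↔ k ∈ G.cupEdges
  rw [mem_cupEdges]
  constructor
  · intro hk
    have h1 := true_mem_upper.1 (hmem k (true, k) hk (by simp [cupOf]))
    have h2 := (List.getElem?_eq_some_iff.1 (marked_iff.1 h1)).1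
    exact ⟨h2, (false_mem_upper h2).1 (hmem k (false, k) hk (by simp [cupOf])), h1⟩
  · rintro ⟨hk, h1, h2⟩
    have h3 := hL _ ((false_mem_upper hk).2 h1)
    rw [List.mem_append, mem_lower] at h3
    rcases h3 with ⟨j, hj, ⟨h4, h5⟩ | ⟨h4, h5⟩⟩ | h3
    · rcases point_cases hj with h' | h' | h' <;> simp [h'.2] at h4
      simp [outLabel, h'.2] at h5
    · simp only [inLabel, Prod.mk.injEq] at h5
      obtain ⟨h5, rfl⟩ := h5
      simp [h2] at h5
    · have h4 := (h.flatMap_right Prod.snd).mem_iff.1 h3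
      change _ ∈ labels _ at h4
      rw [labels_append, labels_append, List.mem_append, List.mem_append] at h4
      rcases h4 with h4 | h4 | h4
      · obtain ⟨z, hz, hz'⟩ := List.mem_flatMap.1 h4
        simp [List.eq_of_mem_replicate hz] at hz'
      · obtain ⟨z, hz, hz'⟩ := List.mem_flatMap.1 h4
        obtain ⟨i, hi, rfl⟩ := List.mem_map.1 hz
        obtain ⟨j, hj, ⟨h5, h6⟩, h7 | h7⟩ := exists_mem_blockAt.1 ⟨i, ho.mem_iff.1 hi, hz'⟩
        · simp only [inLabel, Prod.mk.injEq] at h7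
          obtain ⟨-, rfl⟩ := h7
          simp [h2] at h5
        · simp [outLabel, h6] at h7
      · obtain ⟨z, hz, hz'⟩ := List.mem_flatMap.1 h4
        obtain ⟨i, hi, rfl⟩ := List.mem_map.1 hz
        simp only [cupOf, List.mem_cons, Prod.mk.injEq, true_and, List.not_mem_nil, or_false,
          Bool.false_eq_true, false_and] at hz'
        exact hz' ▸ hi

/-- The caps are determined by the set of the endpoints that they join: the two endpoints of an edge
are the only ones with its colour, and they have opposite orientations. -/
theorem capEquiv_capPairs {ps : List ((Bool × ℕ) × (Bool × ℕ))} (hp : ∀ p ∈ ps, CapPair p)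
    (h : (flatPairs ps).Perm (flatPairs G.capPairs)) : CapEquiv ps G.capPairs := by
  have h1 := CapEquiv.map_flip (fun p => !p.1.1) ps
  have h2 : (ps.map fun p => if (!p.1.1) = true then (p.2, p.1) else p) =
      (ps.map fun p => p.1.2).map capOf := by
    rw [List.map_map, List.map_inj_left]
    rintro ⟨⟨o, x⟩, q⟩ hpq
    obtain rfl : q = (!o, x) := hp _ hpq
    cases o <;> rfl
  rw [h2] at h1
  refine h1.trans (.of_perm ?_)
  obtain ⟨-, τ, -, h3, -⟩ := h1
  have h4 := (h3 ▸ act_perm τ (flatPairs ps)).trans h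
  have h5 := (h4.filter (·.1)).map Prod.snd
  rw [capPairs, filter_flatPairs_caps, filter_flatPairs_caps] at h5
  have h6 : ∀ l : List ℕ, (l.map (true, ·)).map Prod.snd = l := fun l => by
    rw [List.map_map]
    exact List.map_id l
  rw [h6, h6] at h5
  exact h5.map capOf

end TDiagram

/-- A knot diagram in standard form that meets a level of the form has no small loops. -/
theorem Conn.loop_not_mem {K : Type} {P : Palette K} {zs : List (Item × CLevel K)}
    (hz : ∀ z ∈ zs, ItemColours P z.1 z.2) {ps : List ((Bool × K) × (Bool × K))}
    (hp : ∀ p ∈ ps, CapPair p) {σ : List ℕ} {a b : CLevel K}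
    (hσ : InRange (a ++ labels zs).length σ) (h : act σ (a ++ labels zs) = b ++ flatPairs ps)
    (hab : a.map Prod.fst = b.map Prod.fst) (hne : a ++ labels zs ≠ [])
    (hc : Conn (a.map Prod.fst)
      (itemsWord a.length (zs.map Prod.fst) ++ (vw σ ++ capsWord ps.length b.length))) :
    Item.loop ∉ zs.map Prod.fst := by
  intro hl
  -- All strands get the colour `false`, and the loops get the colour `true`.
  let g : Bool × K → Bool × Bool := fun p => (p.1, false)
  let zs' : List (Item × CLevel Bool) := zs.map fun z => (z.1, z.2.map g)
  have h1 : zs'.map Prod.fst = zs.map Prod.fst := by simp [zs', Function.comp_def]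
  have h2 : labels zs' = (labels zs).map g := by
    simp [zs', labels, List.map_flatMap, List.flatMap_map]
  have h3 : ∀ z ∈ zs', ItemColours (componentPalette Bool) z.1 z.2 := by
    intro z hz'
    obtain ⟨⟨t, l⟩, hm, rfl⟩ := List.mem_map.1 hz'
    have := hz _ hm
    cases t with
    | loop =>
      obtain rfl : l = [] := this
      rfl
    | block s =>
      obtain ⟨x, x', y, y', rfl, -⟩ := this
      exact ⟨false, false, false, false, rfl, by cases s <;> exact ⟨rfl, rfl⟩⟩
    | cup =>
      obtain ⟨x, rfl⟩ := this
      exact ⟨false, rfl⟩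
  have h4 : flatPairs (ps.map (Prod.map g g)) = (flatPairs ps).map g := by
    simp [flatPairs, List.map_flatMap, List.flatMap_map]
  have h5 : ∀ p ∈ ps.map (Prod.map g g), CapPair p := by
    intro p hp'
    obtain ⟨⟨⟨o, x⟩, q⟩, hq, rfl⟩ := List.mem_map.1 hp'
    obtain rfl : q = (!o, x) := hp _ hq
    rfl
  have h6 : b.map g = a.map g := by
    have e : ∀ c : CLevel K, c.map g = (c.map Prod.fst).map fun o => (o, false) := fun c => by
      simp [g]
    rw [e, e, hab]
  have h7 := cword_standard (P := componentPalette Bool) h3 h5 (a := a.map g) (b := b.map g) (σ := σ)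
    (by simpa [h2] using hσ) (by rw [h2, ← List.map_append, act_map, h, List.map_append, h4]) true
  rw [h1, if_pos hl, h6, h2, ← List.map_append, List.length_map, List.length_map] at h7
  have hlen : a.length = b.length := by simpa using congrArg List.length hab
  obtain ⟨y, hy⟩ := hc (a.map g) _ _ (by simp [g, Function.comp_def]) (by rw [← hlen]; exact h7)
  obtain ⟨z, hz'⟩ := List.exists_mem_of_ne_nil _ hne
  have e1 : false ∈ ({y} : Set Bool) :=
    hy ▸ .inl (List.mem_map_of_mem (f := Prod.snd) (List.mem_map_of_mem (f := g) hz'))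
  have e2 : true ∈ ({y} : Set Bool) := hy ▸ .inr rfl
  rw [Set.mem_singleton_iff] at e1 e2
  rw [← e1] at e2
  cases e2

/-- A diagram which consists of small loops has as many components as loops. -/
theorem Conn.eq_one_of_loops {n : ℕ} (h : Conn [] (itemsWord 0 (List.replicate n Item.loop))) :
    n = 1 := by
  have key : ∀ (n : ℕ) (x : Bool), CWord (componentPalette Bool)
      (itemsWord ([] : CLevel Bool).length (List.replicate n Item.loop)) [] [] [] (if n = 0 then ∅ else {x}) := by
    classical
    intro n x
    have := cword_itemsWord (P := componentPalette Bool) (zs := List.replicate n (Item.loop, []))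
      (by
        intro z hz
        rw [List.eq_of_mem_replicate hz]
        rfl) [] x
    have e1 : labels (List.replicate n (Item.loop, ([] : CLevel Bool))) = [] := by
      simp [labels]
    have e2 : overs (List.replicate n (Item.loop, ([] : CLevel Bool))) = [] := by
      simp [overs, Item.over]
    rw [e1, e2, List.map_replicate] at this
    rw [List.append_nil, hues_nil, Set.empty_union] at this
    convert this using 1
    by_cases hn : n = 0 <;> simp [hn, List.mem_replicate]
  match n, h with
  | 0, h =>
    obtain ⟨x, hx⟩ := h [] [] ∅ rfl (by simpa using key 0 true)
    exact absurd hx.symm (Set.singleton_ne_empty x)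
  | 1, _ => rfl
  | n + 2, h =>
    have h1 := key (n + 1) true
    have h2 : CWord (componentPalette Bool) (shift ([] : CLevel Bool).length Item.loop.word) [] [] []
        {false} := cword_loop.2 ⟨rfl, rfl, false, by simp⟩
    obtain ⟨x, hx⟩ := h [] [] _ rfl (cword_append.2 ⟨_, _, _, _, _, h2, h1, rfl, rfl⟩)
    have e1 : false ∈ ({x} : Set Bool) := hx ▸ .inl rfl
    have e2 : true ∈ ({x} : Set Bool) := hx ▸ .inr (by simp)
    rw [Set.mem_singleton_iff] at e1 e2
    rw [← e1] at e2
    cases e2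

namespace TDiagram
variable {G : TDiagram}

theorem labels_replicate_loop {α : Type} (n : ℕ) :
    labels (List.replicate n (Item.loop, ([] : List α))) = [] := by simp [labels]

/-- The items of a reduced picture of `G` in standard form are those of the standard picture. -/
theorem perm_items {zs : List (Item × CLevel ℕ)} {ps : List ((Bool × ℕ) × (Bool × ℕ))} {σ : List ℕ}
    (hz : ∀ z ∈ zs, ItemColours G.palette z.1 z.2) (hp : ∀ p ∈ ps, CapPair p)
    (ho : (overs zs).Perm (G.positions CirclePoint.isHead))
    (hσ : InRange (G.lower ++ labels zs).length σ)
    (h : act σ (G.lower ++ labels zs) = G.upper ++ flatPairs ps)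
    (hR : Reduced G.lower.length (zs.map Prod.fst) σ G.upper.length)
    (hc : Conn (G.lower.map Prod.fst)
      (itemsWord G.lower.length (zs.map Prod.fst) ++ (vw σ ++ capsWord ps.length G.upper.length))) :
    zs.Perm G.items := by
  obtain ⟨n, xs, h1⟩ := exists_perm_items hz
  have h2 : xs.Perm G.cupEdges := by
    refine perm_cupEdges ho h1 (subperm_of_reduced hz hR h) fun z hz' => ?_
    rw [← (act_perm σ _).mem_iff, h]
    exact List.mem_append_left _ hz'
  have h3 : zs.Perm (List.replicate n (.loop, []) ++
      ((G.positions CirclePoint.isHead).map G.blockAt ++ G.cupEdges.map cupOf)) :=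
    h1.trans (.append_left _ ((ho.map _).append (h2.map _)))
  suffices h4 : List.replicate n (Item.loop, ([] : CLevel ℕ)) =
      if G.points.length = 0 then [(.loop, [])] else [] by
    rw [h4] at h3
    exact h3
  split_ifs with h0
  · have hpos : G.positions = fun _ => [] := by
      funext p
      simp [positions, h0]
    have hL : G.lower = [] := by simp [lower, hpos]
    have hU : G.upper = [] := by simp [upper, hpos]
    have hzs : zs = List.replicate n (.loop, []) := by
      rw [← List.perm_replicate]
      simpa [hpos, cupEdges, h0] using h3
    rw [hzs, hL, labels_replicate_loop] at hσ h
    have hs : σ = [] := List.eq_nil_iff_forall_not_mem.2 fun i hi => by simpa using hσ i hi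
    subst hs
    rw [hU] at h
    have hps : ps = [] := by
      have := congrArg List.length h
      simp at this
      exact this
    rw [hzs, hps, hL, List.map_replicate] at hc
    have := Conn.eq_one_of_loops (n := n) (by simpa [vw] using hc)
    rw [this]
    rfl
  · have h5 : (labels zs).Perm (labels G.items) := by
      refine (h3.flatMap_right Prod.snd).trans (.of_eq ?_)
      change labels _ = _
      rw [items, if_neg h0, labels_append, labels_replicate_loop]
      rfl
    have h6 : G.lower ++ labels zs ≠ [] := by
      have := mem_lower_append.2 (isEnd_inLabel (Nat.pos_of_ne_zero h0))
      rw [← (h5.append_left _).mem_iff] at this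
      exact List.ne_nil_of_mem this
    have h7 := hc.loop_not_mem hz hp hσ h map_fst_lower h6
    cases n with
    | zero => rfl
    | succ n =>
      refine absurd ?_ h7
      rw [(h3.map Prod.fst).mem_iff]
      simp [List.replicate_succ]

/-- A picture of `G` whose ends are those of the standard picture is equivalent to it. -/
theorem rel_word {w : List Slab} {cs : List ℕ} {us : Set ℕ}
    (hw : CWord G.palette w G.lower G.upper cs us) (ho : cs.Perm (G.positions CirclePoint.isHead))
    (hc : Conn (G.lower.map Prod.fst) w) : Rel (G.lower.map Prod.fst) w G.word := by
  obtain ⟨hv, hr⟩ := hw.valid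
  obtain ⟨I, σ, k, -, hR, hrel⟩ := exists_reduced hv
  rw [hr, List.length_map, List.length_map] at hR
  rw [hr, List.length_map, List.length_map] at hrel
  have hc' := hc.of_rel hrel
  refine hrel.trans ?_
  obtain ⟨cs', hcs, hw'⟩ := hrel.cword hw
  obtain ⟨zs, ps, rfl, hz, rfl, rfl, hp, hσ, hact, -⟩ := hw'.exists_standard
  have hI := perm_items hz hp (hcs.trans ho) hσ hact hR hc'
  have hlab : (labels zs).Perm (labels G.items) := hI.flatMap_right _
  have hcap : (flatPairs ps).Perm (flatPairs G.capPairs) := by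
    have h1 := act_perm σ (G.lower ++ labels zs)
    rw [hact] at h1
    exact (List.perm_append_left_iff _).1
      (h1.trans ((hlab.append_left _).trans lower_append_perm))
  obtain ⟨τ, t1, t2, t3⟩ := exists_rel_items_perm hI (ItemColours.labelled hz)
  obtain ⟨hk, τ', s1, s2, s3⟩ := capEquiv_capPairs hp hcap
  set m := G.upper.length with hm
  set N := (G.lower ++ labels G.items).length with hN
  have hN1 : (G.lower ++ labels zs).length = N := by
    rw [hN, List.length_append, List.length_append, hlab.length_eq]
  have hN2 : N = m + 2 * ps.length := by
    rw [hN, lower_append_perm.length_eq, List.length_append, length_flatPairs, hk]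
  have hN3 : N = G.lower.length + (labels zs).length := by rw [← hN1, List.length_append]
  let τ1 := τ.map (G.lower.length + ·)
  let τ2 := τ'.map (m + ·)
  have i1 : InRange N τ1 := by
    rw [hN3]
    exact t1.shift _
  have i2 : InRange N τ2 := by
    rw [hN2]
    exact s1.shift _
  rw [hN1] at hσ
  have hrunI := run_itemsWord' (G.lower.map Prod.fst) (zs.map Prod.fst)
  have hrunJ := run_itemsWord' (G.lower.map Prod.fst) (G.items.map Prod.fst)
  rw [List.length_map] at hrunI hrunJ
  have hlJ : (G.lower.map Prod.fst ++ itemsOut (G.items.map Prod.fst)).length = N := by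
    rw [hN, List.length_append, List.length_append, (ItemColours.labelled itemColours_items).length,
      List.length_map]
  have hvr : VRel N (τ1 ++ (σ ++ τ2)) G.perm := by
    refine vrel_of_act_eq nodup_lower_append ?_ inRange_perm ?_
    · rw [inRange_append, inRange_append]
      exact ⟨i1, hσ, i2⟩
    · rw [act_append, act_append, act_append_right, t2, hact, act_append_right, s2, act_perm_eq]
  -- The items are rearranged at the bottom and the caps at the top.
  have r1 := (t3 G.lower.length (G.lower.map Prod.fst) (by simp)).append_right
    (v := vw σ ++ capsWord ps.length m) (by
      have := hrel.valid_iff.1 hv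
      rw [valid_append] at this
      exact this.2)
  have v1 := (r1.valid_iff).1 (hrel.valid_iff.1 hv)
  have r2 := ((s3 m).pre (itemsWord G.lower.length (G.items.map Prod.fst) ++ (vw τ1 ++ vw σ)))
    (a := G.lower.map Prod.fst) (by simpa [τ1] using v1)
  simp only [List.append_assoc] at r1 r2
  have r3 := r1.trans r2
  have v3 := r3.valid_iff.1 (hrel.valid_iff.1 hv)
  have e : vw τ1 ++ (vw σ ++ (vw τ2 ++ capsWord ps.length m)) =
      vw (τ1 ++ (σ ++ τ2)) ++ capsWord ps.length m := by
    simp [vw_append]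
  rw [e] at r3 v3
  rw [valid_append, valid_append, hrunJ.2] at v3
  refine r3.trans ?_
  rw [word, ← hm, ← hk]
  refine Rel.append_left hrunJ.1 ?_
  rw [hrunJ.2]
  exact (hvr _ hlJ.ge).append_right v3.2.2

end TDiagram

/-- The colours of the edges on both sides of the section are determined by the markings there. -/
theorem exists_markings {G : TDiagram} {α β : CLevel ℕ} (h : List.Forall₂ G.palette.Glues α β) :
    α = (sectionColours α β).map G.lowerLabel ∧ β = (sectionColours α β).map G.upperLabel := by
  induction h with
  | nil => exact ⟨rfl, rfl⟩
  | @cons a b α β h _ ih =>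
    have h1 : a = G.lowerLabel (if a.1 then b.2 else a.2) ∧
        b = G.upperLabel (if a.1 then b.2 else a.2) := by
      obtain ⟨o, x⟩ := a
      obtain ⟨o', y⟩ := b
      obtain ⟨rfl : o = o', h⟩ := h
      cases o
      · obtain ⟨h2, rfl⟩ : G.points[x]? = some (.marking (-1)) ∧ y = G.succ x := h
        have m1 := TDiagram.marked_iff.2 h2
        have m2 : G.marked 1 x = false := TDiagram.marked_eq_false (by simp [h2])
        simp [TDiagram.lowerLabel, TDiagram.upperLabel, TDiagram.inLabel, TDiagram.outLabel, m1, m2]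
      · obtain ⟨h2, rfl⟩ : G.points[y]? = some (.marking 1) ∧ x = G.succ y := h
        have m1 := TDiagram.marked_iff.2 h2
        have m2 : G.marked (-1) y = false := TDiagram.marked_eq_false (by simp [h2])
        simp [TDiagram.lowerLabel, TDiagram.upperLabel, TDiagram.inLabel, TDiagram.outLabel, m1, m2]
    have h2 : sectionColours (a :: α) (b :: β) =
        (if a.1 then b.2 else a.2) :: sectionColours α β := rfl
    rw [h2, List.map_cons, List.map_cons, ← ih.1, ← ih.2, ← h1.1, ← h1.2]
    exact ⟨rfl, rfl⟩

/-- A tangle which is a picture of `G` is equivalent to the standard one: the strands are permuted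
along the section, and the diagram is then brought to the standard form inside the strip. -/
theorem Pictures.equivalent {G : TDiagram} {T : Tangle} {α β : CLevel ℕ}
    (hα : α.map Prod.fst = T.bot) (h : Pictures G T.word α β) :
    VirtuallyEquivalent T G.tangle := by
  obtain ⟨h1, h2, cs, us, h3, h4⟩ := h
  obtain ⟨e1, e2⟩ := exists_markings h1
  obtain ⟨σ, hσ, hact⟩ := exists_act_of_perm h2
  have hl : α.length = (sectionColours α β).length := by simpa using congrArg List.length e1
  have hl' : β.length = (sectionColours α β).length := by simpa using congrArg List.length e2
  have a1 : act σ α = G.lower := by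
    rw [TDiagram.lower, ← hact, ← act_map, ← e1]
  have a2 : act σ β = G.upper := by
    rw [TDiagram.upper, ← hact, ← act_map, ← e2]
  have hσα : InRange α.length σ := hl ▸ hσ
  have hσβ : InRange β.length σ := hl' ▸ hσ
  obtain ⟨U, hU, hTU⟩ := T.exists_conjugate (σ := σ) (by rwa [← hα, List.length_map])
  rw [← hα, act_map, a1] at hU
  refine hTU.trans _ _ _ ?_
  have b1 : U.bot = G.lower.map Prod.fst := by rw [hU]
  have b2 : U.word = vw σ.reverse ++ (T.word ++ vw σ) := by rw [hU]
  obtain ⟨us', h5⟩ : ∃ us', CWord G.palette U.word G.lower G.upper cs us' := by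
    rw [b2]
    exact ⟨_, cword_append.2 ⟨α, [], cs, _, _, cword_vw.2
      ⟨by rw [← a1, length_act]; exact hσα.reverse, by rw [← a1, act_reverse_act hσα], rfl, rfl⟩,
      cword_append.2 ⟨β, cs, [], us, _, h3, cword_vw.2 ⟨hσβ, a2.symm, rfl, rfl⟩, (List.append_nil cs).symm, rfl⟩,
      rfl, rfl⟩⟩
  exact VirtuallyEquivalent.of_rel (TDiagram.rel_word h5 h4 (b1 ▸ U.conn)) U G.tangle
    (by rw [← b1]) rfl

/-- All the tangles with the same T-diagram are equivalent to its standard picture. -/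
theorem Pile.Reads.equivalent {T : Tangle} {G : TDiagram} {e : T.RealCrossing ≃ G.Arrow}
    {col : ℕ × ℕ → ℕ} (h : T.Reads G e col) : VirtuallyEquivalent T G.tangle :=
  (h.pictures T.isClosable).equivalent ((T.map_fst_coloured col 0).trans T.level_zero)

theorem Tangle.equivalent_of_same {T U : Tangle} (h : T.tDiagram.Same U.tDiagram) :
    VirtuallyEquivalent T U := by
  obtain ⟨e, col, h1⟩ := T.reads_edge.of_same h
  exact h1.equivalent.trans _ _ _ (U.reads_edge.equivalent.symm _ _)

end VirtualTangle

theorem mainTheorem10 :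
    (∀ G : VirtualTangle.TDiagram, ∃ T : VirtualTangle.Tangle, T.tDiagram.Same G) ∧
    (∀ T U : VirtualTangle.Tangle, T.tDiagram.Same U.tDiagram →
      VirtualTangle.VirtuallyEquivalent T U) :=
  ⟨fun G => ⟨G.tangle, G.tangle_same⟩, fun _ _ => VirtualTangle.Tangle.equivalent_of_same⟩
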